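/- Let $M$ be a smooth $n$-dimensional manifold (Hausdorff, second countable, without boundary), and let $S^1=\mathbb R/\mathbb Z$. For $k\ge 2$ let $W^{k,2}(S^1,M)$ be the set of continuous loops in $M$ whose expressions in local charts of $M$ are of class $W^{k,2}_{loc}$, and let $\mathcal D^k$ be the set of bijections $\psi:S^1\to S^1$ such that $\psi$ and $\psi^{-1}$ are of class $W^{k,2}$. We use the scale calculus of Hofer, Wysocki and Zehnder: sc-Banach spaces, maps of class $sc^k$, and sc-manifolds (Hausdorff paracompact spaces with an sc-smooth atlas of charts in sc-Banach spaces). The charts of $W^{2,2}(S^1,M)$ are the following. Let $E\to S^1$ be a smooth vector bundle of rank $n$, and let $e$ be a fibre-preserving diffeomorphism (over $S^1$) from an open subset of $S^1\times M$ onto an open subset of $E$. The associated chart sends a loop $v$ whose graph lies in the domain of $e$ to the section $t\mapsto e(t,v(t))$ in $W^{2,2}(S^1,E)$, and $W^{2,2}(S^1,E)$ carries the sc-structure $W^{m+2,2}(S^1,E)$, $m\ge 0$. (For instance, $e(t,q)=\exp_{\gamma(t)}^{-1}(q)$ for a smooth loop $\gamma$, a Riemannian metric on $M$, and $E=\gamma^*TM$.)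 The topology of $W^{2,2}(S^1,M)$ is the one generated by these charts. The set $\mathcal D=\mathcal D^2$ carries the subspace topology and the restricted charts from $W^{2,2}(S^1,S^1)$. Then: 1. $W^{2,2}(S^1,M)$ is an sc-manifold, and its $m$-th level is $W^{m+2,2}(S^1,M)$ for every $m\ge 0$. 2. $\mathcal D$ is an open subset of $W^{2,2}(S^1,S^1)$ and an sc-manifold, and its $m$-th level is $\mathcal D^{m+2}$ for every $m\ge 0$. 3. The reparametrization action $$f:W^{2,2}(S^1,M)\times\mathcal D\to W^{2,2}(S^1,M),\qquad (v,\psi)\mapsto v\circ\psi,$$ is well defined and sc-smooth. 4. $\mathcal D$ with the multiplication $\phi\psi=\psi\circ\phi$ is an sc-Lie group: it is a group and an sc-manifold, and multiplication and inversion are sc-smooth. -/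

import Mathlib

open Set Filter Topology MeasureTheory
open scoped ContDiff Manifold

/-! ### Sobolev functions of one variable, through weak derivatives -/

section WeakDerivatives

variable {E : Type*} [NormedAddCommGroup E]

/-- `f` is locally square integrable on `U`. -/
def IsL2Loc (U : Set ℝ) (f : ℝ → E) : Prop :=
  ∀ K : Set ℝ, K ⊆ U → IsCompact K → MemLp f 2 (volume.restrict K)

theorem IsL2Loc.locallyIntegrable {f : ℝ → E} (hf : IsL2Loc univ f) :
    LocallyIntegrable f volume := by
  rw [locallyIntegrable_iff]
  intro K hK
  have : IsFiniteMeasure (volume.restrict K) :=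
    ⟨by simpa using hK.measure_lt_top⟩
  exact (hf K (subset_univ K) hK).integrable (by norm_num)

variable [NormedSpace ℝ E]

/-- `g` is a weak derivative of `f` on the open set `U ⊆ ℝ`. -/
def IsWeakDerivOn (U : Set ℝ) (f g : ℝ → E) : Prop :=
  ∀ η : ℝ → ℝ, ContDiff ℝ ∞ η → HasCompactSupport η → tsupport η ⊆ U →
    ∫ t, deriv η t • f t = -∫ t, η t • g t

/-- `g 0 = f, g 1, …, g k` are the successive weak derivatives of `f` on `U`, all of them locally
square integrable on `U`. -/
structure IsSobolevJet (k : ℕ) (U : Set ℝ) (f : ℝ → E) (g : ℕ → ℝ → E) : Prop where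
  zero : g 0 = f
  l2 : ∀ j ≤ k, IsL2Loc U (g j)
  weak : ∀ j < k, IsWeakDerivOn U (g j) (g (j + 1))

/-- `f` belongs to `W^{k,2}_loc(U)`. -/
def MemSobolevLoc (k : ℕ) (U : Set ℝ) (f : ℝ → E) : Prop :=
  ∃ g : ℕ → ℝ → E, IsSobolevJet k U f g

theorem integrable_test {f : ℝ → E} (hf : IsL2Loc univ f) {η : ℝ → ℝ}
    (hη : ContDiff ℝ ∞ η) (hc : HasCompactSupport η) :
    Integrable (fun t => η t • f t) volume :=
  hf.locallyIntegrable.integrable_smul_left_of_hasCompactSupport hη.continuous hc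

theorem integrable_deriv_test {f : ℝ → E} (hf : IsL2Loc univ f) {η : ℝ → ℝ}
    (hη : ContDiff ℝ ∞ η) (hc : HasCompactSupport η) :
    Integrable (fun t => deriv η t • f t) volume :=
  hf.locallyIntegrable.integrable_smul_left_of_hasCompactSupport
    (hη.continuous_deriv (by simp)) hc.deriv

theorem IsSobolevJet.add {k : ℕ} {f₁ f₂ : ℝ → E} {g₁ g₂ : ℕ → ℝ → E}
    (h₁ : IsSobolevJet k univ f₁ g₁) (h₂ : IsSobolevJet k univ f₂ g₂) :
    IsSobolevJet k univ (f₁ + f₂) (g₁ + g₂) where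
  zero := by simp [h₁.zero, h₂.zero]
  l2 j hj K hK hc := (h₁.l2 j hj K hK hc).add (h₂.l2 j hj K hK hc)
  weak j hj η hη hc hs := by
    simp only [Pi.add_apply, smul_add]
    rw [integral_add (integrable_deriv_test (h₁.l2 j hj.le) hη hc)
        (integrable_deriv_test (h₂.l2 j hj.le) hη hc),
      integral_add (integrable_test (h₁.l2 (j + 1) hj) hη hc)
        (integrable_test (h₂.l2 (j + 1) hj) hη hc),
      h₁.weak j hj η hη hc hs, h₂.weak j hj η hη hc hs, neg_add]

theorem IsSobolevJet.const_smul {k : ℕ} {f : ℝ → E} {g : ℕ → ℝ → E} (c : ℝ)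
    (h : IsSobolevJet k univ f g) : IsSobolevJet k univ (c • f) (c • g) where
  zero := by simp [h.zero]
  l2 j hj K hK hc := (h.l2 j hj K hK hc).const_smul c
  weak j hj η hη hc hs := by
    have := h.weak j hj η hη hc hs
    simp only [Pi.smul_apply]
    simp_rw [smul_comm _ c]
    rw [integral_smul, integral_smul, this, smul_neg]

/-- Weak derivatives are unique almost everywhere. -/
theorem IsSobolevJet.ae_eq [CompleteSpace E] {k : ℕ} {f : ℝ → E} {g₁ g₂ : ℕ → ℝ → E}
    (h₁ : IsSobolevJet k univ f g₁) (h₂ : IsSobolevJet k univ f g₂) (j : ℕ) (hj : j ≤ k) :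
    g₁ j =ᵐ[volume] g₂ j := by
  induction j with
  | zero => rw [h₁.zero, h₂.zero]
  | succ j ih =>
    have ih := ih (by omega)
    have hi₁ := (h₁.l2 (j + 1) hj)
    have hi₂ := (h₂.l2 (j + 1) hj)
    have key : ∀ᵐ t ∂(volume : Measure ℝ), (g₁ (j + 1) - g₂ (j + 1)) t = 0 := by
      refine ae_eq_zero_of_integral_contDiff_smul_eq_zero
        (hi₁.locallyIntegrable.sub hi₂.locallyIntegrable) ?_
      intro η hη hc
      have e₁ := h₁.weak j hj η hη hc (subset_univ _)
      have e₂ := h₂.weak j hj η hη hc (subset_univ _)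
      have e : ∫ t, deriv η t • g₁ j t = ∫ t, deriv η t • g₂ j t := by
        refine integral_congr_ae ?_
        filter_upwards [ih] with t ht
        rw [ht]
      simp only [Pi.sub_apply, smul_sub]
      rw [integral_sub (integrable_test hi₁ hη hc) (integrable_test hi₂ hη hc), sub_eq_zero]
      rw [e₁, e₂] at e
      exact neg_injective e
    filter_upwards [key] with t ht
    exact sub_eq_zero.mp ht

end WeakDerivatives

/-! ### Sobolev sections of vector bundles over the circle

Every real vector bundle of rank `n` over `S¹ = ℝ/ℤ` is obtained from `ℝ × ℝⁿ` by identifying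
`(t, x)` with `(t + 1, A x)` for a linear automorphism `A`; its sections are the maps
`ξ : ℝ → ℝⁿ` with `ξ (t + 1) = A (ξ t)`. For `A = id` they are the maps `S¹ → ℝⁿ`. -/

section Sections

variable {n : ℕ}

/-- The sections of class `W^{k,2}` of the bundle over the circle with clutching map `A`
(for `k ≥ 1` these have a continuous representative, which is the one used here). -/
def sobolevSubmodule (A : EuclideanSpace ℝ (Fin n) ≃L[ℝ] EuclideanSpace ℝ (Fin n)) (k : ℕ) :
    Submodule ℝ (ℝ → EuclideanSpace ℝ (Fin n)) where
  carrier := {ξ | Continuous ξ ∧ (∀ t, ξ (t + 1) = A (ξ t)) ∧ MemSobolevLoc k univ ξ}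
  add_mem' := by
    rintro ξ ζ ⟨hc, hp, g, hg⟩ ⟨hc₂, hp₂, g₂, hg₂⟩
    exact ⟨hc.add hc₂, fun t => by simp [hp, hp₂], g + g₂, hg.add hg₂⟩
  zero_mem' := by
    refine ⟨continuous_const, fun t => by simp, fun _ => 0, rfl, ?_, ?_⟩
    · intro j hj K hK hc
      exact MemLp.zero'
    · intro j hj η hη hc hs
      simp
  smul_mem' := by
    rintro c ξ ⟨hc, hp, g, hg⟩
    exact ⟨hc.const_smul c, fun t => by simp [hp], c • g, hg.const_smul c⟩

/-- The space `W^{k,2}` of sections, with the norm `(∑_{j ≤ k} ∫₀¹ |ξ^{(j)}|²)^{1/2}` below. -/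
def SobolevSection (A : EuclideanSpace ℝ (Fin n) ≃L[ℝ] EuclideanSpace ℝ (Fin n)) (k : ℕ) : Type :=
  ↥(sobolevSubmodule A k)

namespace SobolevSection

variable (A : EuclideanSpace ℝ (Fin n) ≃L[ℝ] EuclideanSpace ℝ (Fin n)) (k : ℕ)

instance : AddCommGroup (SobolevSection A k) :=
  inferInstanceAs (AddCommGroup ↥(sobolevSubmodule A k))

instance : Module ℝ (SobolevSection A k) :=
  inferInstanceAs (Module ℝ ↥(sobolevSubmodule A k))

variable {A k}

/-- The map `ℝ → ℝⁿ` underlying a section. -/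
def toFun (ξ : SobolevSection A k) : ℝ → EuclideanSpace ℝ (Fin n) :=
  Subtype.val (p := (· ∈ sobolevSubmodule A k)) ξ

instance : CoeFun (SobolevSection A k) (fun _ => ℝ → EuclideanSpace ℝ (Fin n)) := ⟨toFun⟩

theorem property (ξ : SobolevSection A k) : Continuous ξ ∧ (∀ t, ξ (t + 1) = A (ξ t)) ∧
    MemSobolevLoc k univ (ξ : ℝ → EuclideanSpace ℝ (Fin n)) :=
  Subtype.property (p := (· ∈ sobolevSubmodule A k)) ξ

@[ext] theorem ext {ξ ζ : SobolevSection A k} (h : ∀ t, ξ t = ζ t) : ξ = ζ :=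
  Subtype.ext (funext h)

/-- The weak derivatives of a section. -/
noncomputable def weakDeriv (ξ : SobolevSection A k) : ℕ → ℝ → EuclideanSpace ℝ (Fin n) :=
  ξ.property.2.2.choose

theorem weakDeriv_spec (ξ : SobolevSection A k) : IsSobolevJet k univ ξ ξ.weakDeriv :=
  ξ.property.2.2.choose_spec

theorem memLp_weakDeriv (ξ : SobolevSection A k) (j : Fin (k + 1)) :
    MemLp (ξ.weakDeriv j) 2 (volume.restrict (Ioc (0 : ℝ) 1)) :=
  (ξ.weakDeriv_spec.l2 j (by omega) (Icc 0 1) (subset_univ _) isCompact_Icc).mono_measure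
    (Measure.restrict_mono Ioc_subset_Icc_self le_rfl)

/-- A section together with its weak derivatives up to order `k`, as an element of the Hilbert sum
of `k + 1` copies of `L²(0,1)`. -/
noncomputable def jet : SobolevSection A k →ₗ[ℝ]
    PiLp 2 (fun _ : Fin (k + 1) =>
      Lp (EuclideanSpace ℝ (Fin n)) 2 (volume.restrict (Ioc (0 : ℝ) 1))) where
  toFun ξ := WithLp.toLp 2 (fun j => (ξ.memLp_weakDeriv j).toLp)
  map_add' ξ ζ := by
    ext1 j
    change _ = (ξ.memLp_weakDeriv j).toLp + (ζ.memLp_weakDeriv j).toLp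
    rw [← MemLp.toLp_add]
    refine MemLp.toLp_congr (memLp_weakDeriv (ξ + ζ) j) _ (ae_restrict_of_ae ?_)
    exact (weakDeriv_spec (ξ + ζ)).ae_eq (ξ.weakDeriv_spec.add ζ.weakDeriv_spec) j (by omega)
  map_smul' c ξ := by
    ext1 j
    change _ = c • (ξ.memLp_weakDeriv j).toLp
    rw [← MemLp.toLp_const_smul]
    refine MemLp.toLp_congr (memLp_weakDeriv (c • ξ) j) _ (ae_restrict_of_ae ?_)
    exact (weakDeriv_spec (c • ξ)).ae_eq (ξ.weakDeriv_spec.const_smul c) j (by omega)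

theorem jet_injective : Function.Injective (jet (A := A) (k := k)) := by
  rw [injective_iff_map_eq_zero]
  intro ξ hξ
  have h0 : (ξ.memLp_weakDeriv 0).toLp = 0 := congrFun (congrArg WithLp.ofLp hξ) 0
  have h1 : (ξ : ℝ → EuclideanSpace ℝ (Fin n)) =ᵐ[volume.restrict (Ioc (0 : ℝ) 1)] fun _ => 0 := by
    have h2 := (MemLp.coeFn_toLp (ξ.memLp_weakDeriv 0)).symm.trans
      ((Lp.eq_zero_iff_ae_eq_zero).1 h0)
    have h3 : ξ.weakDeriv ((0 : Fin (k + 1)) : ℕ) = ξ := ξ.weakDeriv_spec.zero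
    rw [h3] at h2
    exact h2
  have h2 : EqOn (ξ : ℝ → EuclideanSpace ℝ (Fin n)) (fun _ => 0) (Ioc 0 1) :=
    Measure.eqOn_Ioc_of_ae_eq volume h1 ξ.property.1.continuousOn continuousOn_const
  have hper : Function.Periodic (fun t => ξ t = 0) 1 := by
    intro t
    simp [ξ.property.2.1 t]
  ext1 t
  obtain ⟨s, hs, hst⟩ := hper.exists_mem_Ioc one_pos t 0
  have hs2 : ξ s = 0 := h2 (by simpa using hs)
  exact hst.mpr hs2

noncomputable instance : NormedAddCommGroup (SobolevSection A k) :=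
  NormedAddCommGroup.induced _ _ (jet (A := A) (k := k)) jet_injective

noncomputable instance : NormedSpace ℝ (SobolevSection A k) :=
  NormedSpace.induced ℝ _ _ (jet (A := A) (k := k))

theorem norm_eq (ξ : SobolevSection A k) : ‖ξ‖ = ‖jet ξ‖ := rfl

/-- The inclusion `W^{k+1,2} ⊆ W^{k,2}` as a linear map. -/
def inclₗ (A : EuclideanSpace ℝ (Fin n) ≃L[ℝ] EuclideanSpace ℝ (Fin n)) (k : ℕ) :
    SobolevSection A (k + 1) →ₗ[ℝ] SobolevSection A k where
  toFun ξ := ⟨ξ, ξ.property.1, ξ.property.2.1, ξ.weakDeriv, ξ.weakDeriv_spec.zero,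
    fun j hj => ξ.weakDeriv_spec.l2 j (by omega), fun j hj => ξ.weakDeriv_spec.weak j (by omega)⟩
  map_add' _ _ := rfl
  map_smul' _ _ := rfl

theorem jet_inclₗ (ξ : SobolevSection A (k + 1)) (j : Fin (k + 1)) :
    jet (inclₗ A k ξ) j = jet ξ j.castSucc := by
  refine MemLp.toLp_congr (memLp_weakDeriv (inclₗ A k ξ) j) (memLp_weakDeriv ξ j.castSucc)
    (ae_restrict_of_ae ?_)
  have h : IsSobolevJet k univ (inclₗ A k ξ) ξ.weakDeriv :=
    ⟨ξ.weakDeriv_spec.zero, fun j hj => ξ.weakDeriv_spec.l2 j (by omega),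
      fun j hj => ξ.weakDeriv_spec.weak j (by omega)⟩
  exact (weakDeriv_spec (inclₗ A k ξ)).ae_eq h j (by omega)

theorem norm_inclₗ_le (ξ : SobolevSection A (k + 1)) : ‖inclₗ A k ξ‖ ≤ 1 * ‖ξ‖ := by
  rw [one_mul, norm_eq, norm_eq, ← sq_le_sq₀ (norm_nonneg _) (norm_nonneg _),
    PiLp.norm_sq_eq_of_L2, PiLp.norm_sq_eq_of_L2, Fin.sum_univ_castSucc (n := k + 1)]
  simp only [jet_inclₗ]
  exact le_add_of_nonneg_right (sq_nonneg _)

/-- The inclusion `W^{k+1,2} ⊆ W^{k,2}`. -/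
noncomputable def incl (A : EuclideanSpace ℝ (Fin n) ≃L[ℝ] EuclideanSpace ℝ (Fin n)) (k : ℕ) :
    SobolevSection A (k + 1) →L[ℝ] SobolevSection A k :=
  (inclₗ A k).mkContinuous 1 norm_inclₗ_le

end SobolevSection

end Sections

/-! ### Scale calculus -/

/-- A scale of normed spaces `E₀ ← E₁ ← E₂ ← …`. -/
structure ScScale where
  X : ℕ → Type
  [normed : ∀ m, NormedAddCommGroup (X m)]
  [space : ∀ m, NormedSpace ℝ (X m)]
  incl : ∀ m, X (m + 1) →L[ℝ] X m

attribute [instance] ScScale.normed ScScale.space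

namespace ScScale

/-- The inclusion `E_m → E₀`. -/
noncomputable def toBase (E : ScScale) : ∀ m, E.X m →L[ℝ] E.X 0
  | 0 => ContinuousLinearMap.id ℝ (E.X 0)
  | m + 1 => (toBase E m).comp (E.incl m)

/-- The scale is an sc-structure on the Banach space `E₀`: the levels are Banach spaces, the
inclusions are injective and compact, and `E_∞ = ⋂ E_k` is dense in every `E_m`. -/
structure IsScBanach (E : ScScale) : Prop where
  complete : ∀ m, CompleteSpace (E.X m)
  injective : ∀ m, Function.Injective (E.incl m)
  compact : ∀ m, IsCompactOperator (E.incl m)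
  dense : ∀ m, Dense {x : E.X m | ∀ k, E.toBase m x ∈ range (E.toBase k)}

/-- The product of two scales. -/
noncomputable abbrev prod (E F : ScScale) : ScScale where
  X m := E.X m × F.X m
  incl m := (E.incl m).prodMap (F.incl m)

/-- The tangent scale `TE = E¹ ⊕ E`, with levels `E_{m+1} ⊕ E_m`. -/
noncomputable abbrev tangent (E : ScScale) : ScScale where
  X m := E.X (m + 1) × E.X m
  incl m := (E.incl (m + 1)).prodMap (E.incl m)

/-- The tangent `TU = U¹ ⊕ E` of a set `U ⊆ E₀`. -/
def tangentSet (E : ScScale) (U : Set (E.X 0)) : Set (E.tangent.X 0) :=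
  {p : E.X 1 × E.X 0 | E.incl 0 p.1 ∈ U}

end ScScale

/-- `f : U → F` is sc-continuous (`sc⁰`): for every `m` it maps `U_m = U ∩ E_m` to `F_m`, and it is
continuous as a map `U_m → F_m`. -/
def Sc0On (E F : ScScale) (U : Set (E.X 0)) (f : E.X 0 → F.X 0) : Prop :=
  ∀ m, ∃ g : E.X m → F.X m, ContinuousOn g (E.toBase m ⁻¹' U) ∧
    ∀ x, E.toBase m x ∈ U → F.toBase m (g x) = f (E.toBase m x)

/-- `Tf : TU → TF` is the tangent map `(x, h) ↦ (f x, Df(x) h)` of `f`, where for `x ∈ U₁` the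
sc-derivative `Df(x) : E₀ → F₀` is a bounded linear map with
`‖f (x + h) - f x - Df(x) h‖₀ / ‖h‖₁ → 0` as `h → 0` in `E₁`. -/
def IsScTangentMap (E F : ScScale) (U : Set (E.X 0)) (f : E.X 0 → F.X 0)
    (Tf : E.tangent.X 0 → F.tangent.X 0) : Prop :=
  ∀ x : E.X 1, E.incl 0 x ∈ U → ∃ L : E.X 0 →L[ℝ] F.X 0,
    HasFDerivAt (fun y : E.X 1 => f (E.incl 0 y)) (L.comp (E.incl 0)) x ∧
    ∀ h : E.X 0, ∃ y : F.X 1, F.incl 0 y = f (E.incl 0 x) ∧ Tf (x, h) = (y, L h)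

/-- `f : U → F` is of class `sc^k` on the open set `U ⊆ E₀`: for `k = 0` it is `sc⁰`, and it is
`sc^{k+1}` if it is `sc⁰` and sc-differentiable with a tangent map `Tf : TU → TF` of class
`sc^k`. -/
def ScOn : ℕ → (E F : ScScale) → Set (E.X 0) → (E.X 0 → F.X 0) → Prop
  | 0, E, F, U, f => Sc0On E F U f
  | k + 1, E, F, U, f => Sc0On E F U f ∧ ∃ Tf : E.tangent.X 0 → F.tangent.X 0,
      IsScTangentMap E F U f Tf ∧ ScOn k E.tangent F.tangent (E.tangentSet U) Tf

/-- `f` is sc-smooth on `U`: of class `sc^k` for every `k`. -/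
def ScSmoothOn (E F : ScScale) (U : Set (E.X 0)) (f : E.X 0 → F.X 0) : Prop :=
  ∀ k, ScOn k E F U f

/-! ### sc-manifolds -/

/-- A bijection from a subset of `X` to a subset of (the base level of) a scale. -/
structure ScChart (X : Type*) where
  model : ScScale
  chart : PartialEquiv X (model.X 0)

namespace ScChart

/-- The product of two charts. -/
noncomputable def prod {X Y : Type*} (c : ScChart X) (d : ScChart Y) : ScChart (X × Y) where
  model := c.model.prod d.model
  chart := c.chart.prod d.chart

open Classical in
/-- The restriction of a chart of `X` to a subset `S`. (The point `x₀` only serves as the value of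
the inverse outside of the target.) -/
noncomputable def restrict {X : Type*} (c : ScChart X) (S : Set X) (x₀ : S) : ScChart S where
  model := c.model
  chart :=
    { toFun := fun x => c.chart x
      invFun := fun y => if h : c.chart.symm y ∈ S then ⟨c.chart.symm y, h⟩ else x₀
      source := {x | (x : X) ∈ c.chart.source}
      target := c.chart.target ∩ c.chart.symm ⁻¹' S
      map_source' := fun x hx =>
        ⟨c.chart.map_source hx, by
          change c.chart.symm (c.chart x) ∈ S
          rw [c.chart.left_inv hx]; exact x.2⟩
      map_target' := fun y hy => by
        have h : c.chart.symm y ∈ S := hy.2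
        simpa [h] using c.chart.map_target hy.1
      left_inv' := fun x hx => by
        have h : c.chart.symm (c.chart x) = x := c.chart.left_inv hx
        have h2 : c.chart.symm (c.chart x) ∈ S := by rw [h]; exact x.2
        rw [dif_pos h2]
        exact Subtype.ext h
      right_inv' := fun y hy => by
        have h : c.chart.symm y ∈ S := hy.2
        rw [dif_pos h]
        exact c.chart.right_inv hy.1 }

end ScChart

/-- The topology on `X` generated by the sets `c⁻¹(V)`, for the charts `c` in the atlas and `V` open
in the model of `c`. -/
abbrev atlasTopology {X : Type*} (𝒜 : Set (ScChart X)) : TopologicalSpace X :=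
  TopologicalSpace.generateFrom {O | ∃ c ∈ 𝒜, ∃ V : Set (c.model.X 0),
    IsOpen V ∧ O = c.chart.source ∩ c.chart ⁻¹' V}

/-- `𝒜` is an sc-smooth atlas on the topological space `X`, which makes it an sc-manifold: `X` is
Hausdorff and paracompact, the charts are homeomorphisms from open subsets of `X` onto open subsets
of sc-Banach spaces, their domains cover `X`, and all transition maps are sc-smooth. -/
structure IsScManifold (X : Type*) [TopologicalSpace X] (𝒜 : Set (ScChart X)) : Prop where
  t2 : T2Space X
  paracompact : ParacompactSpace X
  banach : ∀ c ∈ 𝒜, c.model.IsScBanach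
  open_source : ∀ c ∈ 𝒜, IsOpen c.chart.source
  open_target : ∀ c ∈ 𝒜, IsOpen c.chart.target
  continuousOn : ∀ c ∈ 𝒜, ContinuousOn c.chart c.chart.source
  continuousOn_symm : ∀ c ∈ 𝒜, ContinuousOn c.chart.symm c.chart.target
  cover : ∀ x : X, ∃ c ∈ 𝒜, x ∈ c.chart.source
  compatible : ∀ c ∈ 𝒜, ∀ d ∈ 𝒜, ScSmoothOn c.model d.model
    (c.chart.target ∩ c.chart.symm ⁻¹' d.chart.source) (fun y => d.chart (c.chart.symm y))

/-- The `m`-th level `X_m` of an sc-manifold: the points represented in charts by elements of the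
`m`-th level of the model. -/
def scLevel {X : Type*} (𝒜 : Set (ScChart X)) (m : ℕ) : Set X :=
  {x | ∃ c ∈ 𝒜, x ∈ c.chart.source ∧ c.chart x ∈ range (c.model.toBase m)}

/-- The product atlas. -/
def prodAtlas {X Y : Type*} (𝒜 : Set (ScChart X)) (ℬ : Set (ScChart Y)) : Set (ScChart (X × Y)) :=
  {e | ∃ c ∈ 𝒜, ∃ d ∈ ℬ, e = c.prod d}

/-- The atlas induced on a subset `S` (used for open `S`). -/
def restrictAtlas {X : Type*} (𝒜 : Set (ScChart X)) (S : Set X) : Set (ScChart S) :=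
  {e | ∃ c ∈ 𝒜, ∃ x₀ : S, e = c.restrict S x₀}

/-- `f : X → Y` is sc-smooth: it is continuous, and all its representatives in charts are
sc-smooth. -/
def ScSmooth {X Y : Type*} [TopologicalSpace X] [TopologicalSpace Y] (𝒜 : Set (ScChart X))
    (ℬ : Set (ScChart Y)) (f : X → Y) : Prop :=
  Continuous f ∧ ∀ c ∈ 𝒜, ∀ d ∈ ℬ, ScSmoothOn c.model d.model
    (c.chart.target ∩ c.chart.symm ⁻¹' (f ⁻¹' d.chart.source))
    (fun y => d.chart (f (c.chart.symm y)))

/-- An sc-Lie group: a group and an sc-manifold, with sc-smooth multiplication and inversion. -/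
structure IsScLieGroup (G : Type*) [TopologicalSpace G] [Group G] (𝒜 : Set (ScChart G)) :
    Prop where
  manifold : IsScManifold G 𝒜
  mul : ScSmooth (prodAtlas 𝒜 𝒜) 𝒜 (fun p : G × G => p.1 * p.2)
  inv : ScSmooth 𝒜 𝒜 (fun g : G => g⁻¹)

/-! ### Loop spaces -/

/-- The sc-structure `W^{m+2,2}`, `m ≥ 0`, on the sections of class `W^{2,2}` of the bundle over the
circle with clutching map `A`. -/
noncomputable abbrev sobolevScale {n : ℕ}
    (A : EuclideanSpace ℝ (Fin n) ≃L[ℝ] EuclideanSpace ℝ (Fin n)) : ScScale where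
  X m := SobolevSection A (m + 2)
  incl m := SobolevSection.incl A (m + 2)

/-- The covering map `ℝ → S¹ = ℝ/ℤ`, with `ℝ/ℤ` realized as the unit circle. -/
noncomputable def toCircle (t : ℝ) : Circle := Circle.exp (2 * Real.pi * t)

theorem toCircle_surjective : Function.Surjective toCircle := by
  intro z
  refine ⟨Complex.arg z / (2 * Real.pi), ?_⟩
  rw [toCircle, mul_div_cancel₀ _ (by positivity)]
  exact Circle.exp_arg z

section LoopSpaces

variable (n : ℕ) (M : Type*) [TopologicalSpace M] [ChartedSpace (EuclideanSpace ℝ (Fin n)) M]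

/-- The map `v : S¹ → M` is of class `W^{k,2}` (for `k ≥ 1`): it is continuous, and near every point
its expression in a chart of `M` is of class `W^{k,2}_loc`. -/
def IsSobolevLoop {M : Type*} [TopologicalSpace M] [ChartedSpace (EuclideanSpace ℝ (Fin n)) M]
    (k : ℕ) (v : Circle → M) : Prop :=
  Continuous v ∧ ∀ t : ℝ, ∃ ε > 0, MemSobolevLoc k (Ioo (t - ε) (t + ε))
    (fun s => chartAt (EuclideanSpace ℝ (Fin n)) (v (toCircle t)) (v (toCircle s)))

/-- The loop space `W^{2,2}(S¹, M)`. -/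
@[ext] structure SobolevLoopSpace where
  toFun : Circle → M
  sobolev : IsSobolevLoop n 2 toFun

instance : CoeFun (SobolevLoopSpace n M) (fun _ => Circle → M) := ⟨SobolevLoopSpace.toFun⟩

/-- A fibre-preserving diffeomorphism, over `S¹`, from an open subset of `S¹ × M` onto an open subset
of a vector bundle over `S¹`. It is given on the universal cover `ℝ` of `S¹`: a diffeomorphism `e`
from an open subset of `ℝ × M` onto an open subset of `ℝ × ℝⁿ` that commutes with the projections to
`ℝ` and is equivariant for `(t, q) ↦ (t + 1, q)` and `(t, x) ↦ (t + 1, A x)`. For instance, a smooth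
loop `γ` and a Riemannian metric give `e (t, q) = (t, exp_{γ(t)}⁻¹ q)`, written in a frame of
`γ^* TM`. -/
structure FiberChart where
  A : EuclideanSpace ℝ (Fin n) ≃L[ℝ] EuclideanSpace ℝ (Fin n)
  e : OpenPartialHomeomorph (ℝ × M) (ℝ × EuclideanSpace ℝ (Fin n))
  fst : ∀ p ∈ e.source, (e p).1 = p.1
  smooth : ContMDiffOn (𝓘(ℝ, ℝ).prod (𝓡 n)) (𝓘(ℝ, ℝ).prod (𝓡 n)) ∞ e e.source
  smooth_symm : ContMDiffOn (𝓘(ℝ, ℝ).prod (𝓡 n)) (𝓘(ℝ, ℝ).prod (𝓡 n)) ∞ e.symm e.target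
  source_iff : ∀ t q, (t + 1, q) ∈ e.source ↔ (t, q) ∈ e.source
  equivariant : ∀ t q, (t, q) ∈ e.source → (e (t + 1, q)).2 = A (e (t, q)).2

variable {n M}

/-- The loop `v` lies in the domain of `c`, and is represented there by the section `ξ`. -/
def FiberChart.Represents (c : FiberChart n M) (v : Circle → M)
    (ξ : ℝ → EuclideanSpace ℝ (Fin n)) : Prop :=
  ∀ t, (t, v (toCircle t)) ∈ c.e.source ∧ c.e (t, v (toCircle t)) = (t, ξ t)

theorem FiberChart.Represents.right_unique {c : FiberChart n M} {v : Circle → M}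
    {ξ ζ : ℝ → EuclideanSpace ℝ (Fin n)} (h : c.Represents v ξ) (h2 : c.Represents v ζ) (t : ℝ) :
    ξ t = ζ t :=
  congrArg Prod.snd ((h t).2.symm.trans (h2 t).2)

theorem FiberChart.Represents.left_unique {c : FiberChart n M} {v w : Circle → M}
    {ξ : ℝ → EuclideanSpace ℝ (Fin n)} (h : c.Represents v ξ) (h2 : c.Represents w ξ) : v = w := by
  funext z
  obtain ⟨t, rfl⟩ := toCircle_surjective z
  exact congrArg Prod.snd (c.e.injOn (h t).1 (h2 t).1 ((h t).2.trans (h2 t).2.symm))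

open Classical in
/-- The bijection `v ↦ ξ`, `e (t, v t) = (t, ξ t)`, from the loops of class `W^{2,2}` with graph in
the domain of `e` to the sections of class `W^{2,2}` with graph in the image of `e`.
(The loop `v₀` only serves as the value of the inverse outside of the target.) -/
noncomputable def FiberChart.loopEquiv (c : FiberChart n M) (v₀ : SobolevLoopSpace n M) :
    PartialEquiv (SobolevLoopSpace n M) (SobolevSection c.A 2) where
  toFun v := if h : ∃ ξ : SobolevSection c.A 2, c.Represents v ξ then h.choose else 0
  invFun ξ := if h : ∃ v : SobolevLoopSpace n M, c.Represents v ξ then h.choose else v₀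
  source := {v | ∃ ξ : SobolevSection c.A 2, c.Represents v ξ}
  target := {ξ | ∃ v : SobolevLoopSpace n M, c.Represents v ξ}
  map_source' v h := by
    rw [mem_ofPred_eq] at h
    rw [dif_pos h]
    exact ⟨v, h.choose_spec⟩
  map_target' ξ h := by
    rw [mem_ofPred_eq] at h
    rw [dif_pos h]
    exact ⟨ξ, h.choose_spec⟩
  left_inv' v h := by
    rw [mem_ofPred_eq] at h
    have h2 : ∃ w : SobolevLoopSpace n M, c.Represents w h.choose := ⟨v, h.choose_spec⟩
    rw [dif_pos h, dif_pos h2]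
    exact SobolevLoopSpace.ext (h2.choose_spec.left_unique h.choose_spec)
  right_inv' ξ h := by
    rw [mem_ofPred_eq] at h
    have h2 : ∃ ζ : SobolevSection c.A 2, c.Represents h.choose ζ := ⟨ξ, h.choose_spec⟩
    rw [dif_pos h, dif_pos h2]
    exact SobolevSection.ext fun t => h2.choose_spec.right_unique h.choose_spec t

/-- The chart of the loop space given by `c`. -/
noncomputable def FiberChart.loopChart (c : FiberChart n M) (v₀ : SobolevLoopSpace n M) :
    ScChart (SobolevLoopSpace n M) where
  model := sobolevScale c.A
  chart := c.loopEquiv v₀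

variable (n M)

/-- The atlas of the loop space `W^{2,2}(S¹, M)`. -/
def loopAtlas : Set (ScChart (SobolevLoopSpace n M)) :=
  {φ | ∃ (c : FiberChart n M) (v₀ : SobolevLoopSpace n M), φ = c.loopChart v₀}

instance : TopologicalSpace (SobolevLoopSpace n M) := atlasTopology (loopAtlas n M)

end LoopSpaces

/-! ### Reparametrizations -/

/-- `ψ : S¹ → S¹` is a diffeomorphism of class `W^{k,2}`: it is bijective, and `ψ` and its inverse are
of class `W^{k,2}`. -/
def IsSobolevDiffeo (k : ℕ) (ψ : Circle → Circle) : Prop :=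
  IsSobolevLoop 1 k ψ ∧ ∃ φ : Circle → Circle, Function.LeftInverse φ ψ ∧
    Function.RightInverse φ ψ ∧ IsSobolevLoop 1 k φ

/-- The set `𝒟 = 𝒟²` of diffeomorphisms of class `W^{2,2}`, as a subset of `W^{2,2}(S¹, S¹)`. -/
def CircleDiffeo : Set (SobolevLoopSpace 1 Circle) := {ψ | IsSobolevDiffeo 2 ψ}

/-- The atlas of `𝒟`, as a subset of `W^{2,2}(S¹, S¹)`. -/
noncomputable def diffeoAtlas : Set (ScChart CircleDiffeo) :=
  restrictAtlas (loopAtlas 1 Circle) CircleDiffeo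

/-! Everything is reduced to functions on the real line. Pulled back along `toCircle` and read in a
fibre chart, a loop becomes an equivariant function `ξ : ℝ → ℝⁿ`. Chart changes become
superpositions `ξ ↦ G (t, ξ t)` with `G` smooth. Reparametrization becomes `(ξ, Ψ) ↦ ξ ∘ Ψ`, where
`Ψ` is a lift of the circle diffeomorphism and again depends on its section by superposition.

In one variable, functions of class `W^{k,2}` are iterated primitives of `L²` functions
(`memSobolevLoc_iff`). Continuity of the three basic operations on `W^{k,2}_loc` then follows by
induction on `k` from the formulas `(G ∘ p)' = DG(p) p'`, `(σ ∘ Ψ)' = Ψ' • (σ' ∘ Ψ)` and `(Ψ⁻¹)' = 1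
/ (Ψ' ∘ Ψ⁻¹)`; see `STendsto.superpose`, `STendsto.comp` and `STendsto.inverse`. The base case of
composition, on `L²`, is a density argument combined with a change of variables. It needs `Ψ` to be
`C¹` with nowhere vanishing derivative, and `W^{2,2} ⊆ C¹`.

Composition is not differentiable in the classical sense, because its derivative in `Ψ` contains
`σ'`, which has one derivative less than `σ`. In scale calculus the base point of a tangent vector
lies one level higher than the vector, and this compensates the loss exactly. The predicate `SobC`
records iterated differentiability of a family `x ↦ P x` of functions on the line: directional
derivatives are taken pointwise in `t`, and continuity is required on every level with values in
`W^{m+k₀,2}_loc`. This class is stable under superposition (`SobC.superpose`), composition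
(`SobLin.sobC_comp`) and inversion (`SobLin.sobC_inverse`), since the derivatives are expressions of
the same kind over the tangent scale. `SobTarget.scOn` converts `SobC` into `sc^k`. The passage from
directional derivatives to the Fréchet-type derivative of scale calculus rests on the compactness of
`E₁ → E₀` (`hasFDerivAt_of_directional`).

The remaining ingredients are of a different nature. The Sobolev spaces of sections form an
sc-Banach scale: compactness is the Arzelà-Ascoli argument, and density is mollification. Charts
cover the loop space because along every continuous loop there is an equivariant smooth frame, and
the inverse function theorem turns it into a fibre chart (`exists_fiberChart`). The loop space is
Hausdorff and paracompact because bump functions embed it into a countable product of Sobolev spaces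
(`metrizableSpace_sobolevLoopSpace`). Finally, a map of class `W^{2,2}` belongs to `𝒟` exactly when
its lifts have degree `±1` and nowhere vanishing derivative. This is a `C¹`-open condition, and by
the formula for the derivative of the inverse it makes the inverse as regular as the map, which
determines the levels of `𝒟`. -/

set_option linter.unusedSectionVars false
set_option linter.unusedVariables false

/-! ### Primitives, Sobolev functions and Sobolev convergence on open subsets of the line -/

section SobolevLine

variable {V W : Type*} [NormedAddCommGroup V] [NormedSpace ℝ V] [NormedAddCommGroup W]
  [NormedSpace ℝ W] {ι : Type*} {l : Filter ι} {U U' : Set ℝ} {k : ℕ}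

/-- `f` is a primitive of `g` on `U`. -/
def IsPrimOn (U : Set ℝ) (f g : ℝ → V) : Prop :=
  ∀ a b, uIcc a b ⊆ U → f b - f a = ∫ t in a..b, g t

/-- `f` is of class `W^{k,2}_loc` on `U`, in terms of classical primitives. -/
def SobolevOn : ℕ → Set ℝ → (ℝ → V) → Prop
  | 0, U, f => IsL2Loc U f
  | k + 1, U, f => IsPrimOn U f (deriv f) ∧ SobolevOn k U (deriv f)

/-- Continuous convergence of `F i` to `f` on `U`. -/
def CConv (l : Filter ι) (U : Set ℝ) (F : ι → ℝ → V) (f : ℝ → V) : Prop :=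
  ∀ t ∈ U, Tendsto (fun p : ι × ℝ => F p.1 p.2) (l ×ˢ 𝓝 t) (𝓝 (f t))

/-- Convergence in `L²` on the compact subsets of `U`. -/
def L2Conv (l : Filter ι) (U : Set ℝ) (F : ι → ℝ → V) (f : ℝ → V) : Prop :=
  ∀ K ⊆ U, IsCompact K → Tendsto (fun i => eLpNorm (F i - f) 2 (volume.restrict K)) l (𝓝 0)

/-- Convergence in `W^{k,2}_loc(U)`. -/
def SobConv : ℕ → Filter ι → Set ℝ → (ι → ℝ → V) → (ℝ → V) → Prop
  | 0, l, U, F, f => L2Conv l U F f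
  | k + 1, l, U, F, f => CConv l U F f ∧ SobConv k l U (fun i => deriv (F i)) (deriv f)

/-- `F i` and `f` are of class `W^{k,2}_loc(U)`, and `F i` converges to `f` in this space. -/
structure STendsto (k : ℕ) (l : Filter ι) (U : Set ℝ) (F : ι → ℝ → V) (f : ℝ → V) : Prop where
  mem : ∀ i, SobolevOn k U (F i)
  lim : SobolevOn k U f
  conv : SobConv k l U F f

theorem IsL2Loc.mono {f : ℝ → V} (h : IsL2Loc U f) (hU : U' ⊆ U) : IsL2Loc U' f :=
  fun K hK hc => h K (hK.trans hU) hc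

theorem IsPrimOn.mono {f g : ℝ → V} (h : IsPrimOn U f g) (hU : U' ⊆ U) : IsPrimOn U' f g :=
  fun a b hab => h a b (hab.trans hU)

theorem SobolevOn.mono {f : ℝ → V} (h : SobolevOn k U f) (hU : U' ⊆ U) : SobolevOn k U' f := by
  induction k generalizing f with
  | zero => exact IsL2Loc.mono h hU
  | succ k ih => exact ⟨h.1.mono hU, ih h.2⟩

theorem SobConv.mono {F : ι → ℝ → V} {f : ℝ → V} (h : SobConv k l U F f) (hU : U' ⊆ U) :
    SobConv k l U' F f := by
  induction k generalizing F f with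
  | zero => exact fun K hK hc => h K (hK.trans hU) hc
  | succ k ih => exact ⟨fun t ht => h.1 t (hU ht), ih h.2⟩

theorem STendsto.mono {F : ι → ℝ → V} {f : ℝ → V} (h : STendsto k l U F f) (hU : U' ⊆ U) :
    STendsto k l U' F f :=
  ⟨fun i => (h.mem i).mono hU, h.lim.mono hU, h.conv.mono hU⟩

theorem CConv.tendsto {F : ι → ℝ → V} {f : ℝ → V} (h : CConv l U F f) {t : ℝ} (ht : t ∈ U) :
    Tendsto (fun i => F i t) l (𝓝 (f t)) :=
  (h t ht).comp (tendsto_id.prodMk (tendsto_const_nhds (x := t)))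

/-- Reindexing a convergent family. -/
theorem SobConv.comp_tendsto {κ : Type*} {l' : Filter κ} {u : κ → ι} (hu : Tendsto u l' l)
    {F : ι → ℝ → V} {f : ℝ → V} (h : SobConv k l U F f) :
    SobConv k l' U (fun i => F (u i)) f := by
  induction k generalizing F f with
  | zero => exact fun K hK hc => (h K hK hc).comp hu
  | succ k ih => exact ⟨fun t ht => (h.1 t ht).comp (hu.prodMap tendsto_id), ih h.2⟩

theorem STendsto.comp_tendsto {κ : Type*} {l' : Filter κ} {u : κ → ι} (hu : Tendsto u l' l)
    {F : ι → ℝ → V} {f : ℝ → V} (h : STendsto k l U F f) :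
    STendsto k l' U (fun i => F (u i)) f :=
  ⟨fun i => h.mem (u i), h.lim, h.conv.comp_tendsto hu⟩

/-- Convergence may be checked on a set of indices that belongs to the filter. -/
theorem SobConv.of_subtype {s : Set ι} (hs : s ∈ l) {F : ι → ℝ → V} {f : ℝ → V}
    (h : SobConv k (comap ((↑) : s → ι) l) U (fun i => F i) f) : SobConv k l U F f := by
  have hm : map ((↑) : s → ι) (comap (↑) l) = l := by
    rw [map_comap, Subtype.range_coe, inf_eq_left.2 (le_principal_iff.2 hs)]
  induction k generalizing F f with
  | zero =>
    intro K hK hc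
    have := h K hK hc
    rw [← hm]
    exact tendsto_map'_iff.2 this
  | succ k ih =>
    refine ⟨fun t ht => ?_, ih h.2⟩
    have := h.1 t ht
    have e : map (Prod.map ((↑) : s → ι) (id : ℝ → ℝ)) (comap (↑) l ×ˢ 𝓝 t) = l ×ˢ 𝓝 t := by
      rw [← prod_map_map_eq', hm, map_id]
    rw [← e]
    exact tendsto_map'_iff.2 this

theorem IsL2Loc.intervalIntegrable {g : ℝ → V} (hg : IsL2Loc U g) {a b : ℝ} (h : uIcc a b ⊆ U) :
    IntervalIntegrable g volume a b := by
  have h1 := hg (uIcc a b) h isCompact_uIcc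
  have : IsFiniteMeasure (volume.restrict (uIcc a b)) :=
    ⟨by simp⟩
  have h2 : IntegrableOn g (uIcc a b) volume := h1.integrable (by norm_num)
  exact h2.intervalIntegrable

theorem exists_uIcc_subset (hU : IsOpen U) {t : ℝ} (ht : t ∈ U) :
    ∃ ε > 0, Icc (t - ε) (t + ε) ⊆ U := by
  obtain ⟨ε, hε, h⟩ := Metric.isOpen_iff.1 hU t ht
  refine ⟨ε / 2, by positivity, fun s hs => h ?_⟩
  rw [Metric.mem_ball, Real.dist_eq, abs_lt]
  constructor <;> linarith [hs.1, hs.2]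

theorem ContinuousOn.isL2Loc {f : ℝ → V} (hf : ContinuousOn f U) : IsL2Loc U f := by
  intro K hK hc
  have hfK := hf.mono hK
  obtain ⟨C, hC⟩ := hc.exists_bound_of_continuousOn hfK
  have : IsFiniteMeasure (volume.restrict K) := ⟨by simpa using hc.measure_lt_top⟩
  refine MemLp.of_bound (hfK.aestronglyMeasurable_of_isCompact hc hc.measurableSet) C ?_
  exact (ae_restrict_mem hc.measurableSet).mono fun t ht => hC t ht

theorem IsL2Loc.congr_ae {f g : ℝ → V} (hf : IsL2Loc U f) (h : ∀ᵐ t, t ∈ U → f t = g t) :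
    IsL2Loc U g := by
  intro K hK hc
  refine (hf K hK hc).ae_eq ?_
  rw [EventuallyEq, ae_restrict_iff' hc.measurableSet]
  filter_upwards [h] with t ht hk using ht (hK hk)

theorem L2Conv.congr_ae {F G : ι → ℝ → V} {f g : ℝ → V} (h : L2Conv l U F f)
    (hF : ∀ᶠ i in l, ∀ᵐ t, t ∈ U → F i t = G i t) (hf : ∀ᵐ t, t ∈ U → f t = g t) :
    L2Conv l U G g := by
  intro K hK hc
  refine (h K hK hc).congr' ?_
  filter_upwards [hF] with i hi
  refine eLpNorm_congr_ae ?_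
  rw [EventuallyEq, ae_restrict_iff' hc.measurableSet]
  filter_upwards [hi, hf] with t h1 h2 hk
  simp [h1 (hK hk), h2 (hK hk)]

theorem IsPrimOn.continuousOn (hU : IsOpen U) {f g : ℝ → V} (h : IsPrimOn U f g)
    (hg : IsL2Loc U g) : ContinuousOn f U := by
  intro t ht
  obtain ⟨ε, hε, hs⟩ := exists_uIcc_subset hU ht
  refine ContinuousAt.continuousWithinAt ?_
  have hle : t - ε ≤ t + ε := by linarith
  have hc := intervalIntegral.continuousOn_primitive_interval' (a := t)
    (hg.intervalIntegrable (a := t - ε) (b := t + ε) (by rwa [uIcc_of_le hle]))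
    (by rw [uIcc_of_le hle]; constructor <;> linarith)
  rw [uIcc_of_le hle] at hc
  have hn : Icc (t - ε) (t + ε) ∈ 𝓝 t := Icc_mem_nhds (by linarith) (by linarith)
  have hca := (hc.continuousAt hn).const_add (f t)
  refine hca.congr ?_
  filter_upwards [hn] with s hsn
  rw [← h t s, add_sub_cancel]
  refine Subset.trans (uIcc_subset_Icc ?_ hsn) hs
  constructor <;> linarith

theorem SobolevOn.of_succ (hU : IsOpen U) {f : ℝ → V} (h : SobolevOn (k + 1) U f) :
    SobolevOn k U f := by
  induction k generalizing f with
  | zero => exact (h.1.continuousOn hU h.2).isL2Loc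
  | succ k ih => exact ⟨h.1, ih h.2⟩

theorem SobolevOn.of_le (hU : IsOpen U) {f : ℝ → V} {j : ℕ} (h : SobolevOn k U f) (hj : j ≤ k) :
    SobolevOn j U f := by
  induction k, hj using Nat.le_induction with
  | base => exact h
  | succ k _ ih => exact ih (h.of_succ hU)

theorem SobolevOn.isL2Loc (hU : IsOpen U) {f : ℝ → V} (h : SobolevOn k U f) : IsL2Loc U f :=
  SobolevOn.of_le hU h (Nat.zero_le k)

theorem SobolevOn.continuousOn (hU : IsOpen U) {f : ℝ → V} (h : SobolevOn (k + 1) U f) :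
    ContinuousOn f U :=
  h.1.continuousOn hU (h.2.isL2Loc hU)

theorem Filter.EventuallyEq.deriv_on {f g : ℝ → V} (hU : IsOpen U) (h : EqOn f g U) :
    EqOn (deriv f) (deriv g) U := fun t ht =>
  (h.eventuallyEq_of_mem (hU.mem_nhds ht)).deriv_eq

theorem IsPrimOn.congr {f g f' g' : ℝ → V} (h : IsPrimOn U f g) (hf : EqOn f f' U)
    (hg : ∀ᵐ t, t ∈ U → g t = g' t) : IsPrimOn U f' g' := by
  intro a b hab
  rw [← hf (hab left_mem_uIcc), ← hf (hab right_mem_uIcc), h a b hab]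
  refine intervalIntegral.integral_congr_ae ?_
  filter_upwards [hg] with t ht h1 using ht (hab (uIoc_subset_uIcc h1))

theorem SobolevOn.congr (hU : IsOpen U) {f g : ℝ → V} (h : SobolevOn k U f) (hfg : EqOn f g U) :
    SobolevOn k U g := by
  induction k generalizing f g with
  | zero => exact IsL2Loc.congr_ae h (ae_of_all _ hfg)
  | succ k ih =>
    have := Filter.EventuallyEq.deriv_on hU hfg
    exact ⟨h.1.congr hfg (ae_of_all _ this), ih h.2 this⟩

theorem SobConv.congr (hU : IsOpen U) {F G : ι → ℝ → V} {f g : ℝ → V} (h : SobConv k l U F f)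
    (hF : ∀ᶠ i in l, EqOn (F i) (G i) U) (hf : EqOn f g U) : SobConv k l U G g := by
  induction k generalizing F G f g with
  | zero =>
    exact L2Conv.congr_ae h (hF.mono fun i hi => ae_of_all _ hi) (ae_of_all _ hf)
  | succ k ih =>
    refine ⟨fun t ht => ?_, ih h.2 (hF.mono fun i hi => Filter.EventuallyEq.deriv_on hU hi)
      (Filter.EventuallyEq.deriv_on hU hf)⟩
    rw [← hf ht]
    refine (h.1 t ht).congr' ?_
    filter_upwards [hF.prod_mk (hU.mem_nhds ht : ∀ᶠ s in 𝓝 t, s ∈ U)] with p hp using hp.1 hp.2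

theorem STendsto.congr (hU : IsOpen U) {F G : ι → ℝ → V} {f g : ℝ → V} (h : STendsto k l U F f)
    (hF : ∀ i, EqOn (F i) (G i) U) (hf : EqOn f g U) : STendsto k l U G g :=
  ⟨fun i => (h.mem i).congr hU (hF i), h.lim.congr hU hf,
    h.conv.congr hU (Eventually.of_forall hF) hf⟩

/-- Local Lebesgue differentiation. -/
theorem IsPrimOn.ae_hasDerivAt [CompleteSpace V] (hU : IsOpen U) {f g : ℝ → V}
    (h : IsPrimOn U f g) (hg : IsL2Loc U g) : ∀ᵐ t, t ∈ U → HasDerivAt f (g t) t := by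
  -- Lebesgue differentiation is available on compact intervals. Intervals with rational end points
  -- suffice to cover `U`, and there are only countably many, so the exceptional null sets add up to
  -- a null set.
  have key : ∀ q : ℚ × ℚ, uIcc (q.1 : ℝ) q.2 ⊆ U →
      ∀ᵐ t : ℝ, t ∈ Ioo (q.1 : ℝ) q.2 → HasDerivAt f (g t) t := by
    intro q hq
    filter_upwards [(hg.intervalIntegrable hq).ae_hasDerivAt_integral] with t ht hti
    have hti2 : t ∈ uIcc (q.1 : ℝ) q.2 := by
      rw [uIcc_of_le (hti.1.trans hti.2).le]; exact Ioo_subset_Icc_self hti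
    have := (ht hti2 q.1 left_mem_uIcc).const_add (f q.1)
    refine this.congr_of_eventuallyEq ?_
    filter_upwards [Ioo_mem_nhds hti.1 hti.2] with s hs
    rw [← h _ s, add_sub_cancel]
    refine (uIcc_subset_uIcc left_mem_uIcc ?_).trans hq
    rw [uIcc_of_le (hti.1.trans hti.2).le]; exact Ioo_subset_Icc_self hs
  have key2 : ∀ᵐ t : ℝ, ∀ q : ℚ × ℚ, uIcc (q.1 : ℝ) q.2 ⊆ U →
      t ∈ Ioo (q.1 : ℝ) q.2 → HasDerivAt f (g t) t := by
    rw [ae_all_iff]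
    intro q
    by_cases hq : uIcc (q.1 : ℝ) q.2 ⊆ U
    · filter_upwards [key q hq] with t ht _ using ht
    · exact ae_of_all _ fun t h => absurd h hq
  filter_upwards [key2] with t ht htU
  obtain ⟨ε, hε, hs⟩ := exists_uIcc_subset hU htU
  obtain ⟨a, ha1, ha2⟩ := exists_rat_btwn (show t - ε < t by linarith)
  obtain ⟨b, hb1, hb2⟩ := exists_rat_btwn (show t < t + ε by linarith)
  refine ht (a, b) ?_ ⟨ha2, hb1⟩
  rw [uIcc_of_le (ha2.trans hb1).le]
  exact (Icc_subset_Icc ha1.le hb2.le).trans hs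

theorem IsPrimOn.hasDerivAt [CompleteSpace V] (hU : IsOpen U) {f g : ℝ → V}
    (h : IsPrimOn U f g) (hg : ContinuousOn g U) {t : ℝ} (ht : t ∈ U) :
    HasDerivAt f (g t) t := by
  obtain ⟨ε, hε, hs⟩ := exists_uIcc_subset hU ht
  have hn : Icc (t - ε) (t + ε) ∈ 𝓝 t := Icc_mem_nhds (by linarith) (by linarith)
  have hsub : ∀ s ∈ Icc (t - ε) (t + ε), uIcc t s ⊆ U := fun s hsn =>
    (uIcc_subset_Icc (by constructor <;> linarith) hsn).trans hs
  have h1 : HasDerivAt (fun s => ∫ r in t..s, g r) (g t) t := by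
    refine intervalIntegral.integral_hasDerivAt_right (by simp) ?_ (hg.continuousAt (hU.mem_nhds ht))
    exact hg.stronglyMeasurableAtFilter hU t ht
  refine (h1.const_add (f t)).congr_of_eventuallyEq ?_
  filter_upwards [hn] with s hsn
  rw [← h t s (hsub s hsn), add_sub_cancel]

theorem SobolevOn.hasDerivAt [CompleteSpace V] (hU : IsOpen U) {f : ℝ → V}
    (h : SobolevOn (k + 2) U f) {t : ℝ} (ht : t ∈ U) : HasDerivAt f (deriv f t) t :=
  h.1.hasDerivAt hU (h.2.continuousOn hU) ht

/-- By Lebesgue differentiation `g` and `deriv f` agree almost everywhere, which is enough for `k =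
0`. For `k ≥ 1` the function `g` is continuous, so they agree everywhere. The choice of `deriv f` as
the representative in `SobolevOn` is therefore harmless. -/
theorem IsPrimOn.sobolevOn [CompleteSpace V] (hU : IsOpen U) {f g : ℝ → V}
    (h : IsPrimOn U f g) (hg : SobolevOn k U g) : SobolevOn (k + 1) U f := by
  have hae : ∀ᵐ t, t ∈ U → g t = deriv f t := by
    filter_upwards [h.ae_hasDerivAt hU (hg.isL2Loc hU)] with t ht htU using (ht htU).deriv.symm
  refine ⟨h.congr (fun _ _ => rfl) hae, ?_⟩
  cases k with
  | zero => exact IsL2Loc.congr_ae hg hae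
  | succ k =>
    exact hg.congr hU fun t ht => (h.hasDerivAt hU (hg.continuousOn hU) ht).deriv.symm

/-- Convergence of primitives. -/
theorem STendsto.of_prim [CompleteSpace V] (hU : IsOpen U) {F G : ι → ℝ → V} {f g : ℝ → V}
    (hF : ∀ i, IsPrimOn U (F i) (G i)) (hf : IsPrimOn U f g) (hc : CConv l U F f)
    (h : STendsto k l U G g) : STendsto (k + 1) l U F f := by
  refine ⟨fun i => (hF i).sobolevOn hU (h.mem i), hf.sobolevOn hU h.lim, hc, ?_⟩
  have hae : ∀ {f g : ℝ → V}, IsPrimOn U f g → SobolevOn k U g →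
      ∀ᵐ t, t ∈ U → g t = deriv f t := by
    intro f g hp hg
    filter_upwards [hp.ae_hasDerivAt hU (hg.isL2Loc hU)] with t ht htU using (ht htU).deriv.symm
  cases k with
  | zero =>
    exact L2Conv.congr_ae h.conv (Eventually.of_forall fun i => hae (hF i) (h.mem i))
      (hae hf h.lim)
  | succ k =>
    exact h.conv.congr hU (Eventually.of_forall fun i t ht =>
      ((hF i).hasDerivAt hU ((h.mem i).continuousOn hU) ht).deriv.symm)
      fun t ht => (hf.hasDerivAt hU (h.lim.continuousOn hU) ht).deriv.symm

theorem STendsto.derivs {F : ι → ℝ → V} {f : ℝ → V} (h : STendsto (k + 1) l U F f) :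
    STendsto k l U (fun i => deriv (F i)) (deriv f) :=
  ⟨fun i => (h.mem i).2, h.lim.2, h.conv.2⟩

theorem STendsto.cconv {F : ι → ℝ → V} {f : ℝ → V} (h : STendsto (k + 1) l U F f) :
    CConv l U F f := h.conv.1

/-- For a continuous limit, continuous convergence amounts to locally uniform convergence. It is the
more convenient notion because it passes through compositions, even when the inner function varies
as well. -/
theorem CConv.tendstoUniformlyOn {F : ι → ℝ → V} {f : ℝ → V} (h : CConv l U F f)
    (hf : ContinuousOn f U) {K : Set ℝ} (hK : K ⊆ U) (hc : IsCompact K) :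
    TendstoUniformlyOn F f l K := by
  rw [← tendstoLocallyUniformlyOn_iff_tendstoUniformlyOn_of_compact hc]
  rw [tendstoLocallyUniformlyOn_iff_filter]
  intro t ht
  rw [tendstoUniformlyOnFilter_iff_tendsto]
  have h1 : Tendsto (fun p : ι × ℝ => F p.1 p.2) (l ×ˢ 𝓝[K] t) (𝓝 (f t)) :=
    (h t (hK ht)).mono_left (prod_mono le_rfl nhdsWithin_le_nhds)
  have h2 : Tendsto (fun p : ι × ℝ => f p.2) (l ×ˢ 𝓝[K] t) (𝓝 (f t)) :=
    ((hf.mono hK) t ht).tendsto.comp tendsto_snd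
  exact (h2.prodMk_nhds h1).mono_right (nhds_le_uniformity (f t))

theorem CConv.eventually_dist_lt {F : ι → ℝ → V} {f : ℝ → V} (h : CConv l U F f)
    (hf : ContinuousOn f U) {K : Set ℝ} (hK : K ⊆ U) (hc : IsCompact K) {ε : ℝ} (hε : 0 < ε) :
    ∀ᶠ i in l, ∀ t ∈ K, ‖F i t - f t‖ < ε := by
  filter_upwards [Metric.tendstoUniformlyOn_iff.1 (h.tendstoUniformlyOn hf hK hc) ε hε] with i hi t ht
  rw [← dist_eq_norm, dist_comm]
  exact hi t ht

theorem eLpNorm_restrict_le_of_bound {K : Set ℝ} (hc : IsCompact K) {f : ℝ → V} {C : ℝ}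
    (h : ∀ t ∈ K, ‖f t‖ ≤ C) :
    eLpNorm f 2 (volume.restrict K) ≤ volume K ^ (2 : ℝ)⁻¹ * ENNReal.ofReal C := by
  have := eLpNorm_le_of_ae_bound (p := 2) (μ := volume.restrict K) (f := f) (C := C)
    ((ae_restrict_mem hc.measurableSet).mono fun t ht => h t ht)
  simpa using this

theorem CConv.l2Conv {F : ι → ℝ → V} {f : ℝ → V} (h : CConv l U F f)
    (hf : ContinuousOn f U) : L2Conv l U F f := by
  intro K hK hc
  have hv : volume K ^ (2 : ℝ)⁻¹ ≠ ⊤ :=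
    (ENNReal.rpow_lt_top_of_nonneg (by positivity) hc.measure_lt_top.ne).ne
  have ht : Tendsto (fun ε : ℝ => volume K ^ (2 : ℝ)⁻¹ * ENNReal.ofReal ε) (𝓝[>] 0) (𝓝 0) := by
    have h1 : Tendsto (fun ε : ℝ => ENNReal.ofReal ε) (𝓝[>] 0) (𝓝 0) := by
      have := (ENNReal.continuous_ofReal.tendsto 0).mono_left
        (nhdsWithin_le_nhds : 𝓝[>] (0 : ℝ) ≤ 𝓝 0)
      simpa using this
    have := ENNReal.Tendsto.const_mul h1 (Or.inr hv)
    simpa using this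
  rw [ENNReal.tendsto_nhds_zero]
  intro δ hδ
  obtain ⟨ε, hε1, hε2⟩ := ((ENNReal.tendsto_nhds_zero.1 ht δ hδ).and self_mem_nhdsWithin).exists
  filter_upwards [h.eventually_dist_lt hf hK hc hε2] with i hi
  exact (eLpNorm_restrict_le_of_bound hc fun t ht => (hi t ht).le).trans hε1

theorem STendsto.of_succ (hU : IsOpen U) {F : ι → ℝ → V} {f : ℝ → V}
    (h : STendsto (k + 1) l U F f) : STendsto k l U F f := by
  refine ⟨fun i => (h.mem i).of_succ hU, h.lim.of_succ hU, ?_⟩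
  induction k generalizing F f with
  | zero => exact h.cconv.l2Conv (h.lim.continuousOn hU)
  | succ k ih => exact ⟨h.cconv, ih h.derivs⟩

theorem STendsto.of_le (hU : IsOpen U) {F : ι → ℝ → V} {f : ℝ → V} {j : ℕ}
    (h : STendsto k l U F f) (hj : j ≤ k) : STendsto j l U F f := by
  induction k, hj using Nat.le_induction with
  | base => exact h
  | succ k _ ih => exact ih (h.of_succ hU)

/-! ### Linear operations -/

theorem IsPrimOn.clm [CompleteSpace V] [CompleteSpace W] (L : V →L[ℝ] W) {f g : ℝ → V}
    (h : IsPrimOn U f g) (hg : IsL2Loc U g) :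
    IsPrimOn U (fun t => L (f t)) (fun t => L (g t)) := by
  intro a b hab
  rw [← map_sub, h a b hab, L.intervalIntegral_comp_comm (hg.intervalIntegrable hab)]

theorem IsL2Loc.clm (L : V →L[ℝ] W) {f : ℝ → V} (h : IsL2Loc U f) :
    IsL2Loc U (fun t => L (f t)) :=
  fun K hK hc => L.comp_memLp' (h K hK hc)

theorem L2Conv.clm (L : V →L[ℝ] W) {F : ι → ℝ → V} {f : ℝ → V} (h : L2Conv l U F f) :
    L2Conv l U (fun i t => L (F i t)) (fun t => L (f t)) := by
  intro K hK hc
  have h1 := ENNReal.Tendsto.const_mul (h K hK hc) (Or.inr (ENNReal.coe_ne_top (r := ‖L‖₊)))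
  rw [mul_zero] at h1
  refine tendsto_of_tendsto_of_tendsto_of_le_of_le tendsto_const_nhds h1 (fun _ => zero_le) ?_
  intro i
  refine eLpNorm_le_nnreal_smul_eLpNorm_of_ae_le_mul (ae_of_all _ fun t => ?_) 2
  simp only [Pi.sub_apply, ← map_sub]
  exact L.le_opNNNorm _

theorem STendsto.clm [CompleteSpace V] [CompleteSpace W] (hU : IsOpen U) (L : V →L[ℝ] W)
    {F : ι → ℝ → V} {f : ℝ → V} (h : STendsto k l U F f) :
    STendsto k l U (fun i t => L (F i t)) (fun t => L (f t)) := by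
  induction k generalizing F f with
  | zero => exact ⟨fun i => IsL2Loc.clm L (h.mem i), IsL2Loc.clm L h.lim, L2Conv.clm L h.conv⟩
  | succ k ih =>
    refine STendsto.of_prim hU (fun i => ((h.mem i).1.clm L ((h.mem i).2.isL2Loc hU)))
      (h.lim.1.clm L (h.lim.2.isL2Loc hU)) ?_ (ih h.derivs)
    exact fun t ht => (L.continuous.tendsto _).comp (h.cconv t ht)

theorem IsPrimOn.add {f g f' g' : ℝ → V} (h : IsPrimOn U f g) (hg : IsL2Loc U g)
    (h' : IsPrimOn U f' g') (hg' : IsL2Loc U g') :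
    IsPrimOn U (fun t => f t + f' t) (fun t => g t + g' t) := by
  intro a b hab
  rw [intervalIntegral.integral_add (hg.intervalIntegrable hab) (hg'.intervalIntegrable hab),
    ← h a b hab, ← h' a b hab, add_sub_add_comm]

theorem L2Conv.add {F F' : ι → ℝ → V} {f f' : ℝ → V} (h : L2Conv l U F f) (h' : L2Conv l U F' f')
    (hm : ∀ i, IsL2Loc U (F i)) (hl : IsL2Loc U f) (hm' : ∀ i, IsL2Loc U (F' i))
    (hl' : IsL2Loc U f') :
    L2Conv l U (fun i t => F i t + F' i t) (fun t => f t + f' t) := by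
  intro K hK hc
  have h1 := (h K hK hc).add (h' K hK hc)
  rw [add_zero] at h1
  refine tendsto_of_tendsto_of_tendsto_of_le_of_le tendsto_const_nhds h1 (fun _ => zero_le) ?_
  intro i
  have e : ((fun t => F i t + F' i t) - fun t => f t + f' t) = (F i - f) + (F' i - f') := by
    ext t; simp only [Pi.sub_apply, Pi.add_apply]; abel
  dsimp only
  rw [e]
  exact eLpNorm_add_le ((hm i K hK hc).sub (hl K hK hc)).1 ((hm' i K hK hc).sub (hl' K hK hc)).1
    (by norm_num)

theorem STendsto.add [CompleteSpace V] (hU : IsOpen U) {F F' : ι → ℝ → V} {f f' : ℝ → V}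
    (h : STendsto k l U F f) (h' : STendsto k l U F' f') :
    STendsto k l U (fun i t => F i t + F' i t) (fun t => f t + f' t) := by
  induction k generalizing F F' f f' with
  | zero =>
    exact ⟨fun i K hK hc => (h.mem i K hK hc).add (h'.mem i K hK hc),
      fun K hK hc => (h.lim K hK hc).add (h'.lim K hK hc),
      L2Conv.add h.conv h'.conv h.mem h.lim h'.mem h'.lim⟩
  | succ k ih =>
    refine STendsto.of_prim hU (fun i => (h.mem i).1.add ((h.mem i).2.isL2Loc hU) (h'.mem i).1
      ((h'.mem i).2.isL2Loc hU)) (h.lim.1.add (h.lim.2.isL2Loc hU) h'.lim.1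
      (h'.lim.2.isL2Loc hU)) ?_ (ih h.derivs h'.derivs)
    exact fun t ht => (h.cconv t ht).add (h'.cconv t ht)

theorem STendsto.prodMk [CompleteSpace V] [CompleteSpace W] (hU : IsOpen U) {F : ι → ℝ → V}
    {f : ℝ → V} {G : ι → ℝ → W} {g : ℝ → W} (h : STendsto k l U F f) (h' : STendsto k l U G g) :
    STendsto k l U (fun i t => (F i t, G i t)) (fun t => (f t, g t)) := by
  have := (h.clm hU (ContinuousLinearMap.inl ℝ V W)).add hU
    (h'.clm hU (ContinuousLinearMap.inr ℝ V W))
  simpa using this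

/-- Constant families allow regularity statements to be read off from convergence statements, as the
field `lim`. -/
theorem SobolevOn.sTendsto (hU : IsOpen U) {f : ℝ → V} (h : SobolevOn k U f) (l : Filter ι) :
    STendsto k l U (fun _ => f) f := by
  refine ⟨fun _ => h, h, ?_⟩
  induction k generalizing f with
  | zero => intro K hK hc; simpa using tendsto_const_nhds
  | succ k ih =>
    exact ⟨fun t ht => ((h.continuousOn hU).continuousAt (hU.mem_nhds ht)).tendsto.comp tendsto_snd,
      ih h.2⟩

theorem ContDiff.sobolevOn [CompleteSpace V] (hU : IsOpen U) {f : ℝ → V} (hf : ContDiff ℝ ∞ f) :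
    SobolevOn k U f := by
  induction k generalizing f with
  | zero => exact hf.continuous.continuousOn.isL2Loc
  | succ k ih =>
    have h1 : ContDiff ℝ ∞ (deriv f) := (contDiff_infty_iff_deriv.1 hf).2
    refine ⟨fun a b _ => ?_, ih h1⟩
    exact (intervalIntegral.integral_deriv_eq_sub
      (fun t _ => (hf.differentiable (by simp)) t) (h1.continuous.intervalIntegrable _ _)).symm

end SobolevLine

/-! ### Locality of Sobolev regularity and Sobolev convergence -/

section Gluing

variable {V W : Type*} [NormedAddCommGroup V] [NormedSpace ℝ V] [NormedAddCommGroup W]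
  [NormedSpace ℝ W] {ι : Type*} {l : Filter ι} {U U' : Set ℝ} {k : ℕ}

theorem eLpNorm_two_eq (f : ℝ → V) (μ : Measure ℝ) :
    eLpNorm f 2 μ = (∫⁻ t, ‖f t‖ₑ ^ (2 : ℝ) ∂μ) ^ (2 : ℝ)⁻¹ := by
  rw [eLpNorm_eq_lintegral_rpow_enorm_toReal (by norm_num) (by norm_num)]
  simp

theorem eLpNorm_restrict_union_le (f : ℝ → V) (s t : Set ℝ) :
    eLpNorm f 2 (volume.restrict (s ∪ t)) ≤
      eLpNorm f 2 (volume.restrict s) + eLpNorm f 2 (volume.restrict t) := by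
  simp only [eLpNorm_two_eq]
  refine le_trans ?_ (ENNReal.rpow_add_le_add_rpow _ _ (by norm_num) (by norm_num))
  gcongr
  exact lintegral_union_le _ _ _

theorem IsL2Loc.of_local {f : ℝ → V} (h : ∀ t ∈ U, ∃ O, IsOpen O ∧ t ∈ O ∧ IsL2Loc O f) :
    IsL2Loc U f := by
  intro K hK hc
  refine hc.induction_on (p := fun s => MemLp f 2 (volume.restrict s)) (by simp)
    (fun s t hst ht => ht.mono_measure (Measure.restrict_mono hst le_rfl)) ?_ ?_
  · intro s t hs ht
    refine ⟨aestronglyMeasurable_union_iff.2 ⟨hs.1, ht.1⟩, ?_⟩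
    exact (eLpNorm_restrict_union_le f s t).trans_lt (ENNReal.add_lt_top.2 ⟨hs.2, ht.2⟩)
  · intro t ht
    obtain ⟨O, hO, htO, hf⟩ := h t (hK ht)
    obtain ⟨ε, hε, hs⟩ := exists_uIcc_subset hO htO
    exact ⟨Icc (t - ε) (t + ε), mem_nhdsWithin_of_mem_nhds (Icc_mem_nhds (by linarith) (by linarith)),
      hf _ hs isCompact_Icc⟩

theorem L2Conv.of_local {F : ι → ℝ → V} {f : ℝ → V}
    (h : ∀ t ∈ U, ∃ O, IsOpen O ∧ t ∈ O ∧ L2Conv l O F f) : L2Conv l U F f := by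
  intro K hK hc
  refine hc.induction_on
    (p := fun s => Tendsto (fun i => eLpNorm (F i - f) 2 (volume.restrict s)) l (𝓝 0))
    (by simpa using tendsto_const_nhds) ?_ ?_ ?_
  · intro s t hst ht
    exact tendsto_of_tendsto_of_tendsto_of_le_of_le tendsto_const_nhds ht (fun _ => zero_le)
      fun i => eLpNorm_mono_measure _ (Measure.restrict_mono hst le_rfl)
  · intro s t hs ht
    have := hs.add ht
    rw [add_zero] at this
    exact tendsto_of_tendsto_of_tendsto_of_le_of_le tendsto_const_nhds this (fun _ => zero_le)
      fun i => eLpNorm_restrict_union_le _ s t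
  · intro t ht
    obtain ⟨O, hO, htO, hf⟩ := h t (hK ht)
    obtain ⟨ε, hε, hs⟩ := exists_uIcc_subset hO htO
    exact ⟨Icc (t - ε) (t + ε), mem_nhdsWithin_of_mem_nhds (Icc_mem_nhds (by linarith) (by linarith)),
      hf _ hs isCompact_Icc⟩

theorem SobConv.of_local {F : ι → ℝ → V} {f : ℝ → V}
    (h : ∀ t ∈ U, ∃ O, IsOpen O ∧ t ∈ O ∧ SobConv k l O F f) : SobConv k l U F f := by
  induction k generalizing F f with
  | zero => exact L2Conv.of_local h
  | succ k ih =>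
    refine ⟨fun t ht => ?_, ih fun t ht => ?_⟩
    · obtain ⟨O, hO, htO, hf⟩ := h t ht
      exact hf.1 t htO
    · obtain ⟨O, hO, htO, hf⟩ := h t ht
      exact ⟨O, hO, htO, hf.2⟩

theorem IsPrimOn.of_local [CompleteSpace V] {f g : ℝ → V} (hg : IsL2Loc U g)
    (h : ∀ t ∈ U, ∃ O, IsOpen O ∧ t ∈ O ∧ IsPrimOn O f g) : IsPrimOn U f g := by
  have main : ∀ a b, a ≤ b → Icc a b ⊆ U → f b - f a = ∫ t in a..b, g t := by
    intro a b hab hs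
    -- `H` is locally constant on `[a, b]`. Hence it is continuous with vanishing right derivative,
    -- and so constant.
    set H : ℝ → V := fun x => f x - ∫ t in a..x, g t with hH
    have hconst : ∀ t ∈ Icc a b, ∃ O ∈ 𝓝 t, ∀ s ∈ O ∩ Icc a b, H s = H t := by
      intro t ht
      obtain ⟨O, hO, htO, hf⟩ := h t (hs ht)
      obtain ⟨ε, hε, hsO⟩ := exists_uIcc_subset hO htO
      refine ⟨Icc (t - ε) (t + ε), Icc_mem_nhds (by linarith) (by linarith), fun s hsn => ?_⟩
      have h1 := hf t s ((uIcc_subset_Icc (by constructor <;> linarith) hsn.1).trans hsO)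
      have i1 : IntervalIntegrable g volume a t := hg.intervalIntegrable
        ((uIcc_subset_Icc (left_mem_Icc.2 hab) ht).trans hs)
      have i2 : IntervalIntegrable g volume a s := hg.intervalIntegrable
        ((uIcc_subset_Icc (left_mem_Icc.2 hab) hsn.2).trans hs)
      have h2 := intervalIntegral.integral_interval_sub_left i2 i1
      simp only [hH]
      rw [← h2] at h1
      rw [sub_eq_sub_iff_sub_eq_sub]
      exact h1
    have h0 := constant_of_has_deriv_right_zero (f := H) (a := a) (b := b) (fun t ht => by
        obtain ⟨O, hO, hc⟩ := hconst t ht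
        refine (continuousWithinAt_const (b := H t)).congr_of_eventuallyEq ?_ rfl
        filter_upwards [mem_nhdsWithin_of_mem_nhds hO, self_mem_nhdsWithin] with s h1 h2
          using hc s ⟨h1, h2⟩) (fun t ht => by
        obtain ⟨O, hO, hc⟩ := hconst t (Ico_subset_Icc_self ht)
        refine (hasDerivWithinAt_const t _ (H t)).congr_of_eventuallyEq ?_ rfl
        filter_upwards [mem_nhdsWithin_of_mem_nhds hO, self_mem_nhdsWithin,
          mem_nhdsWithin_of_mem_nhds (Iio_mem_nhds ht.2)] with s h1 h2 h3
          using hc s ⟨h1, ht.1.trans h2, h3.le⟩) b (right_mem_Icc.2 hab)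
    simp only [hH, intervalIntegral.integral_same, sub_zero] at h0
    rw [← h0]; abel
  intro a b hab
  rcases le_total a b with h1 | h1
  · exact main a b h1 (by rwa [uIcc_of_le h1] at hab)
  · rw [intervalIntegral.integral_symm, ← main b a h1 (by rwa [uIcc_of_ge h1] at hab)]
    abel

theorem SobolevOn.of_local [CompleteSpace V] {f : ℝ → V}
    (h : ∀ t ∈ U, ∃ O, IsOpen O ∧ t ∈ O ∧ SobolevOn k O f) : SobolevOn k U f := by
  induction k generalizing f with
  | zero => exact IsL2Loc.of_local h
  | succ k ih =>
    refine ⟨IsPrimOn.of_local (IsL2Loc.of_local fun t ht => ?_) fun t ht => ?_, ih fun t ht => ?_⟩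
    all_goals obtain ⟨O, hO, htO, hf⟩ := h t ht
    · exact ⟨O, hO, htO, hf.2.isL2Loc hO⟩
    · exact ⟨O, hO, htO, hf.1⟩
    · exact ⟨O, hO, htO, hf.2⟩

end Gluing

/-! ### Superposition with smooth functions -/

section Superposition

variable {V W Z : Type*} [NormedAddCommGroup V] [NormedSpace ℝ V] [NormedAddCommGroup W]
  [NormedSpace ℝ W] [NormedAddCommGroup Z] [NormedSpace ℝ Z]
  {ι : Type*} {l : Filter ι} {U U' : Set ℝ} {k : ℕ}

/-- Absolute continuity only involves increments. The estimate is applied with `G` a primitive of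
`‖g‖`, to handle vector valued primitives, and with `f` a Lipschitz function of `G`. -/
theorem AbsolutelyContinuousOnInterval.of_dist_le {X Y : Type*} [PseudoMetricSpace X]
    [PseudoMetricSpace Y] {f : ℝ → X} {G : ℝ → Y} {a b K : ℝ}
    (hG : AbsolutelyContinuousOnInterval G a b)
    (h : ∀ x ∈ uIcc a b, ∀ y ∈ uIcc a b, dist (f x) (f y) ≤ K * dist (G x) (G y)) :
    AbsolutelyContinuousOnInterval f a b := by
  have h1 : Tendsto (fun E : ℕ × (ℕ → ℝ × ℝ) =>
      K * ∑ i ∈ Finset.range E.1, dist (G (E.2 i).1) (G (E.2 i).2))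
      (AbsolutelyContinuousOnInterval.totalLengthFilter ⊓
        𝓟 (AbsolutelyContinuousOnInterval.disjWithin a b)) (𝓝 0) := by
    simpa using Tendsto.const_mul K hG
  refine squeeze_zero' (Eventually.of_forall fun E => Finset.sum_nonneg fun i _ => dist_nonneg)
    ?_ h1
  filter_upwards [mem_inf_of_right (mem_principal_self _)] with E hE
  rw [Finset.mul_sum]
  exact Finset.sum_le_sum fun i hi => h _ (hE.1 i hi).1 _ (hE.1 i hi).2

theorem IsPrimOn.dist_le {f g : ℝ → V} (h : IsPrimOn U f g) (hg : IsL2Loc U g) {a b : ℝ}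
    (hab : uIcc a b ⊆ U) {x y : ℝ} (hx : x ∈ uIcc a b) (hy : y ∈ uIcc a b) :
    dist (f x) (f y) ≤ dist (∫ t in a..x, ‖g t‖) (∫ t in a..y, ‖g t‖) := by
  have hi : ∀ {x y}, x ∈ uIcc a b → y ∈ uIcc a b → IntervalIntegrable g volume x y :=
    fun hx hy => hg.intervalIntegrable ((uIcc_subset_uIcc hx hy).trans hab)
  rw [dist_comm, dist_eq_norm, h x y ((uIcc_subset_uIcc hx hy).trans hab), dist_comm, Real.dist_eq,
    intervalIntegral.integral_interval_sub_left (hi left_mem_uIcc hy).norm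
      (hi left_mem_uIcc hx).norm]
  exact intervalIntegral.norm_integral_le_abs_integral_norm

theorem IsPrimOn.absolutelyContinuous {f g : ℝ → V} (h : IsPrimOn U f g) (hg : IsL2Loc U g)
    {a b : ℝ} (hab : uIcc a b ⊆ U) : AbsolutelyContinuousOnInterval f a b := by
  refine ((hg.intervalIntegrable hab).norm.absolutelyContinuousOnInterval_intervalIntegral
    left_mem_uIcc).of_dist_le (K := 1) fun x hx y hy => ?_
  rw [one_mul]
  exact h.dist_le hg hab hx hy

/-- The difference of `f` and the indefinite integral of `g` is absolutely continuous with
derivative zero almost everywhere, hence constant. -/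
theorem isPrimOn_of_absolutelyContinuous [CompleteSpace V] {f g : ℝ → V} (hg : IsL2Loc U g)
    (hac : ∀ a b, uIcc a b ⊆ U → AbsolutelyContinuousOnInterval f a b)
    (hd : ∀ᵐ t, t ∈ U → HasDerivAt f (g t) t) : IsPrimOn U f g := by
  intro a b hab
  have hp : AbsolutelyContinuousOnInterval (fun x => ∫ t in a..x, g t) a b := by
    refine ((hg.intervalIntegrable hab).norm.absolutelyContinuousOnInterval_intervalIntegral
      left_mem_uIcc).of_dist_le (K := 1) fun x hx y hy => ?_
    have hi : ∀ {x y}, x ∈ uIcc a b → y ∈ uIcc a b → IntervalIntegrable g volume x y :=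
      fun hx hy => hg.intervalIntegrable ((uIcc_subset_uIcc hx hy).trans hab)
    rw [one_mul, dist_comm, dist_eq_norm, intervalIntegral.integral_interval_sub_left
      (hi left_mem_uIcc hy) (hi left_mem_uIcc hx), dist_comm, Real.dist_eq,
      intervalIntegral.integral_interval_sub_left (hi left_mem_uIcc hy).norm
      (hi left_mem_uIcc hx).norm]
    exact intervalIntegral.norm_integral_le_abs_integral_norm
  obtain ⟨C, hC⟩ := ((hac a b hab).fun_sub hp).const_of_ae_hasDerivAt_zero (by
    filter_upwards [hd, (hg.intervalIntegrable hab).ae_hasDerivAt_integral] with t h1 h2 ht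
    have := (h1 (hab ht)).fun_sub (h2 ht a left_mem_uIcc)
    rwa [sub_self] at this)
  have e1 := hC a left_mem_uIcc
  have e2 := hC b right_mem_uIcc
  simp only [intervalIntegral.integral_same, sub_zero] at e1
  rw [e1, ← e2]; abel

/-- Products of continuous families of operators with `L²` functions. -/
theorem IsL2Loc.clm_apply {a : ℝ → V →L[ℝ] W} {g : ℝ → V} (ha : ContinuousOn a U)
    (hg : IsL2Loc U g) : IsL2Loc U (fun t => a t (g t)) := by
  intro K hK hc
  obtain ⟨C, hC⟩ := hc.exists_bound_of_continuousOn (ha.mono hK)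
  refine MemLp.of_le_mul (hg K hK hc) (c := C) ?_ ?_
  · exact (ContinuousLinearMap.id ℝ (V →L[ℝ] W)).aestronglyMeasurable_comp₂
      ((ha.mono hK).aestronglyMeasurable_of_isCompact hc hc.measurableSet) (hg K hK hc).1
  · filter_upwards [ae_restrict_mem hc.measurableSet] with t ht
    exact ((a t).le_opNorm _).trans (mul_le_mul_of_nonneg_right (hC t ht) (norm_nonneg _))

/-- Split `A i (G i) - a g` into `A i (G i - g)`, where the operators are eventually bounded by `C +
1` on the compact set, and `(A i - a) g`, where the operators tend to zero uniformly. -/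
theorem L2Conv.clm_apply {A : ι → ℝ → V →L[ℝ] W} {a : ℝ → V →L[ℝ] W} {G : ι → ℝ → V} {g : ℝ → V}
    (hA : CConv l U A a) (hAc : ∀ i, ContinuousOn (A i) U) (ha : ContinuousOn a U)
    (hG : L2Conv l U G g) (hGm : ∀ i, IsL2Loc U (G i)) (hg : IsL2Loc U g) :
    L2Conv l U (fun i t => A i t (G i t)) (fun t => a t (g t)) := by
  intro K hK hc
  obtain ⟨C, hC⟩ := hc.exists_bound_of_continuousOn (ha.mono hK)
  have hN : eLpNorm g 2 (volume.restrict K) ≠ ⊤ := (hg K hK hc).2.ne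
  have h1 : Tendsto (fun i => ENNReal.ofReal (C + 1) * eLpNorm (G i - g) 2 (volume.restrict K)) l
      (𝓝 0) := by
    simpa using ENNReal.Tendsto.const_mul (hG K hK hc) (Or.inr (ENNReal.ofReal_ne_top (r := C + 1)))
  rw [ENNReal.tendsto_nhds_zero]
  intro δ hδ
  have h2 : Tendsto (fun ε : ℝ => ENNReal.ofReal ε * eLpNorm g 2 (volume.restrict K))
      (𝓝[>] 0) (𝓝 0) := by
    have h1 : Tendsto (fun ε : ℝ => ENNReal.ofReal ε) (𝓝[>] 0) (𝓝 0) := by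
      simpa using (ENNReal.continuous_ofReal.tendsto 0).mono_left
        (nhdsWithin_le_nhds : 𝓝[>] (0 : ℝ) ≤ 𝓝 0)
    simpa using ENNReal.Tendsto.mul_const h1 (Or.inr hN)
  have hδ2 : 0 < δ / 2 := ENNReal.half_pos hδ.ne'
  obtain ⟨ε, hε1, hε2⟩ := ((ENNReal.tendsto_nhds_zero.1 h2 _ hδ2).and self_mem_nhdsWithin).exists
  filter_upwards [ENNReal.tendsto_nhds_zero.1 h1 _ hδ2, hA.eventually_dist_lt ha hK hc hε2,
    hA.eventually_dist_lt ha hK hc one_pos] with i i1 i2 i3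
  have e : ((fun t => A i t (G i t)) - fun t => a t (g t)) =
      (fun t => A i t ((G i - g) t)) + (fun t => (A i t - a t) (g t)) := by
    ext t; simp
  rw [e]
  have m1 : AEStronglyMeasurable (fun t => A i t ((G i - g) t)) (volume.restrict K) :=
    (ContinuousLinearMap.id ℝ (V →L[ℝ] W)).aestronglyMeasurable_comp₂
      (((hAc i).mono hK).aestronglyMeasurable_of_isCompact hc hc.measurableSet)
      ((hGm i K hK hc).sub (hg K hK hc)).1
  have m2 : AEStronglyMeasurable (fun t => (A i t - a t) (g t)) (volume.restrict K) :=
    (ContinuousLinearMap.id ℝ (V →L[ℝ] W)).aestronglyMeasurable_comp₂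
      ((((hAc i).sub ha).mono hK).aestronglyMeasurable_of_isCompact hc hc.measurableSet)
      (hg K hK hc).1
  refine (eLpNorm_add_le m1 m2 (by norm_num)).trans ?_
  rw [← ENNReal.add_halves δ]
  refine add_le_add (le_trans ?_ i1) (le_trans ?_ hε1)
  · refine eLpNorm_le_mul_eLpNorm_of_ae_le_mul ?_ 2
    filter_upwards [ae_restrict_mem hc.measurableSet] with t ht
    refine ((A i t).le_opNorm _).trans (mul_le_mul_of_nonneg_right ?_ (norm_nonneg _))
    have h3 := i3 t ht
    have h4 : ‖A i t‖ ≤ ‖a t‖ + ‖A i t - a t‖ := norm_le_insert' _ _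
    linarith [hC t ht]
  · refine eLpNorm_le_mul_eLpNorm_of_ae_le_mul ?_ 2
    filter_upwards [ae_restrict_mem hc.measurableSet] with t ht
    exact ((A i t - a t).le_opNorm _).trans (mul_le_mul_of_nonneg_right (i2 t ht).le (norm_nonneg _))

theorem ContDiffOn.continuousOn_fderiv' {Ω : Set Z} (hΩ : IsOpen Ω) {F : Z → W}
    (hF : ContDiffOn ℝ ∞ F Ω) : ContinuousOn (fderiv ℝ F) Ω :=
  hF.continuousOn_fderiv_of_isOpen hΩ (by simp)

/-- Near each point `F` is Lipschitz, so `F ∘ p` is absolutely continuous there, and the chain rule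
holds wherever `p` has derivative `q`, that is, almost everywhere. Primitives may be checked
locally, so no global Lipschitz bound is needed. -/
theorem IsPrimOn.superpose [CompleteSpace W] [CompleteSpace Z] (hU : IsOpen U) {Ω : Set Z}
    (hΩ : IsOpen Ω) {F : Z → W} (hF : ContDiffOn ℝ ∞ F Ω) {p q : ℝ → Z} (h : IsPrimOn U p q)
    (hq : IsL2Loc U q) (hp : ∀ t ∈ U, p t ∈ Ω) :
    IsPrimOn U (fun t => F (p t)) (fun t => fderiv ℝ F (p t) (q t)) := by
  have hpc := h.continuousOn hU hq
  have hL : IsL2Loc U (fun t => fderiv ℝ F (p t) (q t)) :=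
    IsL2Loc.clm_apply ((hF.continuousOn_fderiv' hΩ).comp hpc hp) hq
  refine IsPrimOn.of_local hL fun t ht => ?_
  obtain ⟨K, N, hN, hK⟩ := ((hF.contDiffAt (hΩ.mem_nhds (hp t ht))).of_le
    (by simp : (1 : WithTop ℕ∞) ≤ ∞)).exists_lipschitzOnWith
  have hO : p ⁻¹' N ∩ U ∈ 𝓝 t :=
    inter_mem ((hpc.continuousAt (hU.mem_nhds ht)).preimage_mem_nhds hN) (hU.mem_nhds ht)
  obtain ⟨O, hOs, hOo, htO⟩ := mem_nhds_iff.1 hO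
  have hOU : O ⊆ U := fun s hs => (hOs hs).2
  refine ⟨O, hOo, htO, isPrimOn_of_absolutelyContinuous (hL.mono hOU) ?_ ?_⟩
  · intro a b hab
    refine ((h.mono hOU).absolutelyContinuous (hq.mono hOU) hab).of_dist_le (K := K) ?_
    exact fun x hx y hy => hK.dist_le_mul _ (hOs (hab hx)).1 _ (hOs (hab hy)).1
  · filter_upwards [h.ae_hasDerivAt hU hq] with s hs hsO
    have hd : HasFDerivAt F (fderiv ℝ F (p s)) (p s) :=
      ((hF.contDiffAt (hΩ.mem_nhds (hp s (hOU hsO)))).differentiableAt (by simp)).hasFDerivAt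
    exact hd.comp_hasDerivAt s (hs (hOU hsO))

theorem CConv.superpose {Ω : Set Z} (hΩ : IsOpen Ω) {F : Z → W} (hF : ContinuousOn F Ω)
    {P : ι → ℝ → Z} {p : ℝ → Z} (h : CConv l U P p) (hp : ∀ t ∈ U, p t ∈ Ω) :
    CConv l U (fun i t => F (P i t)) (fun t => F (p t)) := fun t ht =>
  ((hF.continuousAt (hΩ.mem_nhds (hp t ht))).tendsto).comp (h t ht)

/-- Superposition operators are continuous on `W^{k,2}_loc`, `k ≥ 1`. -/
theorem STendsto.superpose [CompleteSpace W] [CompleteSpace Z] (hU : IsOpen U) {Ω : Set Z}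
    (hΩ : IsOpen Ω) {F : Z → W} (hF : ContDiffOn ℝ ∞ F Ω) {P : ι → ℝ → Z} {p : ℝ → Z}
    (h : STendsto (k + 1) l U P p) (hP : ∀ i, ∀ t ∈ U, P i t ∈ Ω) (hp : ∀ t ∈ U, p t ∈ Ω) :
    STendsto (k + 1) l U (fun i t => F (P i t)) (fun t => F (p t)) := by
  have hmem : ∀ {q : ℝ → Z}, SobolevOn (k + 1) U q → (∀ t ∈ U, q t ∈ Ω) →
      IsPrimOn U (fun t => F (q t)) (fun t => fderiv ℝ F (q t) (deriv q t)) := fun hq hΩq =>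
    hq.1.superpose hU hΩ hF (hq.2.isL2Loc hU) hΩq
  refine STendsto.of_prim hU (fun i => hmem (h.mem i) (hP i)) (hmem h.lim hp)
    (h.cconv.superpose hΩ hF.continuousOn hp) ?_
  have hF' := hF.continuousOn_fderiv' hΩ
  induction k generalizing W Z with
  | zero =>
    have hc : ∀ {q : ℝ → Z}, SobolevOn 1 U q → (∀ t ∈ U, q t ∈ Ω) →
        ContinuousOn (fun t => fderiv ℝ F (q t)) U := fun hq hΩq =>
      hF'.comp (hq.continuousOn hU) hΩq
    refine ⟨fun i => IsL2Loc.clm_apply (hc (h.mem i) (hP i)) (h.mem i).2,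
      IsL2Loc.clm_apply (hc h.lim hp) h.lim.2,
      L2Conv.clm_apply (h.cconv.superpose hΩ hF' hp) (fun i => hc (h.mem i) (hP i)) (hc h.lim hp)
        h.conv.2 (fun i => (h.mem i).2) h.lim.2⟩
  | succ k ih =>
    -- The derivative `DF(p) p'` is itself a superposition, of the smooth function `(z, w) ↦ DF(z)
    -- w` with the curve `(p, p')`. This curve has one order of regularity less than `p`, so the
    -- induction hypothesis applies to it.
    have hG : ContDiffOn ℝ ∞ (fun z : Z × Z => fderiv ℝ F z.1 z.2) (Ω ×ˢ univ) := by
      have h1 : ContDiffOn ℝ ∞ (fderiv ℝ F) Ω := hF.fderiv_of_isOpen hΩ (by simp)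
      exact (h1.comp contDiff_fst.contDiffOn (fun z hz => hz.1)).clm_apply contDiff_snd.contDiffOn
    have hpair : STendsto (k + 1) l U (fun i t => (P i t, deriv (P i) t))
      (fun t => (p t, deriv p t)) := (h.of_succ hU).prodMk hU h.derivs
    have hΩ2 := hΩ.prod (isOpen_univ (X := Z))
    have hm2 : ∀ {q : ℝ → Z × Z}, SobolevOn (k + 1) U q → (∀ t ∈ U, q t ∈ Ω ×ˢ univ) →
      IsPrimOn U (fun t => fderiv ℝ F (q t).1 (q t).2)
        (fun t => fderiv ℝ (fun z : Z × Z => fderiv ℝ F z.1 z.2) (q t) (deriv q t)) :=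
      fun hq hΩq => hq.1.superpose hU hΩ2 hG (hq.2.isL2Loc hU) hΩq
    have hP2 : ∀ i, ∀ t ∈ U, (P i t, deriv (P i) t) ∈ Ω ×ˢ (univ : Set Z) :=
      fun i t ht => ⟨hP i t ht, trivial⟩
    have hp2 : ∀ t ∈ U, (p t, deriv p t) ∈ Ω ×ˢ (univ : Set Z) := fun t ht => ⟨hp t ht, trivial⟩
    exact STendsto.of_prim hU (fun i => hm2 (hpair.mem i) (hP2 i)) (hm2 hpair.lim hp2)
      (hpair.cconv.superpose hΩ2 hG.continuousOn hp2)
      (ih hΩ2 hG hpair hP2 hp2 hm2 (hG.continuousOn_fderiv' hΩ2))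

theorem SobolevOn.superpose [CompleteSpace W] [CompleteSpace Z] (hU : IsOpen U) {Ω : Set Z}
    (hΩ : IsOpen Ω) {F : Z → W} (hF : ContDiffOn ℝ ∞ F Ω) {p : ℝ → Z}
    (h : SobolevOn (k + 1) U p) (hp : ∀ t ∈ U, p t ∈ Ω) :
    SobolevOn (k + 1) U (fun t => F (p t)) :=
  ((h.sTendsto hU (⊤ : Filter Unit)).superpose hU hΩ hF (fun _ => hp) hp).lim

end Superposition

/-! ### Composition with immersions of the line -/

section Composition

variable {V : Type*} [NormedAddCommGroup V] [NormedSpace ℝ V] {ι : Type*} {l : Filter ι} {k : ℕ}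

/-- `Ψ` is continuously differentiable with nowhere vanishing derivative. -/
structure IsC1Immersion (Ψ : ℝ → ℝ) : Prop where
  hasDerivAt : ∀ t, HasDerivAt Ψ (deriv Ψ t) t
  continuous_deriv : Continuous (deriv Ψ)
  ne_zero : ∀ t, deriv Ψ t ≠ 0

theorem IsC1Immersion.continuous {Ψ : ℝ → ℝ} (h : IsC1Immersion Ψ) : Continuous Ψ :=
  continuous_iff_continuousAt.2 fun t => (h.hasDerivAt t).continuousAt

theorem IsC1Immersion.injective {Ψ : ℝ → ℝ} (h : IsC1Immersion Ψ) : Function.Injective Ψ := by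
  have key : ∀ a b, a < b → Ψ a ≠ Ψ b := fun a b hab e => by
    obtain ⟨c, -, hc⟩ := exists_deriv_eq_zero hab h.continuous.continuousOn e
    exact h.ne_zero c hc
  intro a b e
  by_contra hne
  rcases lt_or_gt_of_ne hne with h1 | h1
  · exact key a b h1 e
  · exact key b a h1 e.symm

theorem IsC1Immersion.neg_or_pos {Ψ : ℝ → ℝ} (h : IsC1Immersion Ψ) :
    (∀ t, deriv Ψ t < 0) ∨ (∀ t, 0 < deriv Ψ t) := by
  simpa using hasDerivWithinAt_forall_lt_or_forall_gt_of_forall_ne convex_univ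
    (fun t _ => (h.hasDerivAt t).hasDerivWithinAt) (fun t _ => h.ne_zero t)

theorem SobolevOn.isC1Immersion {Ψ : ℝ → ℝ} (h : SobolevOn (k + 2) univ Ψ)
    (h0 : ∀ t, deriv Ψ t ≠ 0) : IsC1Immersion Ψ :=
  ⟨fun t => h.hasDerivAt isOpen_univ (mem_univ t),
    continuousOn_univ.1 (h.2.continuousOn isOpen_univ), h0⟩

/-- Change of variables: the image measure has density `1 / |Ψ'|`, which is at most `c⁻¹`. In `L²`
this costs the factor `c^{-1/2}` in the next lemma. -/
theorem IsC1Immersion.map_restrict_le {Ψ : ℝ → ℝ} (h : IsC1Immersion Ψ) {K K' : Set ℝ}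
    (hK : MeasurableSet K) (hK' : MeasurableSet K') (hm : MapsTo Ψ K K') {c : ℝ} (hc : 0 < c)
    (hd : ∀ t ∈ K, c ≤ |deriv Ψ t|) :
    (volume.restrict K).map Ψ ≤ ENNReal.ofReal c⁻¹ • volume.restrict K' := by
  refine Measure.le_iff.2 fun s hs => ?_
  rw [Measure.map_apply h.continuous.measurable hs, Measure.smul_apply, smul_eq_mul,
    Measure.restrict_apply hs]
  have hm1 : MeasurableSet (Ψ ⁻¹' s) := h.continuous.measurable hs
  calc volume.restrict K (Ψ ⁻¹' s) = ∫⁻ t in K, s.indicator 1 (Ψ t) := by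
        rw [← lintegral_indicator_one hm1]; rfl
    _ ≤ ∫⁻ t in K, ENNReal.ofReal c⁻¹ * (ENNReal.ofReal |deriv Ψ t| * s.indicator 1 (Ψ t)) := by
        refine setLIntegral_mono' hK fun t ht => ?_
        rw [← mul_assoc, ← ENNReal.ofReal_mul (by positivity)]
        refine le_mul_of_one_le_left zero_le ?_
        rw [← ENNReal.ofReal_one]
        refine ENNReal.ofReal_le_ofReal ?_
        rw [inv_mul_eq_div, one_le_div hc]
        exact hd t ht
    _ = ENNReal.ofReal c⁻¹ * ∫⁻ x in Ψ '' K, s.indicator 1 x := by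
        rw [lintegral_const_mul' _ _ ENNReal.ofReal_ne_top,
          lintegral_image_eq_lintegral_abs_deriv_mul hK
            (fun t _ => (h.hasDerivAt t).hasDerivWithinAt) h.injective.injOn]
    _ ≤ ENNReal.ofReal c⁻¹ * ∫⁻ x in K', s.indicator 1 x := by
        gcongr
        exact hm.image_subset
    _ = ENNReal.ofReal c⁻¹ * volume (s ∩ K') := by
        rw [lintegral_indicator_one hs, Measure.restrict_apply hs]

theorem IsC1Immersion.memLp_comp {Ψ : ℝ → ℝ} (h : IsC1Immersion Ψ) {K K' : Set ℝ}
    (hK : MeasurableSet K) (hK' : MeasurableSet K') (hm : MapsTo Ψ K K') {c : ℝ} (hc : 0 < c)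
    (hd : ∀ t ∈ K, c ≤ |deriv Ψ t|) {f : ℝ → V} (hf : MemLp f 2 (volume.restrict K')) :
    MemLp (fun t => f (Ψ t)) 2 (volume.restrict K) ∧
      eLpNorm (fun t => f (Ψ t)) 2 (volume.restrict K) ≤
        ENNReal.ofReal c⁻¹ ^ (2 : ℝ)⁻¹ * eLpNorm f 2 (volume.restrict K') := by
  have hle := h.map_restrict_le hK hK' hm hc hd
  have hf2 := hf.of_measure_le_smul ENNReal.ofReal_ne_top hle
  refine ⟨hf2.comp_of_map h.continuous.measurable.aemeasurable, ?_⟩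
  have e := eLpNorm_map_measure (p := 2) hf2.1 h.continuous.measurable.aemeasurable
  refine le_trans e.symm.le ((eLpNorm_mono_measure f hle).trans ?_)
  rw [eLpNorm_smul_measure_of_ne_top (by norm_num)]
  simp

theorem IsC1Immersion.exists_lower_bound {Ψ : ℝ → ℝ} (h : IsC1Immersion Ψ) {K : Set ℝ}
    (hK : IsCompact K) : ∃ c > 0, ∀ t ∈ K, c ≤ |deriv Ψ t| := by
  rcases K.eq_empty_or_nonempty with rfl | hne
  · exact ⟨1, one_pos, by simp⟩
  obtain ⟨t, -, ht⟩ := hK.exists_isMinOn hne h.continuous_deriv.abs.continuousOn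
  exact ⟨_, abs_pos.2 (h.ne_zero t), fun s hs => ht hs⟩

theorem IsL2Loc.comp {f : ℝ → V} (hf : IsL2Loc univ f) {Ψ : ℝ → ℝ} (h : IsC1Immersion Ψ) :
    IsL2Loc univ (fun t => f (Ψ t)) := by
  intro K _ hK
  obtain ⟨c, hc, hd⟩ := h.exists_lower_bound hK
  have hK' := hK.image h.continuous
  exact (h.memLp_comp hK.measurableSet hK'.measurableSet (mapsTo_image _ _) hc hd
    (hf _ (subset_univ _) hK')).1

/-- `C¹_loc` convergence of immersions of the line. -/
structure C1Conv (l : Filter ι) (P : ι → ℝ → ℝ) (Ψ : ℝ → ℝ) : Prop where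
  mem : ∀ i, IsC1Immersion (P i)
  lim : IsC1Immersion Ψ
  conv : CConv l univ P Ψ
  conv_deriv : CConv l univ (fun i => deriv (P i)) (deriv Ψ)

theorem STendsto.c1Conv {P : ι → ℝ → ℝ} {Ψ : ℝ → ℝ} (h : STendsto (k + 2) l univ P Ψ)
    (hP : ∀ i t, deriv (P i) t ≠ 0) (hΨ : ∀ t, deriv Ψ t ≠ 0) : C1Conv l P Ψ :=
  ⟨fun i => (h.mem i).isC1Immersion (hP i), h.lim.isC1Immersion hΨ, h.cconv, h.derivs.cconv⟩

theorem exists_approx_const {D : ENNReal} (hD : D ≠ ⊤) {δ : ENNReal} (hδ : 0 < δ) :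
    ∃ ε : ENNReal, ε ≠ 0 ∧ D * ε ≤ δ := by
  have h1 : Tendsto (fun ε : ℝ => D * ENNReal.ofReal ε) (𝓝[>] 0) (𝓝 0) := by
    have h1 : Tendsto (fun ε : ℝ => ENNReal.ofReal ε) (𝓝[>] 0) (𝓝 0) := by
      simpa using (ENNReal.continuous_ofReal.tendsto 0).mono_left
        (nhdsWithin_le_nhds : 𝓝[>] (0 : ℝ) ≤ 𝓝 0)
    simpa using ENNReal.Tendsto.const_mul h1 (Or.inr hD)
  obtain ⟨ε, h1, h2⟩ := ((ENNReal.tendsto_nhds_zero.1 h1 _ hδ).and self_mem_nhdsWithin).exists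
  exact ⟨ENNReal.ofReal ε, by simpa using h2, h1⟩

/-- Approximate `σ` in `L²` by a continuous function `τ` and write `S i ∘ P i - σ ∘ Ψ` as `(S i - σ)
∘ P i + (σ - τ) ∘ P i + (τ ∘ P i - τ ∘ Ψ) - (σ - τ) ∘ Ψ`. The third term is small by locally uniform
convergence, the others by the change of variables with a constant that does not depend on `i`. -/
theorem L2Conv.comp {S : ι → ℝ → V} {σ : ℝ → V} {P : ι → ℝ → ℝ} {Ψ : ℝ → ℝ}
    (hS : L2Conv l univ S σ) (hSm : ∀ i, IsL2Loc univ (S i)) (hσ : IsL2Loc univ σ)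
    (hP : C1Conv l P Ψ) :
    L2Conv l univ (fun i t => S i (P i t)) (fun t => σ (Ψ t)) := by
  intro K _ hK
  have hKm := hK.measurableSet
  obtain ⟨c, hc, hd⟩ := hP.lim.exists_lower_bound hK
  -- For almost all indices, `P i` is at distance less than `1` from `Ψ` on `K`, so it maps `K` into
  -- this thickening, and its derivative has absolute value at least `c / 2` there.
  set K' : Set ℝ := Metric.cthickening 1 (Ψ '' K) with hK'
  have hK'c : IsCompact K' := (hK.image hP.lim.continuous).cthickening
  have hK'm := hK'c.measurableSet
  have hm0 : MapsTo Ψ K K' := fun t ht => Metric.self_subset_cthickening _ (mem_image_of_mem _ ht)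
  set D : ENNReal := ENNReal.ofReal (c / 2)⁻¹ ^ (2 : ℝ)⁻¹ with hD
  have hDt : D ≠ ⊤ := ENNReal.rpow_ne_top_of_nonneg (by norm_num) ENNReal.ofReal_ne_top
  have hev : ∀ᶠ i in l, MapsTo (P i) K K' ∧ ∀ t ∈ K, c / 2 ≤ |deriv (P i) t| := by
    filter_upwards [hP.conv.eventually_dist_lt hP.lim.continuous.continuousOn (subset_univ K) hK
      one_pos, hP.conv_deriv.eventually_dist_lt hP.lim.continuous_deriv.continuousOn
      (subset_univ K) hK (half_pos hc)] with i h1 h2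
    refine ⟨fun t ht => ?_, fun t ht => ?_⟩
    · refine Metric.mem_cthickening_of_dist_le (P i t) (Ψ t) 1 _ (mem_image_of_mem _ ht) ?_
      rw [dist_eq_norm]; exact (h1 t ht).le
    · have := hd t ht
      have h3 := h2 t ht
      rw [Real.norm_eq_abs] at h3
      have := abs_sub_abs_le_abs_sub (deriv Ψ t) (deriv (P i) t)
      rw [abs_sub_comm] at this
      linarith
  rw [ENNReal.tendsto_nhds_zero]
  intro δ hδ
  have hδ4 : 0 < δ / 2 / 2 := ENNReal.half_pos (ENNReal.half_pos hδ.ne').ne'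
  obtain ⟨ε, hε0, hε⟩ := exists_approx_const hDt hδ4
  obtain ⟨τ, hτs, hτ, hτc, hτm⟩ :=
    (hσ K' (subset_univ _) hK'c).exists_hasCompactSupport_eLpNorm_sub_le (by norm_num) hε0
  have hτm' := hτm
  have hσm := hσ K' (subset_univ _) hK'c
  have c1 : Tendsto (fun i => D * eLpNorm (S i - σ) 2 (volume.restrict K')) l (𝓝 0) := by
    simpa using ENNReal.Tendsto.const_mul (hS K' (subset_univ _) hK'c) (Or.inr hDt)
  have c2 : L2Conv l univ (fun i t => τ (P i t)) (fun t => τ (Ψ t)) := by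
    refine CConv.l2Conv (fun t ht => (hτc.tendsto _).comp (hP.conv t ht)) ?_
    exact (hτc.comp hP.lim.continuous).continuousOn
  filter_upwards [ENNReal.tendsto_nhds_zero.1 c1 _ hδ4,
    ENNReal.tendsto_nhds_zero.1 (c2 K (subset_univ _) hK) _ hδ4, hev] with i i1 i2 ⟨i3, i4⟩
  have A1 := (hP.mem i).memLp_comp hKm hK'm i3 (half_pos hc) i4
    ((hSm i K' (subset_univ _) hK'c).sub hσm)
  have A2 := (hP.mem i).memLp_comp hKm hK'm i3 (half_pos hc) i4 (hσm.sub hτm)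
  have A3 := hP.lim.memLp_comp hKm hK'm hm0 (half_pos hc) (fun t ht => by linarith [hd t ht])
    (hσm.sub hτm)
  have A4 : AEStronglyMeasurable ((fun t => τ (P i t)) - fun t => τ (Ψ t)) (volume.restrict K) :=
    ((hτc.comp (hP.mem i).continuous).sub (hτc.comp hP.lim.continuous)).aestronglyMeasurable
  have e : ((fun t => S i (P i t)) - fun t => σ (Ψ t)) =
      ((fun t => (S i - σ) (P i t)) + fun t => (σ - τ) (P i t)) +
      (((fun t => τ (P i t)) - fun t => τ (Ψ t)) - fun t => (σ - τ) (Ψ t)) := by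
    ext t; simp
  rw [e]
  have hsum : δ = (δ / 2 / 2 + δ / 2 / 2) + (δ / 2 / 2 + δ / 2 / 2) := by
    rw [ENNReal.add_halves, ENNReal.add_halves]
  rw [hsum]
  refine (eLpNorm_add_le (A1.1.1.add A2.1.1) (A4.sub A3.1.1) (by norm_num)).trans
    (add_le_add ((eLpNorm_add_le A1.1.1 A2.1.1 (by norm_num)).trans (add_le_add ?_ ?_))
      ((eLpNorm_sub_le A4 A3.1.1 (by norm_num)).trans (add_le_add i2 ?_)))
  · exact A1.2.trans i1
  · exact A2.2.trans ((mul_le_mul_right hτ _).trans hε)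
  · exact A3.2.trans ((mul_le_mul_right hτ _).trans hε)

/-- The derivative of an immersion of the line has constant sign. The substitution formula for
monotone changes of variables then applies without any continuity of `g`. -/
theorem IsPrimOn.comp {f g : ℝ → V} (h : IsPrimOn univ f g) {Ψ : ℝ → ℝ} (hΨ : IsC1Immersion Ψ) :
    IsPrimOn univ (fun t => f (Ψ t)) (fun t => deriv Ψ t • g (Ψ t)) := by
  intro a b _
  rw [h _ _ (subset_univ _)]
  rcases hΨ.neg_or_pos with h1 | h1
  · exact (intervalIntegral.integral_deriv_smul_comp_of_deriv_nonpos hΨ.continuous.continuousOn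
      (fun x _ => hΨ.hasDerivAt x) (fun x _ => (h1 x).le)).symm
  · exact (intervalIntegral.integral_deriv_smul_comp_of_deriv_nonneg hΨ.continuous.continuousOn
      (fun x _ => hΨ.hasDerivAt x) (fun x _ => (h1 x).le)).symm

theorem STendsto.comp_zero {S : ι → ℝ → V} {σ : ℝ → V} {P : ι → ℝ → ℝ} {Ψ : ℝ → ℝ}
    (hS : STendsto 0 l univ S σ) (hP : C1Conv l P Ψ) :
    STendsto 0 l univ (fun i t => S i (P i t)) (fun t => σ (Ψ t)) :=
  ⟨fun i => IsL2Loc.comp (hS.mem i) (hP.mem i), IsL2Loc.comp hS.lim hP.lim,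
    L2Conv.comp hS.conv hS.mem hS.lim hP⟩

theorem CConv.comp {S : ι → ℝ → V} {σ : ℝ → V} {P : ι → ℝ → ℝ} {Ψ : ℝ → ℝ}
    (hS : CConv l univ S σ) (hP : CConv l univ P Ψ) :
    CConv l univ (fun i t => S i (P i t)) (fun t => σ (Ψ t)) := fun t ht =>
  (hS (Ψ t) (mem_univ _)).comp (tendsto_fst.prodMk (hP t ht))

theorem STendsto.comp_one [CompleteSpace V] {S : ι → ℝ → V} {σ : ℝ → V} {P : ι → ℝ → ℝ}
    {Ψ : ℝ → ℝ} (hS : STendsto 1 l univ S σ) (hP : C1Conv l P Ψ) :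
    STendsto 1 l univ (fun i t => S i (P i t)) (fun t => σ (Ψ t)) := by
  refine STendsto.of_prim isOpen_univ (fun i => (hS.mem i).1.comp (hP.mem i))
    (hS.lim.1.comp hP.lim) (hS.cconv.comp hP.conv) ?_
  have h0 := hS.derivs.comp_zero hP
  let L : ℝ →L[ℝ] V →L[ℝ] V := ContinuousLinearMap.lsmul ℝ ℝ
  have hL : ∀ {Ψ : ℝ → ℝ}, IsC1Immersion Ψ → ContinuousOn (fun t => L (deriv Ψ t)) univ :=
    fun h => (L.continuous.comp h.continuous_deriv).continuousOn
  refine ⟨fun i => IsL2Loc.clm_apply (hL (hP.mem i)) (h0.mem i),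
    IsL2Loc.clm_apply (hL hP.lim) h0.lim, ?_⟩
  exact L2Conv.clm_apply (A := fun i t => L (deriv (P i) t)) (a := fun t => L (deriv Ψ t))
    (fun t ht => (L.continuous.tendsto _).comp (hP.conv_deriv t ht)) (fun i => hL (hP.mem i))
    (hL hP.lim) h0.conv h0.mem h0.lim

theorem STendsto.smul [CompleteSpace V] {U : Set ℝ} (hU : IsOpen U) {A : ι → ℝ → ℝ} {a : ℝ → ℝ}
    {S : ι → ℝ → V} {σ : ℝ → V} (hA : STendsto (k + 1) l U A a) (hS : STendsto (k + 1) l U S σ) :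
    STendsto (k + 1) l U (fun i t => A i t • S i t) (fun t => a t • σ t) :=
  (hA.prodMk hU hS).superpose hU isOpen_univ (F := fun z : ℝ × V => z.1 • z.2)
    (contDiff_fst.smul contDiff_snd).contDiffOn (fun _ _ _ => trivial) (fun _ _ => trivial)

/-- Composition `W^{k,2} × W^{k,2} → W^{k,2}` is continuous, `k ≥ 2`. -/
theorem STendsto.comp [CompleteSpace V] {j : ℕ} {S : ι → ℝ → V} {σ : ℝ → V} {P : ι → ℝ → ℝ}
    {Ψ : ℝ → ℝ} (hS : STendsto k l univ S σ) (hP : STendsto j l univ P Ψ) (hk : k ≤ j) (hj : 2 ≤ j)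
    (hP0 : ∀ i t, deriv (P i) t ≠ 0) (hΨ0 : ∀ t, deriv Ψ t ≠ 0) :
    STendsto k l univ (fun i t => S i (P i t)) (fun t => σ (Ψ t)) := by
  obtain ⟨j, rfl⟩ := Nat.exists_eq_add_of_le' hj
  have hC := hP.c1Conv hP0 hΨ0
  induction k generalizing S σ with
  | zero => exact hS.comp_zero hC
  | succ k ih =>
    -- Order one is separate: there the derivative `Ψ' • (σ' ∘ Ψ)` is a continuous factor times an
    -- `L²` factor. From order two on, both factors lie in a space `W^{k+1,2}` on which
    -- multiplication is continuous.
    cases k with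
    | zero => exact hS.comp_one hC
    | succ k =>
      refine STendsto.of_prim isOpen_univ (fun i => (hS.mem i).1.comp (hC.mem i))
        (hS.lim.1.comp hC.lim) (hS.cconv.comp hC.conv) ?_
      exact (hP.derivs.of_le isOpen_univ (by omega)).smul isOpen_univ (ih hS.derivs (by omega))

/-! ### Inversion -/

/-- The limit `Ψ` is strictly monotone, so `t` lies strictly between `Ψ (s - ε/2)` and `Ψ (s +
ε/2)`, where `s = Φ t`. For nearby data the corresponding values of `P i` still enclose the point,
and the intermediate value theorem places its preimage within `ε` of `s`. Monotonicity of the `P i`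
is not needed. -/
theorem CConv.inverse {P Q : ι → ℝ → ℝ} {Ψ Φ : ℝ → ℝ} (hP : CConv l univ P Ψ)
    (hPc : ∀ i, Continuous (P i)) (hΨ : IsC1Immersion Ψ) (hQ : ∀ i t, Q i (P i t) = t)
    (hΦ : ∀ t, Ψ (Φ t) = t) : CConv l univ Q Φ := by
  intro t _
  rw [Metric.tendsto_nhds]
  intro ε hε
  set s := Φ t with hs
  have hst : t ∈ Ioo (min (Ψ (s - ε / 2)) (Ψ (s + ε / 2))) (max (Ψ (s - ε / 2)) (Ψ (s + ε / 2))) := by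
    have ht : Ψ s = t := hΦ t
    rcases hΨ.neg_or_pos with h1 | h1
    · have := strictAnti_of_deriv_neg h1
      rw [min_eq_right (this.antitone (by linarith)), max_eq_left (this.antitone (by linarith)), ← ht]
      exact ⟨this (by linarith), this (by linarith)⟩
    · have := strictMono_of_deriv_pos h1
      rw [min_eq_left (this.monotone (by linarith)), max_eq_right (this.monotone (by linarith)), ← ht]
      exact ⟨this (by linarith), this (by linarith)⟩
  have h1 := (hP.tendsto (mem_univ (s - ε / 2))).comp (tendsto_fst (f := l) (g := 𝓝 t))
  have h2 := (hP.tendsto (mem_univ (s + ε / 2))).comp (tendsto_fst (f := l) (g := 𝓝 t))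
  have h3 : Tendsto (fun p : ι × ℝ => p.2) (l ×ˢ 𝓝 t) (𝓝 t) := tendsto_snd
  filter_upwards [(h1.min h2).eventually_lt h3 hst.1, h3.eventually_lt (h1.max h2) hst.2]
    with p hp1 hp2
  obtain ⟨r, hr, hrp⟩ := intermediate_value_uIcc (a := s - ε / 2) (b := s + ε / 2)
    (hPc p.1).continuousOn ⟨hp1.le, hp2.le⟩
  rw [← hrp, hQ, Real.dist_eq, abs_lt]
  rw [uIcc_of_le (by linarith)] at hr
  constructor <;> linarith [hr.1, hr.2]

theorem IsC1Immersion.hasDerivAt_inverse {Ψ Φ : ℝ → ℝ} (h : IsC1Immersion Ψ)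
    (h1 : ∀ t, Φ (Ψ t) = t) (h2 : ∀ t, Ψ (Φ t) = t) (t : ℝ) :
    HasDerivAt Φ (deriv Ψ (Φ t))⁻¹ t := by
  -- Continuity of the inverse is the previous lemma for a constant family.
  have hc : CConv (⊤ : Filter Unit) univ (fun _ => Φ) Φ :=
    CConv.inverse (P := fun _ => Ψ) (fun t _ => (h.continuous.tendsto t).comp tendsto_snd)
      (fun _ => h.continuous) h (fun _ => h1) h2
  have hcont : ContinuousAt Φ t :=
    (hc t (mem_univ t)).comp ((tendsto_const_nhds (x := ()) |>.mono_right le_top).prodMk tendsto_id)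
  exact HasDerivAt.of_local_left_inverse hcont (h.hasDerivAt _) (h.ne_zero _)
    (Eventually.of_forall h2)

theorem IsC1Immersion.inverse {Ψ Φ : ℝ → ℝ} (h : IsC1Immersion Ψ)
    (h1 : ∀ t, Φ (Ψ t) = t) (h2 : ∀ t, Ψ (Φ t) = t) : IsC1Immersion Φ := by
  have hd := h.hasDerivAt_inverse h1 h2
  have hc : Continuous Φ := continuous_iff_continuousAt.2 fun t => (hd t).continuousAt
  have e : deriv Φ = fun t => (deriv Ψ (Φ t))⁻¹ := funext fun t => (hd t).deriv
  refine ⟨fun t => by rw [e]; exact hd t, ?_, fun t => by rw [e]; exact inv_ne_zero (h.ne_zero _)⟩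
  rw [e]
  exact (h.continuous_deriv.comp hc).inv₀ fun t => h.ne_zero _

theorem C1Conv.inverse {P Q : ι → ℝ → ℝ} {Ψ Φ : ℝ → ℝ} (hP : C1Conv l P Ψ)
    (hQ : ∀ i t, Q i (P i t) = t) (hQ2 : ∀ i t, P i (Q i t) = t) (hΦ : ∀ t, Φ (Ψ t) = t)
    (hΦ2 : ∀ t, Ψ (Φ t) = t) : C1Conv l Q Φ := by
  have hc := hP.conv.inverse (fun i => (hP.mem i).continuous) hP.lim hQ hΦ2
  refine ⟨fun i => (hP.mem i).inverse (hQ i) (hQ2 i), hP.lim.inverse hΦ hΦ2, hc, fun t ht => ?_⟩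
  rw [(hP.lim.hasDerivAt_inverse hΦ hΦ2 t).deriv]
  have := ((hP.conv_deriv.comp hc) t ht).inv₀ (hP.lim.ne_zero _)
  refine this.congr fun p => ?_
  change _ = deriv (Q p.1) p.2
  rw [((hP.mem p.1).hasDerivAt_inverse (hQ _) (hQ2 _) p.2).deriv]

/-- Inversion is continuous on `W^{k,2}`, `k ≥ 2`. -/
theorem STendsto.inverse {P Q : ι → ℝ → ℝ} {Ψ Φ : ℝ → ℝ} (hP : STendsto (k + 2) l univ P Ψ)
    (hP0 : ∀ i t, deriv (P i) t ≠ 0) (hΨ0 : ∀ t, deriv Ψ t ≠ 0)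
    (hQ : ∀ i t, Q i (P i t) = t) (hQ2 : ∀ i t, P i (Q i t) = t) (hΦ : ∀ t, Φ (Ψ t) = t)
    (hΦ2 : ∀ t, Ψ (Φ t) = t) : STendsto (k + 2) l univ Q Φ := by
  have hC := hP.c1Conv hP0 hΨ0
  have hC' := hC.inverse hQ hQ2 hΦ hΦ2
  have prim : ∀ {Ψ Φ : ℝ → ℝ}, IsC1Immersion Ψ → (∀ t, Φ (Ψ t) = t) → (∀ t, Ψ (Φ t) = t) →
      IsPrimOn univ Φ (fun t => (deriv Ψ (Φ t))⁻¹) := by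
    intro Ψ Φ h h1 h2 a b _
    have h3 := h.inverse h1 h2
    rw [intervalIntegral.integral_eq_sub_of_hasDerivAt
      (fun t _ => h.hasDerivAt_inverse h1 h2 t)]
    refine Continuous.intervalIntegrable ?_ _ _
    exact (h.continuous_deriv.comp h3.continuous).inv₀ fun t => h.ne_zero _
  have hinv : ContDiffOn ℝ ∞ (fun x : ℝ => x⁻¹) {x | x ≠ 0} :=
    fun x hx => (contDiffAt_inv ℝ hx).contDiffWithinAt
  -- Since `Q' = 1 / (P' ∘ Q)`, convergence of `P' ∘ Q` in order `j + 1` gives convergence of `Q` in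
  -- order `j + 2`. Composition with `Q` in turn only needs the order already reached, so the
  -- regularity is bootstrapped.
  have step : ∀ j, STendsto (j + 1) l univ (fun i t => deriv (P i) (Q i t))
      (fun t => deriv Ψ (Φ t)) → STendsto (j + 2) l univ Q Φ := fun j h =>
    STendsto.of_prim isOpen_univ (fun i => prim (hC.mem i) (hQ i) (hQ2 i)) (prim hC.lim hΦ hΦ2)
      hC'.conv (h.superpose isOpen_univ isOpen_ne hinv (fun i t _ => hP0 i _) (fun t _ => hΨ0 _))
  induction k with
  | zero => exact step 0 (hP.derivs.comp_one hC')
  | succ k ih =>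
    refine step (k + 1) (hP.derivs.comp (ih (hP.of_succ isOpen_univ)) le_rfl (by omega) ?_ ?_)
    · exact fun i => (hC'.mem i).ne_zero
    · exact hC'.lim.ne_zero

end Composition

/-! ### Weak derivatives and primitives -/

section WeakBridge

variable {V : Type*} [NormedAddCommGroup V] [NormedSpace ℝ V] {I : Set ℝ} {k : ℕ}

theorem IsL2Loc.integrableOn {f : ℝ → V} (hf : IsL2Loc I f) {K : Set ℝ} (hK : K ⊆ I)
    (hc : IsCompact K) : IntegrableOn f K volume := by
  have : IsFiniteMeasure (volume.restrict K) := ⟨by simpa using hc.measure_lt_top⟩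
  exact (hf K hK hc).integrable (by norm_num)

theorem IsL2Loc.integrable_smul {f : ℝ → V} (hf : IsL2Loc I f) {η : ℝ → ℝ} (hη : Continuous η)
    (hc : HasCompactSupport η) (hs : tsupport η ⊆ I) : Integrable (fun t => η t • f t) volume := by
  have h1 : IntegrableOn (fun t => η t • f t) (tsupport η) volume :=
    (hf.integrableOn hs hc).continuousOn_smul hη.continuousOn hc
  refine h1.integrable_of_forall_notMem_eq_zero fun t ht => ?_
  rw [image_eq_zero_of_notMem_tsupport ht, zero_smul]

theorem IsL2Loc.sub {f g : ℝ → V} (hf : IsL2Loc I f) (hg : IsL2Loc I g) :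
    IsL2Loc I (fun t => f t - g t) :=
  fun K hK hc => (hf K hK hc).sub (hg K hK hc)

theorem exists_Icc_subset_of_isCompact (hI : IsOpen I) (hI' : I.OrdConnected) {K : Set ℝ}
    (hK : IsCompact K) (hKI : K ⊆ I) (hne : K.Nonempty) :
    ∃ a b, a < b ∧ Icc a b ⊆ I ∧ K ⊆ Ioo a b := by
  have hm := hK.sInf_mem hne
  have hM := hK.sSup_mem hne
  obtain ⟨ε, hε, h1⟩ := exists_uIcc_subset hI (hKI hm)
  obtain ⟨ε', hε', h2⟩ := exists_uIcc_subset hI (hKI hM)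
  have hle : sInf K ≤ sSup K := csInf_le hK.bddBelow hM
  refine ⟨sInf K - ε, sSup K + ε', by linarith, hI'.out (h1 ⟨le_rfl, by linarith⟩)
    (h2 ⟨by linarith, le_rfl⟩), fun t ht => ⟨?_, ?_⟩⟩
  · linarith [csInf_le hK.bddBelow ht]
  · linarith [le_csSup hK.bddAbove ht]

/-- Integration by parts: the chain rule for the bilinear map `(x, y) ↦ x • y` along the curve `(η,
f)` is the product rule, and `η` vanishes at both ends of a compact interval containing its support.
Order connectedness of `I` ensures that such an interval lies in `I`. -/
theorem IsPrimOn.isWeakDerivOn [CompleteSpace V] (hI : IsOpen I) (hI' : I.OrdConnected)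
    {f g : ℝ → V} (h : IsPrimOn I f g) (hg : IsL2Loc I g) : IsWeakDerivOn I f g := by
  intro η hη hc hs
  rcases (tsupport η).eq_empty_or_nonempty with h0 | hne
  · have : η = 0 := by
      rw [← tsupport_eq_empty_iff]; exact h0
    subst this; simp
  have hf := (h.continuousOn hI hg).isL2Loc
  obtain ⟨a, b, hab, habI, hK⟩ := exists_Icc_subset_of_isCompact hI hI' hc hs hne
  have hdη : ContDiff ℝ ∞ (deriv η) := (contDiff_infty_iff_deriv.1 hη).2
  have hds : tsupport (deriv η) ⊆ tsupport η := closure_minimal support_deriv_subset isClosed_closure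
  have i1 := hf.integrable_smul hdη.continuous hc.deriv (hds.trans hs)
  have i2 := hg.integrable_smul hη.continuous hc hs
  have e1 : ∫ t in a..b, deriv η t • f t = ∫ t, deriv η t • f t := by
    refine intervalIntegral.integral_eq_integral_of_support_subset fun t ht => ?_
    refine Ioo_subset_Ioc_self (hK (hds ?_))
    by_contra h
    exact ht (by simp [image_eq_zero_of_notMem_tsupport h])
  have e2 : ∫ t in a..b, η t • g t = ∫ t, η t • g t := by
    refine intervalIntegral.integral_eq_integral_of_support_subset fun t ht => ?_
    refine Ioo_subset_Ioc_self (hK ?_)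
    by_contra h
    exact ht (by simp [image_eq_zero_of_notMem_tsupport h])
  have ha : η a = 0 := image_eq_zero_of_notMem_tsupport fun h => lt_irrefl _ (hK h).1
  have hb : η b = 0 := image_eq_zero_of_notMem_tsupport fun h => lt_irrefl _ (hK h).2
  have hηp : IsPrimOn I η (deriv η) := fun x y _ =>
    (intervalIntegral.integral_deriv_eq_sub (fun t _ => (hη.differentiable (by simp)) t)
      (hdη.continuous.intervalIntegrable _ _)).symm
  have hp : IsPrimOn I (fun t => (η t, f t)) (fun t => (deriv η t, g t)) := by
    have hd : IsL2Loc I (deriv η) := hdη.continuous.continuousOn.isL2Loc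
    have := (hηp.clm (ContinuousLinearMap.inl ℝ ℝ V) hd).add
      (hd.clm (ContinuousLinearMap.inl ℝ ℝ V)) (h.clm (ContinuousLinearMap.inr ℝ ℝ V) hg)
      (hg.clm (ContinuousLinearMap.inr ℝ ℝ V))
    simpa using this
  have hq : IsL2Loc I (fun t => (deriv η t, g t)) := fun K hK hc =>
    (((hdη.continuous.continuousOn.isL2Loc (U := I)).clm (ContinuousLinearMap.inl ℝ ℝ V) K hK
      hc).add (hg.clm (ContinuousLinearMap.inr ℝ ℝ V) K hK hc)).ae_eq
      (ae_of_all _ fun t => by simp)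
  have hprod := hp.superpose hI isOpen_univ (F := fun z : ℝ × V => z.1 • z.2)
    (contDiff_fst.smul contDiff_snd).contDiffOn hq (fun _ _ => trivial) a b
    (by rwa [uIcc_of_le hab.le])
  have hfd : ∀ z w : ℝ × V, fderiv ℝ (fun z : ℝ × V => z.1 • z.2) z w = w.1 • z.2 + z.1 • w.2 := by
    intro z w
    have := (hasFDerivAt_fst (𝕜 := ℝ) (p := z)).fun_smul (hasFDerivAt_snd (𝕜 := ℝ) (p := z))
    rw [this.fderiv]
    simp [add_comm]
  simp only [ha, hb, zero_smul, sub_zero, hfd] at hprod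
  rw [intervalIntegral.integral_add i1.intervalIntegrable i2.intervalIntegrable, e1, e2] at hprod
  exact eq_neg_of_add_eq_zero_left hprod.symm

theorem SobolevOn.iterate_deriv {f : ℝ → V} {j : ℕ} (h : SobolevOn (k + j) I f) :
    SobolevOn k I (deriv^[j] f) := by
  induction j generalizing f with
  | zero => exact h
  | succ j ih => exact ih h.2

theorem SobolevOn.isSobolevJet [CompleteSpace V] (hI : IsOpen I) (hI' : I.OrdConnected)
    {f : ℝ → V} (h : SobolevOn k I f) : IsSobolevJet k I f (fun j => deriv^[j] f) where
  zero := rfl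
  l2 j hj := by
    obtain ⟨i, rfl⟩ := Nat.exists_eq_add_of_le' hj
    exact h.iterate_deriv.isL2Loc hI
  weak j hj := by
    obtain ⟨i, rfl⟩ := Nat.exists_eq_add_of_le' (Nat.succ_le_of_lt hj)
    have h1 : SobolevOn (i + 1) I (deriv^[j] f) :=
      SobolevOn.iterate_deriv (by rwa [show i + 1 + j = i + j.succ by omega])
    rw [Function.iterate_succ_apply']
    exact h1.1.isWeakDerivOn hI hI' (h1.2.isL2Loc hI)

/-- The lemma of du Bois-Reymond. -/
theorem exists_ae_const_of_integral_deriv_smul [CompleteSpace V] (hI : IsOpen I)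
    (hI' : I.OrdConnected) {f : ℝ → V} (hf : IsL2Loc I f)
    (h : ∀ η : ℝ → ℝ, ContDiff ℝ ∞ η → HasCompactSupport η → tsupport η ⊆ I →
      ∫ t, deriv η t • f t = 0) : ∃ c, ∀ᵐ t, t ∈ I → f t = c := by
  rcases I.eq_empty_or_nonempty with rfl | ⟨t₀, ht₀⟩
  · exact ⟨0, ae_of_all _ fun t ht => ht.elim⟩
  obtain ⟨ε, hε, hεI⟩ := exists_uIcc_subset hI ht₀
  let b : ContDiffBump t₀ := ⟨ε / 2, ε, by positivity, by linarith⟩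
  set wt := b.normed volume with hwt
  have hwtd : ContDiff ℝ ∞ wt := b.contDiff_normed
  have hwtc : HasCompactSupport wt := b.hasCompactSupport_normed
  have hwts : tsupport wt ⊆ I := by
    rw [hwt, b.tsupport_normed_eq, Real.closedBall_eq_Icc]; exact hεI
  -- As `wt` has integral one, the constant can only be the mean of `f` with weight `wt`.
  refine ⟨∫ t, wt t • f t, ?_⟩
  set c := ∫ t, wt t • f t with hc
  have hfc : IsL2Loc I (fun t => f t - c) := hf.sub continuousOn_const.isL2Loc
  have key := hI.ae_eq_zero_of_integral_contDiff_smul_eq_zero (μ := volume)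
    (f := fun t => f t - c) ((locallyIntegrableOn_iff hI.isLocallyClosed).2
      fun K hK hKc => hfc.integrableOn hK hKc) ?_
  · filter_upwards [key] with t ht htI using sub_eq_zero.1 (ht htI)
  intro φ hφ hφc hφs
  set m := ∫ t, φ t with hm
  -- Subtracting the multiple of `wt` with the same integral makes the mean of `φ` vanish. A test
  -- function of mean zero is the derivative of a test function, here of `η`, to which the
  -- hypothesis applies.
  set ρ : ℝ → ℝ := fun t => φ t - m * wt t with hρ
  have hρd : ContDiff ℝ ∞ ρ := hφ.sub (contDiff_const.mul hwtd)
  obtain ⟨x, y, hxy, hxyI, hsub⟩ := exists_Icc_subset_of_isCompact hI hI'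
    (hφc.isCompact.union hwtc.isCompact) (union_subset hφs hwts)
    ⟨t₀, Or.inr (by rw [hwt, b.tsupport_normed_eq]; exact Metric.mem_closedBall_self hε.le)⟩
  have hρ0 : ∀ t ∉ Ioo x y, ρ t = 0 := by
    intro t ht
    have h1 : φ t = 0 := image_eq_zero_of_notMem_tsupport fun h => ht (hsub (Or.inl h))
    have h2 : wt t = 0 := image_eq_zero_of_notMem_tsupport fun h => ht (hsub (Or.inr h))
    simp [hρ, h1, h2]
  have iφ : Integrable φ := hφ.continuous.integrable_of_hasCompactSupport hφc
  have iwt : Integrable wt := hwtd.continuous.integrable_of_hasCompactSupport hwtc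
  have hρint : ∫ t, ρ t = 0 := by
    simp only [hρ]
    rw [integral_sub iφ (iwt.const_mul m), integral_const_mul, b.integral_normed]
    simp [hm]
  set η : ℝ → ℝ := fun t => ∫ s in x..t, ρ s with hη
  have hηderiv : ∀ t, HasDerivAt η (ρ t) t := fun t =>
    intervalIntegral.integral_hasDerivAt_right (hρd.continuous.intervalIntegrable _ _)
      (hρd.continuous.stronglyMeasurableAtFilter _ _) hρd.continuous.continuousAt
  have hηd' : deriv η = ρ := funext fun t => (hηderiv t).deriv
  have hηd : ContDiff ℝ ∞ η := contDiff_infty_iff_deriv.2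
    ⟨fun t => (hηderiv t).differentiableAt, by rw [hηd']; exact hρd⟩
  have hηy : ∫ s in x..y, ρ s = 0 := by
    rw [intervalIntegral.integral_eq_integral_of_support_subset, hρint]
    intro t ht
    by_contra h
    exact ht (hρ0 t fun h' => h (Ioo_subset_Ioc_self h'))
  have hηs : Function.support η ⊆ Icc x y := by
    intro t ht
    by_contra hn
    refine ht ?_
    rcases lt_or_ge t x with h1 | h1
    · refine (intervalIntegral.integral_congr fun s hs => ?_).trans
        (intervalIntegral.integral_zero (a := x) (b := t) (E := ℝ))
      rw [uIcc_of_ge h1.le] at hs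
      exact hρ0 s fun h => not_lt.2 hs.2 h.1
    · have h2 : y < t := not_le.1 fun h => hn ⟨h1, h⟩
      have h3 : ∫ s in y..t, ρ s = 0 := by
        refine (intervalIntegral.integral_congr fun s hs => ?_).trans
          (intervalIntegral.integral_zero (a := y) (b := t) (E := ℝ))
        rw [uIcc_of_le h2.le] at hs
        exact hρ0 s fun h => not_lt.2 hs.1 h.2
      rw [hη]
      dsimp only
      rw [← intervalIntegral.integral_add_adjacent_intervals
        (hρd.continuous.intervalIntegrable x y) (hρd.continuous.intervalIntegrable y t), hηy, h3,
        add_zero]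
  have hηt : tsupport η ⊆ Icc x y := closure_minimal hηs isClosed_Icc
  have h0 := h η hηd (isCompact_Icc.of_isClosed_subset isClosed_closure hηt) (hηt.trans hxyI)
  rw [hηd'] at h0
  have i1 := hf.integrable_smul hφ.continuous hφc hφs
  have i2 := hf.integrable_smul hwtd.continuous hwtc hwts
  have e1 : ∫ t, ρ t • f t = (∫ t, φ t • f t) - m • c := by
    simp only [hρ, sub_smul, mul_smul]
    have i3 : Integrable (fun t => m • wt t • f t) := i2.smul m
    rw [integral_sub i1 i3, integral_smul]
  simp only [smul_sub]
  rw [integral_sub i1 (iφ.smul_const c), integral_smul_const, ← hm, ← e1, h0]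

theorem isPrimOn_integral (hI' : I.OrdConnected) {g : ℝ → V} (hg : IsL2Loc I g) {t₀ : ℝ}
    (ht₀ : t₀ ∈ I) : IsPrimOn I (fun t => ∫ s in t₀..t, g s) g := by
  intro a b hab
  have h1 := hg.intervalIntegrable (hI'.uIcc_subset ht₀ (hab left_mem_uIcc))
  have h2 := hg.intervalIntegrable (hI'.uIcc_subset ht₀ (hab right_mem_uIcc))
  exact intervalIntegral.integral_interval_sub_left h2 h1

/-- By induction `g 1` agrees almost everywhere with a regular function `q`. A primitive `F` of `q`
has the same weak derivative as `f`, so by du Bois-Reymond `f - F` is almost everywhere constant. -/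
theorem IsSobolevJet.exists_sobolevOn [CompleteSpace V] (hI : IsOpen I) (hI' : I.OrdConnected)
    {f : ℝ → V} {g : ℕ → ℝ → V} (h : IsSobolevJet k I f g) :
    ∃ f' : ℝ → V, SobolevOn k I f' ∧ ∀ᵐ t, t ∈ I → f t = f' t := by
  induction k generalizing f g with
  | zero => exact ⟨f, by rw [← h.zero]; exact h.l2 0 le_rfl, ae_of_all _ fun _ _ => rfl⟩
  | succ k ih =>
    rcases I.eq_empty_or_nonempty with rfl | ⟨t₀, ht₀⟩
    · exact ⟨0, ContDiff.sobolevOn hI contDiff_const, ae_of_all _ fun _ h => h.elim⟩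
    have hs : IsSobolevJet k I (g 1) (fun j => g (j + 1)) :=
      ⟨rfl, fun j hj => h.l2 (j + 1) (by omega), fun j hj => h.weak (j + 1) (by omega)⟩
    obtain ⟨q, hq, hqg⟩ := ih hs
    have hqL := hq.isL2Loc hI
    set F : ℝ → V := fun t => ∫ s in t₀..t, q s with hF
    have hFp : IsPrimOn I F q := isPrimOn_integral hI' hqL ht₀
    have hFL := (hFp.continuousOn hI hqL).isL2Loc
    have hfL : IsL2Loc I f := by rw [← h.zero]; exact h.l2 0 (by omega)
    obtain ⟨c, hc⟩ := exists_ae_const_of_integral_deriv_smul hI hI' (hfL.sub hFL) (by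
      intro η hη hηc hηs
      have hdη : ContDiff ℝ ∞ (deriv η) := (contDiff_infty_iff_deriv.1 hη).2
      have hds : tsupport (deriv η) ⊆ tsupport η :=
        closure_minimal support_deriv_subset isClosed_closure
      have w1 := h.weak 0 (by omega) η hη hηc hηs
      rw [h.zero] at w1
      have w2 := hFp.isWeakDerivOn hI hI' hqL η hη hηc hηs
      simp only [smul_sub]
      rw [integral_sub (hfL.integrable_smul hdη.continuous hηc.deriv (hds.trans hηs))
        (hFL.integrable_smul hdη.continuous hηc.deriv (hds.trans hηs)), w1, w2, sub_eq_zero, neg_inj]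
      refine integral_congr_ae ?_
      filter_upwards [hqg] with t ht
      by_cases htI : t ∈ tsupport η
      · simp only [zero_add]; rw [ht (hηs htI)]
      · simp [image_eq_zero_of_notMem_tsupport htI])
    refine ⟨fun t => F t + c, IsPrimOn.sobolevOn hI ?_ hq, ?_⟩
    · intro a b hab
      rw [← hFp a b hab]; simp
    · filter_upwards [hc] with t ht htI
      rw [← ht htI]; simp

/-- For `k ≥ 1` the representative provided by the previous lemma is continuous, and two continuous
functions that agree almost everywhere on an open set agree on it. For `k = 0` continuity alone
gives local square integrability. -/
theorem memSobolevLoc_iff [CompleteSpace V] (hI : IsOpen I) (hI' : I.OrdConnected) {f : ℝ → V}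
    (hf : ContinuousOn f I) : MemSobolevLoc k I f ↔ SobolevOn k I f := by
  refine ⟨fun ⟨g, hg⟩ => ?_, fun h => ⟨_, h.isSobolevJet hI hI'⟩⟩
  obtain ⟨f', hf', he⟩ := hg.exists_sobolevOn hI hI'
  cases k with
  | zero => exact hf.isL2Loc
  | succ k =>
    refine hf'.congr hI ?_
    refine (Measure.eqOn_open_of_ae_eq (μ := volume) ?_ hI hf (hf'.continuousOn hI)).symm
    rw [EventuallyEq, ae_restrict_iff' hI.measurableSet]
    exact he

end WeakBridge

/-! ### Equivariant functions -/

section Equivariant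

variable {V : Type*} [NormedAddCommGroup V] [NormedSpace ℝ V] {ι : Type*} {l : Filter ι} {k : ℕ}

theorem map_add_restrict_Ioc (a b c : ℝ) :
    (volume.restrict (Ioc a b)).map (· + c) = volume.restrict (Ioc (a + c) (b + c)) := by
  have h := (measurePreserving_add_right (volume : Measure ℝ) c).restrict_preimage
    (measurableSet_Ioc (a := a + c) (b := b + c))
  have e : (· + c) ⁻¹' Ioc (a + c) (b + c) = Ioc a b := by ext; simp
  rw [e] at h
  exact h.map_eq

theorem eLpNorm_shift (h : ℝ → V) (a b c : ℝ) :
    eLpNorm h 2 (volume.restrict (Ioc (a + c) (b + c))) =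
      eLpNorm (fun t => h (t + c)) 2 (volume.restrict (Ioc a b)) := by
  rw [← map_add_restrict_Ioc, (measurableEmbedding_addRight c).eLpNorm_map_measure]
  rfl

theorem eLpNorm_clm_le (L : V →L[ℝ] V) (h : ℝ → V) (μ : Measure ℝ) :
    eLpNorm (fun t => L (h t)) 2 μ ≤ ‖L‖₊ • eLpNorm h 2 μ :=
  eLpNorm_le_nnreal_smul_eLpNorm_of_ae_le_mul (ae_of_all _ fun _ => L.le_opNNNorm _) 2

/-- `L²` control of equivariant functions on one period gives control on compact sets. -/
theorem tendsto_eLpNorm_of_equivariant (A : V ≃L[ℝ] V) {H : ι → ℝ → V}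
    (hH : ∀ i t, H i (t + 1) = A (H i t))
    (h0 : Tendsto (fun i => eLpNorm (H i) 2 (volume.restrict (Ioc 0 1))) l (𝓝 0))
    {K : Set ℝ} (hK : IsCompact K) :
    Tendsto (fun i => eLpNorm (H i) 2 (volume.restrict K)) l (𝓝 0) := by
  have hcl : ∀ (L : V →L[ℝ] V) (a b : ℝ),
      Tendsto (fun i => eLpNorm (H i) 2 (volume.restrict (Ioc a b))) l (𝓝 0) →
      Tendsto (fun i => eLpNorm (fun t => L (H i t)) 2 (volume.restrict (Ioc a b))) l (𝓝 0) := by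
    intro L a b h
    have h1 := ENNReal.Tendsto.const_mul h (Or.inr (ENNReal.coe_ne_top (r := ‖L‖₊)))
    rw [mul_zero] at h1
    exact tendsto_of_tendsto_of_tendsto_of_le_of_le tendsto_const_nhds h1 (fun _ => zero_le)
      fun i => eLpNorm_clm_le L _ _
  have hm : ∀ m : ℤ, Tendsto (fun i => eLpNorm (H i) 2 (volume.restrict (Ioc (m : ℝ) (m + 1)))) l
      (𝓝 0) := by
    intro m
    induction m using Int.induction_on with
    | zero => simpa using h0
    | succ m ih =>
      refine (hcl (A : V →L[ℝ] V) _ _ ih).congr fun i => ?_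
      push_cast
      rw [eLpNorm_shift (H i) (m : ℝ) (m + 1) 1]
      simp [hH]
    | pred m ih =>
      refine (hcl (A.symm : V →L[ℝ] V) _ _ ih).congr fun i => ?_
      have := eLpNorm_shift (fun t => A.symm (H i t)) (((-(m : ℤ) - 1 : ℤ)) : ℝ)
        (((-(m : ℤ) - 1 : ℤ) : ℝ) + 1) 1
      simp only [hH, ContinuousLinearEquiv.symm_apply_apply] at this
      rw [← this]
      push_cast
      simp
  refine hK.induction_on
    (p := fun s => Tendsto (fun i => eLpNorm (H i) 2 (volume.restrict s)) l (𝓝 0))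
    (by simpa using tendsto_const_nhds) ?_ ?_ ?_
  · intro s t hst ht
    exact tendsto_of_tendsto_of_tendsto_of_le_of_le tendsto_const_nhds ht (fun _ => zero_le)
      fun i => eLpNorm_mono_measure _ (Measure.restrict_mono hst le_rfl)
  · intro s t hs ht
    have := hs.add ht
    rw [add_zero] at this
    exact tendsto_of_tendsto_of_tendsto_of_le_of_le tendsto_const_nhds this (fun _ => zero_le)
      fun i => eLpNorm_restrict_union_le _ s t
  · intro t ht
    -- Two consecutive periods are needed: when `t` is an integer, the half-open interval ending at
    -- `t` is not a neighbourhood of it.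
    have e : Ioc (((⌈t⌉ - 1 : ℤ)) : ℝ) (((⌈t⌉ - 1 : ℤ) : ℝ) + 1) ∪
        Ioc ((⌈t⌉ : ℤ) : ℝ) ((⌈t⌉ : ℤ) + 1) ∈ 𝓝 t := by
      push_cast
      rw [sub_add_cancel, Ioc_union_Ioc_eq_Ioc (by linarith) (by linarith)]
      exact Ioc_mem_nhds (by linarith [Int.ceil_lt_add_one t]) (by linarith [Int.le_ceil t])
    refine ⟨_, mem_nhdsWithin_of_mem_nhds e, ?_⟩
    have := (hm (⌈t⌉ - 1)).add (hm ⌈t⌉)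
    rw [add_zero] at this
    exact tendsto_of_tendsto_of_tendsto_of_le_of_le tendsto_const_nhds this (fun _ => zero_le)
      fun i => eLpNorm_restrict_union_le _ _ _

theorem memLp_clm_shift (L : V →L[ℝ] V) {H : ℝ → V} {a b c : ℝ} (h0 : ∀ t, H (t + c) = L (H t))
    (h : MemLp H 2 (volume.restrict (Ioc a b))) :
    MemLp H 2 (volume.restrict (Ioc (a + c) (b + c))) := by
  rw [← map_add_restrict_Ioc, (measurableEmbedding_addRight c).memLp_map_measure_iff]
  have := L.comp_memLp' h
  refine this.ae_eq (ae_of_all _ fun t => ?_)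
  simp [h0]

theorem isL2Loc_of_equivariant (A : V ≃L[ℝ] V) {H : ℝ → V} (hH : ∀ t, H (t + 1) = A (H t))
    (h0 : MemLp H 2 (volume.restrict (Ioc 0 1))) : IsL2Loc univ H := by
  have hm : ∀ m : ℤ, MemLp H 2 (volume.restrict (Ioc (m : ℝ) (m + 1))) := by
    intro m
    induction m using Int.induction_on with
    | zero => simpa using h0
    | succ m ih =>
      have := memLp_clm_shift (A : V →L[ℝ] V) (c := 1) (fun t => hH t) ih
      push_cast; exact this
    | pred m ih =>
      have := memLp_clm_shift (A.symm : V →L[ℝ] V) (c := -1)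
        (fun t => by
          have := hH (t + -1)
          rw [neg_add_cancel_right] at this
          rw [this]; simp) ih
      push_cast at this ⊢
      convert this using 3 <;> ring
  intro K _ hK
  refine hK.induction_on (p := fun s => MemLp H 2 (volume.restrict s)) (by simp)
    (fun s t hst ht => ht.mono_measure (Measure.restrict_mono hst le_rfl)) ?_ ?_
  · intro s t hs ht
    refine ⟨aestronglyMeasurable_union_iff.2 ⟨hs.1, ht.1⟩, ?_⟩
    exact (eLpNorm_restrict_union_le H s t).trans_lt (ENNReal.add_lt_top.2 ⟨hs.2, ht.2⟩)
  · intro t ht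
    have e : Ioc (((⌈t⌉ - 1 : ℤ)) : ℝ) (((⌈t⌉ - 1 : ℤ) : ℝ) + 1) ∪
        Ioc ((⌈t⌉ : ℤ) : ℝ) ((⌈t⌉ : ℤ) + 1) ∈ 𝓝 t := by
      push_cast
      rw [sub_add_cancel, Ioc_union_Ioc_eq_Ioc (by linarith) (by linarith)]
      exact Ioc_mem_nhds (by linarith [Int.ceil_lt_add_one t]) (by linarith [Int.le_ceil t])
    refine ⟨_, mem_nhdsWithin_of_mem_nhds e, aestronglyMeasurable_union_iff.2
      ⟨(hm _).1, (hm _).1⟩, ?_⟩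
    exact (eLpNorm_restrict_union_le H _ _).trans_lt (ENNReal.add_lt_top.2 ⟨(hm _).2, (hm _).2⟩)

theorem iterate_deriv_equivariant (A : V ≃L[ℝ] V) {f : ℝ → V} (hf : ∀ t, f (t + 1) = A (f t))
    (j : ℕ) (t : ℝ) : (deriv^[j] f) (t + 1) = A ((deriv^[j] f) t) := by
  induction j generalizing f t with
  | zero => exact hf t
  | succ j ih =>
    refine ih (f := deriv f) (fun t => ?_) t
    rw [← deriv_comp_add_const (f := f) (a := 1)]
    have : (fun x => f (x + 1)) = fun x => A (f x) := funext hf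
    rw [this]
    by_cases hd : DifferentiableAt ℝ f t
    · exact (A.toContinuousLinearMap.hasFDerivAt.comp_hasDerivAt t hd.hasDerivAt).deriv
    -- As `A` is invertible, `A ∘ f` is not differentiable where `f` is not, and both sides take the
    -- default value zero.
    · rw [deriv_zero_of_not_differentiableAt hd, map_zero,
        deriv_zero_of_not_differentiableAt]
      intro h
      apply hd
      have h2 := (A.symm.toContinuousLinearMap.hasFDerivAt.comp_hasDerivAt t h.hasDerivAt)
      have h3 : (⇑A.symm.toContinuousLinearMap ∘ fun x => A (f x)) = f := by ext; simp
      rw [h3] at h2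
      exact h2.differentiableAt

/-! ### `L²` convergence of a function and of its derivative -/

theorem L2Conv.integral_tendsto {F : ι → ℝ → V} {f : ℝ → V} (h : L2Conv l univ F f)
    (hF : ∀ i, IsL2Loc univ (F i)) (hf : IsL2Loc univ f) {K : Set ℝ} (hK : IsCompact K) :
    Tendsto (fun i => ∫ t in K, ‖F i t - f t‖) l (𝓝 0) := by
  have hv : volume K ^ (2 : ℝ)⁻¹ ≠ ⊤ :=
    (ENNReal.rpow_lt_top_of_nonneg (by positivity) hK.measure_lt_top.ne).ne
  have h1 : Tendsto (fun i => eLpNorm (F i - f) 2 (volume.restrict K) * volume K ^ (2 : ℝ)⁻¹) l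
      (𝓝 0) := by
    simpa using ENNReal.Tendsto.mul_const (h K (subset_univ _) hK) (Or.inr hv)
  have hm : ∀ i, AEStronglyMeasurable (F i - f) (volume.restrict K) := fun i =>
    ((hF i K (subset_univ _) hK).sub (hf K (subset_univ _) hK)).1
  have h2 : Tendsto (fun i => eLpNorm (F i - f) 1 (volume.restrict K)) l (𝓝 0) := by
    refine tendsto_of_tendsto_of_tendsto_of_le_of_le tendsto_const_nhds h1 (fun _ => zero_le) ?_
    intro i
    refine (eLpNorm_le_eLpNorm_mul_rpow_measure_univ (p := 1) (q := 2) (by norm_num) (hm i)).trans ?_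
    rw [Measure.restrict_apply_univ]
    norm_num
  have h3 := (ENNReal.tendsto_toReal ENNReal.zero_ne_top).comp h2
  refine h3.congr fun i => ?_
  rw [Function.comp_apply, eLpNorm_one_eq_lintegral_enorm, ← integral_norm_eq_lintegral_enorm (hm i)]
  rfl

theorem IsPrimOn.sub {U : Set ℝ} {f g f' g' : ℝ → V} (h : IsPrimOn U f g) (hg : IsL2Loc U g)
    (h' : IsPrimOn U f' g') (hg' : IsL2Loc U g') :
    IsPrimOn U (fun t => f t - f' t) (fun t => g t - g' t) := by
  intro a b hab
  rw [intervalIntegral.integral_sub (hg.intervalIntegrable hab) (hg'.intervalIntegrable hab),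
    ← h a b hab, ← h' a b hab, sub_sub_sub_comm]

theorem IsPrimOn.norm_sub_le {f g : ℝ → V} (h : IsPrimOn univ f g) (hg : IsL2Loc univ g)
    {a b r s : ℝ} (hr : r ∈ Icc a b) (hs : s ∈ Icc a b) :
    ‖f s - f r‖ ≤ ∫ t in Icc a b, ‖g t‖ := by
  rw [h r s (subset_univ _)]
  refine (intervalIntegral.norm_integral_le_integral_norm_uIoc).trans ?_
  refine setIntegral_mono_set (hg.integrableOn (subset_univ _) isCompact_Icc).norm
    (ae_of_all _ fun t => norm_nonneg _) (LE.le.eventuallyLE ?_)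
  exact uIoc_subset_uIcc.trans (uIcc_subset_Icc hr hs)

/-- The one-dimensional Sobolev inequality: on an interval of length two, the value of a function at
any point is bounded by its mean plus the `L¹` norm of its derivative. The constants used are not
optimal. -/
theorem cconv_of_l2Conv {F G : ι → ℝ → V} {f g : ℝ → V} (hF : ∀ i, IsPrimOn univ (F i) (G i))
    (hG : ∀ i, IsL2Loc univ (G i)) (hf : IsPrimOn univ f g) (hg : IsL2Loc univ g)
    (h0 : L2Conv l univ F f) (h1 : L2Conv l univ G g) : CConv l univ F f := by
  intro t _
  set J := Icc (t - 1) (t + 1) with hJ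
  have hFc : ∀ i, ContinuousOn (F i) univ := fun i => (hF i).continuousOn isOpen_univ (hG i)
  have hfc := hf.continuousOn isOpen_univ hg
  have hd : ∀ i, ContinuousOn (fun s => F i s - f s) univ := fun i => (hFc i).sub hfc
  have a1 := (h0.integral_tendsto (fun i => (hFc i).isL2Loc) hfc.isL2Loc
    (isCompact_Icc (a := t - 1) (b := t + 1)))
  have a2 := h1.integral_tendsto hG hg (isCompact_Icc (a := t - 1) (b := t + 1))
  have key : ∀ i, ∀ s ∈ J, ‖F i s - f s‖ ≤
      (∫ r in J, ‖F i r - f r‖) + 2 * ∫ r in J, ‖G i r - g r‖ := by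
    intro i s hs
    set M := ∫ r in J, ‖G i r - g r‖ with hM
    have hM0 : 0 ≤ M := integral_nonneg fun _ => norm_nonneg _
    have b1 : ∀ r ∈ J, ‖F i s - f s‖ - M ≤ ‖F i r - f r‖ := by
      intro r hr
      have := ((hF i).sub (hG i) hf hg).norm_sub_le ((hG i).sub hg) hr hs
      have h2 := norm_sub_norm_le (F i s - f s) (F i r - f r)
      linarith
    have i1 : IntegrableOn (fun r => ‖F i r - f r‖) J :=
      (((hd i).isL2Loc).integrableOn (subset_univ _) isCompact_Icc).norm
    have hvol : volume.real J = 2 := by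
      rw [hJ, Real.volume_real_Icc_of_le (by linarith)]; ring
    have b2 := setIntegral_mono_on (integrableOn_const (C := ‖F i s - f s‖ - M)
      (isCompact_Icc (a := t - 1) (b := t + 1)).measure_lt_top.ne) i1 measurableSet_Icc b1
    rw [setIntegral_const, hvol, smul_eq_mul] at b2
    have : 0 ≤ ∫ r in J, ‖F i r - f r‖ := integral_nonneg fun _ => norm_nonneg _
    linarith [norm_nonneg (F i s - f s)]
  have a3 := a1.add (a2.const_mul 2)
  rw [mul_zero, add_zero] at a3
  have a4 : Tendsto (fun p : ι × ℝ => F p.1 p.2 - f p.2) (l ×ˢ 𝓝 t) (𝓝 0) := by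
    refine squeeze_zero_norm' ?_ (a3.comp tendsto_fst)
    filter_upwards [(tendsto_snd (f := l) (g := 𝓝 t)).eventually
      (Icc_mem_nhds (show t - 1 < t by linarith) (show t < t + 1 by linarith))] with p hp
    exact key p.1 p.2 hp
  have a5 : Tendsto (fun p : ι × ℝ => f p.2) (l ×ˢ 𝓝 t) (𝓝 (f t)) :=
    ((hfc.continuousAt univ_mem).tendsto).comp tendsto_snd
  simpa using a4.add a5

theorem STendsto.of_l2Conv {F : ι → ℝ → V} {f : ℝ → V} (hF : ∀ i, SobolevOn k univ (F i))
    (hf : SobolevOn k univ f)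
    (h : ∀ j ≤ k, L2Conv l univ (fun i => deriv^[j] (F i)) (deriv^[j] f)) :
    STendsto k l univ F f := by
  refine ⟨hF, hf, ?_⟩
  induction k generalizing F f with
  | zero => exact h 0 le_rfl
  | succ k ih =>
    refine ⟨cconv_of_l2Conv (fun i => (hF i).1) (fun i => (hF i).2.isL2Loc isOpen_univ) hf.1
      (hf.2.isL2Loc isOpen_univ) (h 0 (by omega)) (h 1 (by omega)), ?_⟩
    exact ih (fun i => (hF i).2) hf.2 fun j hj => h (j + 1) (by omega)

theorem STendsto.l2Conv {F : ι → ℝ → V} {f : ℝ → V} (h : STendsto k l univ F f) {j : ℕ}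
    (hj : j ≤ k) : L2Conv l univ (fun i => deriv^[j] (F i)) (deriv^[j] f) := by
  induction j generalizing k F f with
  | zero => exact (h.of_le isOpen_univ (Nat.zero_le k)).conv
  | succ j ih =>
    obtain ⟨i, rfl⟩ := Nat.exists_eq_add_of_le' hj
    exact ih (h.derivs (k := i + j)) (by omega)

/-- A family all of whose derivatives converge in `L²` has a limit in `W^{k,2}_loc`. -/
theorem exists_limit_of_l2Conv [CompleteSpace V] [l.NeBot] {F : ι → ℝ → V}
    (hF : ∀ i, SobolevOn k univ (F i)) {H : ℕ → ℝ → V} (hH : ∀ j ≤ k, IsL2Loc univ (H j))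
    (h : ∀ j ≤ k, L2Conv l univ (fun i => deriv^[j] (F i)) (H j)) :
    ∃ f, STendsto k l univ F f := by
  induction k generalizing F H with
  | zero => exact ⟨H 0, hF, hH 0 le_rfl, h 0 le_rfl⟩
  | succ k ih =>
    obtain ⟨g, hg⟩ := ih (F := fun i => deriv (F i)) (H := fun j => H (j + 1))
      (fun i => (hF i).2) (fun j hj => hH (j + 1) (by omega)) (fun j hj => h (j + 1) (by omega))
    have hgL := hg.lim.isL2Loc isOpen_univ
    have hGL := fun i => (hg.mem i).isL2Loc isOpen_univ
    have hgc : L2Conv l univ (fun i => deriv (F i)) g := (hg.of_le isOpen_univ (Nat.zero_le k)).conv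
    have hprim := isPrimOn_integral (I := univ) ordConnected_univ hgL (mem_univ 0)
    set G : ℝ → V := fun t => ∫ s in (0 : ℝ)..t, g s with hGdef
    have hGc := hprim.continuousOn isOpen_univ hgL
    have c1 : CConv l univ (fun i t => F i t - F i 0) G := by
      intro t _
      have hd : ∀ i s, F i s - F i 0 - G s = ∫ r in (0 : ℝ)..s, (deriv (F i) r - g r) := by
        intro i s
        rw [intervalIntegral.integral_sub ((hGL i).intervalIntegrable (subset_univ _))
          (hgL.intervalIntegrable (subset_univ _)), ← (hF i).1 0 s (subset_univ _)]
      have a2 := hgc.integral_tendsto hGL hgL (isCompact_Icc (a := -|t| - 1) (b := |t| + 1))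
      have a4 : Tendsto (fun p : ι × ℝ => F p.1 p.2 - F p.1 0 - G p.2) (l ×ˢ 𝓝 t) (𝓝 0) := by
        refine squeeze_zero_norm' ?_ (a2.comp tendsto_fst)
        filter_upwards [(tendsto_snd (f := l) (g := 𝓝 t)).eventually
          (Icc_mem_nhds (show -|t| - 1 < t by linarith [neg_abs_le t])
            (show t < |t| + 1 by linarith [le_abs_self t]))] with p hp
        rw [hd]
        refine (intervalIntegral.norm_integral_le_integral_norm_uIoc).trans ?_
        refine setIntegral_mono_set (((hGL p.1).sub hgL).integrableOn (subset_univ _)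
          isCompact_Icc).norm (ae_of_all _ fun t => norm_nonneg _) (LE.le.eventuallyLE ?_)
        exact uIoc_subset_uIcc.trans (uIcc_subset_Icc
          ⟨by linarith [abs_nonneg t], by linarith [abs_nonneg t]⟩ hp)
      have a5 : Tendsto (fun p : ι × ℝ => G p.2) (l ×ˢ 𝓝 t) (𝓝 (G t)) :=
        ((hGc.continuousAt univ_mem).tendsto).comp tendsto_snd
      simpa using a4.add a5
    have hFL : ∀ i, IsL2Loc univ (F i) := fun i => (hF i).isL2Loc isOpen_univ
    have hFcont : ∀ i, ContinuousOn (F i) univ := fun i => (hF i).continuousOn isOpen_univ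
    have hJ := isCompact_Icc (a := (0 : ℝ)) (b := 1)
    have i0 := (h 0 (by omega)).integral_tendsto hFL (hH 0 (by omega)) hJ
    have i1 := (c1.l2Conv hGc).integral_tendsto
      (fun i => ((hFcont i).sub continuousOn_const).isL2Loc) hGc.isL2Loc hJ
    -- Integrating the derivatives only yields convergence up to constants. The constants converge
    -- because `F i 0` is the mean over `[0, 1]` of `F i - (F i - F i 0)`, and both terms converge
    -- in `L¹`.
    have hc : Tendsto (fun i => F i 0) l (𝓝 (∫ t in Icc (0 : ℝ) 1, (H 0 t - G t))) := by
      rw [tendsto_iff_norm_sub_tendsto_zero]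
      have i2 := i0.add i1
      rw [add_zero] at i2
      refine squeeze_zero (fun _ => norm_nonneg _) (fun i => ?_) i2
      have hconst : F i 0 = ∫ t in Icc (0 : ℝ) 1, F i 0 := by simp
      have k0 : IntegrableOn (fun _ : ℝ => F i 0) (Icc (0 : ℝ) 1) :=
        ((continuousOn_const (s := univ)).isL2Loc).integrableOn (subset_univ _) hJ
      have k1 := ((hFL i).sub (hH 0 (by omega))).integrableOn (subset_univ (Icc (0 : ℝ) 1)) hJ
      have k2 : IntegrableOn (fun t => F i t - F i 0 - G t) (Icc (0 : ℝ) 1) :=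
        ((((hFcont i).sub continuousOn_const).sub hGc).isL2Loc).integrableOn (subset_univ _) hJ
      have k3 : IntegrableOn (fun t => H 0 t - G t) (Icc (0 : ℝ) 1) :=
        ((hH 0 (by omega)).sub hGc.isL2Loc).integrableOn (subset_univ _) hJ
      have e : F i 0 - ∫ t in Icc (0 : ℝ) 1, (H 0 t - G t) =
          (∫ t in Icc (0 : ℝ) 1, (F i t - H 0 t)) - ∫ t in Icc (0 : ℝ) 1, (F i t - F i 0 - G t) := by
        rw [← integral_sub k1 k2]
        conv_lhs => rw [hconst]
        rw [← integral_sub k0 k3]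
        congr 1; ext t; abel
      rw [e]
      refine (_root_.norm_sub_le _ _).trans (add_le_add (norm_integral_le_integral_norm _)
        (norm_integral_le_integral_norm _))
    set c := ∫ t in Icc (0 : ℝ) 1, (H 0 t - G t) with hcdef
    refine ⟨fun t => G t + c, STendsto.of_prim isOpen_univ (fun i => (hF i).1) (g := g) ?_ ?_ hg⟩
    · intro a b hab
      rw [← hprim a b hab, add_sub_add_right_eq_sub]
    · intro t ht
      have := (c1 t ht).add (hc.comp tendsto_fst)
      simpa using this

end Equivariant

/-! ### The spaces of sections -/

section HolderBounds

variable {V : Type*} [NormedAddCommGroup V] [NormedSpace ℝ V] {ι : Type*} {l : Filter ι} {k : ℕ}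

/-- The Cauchy-Schwarz inequality gives Hölder continuity with exponent `1/2`, hence equicontinuity
of bounded sets of `W^{1,2}`. -/
theorem IsPrimOn.norm_sub_le_sqrt {f g : ℝ → V} (h : IsPrimOn univ f g) (hg : IsL2Loc univ g)
    {a b r s : ℝ} (hr : r ∈ Icc a b) (hs : s ∈ Icc a b) :
    ‖f s - f r‖ ≤ √|s - r| * (eLpNorm g 2 (volume.restrict (Ioc a b))).toReal := by
  have hsub : uIoc r s ⊆ Ioc a b := Ioc_subset_Ioc (le_min hr.1 hs.1) (max_le hr.2 hs.2)
  have hL := hg (Icc a b) (subset_univ _) isCompact_Icc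
  have hL' : MemLp g 2 (volume.restrict (Ioc a b)) :=
    hL.mono_measure (Measure.restrict_mono Ioc_subset_Icc_self le_rfl)
  have hm : AEStronglyMeasurable g (volume.restrict (uIoc r s)) :=
    (hL'.mono_measure (Measure.restrict_mono hsub le_rfl)).1
  rw [h r s (subset_univ _)]
  refine intervalIntegral.norm_integral_le_integral_norm_uIoc.trans ?_
  have h1 := eLpNorm_le_eLpNorm_mul_rpow_measure_univ (p := 1) (q := 2) (by norm_num) hm
  rw [Measure.restrict_apply_univ] at h1
  have h2 : eLpNorm g 1 (volume.restrict (uIoc r s)) ≤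
      eLpNorm g 2 (volume.restrict (Ioc a b)) * volume (uIoc r s) ^ (2 : ℝ)⁻¹ := by
    refine h1.trans ?_
    norm_num
    gcongr
  have hv : volume (uIoc r s) = ENNReal.ofReal |s - r| := by
    rw [uIoc, Real.volume_Ioc, max_sub_min_eq_abs]
  rw [hv, ENNReal.ofReal_rpow_of_nonneg (abs_nonneg _) (by norm_num)] at h2
  have h3 := ENNReal.toReal_mono (ENNReal.mul_ne_top hL'.2.ne ENNReal.ofReal_ne_top) h2
  rw [ENNReal.toReal_mul, ENNReal.toReal_ofReal (by positivity), eLpNorm_one_eq_lintegral_enorm,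
    ← integral_norm_eq_lintegral_enorm hm] at h3
  rw [Real.sqrt_eq_rpow, mul_comm]
  simpa using h3

/-- The oscillation over one period is at most `M`, the norm of `g`. If `‖f s‖` exceeds `M`, then
`‖f‖ ≥ ‖f s‖ - M` on the whole period of length one, which bounds `‖f s‖ - M` by the norm of `f`. -/
theorem IsPrimOn.norm_le_of_period {f g : ℝ → V} (h : IsPrimOn univ f g) (hg : IsL2Loc univ g)
    {s : ℝ} (hs : s ∈ Icc (0 : ℝ) 1) :
    ‖f s‖ ≤ (eLpNorm f 2 (volume.restrict (Ioc 0 1))).toReal +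
      (eLpNorm g 2 (volume.restrict (Ioc 0 1))).toReal := by
  set M := (eLpNorm g 2 (volume.restrict (Ioc 0 1))).toReal with hM
  have hM0 : 0 ≤ M := ENNReal.toReal_nonneg
  by_cases hc : ‖f s‖ ≤ M
  · have : 0 ≤ (eLpNorm f 2 (volume.restrict (Ioc 0 1))).toReal := ENNReal.toReal_nonneg
    linarith
  push Not at hc
  have hfc := h.continuousOn isOpen_univ hg
  have hL : MemLp f 2 (volume.restrict (Ioc 0 1)) :=
    (hfc.isL2Loc (Icc 0 1) (subset_univ _) isCompact_Icc).mono_measure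
      (Measure.restrict_mono Ioc_subset_Icc_self le_rfl)
  have b1 : ∀ r ∈ Ioc (0 : ℝ) 1, ‖f s‖ - M ≤ ‖f r‖ := by
    intro r hr
    have h1 := h.norm_sub_le_sqrt hg (Ioc_subset_Icc_self hr) hs
    have h2 : √|s - r| ≤ 1 := by
      rw [Real.sqrt_le_iff, one_pow, abs_le]
      refine ⟨zero_le_one, ?_⟩
      exact ⟨by linarith [hs.1, hr.2], by linarith [hs.2, hr.1]⟩
    have h3 := norm_sub_norm_le (f s) (f r)
    nlinarith
  have b2 : eLpNorm (fun _ : ℝ => ‖f s‖ - M) 2 (volume.restrict (Ioc (0 : ℝ) 1)) ≤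
      eLpNorm f 2 (volume.restrict (Ioc 0 1)) := by
    refine eLpNorm_mono_ae ?_
    filter_upwards [ae_restrict_mem measurableSet_Ioc] with r hr
    rw [Real.norm_of_nonneg (by linarith)]
    exact b1 r hr
  rw [eLpNorm_const _ (by norm_num) (by simp)] at b2
  have b3 := ENNReal.toReal_mono hL.2.ne b2
  simp at b3
  rw [abs_of_nonneg (by linarith)] at b3
  linarith

/-- Limits in `L²` of derivatives of sections are only known on one period. Extending them
equivariantly gives locally square integrable functions on the line, to which
`exists_limit_of_l2Conv` applies. -/
theorem exists_equivariant_extension (A : V ≃L[ℝ] V) (g : ℝ → V) :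
    ∃ H : ℝ → V, (∀ t, H (t + 1) = A (H t)) ∧ EqOn H g (Ioc 0 1) := by
  refine ⟨fun t => (A ^ (⌈t⌉ - 1)) (g (t - (⌈t⌉ - 1 : ℤ))), fun t => ?_, fun t ht => ?_⟩
  · have h1 : ⌈t + 1⌉ - 1 = 1 + (⌈t⌉ - 1) := by rw [Int.ceil_add_one]; ring
    simp only [h1]
    rw [zpow_add, zpow_one]
    push_cast
    rw [show t + 1 - (1 + ((⌈t⌉ : ℝ) - 1)) = t - ((⌈t⌉ : ℝ) - 1) by ring]
    rfl
  · have h1 : ⌈t⌉ = 1 := by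
      rw [Int.ceil_eq_iff]; simpa using ht
    simp only [h1, sub_self, zpow_zero, Int.cast_zero, sub_zero]
    rfl

theorem STendsto.const_vec [CompleteSpace V] {U : Set ℝ} (hU : IsOpen U) {c : ι → V} {x : V}
    (h : Tendsto c l (𝓝 x)) : STendsto k l U (fun i _ => c i) (fun _ => x) := by
  refine STendsto.of_succ hU (STendsto.of_prim hU (G := fun _ _ => 0) (g := fun _ => 0)
    (fun i a b hab => by simp) (fun a b hab => by simp) (fun t ht => h.comp tendsto_fst) ?_)
  exact SobolevOn.sTendsto hU (contDiff_const.sobolevOn hU) l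

theorem SobolevOn.comp_add_const [CompleteSpace V] {f : ℝ → V} (hf : SobolevOn (k + 2) univ f)
    (s₀ : ℝ) : STendsto (k + 2) (𝓝 s₀) univ (fun s t => f (t + s)) (fun t => f (t + s₀)) := by
  have h1 : STendsto (k + 2) (𝓝 s₀) univ (fun s t => t + s) (fun t => t + s₀) :=
    (SobolevOn.sTendsto isOpen_univ (contDiff_id.sobolevOn isOpen_univ) (𝓝 s₀)).add isOpen_univ
      (STendsto.const_vec isOpen_univ tendsto_id)
  exact (SobolevOn.sTendsto isOpen_univ hf (𝓝 s₀)).comp h1 le_rfl (by omega)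
    (fun i t => by simp) (fun t => by simp)

end HolderBounds

namespace SobolevSection

variable {n : ℕ} {A : EuclideanSpace ℝ (Fin n) ≃L[ℝ] EuclideanSpace ℝ (Fin n)} {k : ℕ}
variable {ι : Type*} {l : Filter ι}

theorem sobolevOn (ξ : SobolevSection A k) : SobolevOn k univ ξ :=
  (memSobolevLoc_iff isOpen_univ ordConnected_univ ξ.property.1.continuousOn).1 ξ.property.2.2

theorem equivariant (ξ : SobolevSection A k) (t : ℝ) : ξ (t + 1) = A (ξ t) := ξ.property.2.1 t

/-- The section given by an equivariant function of class `W^{k,2}`. -/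
def ofSobolevOn (f : ℝ → EuclideanSpace ℝ (Fin n)) (hc : Continuous f)
    (hA : ∀ t, f (t + 1) = A (f t)) (hf : SobolevOn k univ f) : SobolevSection A k :=
  ⟨f, hc, hA, (memSobolevLoc_iff isOpen_univ ordConnected_univ hc.continuousOn).2 hf⟩

@[simp] theorem coe_ofSobolevOn (f : ℝ → EuclideanSpace ℝ (Fin n)) (hc : Continuous f)
    (hA : ∀ t, f (t + 1) = A (f t)) (hf : SobolevOn k univ f) :
    (ofSobolevOn f hc hA hf : ℝ → EuclideanSpace ℝ (Fin n)) = f := rfl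

theorem memLp_iterate_deriv (ξ : SobolevSection A k) {j : ℕ} (hj : j ≤ k) :
    MemLp (deriv^[j] ξ) 2 (volume.restrict (Ioc (0 : ℝ) 1)) :=
  ((ξ.sobolevOn.isSobolevJet isOpen_univ ordConnected_univ).l2 j hj (Icc 0 1) (subset_univ _)
    isCompact_Icc).mono_measure (Measure.restrict_mono Ioc_subset_Icc_self le_rfl)

theorem jet_apply (ξ : SobolevSection A k) (j : Fin (k + 1)) :
    jet ξ j = (ξ.memLp_iterate_deriv (j := j) (by omega)).toLp :=
  MemLp.toLp_congr (memLp_weakDeriv ξ j) _ (ae_restrict_of_ae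
    (ξ.weakDeriv_spec.ae_eq (ξ.sobolevOn.isSobolevJet isOpen_univ ordConnected_univ) j (by omega)))

theorem isometry_jet : Isometry (jet (A := A) (k := k)) :=
  AddMonoidHomClass.isometry_of_norm (jet (A := A) (k := k)) fun _ => rfl

theorem eLpNorm_iterate_deriv_le (ξ : SobolevSection A k) {j : ℕ} (hj : j ≤ k) :
    (eLpNorm (deriv^[j] ξ) 2 (volume.restrict (Ioc (0 : ℝ) 1))).toReal ≤ ‖ξ‖ := by
  have h := PiLp.norm_apply_le (jet ξ) (⟨j, by omega⟩ : Fin (k + 1))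
  rw [jet_apply, Lp.norm_toLp] at h
  exact h

theorem tendsto_iff_eLpNorm {Ξ : ι → SobolevSection A k} {ξ : SobolevSection A k} :
    Tendsto Ξ l (𝓝 ξ) ↔ ∀ j ≤ k, Tendsto (fun i => eLpNorm (deriv^[j] (Ξ i) - deriv^[j] ξ) 2
      (volume.restrict (Ioc (0 : ℝ) 1))) l (𝓝 0) := by
  rw [isometry_jet.isEmbedding.isInducing.tendsto_nhds_iff,
    (PiLp.homeomorph 2 _).isInducing.tendsto_nhds_iff, tendsto_pi_nhds]
  have : ∀ j : Fin (k + 1), Tendsto (fun i => jet (Ξ i) j) l (𝓝 (jet ξ j)) ↔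
      Tendsto (fun i => eLpNorm (deriv^[j] (Ξ i) - deriv^[j] ξ) 2
      (volume.restrict (Ioc (0 : ℝ) 1))) l (𝓝 0) := by
    intro j
    simp only [jet_apply]
    exact Lp.tendsto_Lp_iff_tendsto_eLpNorm'' _ (fun i => (Ξ i).memLp_iterate_deriv (by omega)) _
      (ξ.memLp_iterate_deriv (by omega))
  constructor
  · intro h j hj
    exact (this ⟨j, by omega⟩).1 (h ⟨j, by omega⟩)
  · intro h j
    exact (this j).2 (h j (by omega))

/-- Convergence in `W^{k,2}` in terms of the underlying functions. -/
theorem tendsto_iff {Ξ : ι → SobolevSection A k} {ξ : SobolevSection A k} :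
    Tendsto Ξ l (𝓝 ξ) ↔ STendsto k l univ (fun i => Ξ i) ξ := by
  rw [tendsto_iff_eLpNorm]
  constructor
  · intro h
    refine STendsto.of_l2Conv (fun i => (Ξ i).sobolevOn) ξ.sobolevOn fun j hj K _ hK => ?_
    exact tendsto_eLpNorm_of_equivariant A (H := fun i => deriv^[j] (Ξ i) - deriv^[j] ξ)
      (fun i t => by
        simp only [Pi.sub_apply, map_sub]
        rw [iterate_deriv_equivariant A (Ξ i).equivariant, iterate_deriv_equivariant A ξ.equivariant])
      (h j hj) hK
  · intro h j hj
    exact tendsto_of_tendsto_of_tendsto_of_le_of_le tendsto_const_nhds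
      (h.l2Conv hj (Icc 0 1) (subset_univ _) isCompact_Icc) (fun _ => zero_le)
      fun i => eLpNorm_mono_measure _ (Measure.restrict_mono Ioc_subset_Icc_self le_rfl)

/-- Evaluation at `t`. -/
def eval (t : ℝ) : SobolevSection A (k + 1) →L[ℝ] EuclideanSpace ℝ (Fin n) where
  toFun ξ := ξ t
  map_add' _ _ := rfl
  map_smul' _ _ := rfl
  cont := continuous_iff_continuousAt.2 fun ξ =>
    ((tendsto_iff (l := 𝓝 ξ) (Ξ := id)).1 tendsto_id).cconv.tendsto (mem_univ t)

/-- It suffices that every derivative converges in `L²` over one period. The limit is again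
equivariant, since convergence is pointwise. Completeness and compactness of the inclusions both
follow from this criterion. -/
theorem exists_tendsto [l.NeBot] {Ξ : ι → SobolevSection A (k + 1)}
    {g : ℕ → ℝ → EuclideanSpace ℝ (Fin n)}
    (hg : ∀ j ≤ k + 1, MemLp (g j) 2 (volume.restrict (Ioc (0 : ℝ) 1)))
    (h : ∀ j ≤ k + 1, Tendsto (fun i => eLpNorm (deriv^[j] (Ξ i) - g j) 2
      (volume.restrict (Ioc (0 : ℝ) 1))) l (𝓝 0)) : ∃ ξ, Tendsto Ξ l (𝓝 ξ) := by
  choose H hH hHg using fun j => exists_equivariant_extension A (g j)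
  have e : ∀ j, H j =ᵐ[volume.restrict (Ioc (0 : ℝ) 1)] g j := fun j =>
    (ae_restrict_mem measurableSet_Ioc).mono fun t ht => hHg j ht
  obtain ⟨f, hf⟩ := exists_limit_of_l2Conv (l := l) (fun i => (Ξ i).sobolevOn) (H := H)
    (fun j hj => isL2Loc_of_equivariant A (hH j) ((hg j hj).ae_eq (e j).symm))
    (fun j hj K _ hK => tendsto_eLpNorm_of_equivariant A
      (H := fun i => deriv^[j] (Ξ i) - H j) (fun i t => by
        simp only [Pi.sub_apply, map_sub]
        rw [iterate_deriv_equivariant A (Ξ i).equivariant, hH])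
      ((h j hj).congr fun i => eLpNorm_congr_ae (EventuallyEq.rfl.sub (e j).symm)) hK)
  refine ⟨ofSobolevOn f (continuousOn_univ.1 (hf.lim.continuousOn isOpen_univ)) (fun t => ?_)
    hf.lim, tendsto_iff.2 hf⟩
  refine tendsto_nhds_unique (hf.cconv.tendsto (mem_univ (t + 1))) ?_
  have := (A.continuous.tendsto _).comp (hf.cconv.tendsto (mem_univ t))
  exact this.congr fun i => ((Ξ i).equivariant t).symm

instance : CompleteSpace (SobolevSection A (k + 1)) := by
  refine Metric.complete_of_cauchySeq_tendsto fun Ξ hΞ => ?_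
  have h1 : CauchySeq (fun i => jet (Ξ i)) := hΞ.map isometry_jet.uniformContinuous
  obtain ⟨y, hy⟩ := cauchySeq_tendsto_of_complete h1
  have hy' := tendsto_pi_nhds.1 (((PiLp.homeomorph 2 _).continuous.tendsto y).comp hy)
  refine exists_tendsto (g := fun j => if h : j < k + 2 then y ⟨j, h⟩ else 0) (fun j hj => ?_)
    (fun j hj => ?_)
  · rw [dif_pos (show j < k + 2 by omega)]
    exact Lp.memLp _
  · rw [dif_pos (show j < k + 2 by omega)]
    have h2 : Tendsto (fun i => jet (Ξ i) ⟨j, by omega⟩) atTop (𝓝 (y ⟨j, by omega⟩)) :=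
      hy' ⟨j, by omega⟩
    rw [Lp.tendsto_Lp_iff_tendsto_eLpNorm'] at h2
    refine h2.congr fun i => eLpNorm_congr_ae (EventuallyEq.sub ?_ EventuallyEq.rfl)
    rw [jet_apply]
    exact MemLp.coeFn_toLp _

/-- The Arzelà-Ascoli argument along an ultrafilter. The derivatives of order `j ≤ k` are uniformly
bounded and uniformly Hölder continuous with exponent `1/2`. Pointwise limits exist in a closed ball
of the finite dimensional space, and equicontinuity upgrades pointwise to locally uniform
convergence. -/
theorem exists_l2_limit (U : Ultrafilter ι) {Ξ : ι → SobolevSection A (k + 1)}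
    (hΞ : ∀ i, ‖Ξ i‖ ≤ 1) {j : ℕ} (hj : j ≤ k) :
    ∃ g : ℝ → EuclideanSpace ℝ (Fin n), MemLp g 2 (volume.restrict (Ioc (0 : ℝ) 1)) ∧
      Tendsto (fun i => eLpNorm (deriv^[j] (Ξ i) - g) 2 (volume.restrict (Ioc (0 : ℝ) 1)))
        U (𝓝 0) := by
  have hprim : ∀ i, IsPrimOn univ (deriv^[j] (Ξ i)) (deriv^[j + 1] (Ξ i)) ∧
      IsL2Loc univ (deriv^[j + 1] (Ξ i)) := by
    intro i
    have h := ((Ξ i).sobolevOn.of_le isOpen_univ (show 1 + j ≤ k + 1 by omega)).iterate_deriv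
    rw [Function.iterate_succ_apply']
    exact h
  have hd1 : ∀ i, (eLpNorm (deriv^[j + 1] (Ξ i)) 2 (volume.restrict (Ioc (0 : ℝ) 1))).toReal ≤ 1 :=
    fun i => ((Ξ i).eLpNorm_iterate_deriv_le (by omega)).trans (hΞ i)
  have hd0 : ∀ i, (eLpNorm (deriv^[j] (Ξ i)) 2 (volume.restrict (Ioc (0 : ℝ) 1))).toReal ≤ 1 :=
    fun i => ((Ξ i).eLpNorm_iterate_deriv_le (by omega)).trans (hΞ i)
  -- Clamping to `[0, 1]` makes the estimates, which are known on one period, valid on the whole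
  -- line.
  let P : ℝ → ℝ := fun t => projIcc (0 : ℝ) 1 zero_le_one t
  have hP : ∀ t, P t ∈ Icc (0 : ℝ) 1 := fun t => (projIcc (0 : ℝ) 1 zero_le_one t).2
  let F : ι → ℝ → EuclideanSpace ℝ (Fin n) := fun i t => (deriv^[j] (Ξ i)) (P t)
  have hF : ∀ i s t, ‖F i s - F i t‖ ≤ √|s - t| := by
    intro i s t
    refine ((hprim i).1.norm_sub_le_sqrt (hprim i).2 (hP t) (hP s)).trans ?_
    calc _ ≤ √|P s - P t| * 1 := by gcongr; exact hd1 i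
      _ ≤ √|s - t| := by
        rw [mul_one]; exact Real.sqrt_le_sqrt (abs_projIcc_sub_projIcc zero_le_one)
  have hlim : ∀ t, ∃ y, Tendsto (fun i => F i t) U (𝓝 y) := by
    intro t
    obtain ⟨y, -, hy⟩ := (isCompact_closedBall (0 : EuclideanSpace ℝ (Fin n)) 2).ultrafilter_le_nhds'
      (U.map fun i => F i t) (by
        refine Ultrafilter.mem_map.2 (univ_mem' fun i => ?_)
        simp only [mem_preimage, mem_closedBall_zero_iff]
        refine ((hprim i).1.norm_le_of_period (hprim i).2 (hP t)).trans ?_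
        linarith [hd0 i, hd1 i])
    exact ⟨y, hy⟩
  choose g hg using hlim
  have hgc : Continuous g := by
    have hgs : ∀ s t, ‖g s - g t‖ ≤ √|s - t| := fun s t =>
      le_of_tendsto ((hg s).sub (hg t)).norm (Eventually.of_forall fun i => hF i s t)
    refine continuous_iff_continuousAt.2 fun t => tendsto_iff_norm_sub_tendsto_zero.2 ?_
    refine squeeze_zero (fun _ => norm_nonneg _) (fun s => hgs s t) ?_
    have : Continuous fun s : ℝ => √|s - t| := by fun_prop
    simpa using this.tendsto t
  have hcc : CConv (U : Filter ι) univ F g := by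
    intro t _
    have h1 : Tendsto (fun p : ι × ℝ => √|p.2 - t|) ((U : Filter ι) ×ˢ 𝓝 t) (𝓝 0) := by
      have : Continuous fun s : ℝ => √|s - t| := by fun_prop
      have := (this.tendsto t).comp (tendsto_snd (f := (U : Filter ι)))
      simpa [Function.comp_def] using this
    have h2 : Tendsto (fun p : ι × ℝ => F p.1 p.2 - F p.1 t) ((U : Filter ι) ×ˢ 𝓝 t) (𝓝 0) :=
      squeeze_zero_norm (fun p => hF p.1 p.2 t) h1
    simpa using h2.add ((hg t).comp tendsto_fst)
  refine ⟨g, (hgc.continuousOn.isL2Loc (Icc 0 1) (subset_univ _) isCompact_Icc).mono_measure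
    (Measure.restrict_mono Ioc_subset_Icc_self le_rfl), ?_⟩
  have h3 := hcc.l2Conv hgc.continuousOn (Icc 0 1) (subset_univ _) isCompact_Icc
  refine tendsto_of_tendsto_of_tendsto_of_le_of_le tendsto_const_nhds h3 (fun _ => zero_le)
    fun i => ?_
  refine le_trans (le_of_eq (eLpNorm_congr_ae ?_))
    (eLpNorm_mono_measure _ (Measure.restrict_mono Ioc_subset_Icc_self le_rfl))
  filter_upwards [ae_restrict_mem measurableSet_Ioc] with t ht
  simp only [Pi.sub_apply, F, P, projIcc_of_mem zero_le_one (Ioc_subset_Icc_self ht)]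

theorem exists_tendsto_incl (T : Ultrafilter ι) {Ξ : ι → SobolevSection A (k + 1 + 1)}
    (hΞ : ∀ i, ‖Ξ i‖ ≤ 1) : ∃ ξ, Tendsto (fun i => incl A (k + 1) (Ξ i)) T (𝓝 ξ) := by
  have : ∀ j, ∃ g : ℝ → EuclideanSpace ℝ (Fin n), j ≤ k + 1 →
      MemLp g 2 (volume.restrict (Ioc (0 : ℝ) 1)) ∧
      Tendsto (fun i => eLpNorm (deriv^[j] (Ξ i) - g) 2
          (volume.restrict (Ioc (0 : ℝ) 1))) T (𝓝 0) := by
    intro j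
    by_cases hj : j ≤ k + 1
    · obtain ⟨g, hg⟩ := exists_l2_limit T hΞ hj
      exact ⟨g, fun _ => hg⟩
    · exact ⟨0, fun h => absurd h hj⟩
  choose g hg using this
  exact exists_tendsto (g := g) (fun j hj => (hg j hj).1) (fun j hj => (hg j hj).2)

/-- An ultrafilter on the image of the ball is the push-forward of an ultrafilter on the ball, so by
hypothesis it converges and is Cauchy. The image is therefore totally bounded, and its closure is
compact in the complete space `F`. -/
theorem isCompactOperator_of_ultrafilter {E F : Type*} [NormedAddCommGroup E] [NormedSpace ℝ E]
    [NormedAddCommGroup F] [NormedSpace ℝ F] [CompleteSpace F] (L : E →L[ℝ] F)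
    (h : ∀ T : Ultrafilter (Metric.closedBall (0 : E) 1), ∃ y,
      Tendsto (fun x : Metric.closedBall (0 : E) 1 => L x) T (𝓝 y)) :
    IsCompactOperator L := by
  refine (isCompactOperator_iff_isCompact_closure_image_closedBall (σ₁₂ := RingHom.id ℝ)
    L.toLinearMap one_pos).2 ((TotallyBounded.closure ?_).isCompact_of_isClosed isClosed_closure)
  rw [totallyBounded_iff_ultrafilter]
  intro U hU
  have hmem : L '' Metric.closedBall 0 1 ∈ U := hU (mem_principal_self _)
  have hne : NeBot (comap (fun x : Metric.closedBall (0 : E) 1 => L x) U) := by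
    refine comap_neBot_iff.2 fun s hs => ?_
    obtain ⟨_, hy, x, hx, rfl⟩ := U.nonempty_of_mem (inter_mem hs hmem)
    exact ⟨⟨x, hx⟩, hy⟩
  obtain ⟨T, hT⟩ := Ultrafilter.exists_le (comap (fun x : Metric.closedBall (0 : E) 1 => L x) U)
  obtain ⟨y, hy⟩ := h T
  have hTU : T.map (fun x : Metric.closedBall (0 : E) 1 => L x) = U :=
    Ultrafilter.coe_le_coe.1 (tendsto_iff_comap.2 hT)
  rw [← hTU]
  exact Filter.Tendsto.cauchy_map hy

theorem isCompactOperator_incl : IsCompactOperator (incl A (k + 1)) :=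
  isCompactOperator_of_ultrafilter _ fun T =>
    exists_tendsto_incl T fun x => mem_closedBall_zero_iff.1 x.2

/-- The translate `t ↦ ξ (t + s)`. -/
def shift (s : ℝ) (ξ : SobolevSection A (k + 2)) : SobolevSection A (k + 2) :=
  ofSobolevOn (fun t => ξ (t + s)) (ξ.property.1.comp (by fun_prop))
    (fun t => by rw [show t + 1 + s = t + s + 1 by ring, ξ.equivariant])
    (ξ.sobolevOn.comp_add_const s).lim

theorem continuous_shift (ξ : SobolevSection A (k + 2)) : Continuous fun s => shift s ξ :=
  continuous_iff_continuousAt.2 fun s => tendsto_iff.2 (ξ.sobolevOn.comp_add_const s)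

/-- Mollification. The translates `s ↦ shift s ξ` form a continuous curve in `W^{k+2,2}`, so its
averages against bump functions shrinking to `0` converge to `ξ` in norm. Evaluation at a point
commutes with the Bochner integral, which identifies these averages with ordinary convolutions and
shows that they are smooth. -/
theorem dense_contDiff :
    Dense {ξ : SobolevSection A (k + 2) | ContDiff ℝ ∞ (ξ : ℝ → EuclideanSpace ℝ (Fin n))} := by
  intro ξ
  let φ : ℕ → ContDiffBump (0 : ℝ) := fun i => ⟨1 / (i + 2), 1 / (i + 1), by positivity,
    one_div_lt_one_div_of_lt (by positivity) (by linarith)⟩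
  have hφ : Tendsto (fun i => (φ i).rOut) atTop (𝓝 0) := tendsto_one_div_add_atTop_nhds_zero_nat
  have h := ContDiffBump.convolution_tendsto_right_of_continuous (μ := volume) hφ
    (continuous_shift ξ) 0
  have h0 : shift 0 ξ = ξ := by ext t; simp [shift]
  rw [h0] at h
  refine mem_closure_of_tendsto h (Eventually.of_forall fun i => ?_)
  have hint : Integrable (fun s => (φ i).normed volume s • shift (0 - s) ξ) :=
    (((φ i).continuous_normed).smul ((continuous_shift ξ).comp (by fun_prop))
      ).integrable_of_hasCompactSupport ((φ i).hasCompactSupport_normed.smul_right)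
  have e : (((MeasureTheory.convolution ((φ i).normed volume) (fun s => shift s ξ)
      (ContinuousLinearMap.lsmul ℝ ℝ) volume) 0 : SobolevSection A (k + 2)) :
        ℝ → EuclideanSpace ℝ (Fin n)) = MeasureTheory.convolution ((φ i).normed volume) ξ
      (ContinuousLinearMap.lsmul ℝ ℝ) volume := by
    funext t
    change eval t _ = _
    rw [convolution_def, convolution_def]
    simp only [ContinuousLinearMap.lsmul_apply]
    rw [← ContinuousLinearMap.integral_comp_comm _ hint]
    congr 1; ext1 s
    rw [map_smul]
    change _ • ξ (t + (0 - s)) = _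
    rw [zero_sub, ← sub_eq_add_neg]
  change ContDiff ℝ ∞ _
  rw [e]
  exact (φ i).hasCompactSupport_normed.contDiff_convolution_left _ (φ i).contDiff_normed
    ξ.property.1.locallyIntegrable

end SobolevSection

/-! ### The sc-Banach scale of Sobolev sections -/

section SobolevScale

variable {n : ℕ} {A : EuclideanSpace ℝ (Fin n) ≃L[ℝ] EuclideanSpace ℝ (Fin n)}

theorem sobolevScale_toBase_apply (m : ℕ) (ξ : (sobolevScale A).X m) (t : ℝ) :
    SobolevSection.toFun ((sobolevScale A).toBase m ξ : SobolevSection A 2) t =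
      SobolevSection.toFun (ξ : SobolevSection A (m + 2)) t := by
  induction m with
  | zero => rfl
  | succ m ih => exact ih _

theorem mem_range_toBase_iff {m : ℕ} {ξ : SobolevSection A 2} :
    ξ ∈ range ((sobolevScale A).toBase m) ↔ SobolevOn (m + 2) univ ξ := by
  constructor
  · rintro ⟨ζ, rfl⟩
    exact (SobolevSection.sobolevOn (ζ : SobolevSection A (m + 2))).congr isOpen_univ
      fun t _ => (sobolevScale_toBase_apply m ζ t).symm
  · intro h
    refine ⟨SobolevSection.ofSobolevOn ξ ξ.property.1 ξ.equivariant h, ?_⟩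
    exact SobolevSection.ext fun t => sobolevScale_toBase_apply m _ t

theorem isScBanach_sobolevScale : (sobolevScale A).IsScBanach where
  complete m := inferInstanceAs (CompleteSpace (SobolevSection A (m + 1 + 1)))
  injective m ξ ζ h := by
    refine SobolevSection.ext fun t => ?_
    exact congrArg (fun x : SobolevSection A (m + 2) => x t) h
  compact m := SobolevSection.isCompactOperator_incl (k := m + 1)
  dense m := by
    refine SobolevSection.dense_contDiff.mono fun ξ hξ k => ?_
    refine (mem_range_toBase_iff (ξ := (sobolevScale A).toBase m ξ)).2 ?_
    refine (hξ.sobolevOn isOpen_univ).congr isOpen_univ fun t _ => ?_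
    exact (sobolevScale_toBase_apply m ξ t).symm

end SobolevScale

/-! ### Scales: shifts, maps, tangents -/

namespace ScScale

/-- The scale `E¹` with levels `E_{m+1}`. -/
noncomputable abbrev shift (E : ScScale) : ScScale where
  X m := E.X (m + 1)
  incl m := E.incl (m + 1)

theorem toBase_succ (E : ScScale) (m : ℕ) (x : E.X (m + 1)) :
    E.toBase (m + 1) x = E.toBase m (E.incl m x) := rfl

theorem incl_toBase_shift (E : ScScale) (m : ℕ) (x : E.X (m + 1)) :
    E.incl 0 (E.shift.toBase m x) = E.toBase (m + 1) x := by
  induction m with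
  | zero => rfl
  | succ m ih => exact ih _

theorem tangent_toBase (E : ScScale) (m : ℕ) (p : E.X (m + 1) × E.X m) :
    E.tangent.toBase m p = (E.shift.toBase m p.1, E.toBase m p.2) := by
  induction m with
  | zero => rfl
  | succ m ih => exact ih _

/-- A level preserving bounded linear map of scales. -/
structure Map (E F : ScScale) where
  map : ∀ m, E.X m →L[ℝ] F.X m
  comm : ∀ m x, map m (E.incl m x) = F.incl m (map (m + 1) x)

theorem Map.toBase_map {E F : ScScale} (φ : Map E F) (m : ℕ) (x : E.X m) :
    F.toBase m (φ.map m x) = φ.map 0 (E.toBase m x) := by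
  induction m with
  | zero => rfl
  | succ m ih => rw [toBase_succ, toBase_succ, ← φ.comm, ih]

/-- The tangent map of a map of scales. -/
noncomputable def Map.tangent {E F : ScScale} (φ : Map E F) : Map E.tangent F.tangent where
  map m := (φ.map (m + 1)).prodMap (φ.map m)
  comm m x := Prod.ext (φ.comm _ _) (φ.comm _ _)

noncomputable def fst (E F : ScScale) : Map (E.prod F) E where
  map m := ContinuousLinearMap.fst ℝ _ _
  comm m x := rfl

noncomputable def snd (E F : ScScale) : Map (E.prod F) F where
  map m := ContinuousLinearMap.snd ℝ _ _
  comm m x := rfl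

/-- The fibre coordinate `(x, h) ↦ h` of the tangent scale. -/
noncomputable def tangentSnd (E : ScScale) : Map E.tangent E where
  map m := ContinuousLinearMap.snd ℝ _ _
  comm m x := rfl

/-- The base coordinate `(x, h) ↦ x ∈ E¹` of the tangent scale. -/
noncomputable def tangentFst (E : ScScale) : Map E.tangent E.shift where
  map m := ContinuousLinearMap.fst ℝ _ _
  comm m x := rfl

/-- The projection `TE → E`, `(x, h) ↦ x`. -/
noncomputable def tangentProj (E : ScScale) : Map E.tangent E where
  map m := (E.incl m).comp (ContinuousLinearMap.fst ℝ _ _)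
  comm m x := rfl

/-- The inclusions of the scale are injective, compact and have dense range. -/
structure IsRegular (E : ScScale) : Prop where
  injective : ∀ m, Function.Injective (E.incl m)
  compact : ∀ m, IsCompactOperator (E.incl m)
  denseRange : ∀ m, DenseRange (E.incl m)

theorem IsRegular.toBase_injective {E : ScScale} (h : E.IsRegular) (m : ℕ) :
    Function.Injective (E.toBase m) := by
  induction m with
  | zero => exact Function.injective_id
  | succ m ih => exact ih.comp (h.injective m)

theorem IsScBanach.toBase_injective {E : ScScale} (h : E.IsScBanach) (m : ℕ) :
    Function.Injective (E.toBase m) := by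
  induction m with
  | zero => exact Function.injective_id
  | succ m ih => exact ih.comp (h.injective m)

/-- Only density of `E_{m+1}` in `E_m` is kept from the density of `E_∞`. In this form the
conditions pass directly to products and tangents, as the induction on the order of
differentiability requires. -/
theorem IsScBanach.isRegular {E : ScScale} (h : E.IsScBanach) : E.IsRegular where
  injective := h.injective
  compact := h.compact
  denseRange m := (h.dense m).mono fun x hx => by
    obtain ⟨y, hy⟩ := hx (m + 1)
    exact ⟨y, h.toBase_injective m hy⟩

theorem _root_.IsCompactOperator.prodMap' {E₁ E₂ F₁ F₂ : Type*} [NormedAddCommGroup E₁]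
    [NormedSpace ℝ E₁] [NormedAddCommGroup E₂] [NormedSpace ℝ E₂] [NormedAddCommGroup F₁]
    [NormedSpace ℝ F₁] [NormedAddCommGroup F₂] [NormedSpace ℝ F₂] {f : E₁ →L[ℝ] F₁}
    {g : E₂ →L[ℝ] F₂} (hf : IsCompactOperator f) (hg : IsCompactOperator g) :
    IsCompactOperator (f.prodMap g) := by
  obtain ⟨K, hK, hfK⟩ := hf
  obtain ⟨L, hL, hgL⟩ := hg
  exact ⟨K ×ˢ L, hK.prod hL, prod_mem_nhds hfK hgL⟩

theorem IsRegular.prod {E F : ScScale} (hE : E.IsRegular) (hF : F.IsRegular) :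
    (E.prod F).IsRegular where
  injective m := (hE.injective m).prodMap (hF.injective m)
  compact m := (hE.compact m).prodMap' (hF.compact m)
  denseRange m := (hE.denseRange m).prodMap (hF.denseRange m)

theorem IsRegular.tangent {E : ScScale} (hE : E.IsRegular) : E.tangent.IsRegular where
  injective m := (hE.injective (m + 1)).prodMap (hE.injective m)
  compact m := (hE.compact (m + 1)).prodMap' (hE.compact m)
  denseRange m := (hE.denseRange (m + 1)).prodMap (hE.denseRange m)

theorem isOpen_tangentSet (E : ScScale) {U : Set (E.X 0)} (hU : IsOpen U) :
    IsOpen (E.tangentSet U) :=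
  hU.preimage ((E.incl 0).continuous.comp continuous_fst)

end ScScale

/-! ### sc-calculus for families of functions -/

section SobCalculus

variable {V W Z : Type*} [NormedAddCommGroup V] [NormedSpace ℝ V] [NormedAddCommGroup W]
  [NormedSpace ℝ W] [NormedAddCommGroup Z] [NormedSpace ℝ Z] {k k₀ : ℕ} {E F : ScScale}

/-- On the `m`-th level, `x ↦ P x` is continuous with values in `W^{m+k₀,2}_loc`. -/
def SobC0 (E : ScScale) (U : Set (E.X 0)) (k₀ : ℕ) (P : E.X 0 → ℝ → V) : Prop :=
  ∀ m (x : {x : E.X m // E.toBase m x ∈ U}), STendsto (m + k₀) (𝓝 x) univ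
    (fun y : {y : E.X m // E.toBase m y ∈ U} => P (E.toBase m y)) (P (E.toBase m x))

/-- `δ (x, h)` is the derivative of `P` at `x` in the direction `h`, evaluated pointwise. -/
structure IsSobDeriv (E : ScScale) (U : Set (E.X 0)) (P : E.X 0 → ℝ → V)
    (δ : E.tangent.X 0 → ℝ → V) : Prop where
  hasDerivAt : ∀ x h : E.X 1, E.incl 0 x ∈ U → ∀ t,
    HasDerivAt (fun s : ℝ => P (E.incl 0 (x + s • h)) t) (δ (x, E.incl 0 h) t) 0
  map_add : ∀ x : E.X 1, E.incl 0 x ∈ U → ∀ (h h' : E.X 0) t,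
    δ (x, h + h') t = δ (x, h) t + δ (x, h') t
  map_smul : ∀ x : E.X 1, E.incl 0 x ∈ U → ∀ (c : ℝ) (h : E.X 0) t,
    δ (x, c • h) t = c • δ (x, h) t

/-- `P` is `k` times sc-differentiable as a family of functions of class `W^{k₀,2}_loc`. -/
def SobC : ℕ → (E : ScScale) → Set (E.X 0) → ℕ → (E.X 0 → ℝ → V) → Prop
  | 0, E, U, k₀, P => SobC0 E U k₀ P
  | k + 1, E, U, k₀, P => SobC0 E U k₀ P ∧ ∃ δ : E.tangent.X 0 → ℝ → V,
      IsSobDeriv E U P δ ∧ SobC k E.tangent (E.tangentSet U) k₀ δ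

theorem SobC.sobC0 {U : Set (E.X 0)} {P : E.X 0 → ℝ → V} (h : SobC k E U k₀ P) :
    SobC0 E U k₀ P := by
  cases k with
  | zero => exact h
  | succ k => exact h.1

theorem SobC.of_succ {U : Set (E.X 0)} {P : E.X 0 → ℝ → V} (h : SobC (k + 1) E U k₀ P) :
    SobC k E U k₀ P := by
  induction k generalizing E with
  | zero => exact h.1
  | succ k ih =>
    obtain ⟨h0, δ, hδ, h1⟩ := h
    exact ⟨h0, δ, hδ, ih h1⟩

theorem SobC0.comp_map {U : Set (E.X 0)} {P : E.X 0 → ℝ → V} (h : SobC0 E U k₀ P)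
    (φ : F.Map E) {U' : Set (F.X 0)} (hU' : ∀ x ∈ U', φ.map 0 x ∈ U) :
    SobC0 F U' k₀ (fun x => P (φ.map 0 x)) := by
  intro m x
  let u : {x : F.X m // F.toBase m x ∈ U'} → {x : E.X m // E.toBase m x ∈ U} := fun y =>
    ⟨φ.map m y, by rw [φ.toBase_map]; exact hU' _ y.2⟩
  have hu : Continuous u := ((φ.map m).continuous.comp continuous_subtype_val).subtype_mk _
  have := (h m (u x)).comp_tendsto (hu.tendsto x)
  simpa only [u, φ.toBase_map] using this

theorem SobC.comp_map {U : Set (E.X 0)} {P : E.X 0 → ℝ → V} (h : SobC k E U k₀ P)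
    (φ : F.Map E) {U' : Set (F.X 0)} (hU' : ∀ x ∈ U', φ.map 0 x ∈ U) :
    SobC k F U' k₀ (fun x => P (φ.map 0 x)) := by
  induction k generalizing E F with
  | zero => exact SobC0.comp_map h φ hU'
  | succ k ih =>
    obtain ⟨h0, δ, hδ, h1⟩ := h
    have hmem : ∀ x : F.X 1, F.incl 0 x ∈ U' → E.incl 0 (φ.map 1 x) ∈ U := fun x hx => by
      rw [← φ.comm]; exact hU' _ hx
    refine ⟨h0.comp_map φ hU', fun p => δ (φ.map 1 p.1, φ.map 0 p.2), ⟨?_, ?_, ?_⟩,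
      ih h1 φ.tangent fun p hp => hmem _ hp⟩
    · intro x h hx t
      have := hδ.hasDerivAt (φ.map 1 x) (φ.map 1 h) (hmem x hx) t
      simpa only [φ.comm, map_add, map_smul] using this
    · intro x hx h h' t
      simp only [map_add]
      exact hδ.map_add _ (hmem x hx) _ _ _
    · intro x hx c h t
      simp only [map_smul]
      exact hδ.map_smul _ (hmem x hx) _ _ _

theorem SobC.mono {U U' : Set (E.X 0)} {P : E.X 0 → ℝ → V} (h : SobC k E U k₀ P) (hU' : U' ⊆ U) :
    SobC k E U' k₀ P :=
  h.comp_map (⟨fun m => ContinuousLinearMap.id ℝ _, fun _ _ => rfl⟩ : E.Map E) hU'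

theorem SobC0.shift {U : Set (E.X 0)} {P : E.X 0 → ℝ → V} (h : SobC0 E U k₀ P) :
    SobC0 E.shift (E.incl 0 ⁻¹' U) (k₀ + 1) (fun x => P (E.incl 0 x)) := by
  intro m x
  let u : {x : E.X (m + 1) // E.shift.toBase m x ∈ E.incl 0 ⁻¹' U} →
      {x : E.X (m + 1) // E.toBase (m + 1) x ∈ U} := fun y =>
    ⟨y, by rw [← E.incl_toBase_shift]; exact y.2⟩
  have hu : Continuous u := continuous_subtype_val.subtype_mk _
  have := (h (m + 1) (u x)).comp_tendsto (hu.tendsto x)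
  rw [show m + 1 + k₀ = m + (k₀ + 1) by ring] at this
  simpa only [u, ← E.incl_toBase_shift] using this

/-- One level up, the functions have one more derivative. This supplies the extra order of the base
component of a tangent map. -/
theorem SobC.shift {U : Set (E.X 0)} {P : E.X 0 → ℝ → V} (h : SobC k E U k₀ P) :
    SobC k E.shift (E.incl 0 ⁻¹' U) (k₀ + 1) (fun x => P (E.incl 0 x)) := by
  induction k generalizing E with
  | zero => exact SobC0.shift h
  | succ k ih =>
    obtain ⟨h0, δ, hδ, h1⟩ := h
    refine ⟨h0.shift, fun p => δ (E.incl 1 p.1, E.incl 0 p.2), ⟨?_, ?_, ?_⟩, ih h1⟩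
    · intro x h hx t
      have := hδ.hasDerivAt (E.incl 1 x) (E.incl 1 h) hx t
      simpa only [map_add, map_smul] using this
    · intro x hx h h' t
      simp only [map_add]
      exact hδ.map_add _ hx _ _ _
    · intro x hx c h t
      simp only [map_smul]
      exact hδ.map_smul _ hx _ _ _

theorem SobC.tangentProj {U : Set (E.X 0)} {P : E.X 0 → ℝ → V} (h : SobC k E U k₀ P) :
    SobC k E.tangent (E.tangentSet U) k₀ (fun p => P (E.incl 0 p.1)) :=
  h.comp_map E.tangentProj fun p hp => hp

theorem SobC.prodMk [CompleteSpace V] [CompleteSpace W] {U : Set (E.X 0)} {P : E.X 0 → ℝ → V}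
    {Q : E.X 0 → ℝ → W} (hP : SobC k E U k₀ P) (hQ : SobC k E U k₀ Q) :
    SobC k E U k₀ (fun x t => (P x t, Q x t)) := by
  induction k generalizing E with
  | zero => exact fun m x => (hP m x).prodMk isOpen_univ (hQ m x)
  | succ k ih =>
    obtain ⟨h0, δ, hδ, h1⟩ := hP
    obtain ⟨h0', δ', hδ', h1'⟩ := hQ
    refine ⟨fun m x => (h0 m x).prodMk isOpen_univ (h0' m x), fun p t => (δ p t, δ' p t),
      ⟨fun x h hx t => (hδ.hasDerivAt x h hx t).prodMk (hδ'.hasDerivAt x h hx t),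
        fun x hx h h' t => Prod.ext (hδ.map_add x hx h h' t) (hδ'.map_add x hx h h' t),
        fun x hx c h t => Prod.ext (hδ.map_smul x hx c h t) (hδ'.map_smul x hx c h t)⟩,
      ih h1 h1'⟩

theorem SobC.const [CompleteSpace V] {U : Set (E.X 0)} {f : ℝ → V} (hf : ContDiff ℝ ∞ f) :
    SobC k E U k₀ (fun _ => f) := by
  induction k generalizing E f with
  | zero => exact fun m x => (hf.sobolevOn isOpen_univ).sTendsto isOpen_univ _
  | succ k ih =>
    refine ⟨fun m x => (hf.sobolevOn isOpen_univ).sTendsto isOpen_univ _, fun p t => 0,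
      ⟨fun x h hx t => hasDerivAt_const _ _, fun _ _ _ _ _ => (add_zero _).symm,
        fun _ _ _ _ _ => (smul_zero _).symm⟩, ih contDiff_const⟩

/-- The directional derivative is `DG(P) δ`, again a superposition, of `(z, w) ↦ DG(z) w` on `Ω × Z`
with the family `(P, δ)` over the tangent scale. The induction therefore runs over all `G`, target
spaces and scales at once. -/
theorem SobC.superpose [CompleteSpace W] [CompleteSpace Z] {U : Set (E.X 0)} {Ω : Set Z}
    (hΩ : IsOpen Ω) {G : Z → W} (hG : ContDiffOn ℝ ∞ G Ω) {P : E.X 0 → ℝ → Z}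
    (hP : SobC k E U (k₀ + 1) P) (hPΩ : ∀ x ∈ U, ∀ t, P x t ∈ Ω) :
    SobC k E U (k₀ + 1) (fun x t => G (P x t)) := by
  have h0 : ∀ {E : ScScale} {U : Set (E.X 0)} {P : E.X 0 → ℝ → Z}, SobC0 E U (k₀ + 1) P →
      (∀ x ∈ U, ∀ t, P x t ∈ Ω) → SobC0 E U (k₀ + 1) (fun x t => G (P x t)) :=
    fun hP hPΩ m x => (hP m x).superpose (k := m + k₀) isOpen_univ hΩ hG
      (fun y t _ => hPΩ _ y.2 t) (fun t _ => hPΩ _ x.2 t)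
  induction k generalizing E Z W with
  | zero => exact h0 hP hPΩ
  | succ k ih =>
    obtain ⟨hP0, δ, hδ, h1⟩ := id hP
    refine ⟨h0 hP0 hPΩ, fun p t => fderiv ℝ G (P (E.incl 0 p.1) t) (δ p t), ⟨?_, ?_, ?_⟩, ?_⟩
    · intro x h hx t
      have hd : HasFDerivAt G (fderiv ℝ G (P (E.incl 0 x) t)) (P (E.incl 0 (x + (0 : ℝ) • h)) t) := by
        rw [zero_smul, add_zero]
        exact ((hG.contDiffAt (hΩ.mem_nhds (hPΩ _ hx t))).differentiableAt (by simp)).hasFDerivAt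
      exact hd.comp_hasDerivAt (0 : ℝ) (hδ.hasDerivAt x h hx t)
    · intro x hx h h' t
      simp only [hδ.map_add x hx, map_add]
    · intro x hx c h t
      simp only [hδ.map_smul x hx, map_smul]
    · have hG' : ContDiffOn ℝ ∞ (fun q : Z × Z => fderiv ℝ G q.1 q.2) (Ω ×ˢ univ) :=
        ((hG.fderiv_of_isOpen hΩ (m := ∞) (by simp)).comp contDiff_fst.contDiffOn
          (fun q hq => hq.1)).clm_apply contDiff_snd.contDiffOn
      exact ih (hΩ.prod isOpen_univ) hG' (hP.of_succ.tangentProj.prodMk h1)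
        (fun p hp t => ⟨hPΩ _ hp t, mem_univ _⟩)
        (fun hP hPΩ m x => (hP m x).superpose (k := m + k₀) isOpen_univ (hΩ.prod isOpen_univ) hG'
          (fun y t _ => hPΩ _ y.2 t) (fun t _ => hPΩ _ x.2 t))

/-- A linear map from a scale to functions which maps `E_m` continuously to `W^{m+k₀,2}_loc`. -/
structure SobLin (E : ScScale) (k₀ : ℕ) (σ : E.X 0 → ℝ → V) : Prop where
  sTendsto : ∀ m (x : E.X m), STendsto (m + k₀) (𝓝 x) univ (fun y => σ (E.toBase m y))
    (σ (E.toBase m x))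
  map_add : ∀ x y t, σ (x + y) t = σ x t + σ y t
  map_smul : ∀ (c : ℝ) x t, σ (c • x) t = c • σ x t

theorem SobLin.comp_map {σ : E.X 0 → ℝ → V} (h : SobLin E k₀ σ) (φ : F.Map E) :
    SobLin F k₀ (fun x => σ (φ.map 0 x)) where
  sTendsto m x := by
    have := (h.sTendsto m (φ.map m x)).comp_tendsto ((φ.map m).continuous.tendsto x)
    simpa only [φ.toBase_map] using this
  map_add x y t := by simp only [_root_.map_add, h.map_add]
  map_smul c x t := by simp only [_root_.map_smul, h.map_smul]

theorem SobLin.shift {σ : E.X 0 → ℝ → V} (h : SobLin E k₀ σ) :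
    SobLin E.shift (k₀ + 1) (fun x => σ (E.incl 0 x)) where
  sTendsto m x := by
    have := h.sTendsto (m + 1) x
    rw [show m + 1 + k₀ = m + (k₀ + 1) by ring] at this
    simpa only [← E.incl_toBase_shift] using this
  map_add x y t := by simp only [_root_.map_add, h.map_add]
  map_smul c x t := by simp only [_root_.map_smul, h.map_smul]

theorem SobLin.sobolevOn {σ : E.X 0 → ℝ → V} (h : SobLin E k₀ σ) (x : E.X 0) :
    SobolevOn k₀ univ (σ x) := by
  have := (h.sTendsto 0 x).lim
  rwa [zero_add] at this

/-- Order at least two makes every `σ x` differentiable at every point, not just almost everywhere.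
This is what makes the pointwise derivative linear in `x`. -/
theorem SobLin.derivs [CompleteSpace V] {σ : E.X 0 → ℝ → V} (h : SobLin E (k₀ + 2) σ) :
    SobLin E (k₀ + 1) (fun x => deriv (σ x)) where
  sTendsto m x := (h.sTendsto m x).derivs (k := m + (k₀ + 1))
  map_add x y t := by
    have e : σ (x + y) = σ x + σ y := funext fun t => h.map_add x y t
    rw [e]
    exact (((h.sobolevOn x).hasDerivAt isOpen_univ (mem_univ t)).add
      ((h.sobolevOn y).hasDerivAt isOpen_univ (mem_univ t))).deriv
  map_smul c x t := by
    have e : σ (c • x) = c • σ x := funext fun t => h.map_smul c x t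
    rw [e]
    exact (((h.sobolevOn x).hasDerivAt isOpen_univ (mem_univ t)).const_smul c).deriv

theorem SobLin.sobC0 {σ : E.X 0 → ℝ → V} (h : SobLin E k₀ σ) {U : Set (E.X 0)} :
    SobC0 E U k₀ σ := fun m x =>
  (h.sTendsto m x).comp_tendsto (continuous_subtype_val.tendsto x)

theorem SobLin.sobC {σ : E.X 0 → ℝ → V} (h : SobLin E k₀ σ) {U : Set (E.X 0)} :
    SobC k E U k₀ σ := by
  induction k generalizing E with
  | zero => exact h.sobC0
  | succ k ih =>
    refine ⟨h.sobC0, fun p => σ p.2, ⟨?_, fun x _ h₁ h₂ t => h.map_add _ _ _,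
      fun x _ c h₁ t => h.map_smul _ _ _⟩, ih (h.comp_map E.tangentSnd)⟩
    intro x y _ t
    simp only [_root_.map_add, _root_.map_smul, h.map_add, h.map_smul]
    simpa using ((hasDerivAt_id (0 : ℝ)).smul_const (σ (E.incl 0 y) t)).const_add (σ (E.incl 0 x) t)

/-- Composition of linear families with a family of immersions of the line. -/
theorem SobLin.sobC_comp [CompleteSpace V] {U : Set (E.X 0)} {σ : E.X 0 → ℝ → V}
    (hσ : SobLin E (k₀ + 2) σ) {Ψ : E.X 0 → ℝ → ℝ} (hΨ : SobC k E U (k₀ + 2) Ψ)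
    (h0 : ∀ x ∈ U, ∀ t, deriv (Ψ x) t ≠ 0) :
    SobC k E U (k₀ + 2) (fun x t => σ x (Ψ x t)) := by
  induction k generalizing E with
  | zero =>
    exact fun m x => (hσ.sobC0 m x).comp (hΨ m x) le_rfl (by omega) (fun y => h0 _ y.2)
      (h0 _ x.2)
  | succ k ih =>
    have hΨk := hΨ.of_succ
    obtain ⟨hΨ0, δ, hδ, h1⟩ := hΨ
    -- The crucial count of derivatives: `σ'` has one derivative less than `σ`, but the base point
    -- of a tangent vector lies in `E¹`, where `σ` has one more. Hence `σ'` is a linear family over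
    -- the tangent scale of the same order `k₀ + 2`.
    have hσ' : SobLin E.tangent (k₀ + 2) (fun p => deriv (σ (E.incl 0 p.1))) :=
      hσ.shift.derivs.comp_map E.tangentFst
    have hdσ : ∀ (x : E.X 1) u, HasDerivAt (σ (E.incl 0 x)) (deriv (σ (E.incl 0 x)) u) u :=
      fun x u => (hσ.sobolevOn _).hasDerivAt isOpen_univ (mem_univ u)
    refine ⟨fun m x => (hσ.sobC0 m x).comp (hΨ0 m x) le_rfl (by omega) (fun y => h0 _ y.2)
      (h0 _ x.2), fun p t => σ p.2 (Ψ (E.incl 0 p.1) t) +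
        δ p t • deriv (σ (E.incl 0 p.1)) (Ψ (E.incl 0 p.1) t), ⟨?_, ?_, ?_⟩, ?_⟩
    · intro x h hx t
      simp only [_root_.map_add, _root_.map_smul, hσ.map_add, hσ.map_smul]
      have d1 := hδ.hasDerivAt x h hx t
      simp only [_root_.map_add, _root_.map_smul] at d1
      have e0 : Ψ (E.incl 0 x + (0 : ℝ) • E.incl 0 h) t = Ψ (E.incl 0 x) t := by simp
      have d2 := HasDerivAt.scomp (0 : ℝ) (by rw [e0]; exact hdσ x _) d1
      have d3 := HasDerivAt.scomp (0 : ℝ) (by rw [e0]; exact hdσ h _) d1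
      have d4 := d2.add ((hasDerivAt_id (0 : ℝ)).smul d3)
      simp only [id, one_smul, zero_smul, zero_add, Function.comp_def, add_zero] at d4
      convert d4 using 1
      · rfl
      · exact add_comm (σ (E.incl 0 h) _) _
    · intro x hx h h' t
      simp only [hδ.map_add x hx, hσ.map_add, add_smul]
      abel
    · intro x hx c h t
      simp only [hδ.map_smul x hx, hσ.map_smul, smul_add, smul_assoc]
    · have a1 := ih (hσ.comp_map E.tangentSnd) hΨk.tangentProj (fun p hp => h0 _ hp)
      have a2 := ih hσ' hΨk.tangentProj (fun p hp => h0 _ hp)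
      exact (a1.prodMk (h1.prodMk a2)).superpose (k₀ := k₀ + 1) isOpen_univ
        (G := fun q : V × ℝ × V => q.1 + q.2.1 • q.2.2)
        (ContDiff.contDiffOn (by fun_prop)) (fun _ _ _ => mem_univ _)

end SobCalculus

/-! ### Smooth dependence of inverse functions on parameters -/

section InverseFamilies

variable {Z : Type*} [NormedAddCommGroup Z] [NormedSpace ℝ Z] {k k₀ : ℕ} {E F : ScScale}
variable {V : Type*} [NormedAddCommGroup V] [NormedSpace ℝ V]

/-- Implicit differentiation from differentiability of `G` at a single point and continuity of the
given solution `u`. Along the solution `G` is constant, so `L (s, u s - u 0)` is of smaller order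
than `(s, u s - u 0)`, and this can be solved for `u s - u 0`. -/
theorem hasDerivAt_of_implicit {G : ℝ × ℝ → ℝ} {u : ℝ → ℝ} {L : ℝ × ℝ →L[ℝ] ℝ}
    (hG : HasFDerivAt G L (0, u 0)) (hu : ContinuousAt u 0) (hL : L (0, 1) ≠ 0)
    (hc : ∀ᶠ s in 𝓝 0, G (s, u s) = G (0, u 0)) :
    HasDerivAt u (-L (1, 0) / L (0, 1)) 0 := by
  have ht : Tendsto (fun s => (s, u s)) (𝓝 0) (𝓝 ((0 : ℝ), u 0)) := tendsto_id.prodMk_nhds hu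
  have h1 := hG.isLittleO.comp_tendsto ht
  have h2 : (fun s => L (s, u s - u 0)) =o[𝓝 0] fun s => (s, u s - u 0) := by
    rw [← Asymptotics.isLittleO_neg_left]
    refine h1.congr' ?_ ?_
    · filter_upwards [hc] with s hs
      have e : (s, u s) - (0, u 0) = (s, u s - u 0) := by simp
      simp only [Function.comp_apply, hs, e, sub_self, zero_sub]
    · filter_upwards with s
      simp
  have hLs : ∀ s, L (s, u s - u 0) = s * L (1, 0) + (u s - u 0) * L (0, 1) := by
    intro s
    have : (s, u s - u 0) = s • ((1 : ℝ), (0 : ℝ)) + (u s - u 0) • ((0 : ℝ), (1 : ℝ)) := by simp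
    rw [this, map_add, map_smul, map_smul]
    rfl
  have h3 : (fun s => u s - u 0 - s • (-L (1, 0) / L (0, 1))) =o[𝓝 0] fun s => (s, u s - u 0) := by
    refine (h2.const_mul_left (L (0, 1))⁻¹).congr_left fun s => ?_
    rw [hLs]
    simp only [smul_eq_mul]
    field_simp
    ring
  have h4 : (fun s => (((0 : ℝ)), u s - u 0 - s • (-L (1, 0) / L (0, 1)))) =o[𝓝 0]
      fun s => (s, u s - u 0) := by
    refine Asymptotics.IsLittleO.of_norm_left ?_
    refine h3.norm_left.congr_left fun s => ?_
    rw [Prod.norm_mk, norm_zero, max_eq_right (norm_nonneg _)]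
  -- The error is small relative to `(s, u s - u 0)`, not yet relative to `s`. Subtracting it from
  -- that pair leaves a multiple of `s`, so the pair itself is `O(s)`.
  have h5 := h4.right_isBigO_sub
  have h6 : (fun s => (s, u s - u 0)) =O[𝓝 0] fun s : ℝ => s := by
    refine h5.trans ?_
    refine Asymptotics.IsBigO.of_bound ‖((1 : ℝ), -L (1, 0) / L (0, 1))‖
      (Eventually.of_forall fun s => ?_)
    have : (s, u s - u 0) - ((0 : ℝ), u s - u 0 - s • (-L (1, 0) / L (0, 1))) =
        s • ((1 : ℝ), -L (1, 0) / L (0, 1)) := by ext <;> simp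
    rw [this, norm_smul, mul_comm]
  rw [hasDerivAt_iff_isLittleO]
  simpa using h3.trans_isBigO h6

theorem SobC0.continuousOn {U : Set (E.X 0)} {P : E.X 0 → ℝ → V} (h : SobC0 E U (k₀ + 1) P)
    (t : ℝ) : ContinuousOn (fun x => P x t) U := by
  rw [continuousOn_iff_continuous_domRestrict, continuous_iff_continuousAt]
  exact fun x => (h 0 x).cconv (k := 0 + k₀) |>.tendsto (mem_univ t)

/-- The inverses of a family of immersions of the line of the form `t ↦ K (t, σ x t)`. -/
theorem SobLin.sobC_inverse [CompleteSpace Z] {U : Set (E.X 0)} (hU : IsOpen U) {σ : E.X 0 → ℝ → Z}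
    (hσ : SobLin E (k₀ + 2) σ) {Ω : Set (ℝ × Z)} (hΩ : IsOpen Ω) {K : ℝ × Z → ℝ}
    (hK : ContDiffOn ℝ ∞ K Ω) (hσΩ : ∀ x ∈ U, ∀ t, (t, σ x t) ∈ Ω)
    (h0 : ∀ x ∈ U, ∀ t, deriv (fun t => K (t, σ x t)) t ≠ 0) {Φ : E.X 0 → ℝ → ℝ}
    (h1 : ∀ x ∈ U, ∀ t, Φ x (K (t, σ x t)) = t)
    (h2 : ∀ x ∈ U, ∀ t, K (Φ x t, σ x (Φ x t)) = t) :
    SobC k E U (k₀ + 2) Φ := by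
  have hΨ : SobC0 E U (k₀ + 2) (fun x t => K (t, σ x t)) :=
    ((SobC.const (k := 0) (f := fun t => t) contDiff_id).prodMk (SobLin.sobC (k := 0) hσ)).superpose
      (k₀ := k₀ + 1) hΩ hK hσΩ
  have hΦ0 : SobC0 E U (k₀ + 2) Φ := fun m x =>
    (hΨ m x).inverse (k := m + k₀) (fun y => h0 _ y.2) (h0 _ x.2) (fun y => h1 _ y.2)
      (fun y => h2 _ y.2) (h1 _ x.2) (h2 _ x.2)
  have hdσ : ∀ (x : E.X 0) u, HasDerivAt (σ x) (deriv (σ x) u) u :=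
    fun x u => (hσ.sobolevOn _).hasDerivAt isOpen_univ (mem_univ u)
  have hdK : ∀ q ∈ Ω, HasFDerivAt K (fderiv ℝ K q) q := fun q hq =>
    ((hK.contDiffAt (hΩ.mem_nhds hq)).differentiableAt (by simp)).hasFDerivAt
  have hdΨ : ∀ x ∈ U, ∀ t, deriv (fun t => K (t, σ x t)) t =
      fderiv ℝ K (t, σ x t) (1, deriv (σ x) t) := fun x hx t =>
    ((hdK _ (hσΩ x hx t)).comp_hasDerivAt t ((hasDerivAt_id t).prodMk (hdσ x t))).deriv
  have hΦd : ∀ x ∈ U, ∀ t, deriv (Φ x) t ≠ 0 := by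
    intro x hx t
    have hS : SobolevOn (k₀ + 2) univ (fun t => K (t, σ x t)) := by
      have := (hΨ 0 ⟨x, hx⟩).lim
      rwa [zero_add] at this
    have := (hS.isC1Immersion (h0 x hx)).hasDerivAt_inverse (h1 x hx) (h2 x hx) t
    rw [this.deriv]
    exact inv_ne_zero (h0 x hx _)
  induction k with
  | zero => exact hΦ0
  | succ k ih =>
    let pr : ℝ × Z × Z × Z → ℝ × Z := fun q => (q.1, q.2.1)
    have hpr : ContDiff ℝ ∞ pr := by fun_prop
    have hfd : ContDiffOn ℝ ∞ (fun q => fderiv ℝ K (pr q)) (pr ⁻¹' Ω) :=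
      (hK.fderiv_of_isOpen hΩ (m := ∞) (by simp)).comp hpr.contDiffOn fun q hq => hq
    have hden : ContDiffOn ℝ ∞ (fun q => fderiv ℝ K (pr q) (1, q.2.2.1)) (pr ⁻¹' Ω) :=
      hfd.clm_apply (ContDiff.contDiffOn (by fun_prop))
    have hnum : ContDiffOn ℝ ∞ (fun q => -fderiv ℝ K (pr q) (0, q.2.2.2)) (pr ⁻¹' Ω) :=
      (hfd.clm_apply (ContDiff.contDiffOn (by fun_prop))).neg
    let Ω' : Set (ℝ × Z × Z × Z) :=
      pr ⁻¹' Ω ∩ (fun q => fderiv ℝ K (pr q) (1, q.2.2.1)) ⁻¹' {0}ᶜ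
    have hΩ' : IsOpen Ω' := hden.continuousOn.isOpen_inter_preimage
      (hΩ.preimage hpr.continuous) isOpen_compl_singleton
    -- Differentiating `K (Φ x t, σ x (Φ x t)) = t` in the direction `h` gives this quotient, with
    -- `(q.1, q.2.1, q.2.2.1, q.2.2.2)` standing for `(Φ, σ x (Φ), (σ x)' (Φ), σ h (Φ))`. The
    -- denominator is the derivative of the immersion at `Φ x t`. All four arguments are controlled
    -- by the induction hypothesis on `Φ` and by `SobLin.sobC_comp`.
    let G : ℝ × Z × Z × Z → ℝ := fun q =>
      -fderiv ℝ K (pr q) (0, q.2.2.2) / fderiv ℝ K (pr q) (1, q.2.2.1)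
    have hG : ContDiffOn ℝ ∞ G Ω' :=
      (hnum.mono inter_subset_left).div (hden.mono inter_subset_left) fun q hq => hq.2
    have hT := ih.tangentProj
    have hdT : ∀ p ∈ E.tangentSet U, ∀ t, deriv (Φ (E.incl 0 p.1)) t ≠ 0 :=
      fun p hp t => hΦd _ hp t
    have b1 := (hσ.comp_map E.tangentProj).sobC_comp hT hdT
    have b2 := (hσ.shift.derivs.comp_map E.tangentFst).sobC_comp hT hdT
    have b3 := (hσ.comp_map E.tangentSnd).sobC_comp hT hdT
    refine ⟨hΦ0, fun p t => G (Φ (E.incl 0 p.1) t, σ (E.incl 0 p.1) (Φ (E.incl 0 p.1) t),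
      deriv (σ (E.incl 0 p.1)) (Φ (E.incl 0 p.1) t), σ p.2 (Φ (E.incl 0 p.1) t)), ⟨?_, ?_, ?_⟩,
      (hT.prodMk (b1.prodMk (b2.prodMk b3))).superpose (k₀ := k₀ + 1) hΩ' hG ?_⟩
    · intro x h hx t
      set X := E.incl 0 x with hX
      set H := E.incl 0 h with hH
      have hc : ContinuousAt (fun s : ℝ => E.incl 0 (x + s • h)) 0 := by fun_prop
      have e0 : E.incl 0 (x + (0 : ℝ) • h) = X := by simp [hX]
      have hU' : U ∈ 𝓝 (E.incl 0 (x + (0 : ℝ) • h)) := hU.mem_nhds (by rw [e0]; exact hx)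
      let u : ℝ → ℝ := fun s => Φ (E.incl 0 (x + s • h)) t
      have hu0 : u 0 = Φ X t := by simp only [u, e0]
      have hu : ContinuousAt u 0 :=
        ContinuousAt.comp (g := fun y => Φ y t) ((hΦ0.continuousOn t).continuousAt hU') hc
      have hσs : ∀ (s : ℝ) r, σ (E.incl 0 (x + s • h)) r = σ X r + s • σ H r := fun s r => by
        rw [_root_.map_add, _root_.map_smul, hσ.map_add, hσ.map_smul]
      have hκ : HasFDerivAt (fun q : ℝ × ℝ => (q.2, σ X q.2 + q.1 • σ H q.2))
          ((ContinuousLinearMap.snd ℝ ℝ ℝ).prod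
            ((ContinuousLinearMap.snd ℝ ℝ ℝ).smulRight (deriv (σ X) (Φ X t)) +
              (ContinuousLinearMap.fst ℝ ℝ ℝ).smulRight (σ H (Φ X t)))) (0, u 0) := by
        have c1 : HasFDerivAt (fun q : ℝ × ℝ => q.1) (ContinuousLinearMap.fst ℝ ℝ ℝ) (0, u 0) :=
          hasFDerivAt_fst
        have c2 : HasFDerivAt (fun q : ℝ × ℝ => q.2) (ContinuousLinearMap.snd ℝ ℝ ℝ) (0, u 0) :=
          hasFDerivAt_snd
        have d1 := (hdσ X (u 0)).hasFDerivAt.comp ((0 : ℝ), u 0) c2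
        have d2 := (hdσ H (u 0)).hasFDerivAt.comp ((0 : ℝ), u 0) c2
        have d3 := c2.prodMk (d1.add (c1.smul d2))
        refine d3.congr_fderiv ?_
        ext <;> simp [hu0]
      have hin : (Φ X t, σ X (Φ X t)) ∈ Ω := hσΩ _ hx _
      have hGd := HasFDerivAt.comp ((0 : ℝ), u 0) (g := K)
        (g' := fderiv ℝ K (Φ X t, σ X (Φ X t))) (by simpa [hu0] using hdK _ hin) hκ
      have hne := h0 X hx (Φ X t)
      rw [hdΨ X hx] at hne
      have := hasDerivAt_of_implicit hGd hu (by simpa using hne) ?_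
      · simpa [G, pr, u] using this
      · have e1 : K (u 0, σ X (u 0)) = t := by rw [hu0]; exact h2 X hx t
        filter_upwards [hc.preimage_mem_nhds hU'] with s hs
        have := h2 _ hs t
        rw [hσs] at this
        simp only [Function.comp_apply, zero_smul, add_zero, e1]
        exact this
    · intro x hx h h' t
      simp only [G, pr, hσ.map_add]
      rw [← add_div, ← neg_add, ← _root_.map_add, Prod.mk_add_mk, add_zero]
    · intro x hx c h t
      simp only [G, pr, hσ.map_smul]
      rw [smul_eq_mul, ← mul_div_assoc, mul_neg, ← smul_eq_mul, ← _root_.map_smul, Prod.smul_mk, smul_zero]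
    · intro p hp t
      refine ⟨hσΩ _ hp _, ?_⟩
      have := h0 _ hp (Φ (E.incl 0 p.1) t)
      rw [hdΨ _ hp] at this
      exact this

end InverseFamilies

/-! ### From families of functions to sc-differentiable maps -/

section Targets

variable {n k : ℕ} {E G : ScScale} {ι : Type}

/-- The elements of the scale `G` are families of equivariant functions; `ev a t` evaluates the
function with index `a`, which on level `m` is of class `W^{m+ord a,2}`, at `t`. -/
structure SobTarget (G : ScScale) (B : EuclideanSpace ℝ (Fin n) ≃L[ℝ] EuclideanSpace ℝ (Fin n))
    (ord : ι → ℕ) (ev : ι → ℝ → G.X 0 →L[ℝ] EuclideanSpace ℝ (Fin n)) : Prop where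
  complete : CompleteSpace (G.X 0)
  ext : ∀ x y : G.X 0, (∀ a t, ev a t x = ev a t y) → x = y
  exists_mem : ∀ m (p : ι → ℝ → EuclideanSpace ℝ (Fin n)), (∀ a, SobolevOn (m + (ord a + 1)) univ (p a)) →
    (∀ a t, p a (t + 1) = B (p a t)) → ∃ x : G.X m, ∀ a t, ev a t (G.toBase m x) = p a t
  tendsto : ∀ m {κ : Type} (l : Filter κ) (X : κ → G.X m) (x : G.X m),
    (∀ a, STendsto (m + (ord a + 1)) l univ (fun i t => ev a t (G.toBase m (X i)))
      (fun t => ev a t (G.toBase m x))) → Tendsto X l (𝓝 x)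

variable {B : EuclideanSpace ℝ (Fin n) ≃L[ℝ] EuclideanSpace ℝ (Fin n)} {ord : ι → ℕ}
  {ev : ι → ℝ → G.X 0 →L[ℝ] EuclideanSpace ℝ (Fin n)}

/-- The value `1` of `ord` corresponds to order `m + 2` on level `m`: the fields of `SobTarget` add
one to `ord`, so that the functions are always of positive order and hence continuous. -/
theorem sobTarget_sobolevScale : SobTarget (sobolevScale B) B (fun _ : Unit => 1)
    (fun _ t => SobolevSection.eval (k := 1) t) where
  complete := inferInstanceAs (CompleteSpace (SobolevSection B (1 + 1)))
  ext x y h := SobolevSection.ext fun t => h () t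
  exists_mem m p hp hB := by
    refine ⟨SobolevSection.ofSobolevOn (k := m + 2) (p ())
      (continuousOn_univ.1 ((hp ()).continuousOn (k := m + 1) isOpen_univ)) (hB ()) (hp ()), ?_⟩
    exact fun a t => sobolevScale_toBase_apply m _ t
  tendsto m κ l X x h := by
    refine SobolevSection.tendsto_iff.2 ((h ()).congr isOpen_univ (fun i t _ => ?_) fun t _ => ?_)
    · exact sobolevScale_toBase_apply m _ t
    · exact sobolevScale_toBase_apply m _ t

/-- Tangent scales stay within the same class of targets once the index set is doubled. The base
functions gain one order and the fibre functions keep theirs. This drives the induction in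
`SobTarget.scOn`. -/
theorem SobTarget.tangent (hG : SobTarget G B ord ev) (hc : CompleteSpace (G.X 1))
    (hi : Function.Injective (G.incl 0)) :
    SobTarget G.tangent B (Sum.elim (fun a => ord a + 1) ord)
      (Sum.elim (fun a t => ((ev a t).comp (G.incl 0)).comp (ContinuousLinearMap.fst ℝ _ _))
        (fun a t => (ev a t).comp (ContinuousLinearMap.snd ℝ _ _))) where
  complete := by
    have := hG.complete
    exact inferInstanceAs (CompleteSpace (G.X 1 × G.X 0))
  ext x y h := by
    refine Prod.ext (hi (hG.ext _ _ fun a t => h (Sum.inl a) t))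
      (hG.ext _ _ fun a t => h (Sum.inr a) t)
  exists_mem m p hp hB := by
    obtain ⟨x, hx⟩ := hG.exists_mem (m + 1) (fun a => p (Sum.inl a)) (fun a => by
      have := hp (Sum.inl a)
      rwa [Sum.elim_inl, show m + (ord a + 1 + 1) = m + 1 + (ord a + 1) by ring] at this)
      (fun a => hB _)
    obtain ⟨y, hy⟩ := hG.exists_mem m (fun a => p (Sum.inr a)) (fun a => hp (Sum.inr a))
      (fun a => hB _)
    refine ⟨(x, y), ?_⟩
    rintro (a | a) t
    · rw [G.tangent_toBase, ← hx a t, ← G.incl_toBase_shift]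
      rfl
    · rw [G.tangent_toBase, ← hy a t]
      rfl
  tendsto m κ l X x h := by
    refine Filter.Tendsto.prodMk_nhds (mx := fun i => (X i).1) (my := fun i => (X i).2)
      (hG.tendsto (m + 1) l _ x.1 fun a => ?_) (hG.tendsto m l _ x.2 fun a => ?_)
    · have := h (Sum.inl a)
      simp only [G.tangent_toBase, Sum.elim_inl] at this
      rw [show m + (ord a + 1 + 1) = m + 1 + (ord a + 1) by ring] at this
      simpa only [ContinuousLinearMap.comp_apply, ContinuousLinearMap.coe_fst',
        G.incl_toBase_shift] using this
    · have := h (Sum.inr a)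
      simp only [G.tangent_toBase] at this
      exact this

/-- Level by level, the elements of `G` with prescribed evaluations exist by `exists_mem`, and
convergence of the evaluations in the appropriate Sobolev spaces gives continuity. Outside of `U`
the values are irrelevant. -/
theorem SobTarget.exists_continuousOn (hG : SobTarget G B ord ev) {U : Set (E.X 0)}
    {Q : ι → E.X 0 → ℝ → EuclideanSpace ℝ (Fin n)} (hQ : ∀ a, SobC0 E U (ord a + 1) (Q a))
    (hB : ∀ x ∈ U, ∀ a t, Q a x (t + 1) = B (Q a x t)) (m : ℕ) :
    ∃ g : E.X m → G.X m, ContinuousOn g (E.toBase m ⁻¹' U) ∧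
      ∀ x, E.toBase m x ∈ U → ∀ a t, ev a t (G.toBase m (g x)) = Q a (E.toBase m x) t := by
  have h1 : ∀ x : E.X m, ∃ y : G.X m, E.toBase m x ∈ U →
      ∀ a t, ev a t (G.toBase m y) = Q a (E.toBase m x) t := by
    intro x
    by_cases hx : E.toBase m x ∈ U
    · obtain ⟨y, hy⟩ := hG.exists_mem m (fun a => Q a (E.toBase m x))
        (fun a => (hQ a m ⟨x, hx⟩).lim) (fun a => hB _ hx a)
      exact ⟨y, fun _ => hy⟩
    · exact ⟨0, fun h => absurd h hx⟩
  choose g hg using h1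
  refine ⟨g, ?_, hg⟩
  rw [continuousOn_iff_continuous_domRestrict, continuous_iff_continuousAt]
  intro x
  refine hG.tendsto m _ _ _ fun a => ?_
  refine (hQ a m x).congr isOpen_univ (fun y t _ => ?_) fun t _ => ?_
  · exact (hg y y.2 a t).symm
  · exact (hg x x.2 a t).symm

/-- Integrating along the segment, `f (x + h) - f x` is the integral of `D (x + s • h, J h)` over
`[0, 1]`; this identity is checked after applying the separating functionals `φ b`. Since `J` maps
the unit ball into a compact set and `D` is jointly continuous, `D (y, J h) - D (x, J h)` is at most
`ε ‖h‖` for `y` near `x`, uniformly in `h`. Without compactness of `J`, joint continuity of `D`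
would not give this uniformity. -/
theorem hasFDerivAt_of_directional {X₁ X₀ Y V β : Type*} [NormedAddCommGroup X₁] [NormedSpace ℝ X₁]
    [NormedAddCommGroup X₀] [NormedSpace ℝ X₀] [NormedAddCommGroup Y] [NormedSpace ℝ Y]
    [CompleteSpace Y] [NormedAddCommGroup V] [NormedSpace ℝ V] [CompleteSpace V]
    {J : X₁ →L[ℝ] X₀} (hJ : IsCompactOperator J)
    {U : Set X₁} (hU : IsOpen U) {f : X₁ → Y} {D : X₁ × X₀ → Y} (hD : ContinuousOn D (U ×ˢ univ))
    (φ : β → Y →L[ℝ] V) (hφ : ∀ y z, (∀ b, φ b y = φ b z) → y = z)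
    (hf : ∀ x ∈ U, ∀ h b, HasDerivAt (fun s : ℝ => φ b (f (x + s • h))) (φ b (D (x, J h))) 0)
    {x : X₁} (hx : x ∈ U) {L : X₀ →L[ℝ] Y} (hL : ∀ h, D (x, h) = L h)
    (hsm : ∀ y ∈ U, ∀ (c : ℝ) h, D (y, c • h) = c • D (y, h)) :
    HasFDerivAt f (L.comp J) x := by
  have hDx : ∀ y ∈ U, ∀ h, ContinuousAt D (y, h) := fun y hy h =>
    hD.continuousAt ((hU.prod isOpen_univ).mem_nhds ⟨hy, mem_univ _⟩)
  refine HasFDerivAt.of_isLittleO (Asymptotics.isLittleO_iff.2 fun ε hε => ?_)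
  obtain ⟨K, hK, hJK⟩ := (isCompactOperator_iff_image_closedBall_subset_compact
    (σ₁₂ := RingHom.id ℝ) J.toLinearMap one_pos).1 hJ
  have hunif : ∀ᶠ y in 𝓝 x, ∀ z ∈ K, ‖D (y, z) - D (x, z)‖ < ε := by
    refine hK.eventually_forall_of_forall_eventually fun z hz => ?_
    have a1 : Tendsto (fun p : X₁ × X₀ => D (p.1, p.2) - D (x, p.2)) (𝓝 (x, z)) (𝓝 0) := by
      have b2 : Tendsto (fun p : X₁ × X₀ => D (x, p.2)) (𝓝 (x, z)) (𝓝 (D (x, z))) :=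
        Tendsto.comp (hDx x hx z) (tendsto_const_nhds.prodMk_nhds (continuous_snd.tendsto (x, z)))
      simpa using Tendsto.sub (hDx x hx z) b2
    have := a1.norm
    rw [norm_zero] at this
    exact this.eventually_lt_const hε
  obtain ⟨r, hr, hball⟩ := Metric.eventually_nhds_iff_ball.1 (hunif.and (hU.eventually_mem hx))
  have hbd : ∀ y ∈ Metric.ball x r, ∀ h, ‖D (y, J h) - D (x, J h)‖ ≤ ε * ‖h‖ := by
    intro y hy h
    by_cases h0 : h = 0
    · subst h0
      have e : ∀ y ∈ U, D (y, J 0) = 0 := fun y hy => by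
        have := hsm y hy 0 0
        simpa using this
      rw [e y (hball y hy).2, e x hx]; simp
    · have hn : ‖h‖ ≠ 0 := norm_ne_zero_iff.2 h0
      have h1 := (hball y hy).1 (J (‖h‖⁻¹ • h)) (hJK ⟨_, by simp [norm_smul, hn], rfl⟩)
      rw [map_smul, hsm y (hball y hy).2, hsm x hx, ← smul_sub, norm_smul, norm_inv, norm_norm,
        inv_mul_lt_iff₀ (by positivity)] at h1
      linarith
  filter_upwards [Metric.ball_mem_nhds x hr] with y hy
  set h := y - x with hh
  have hseg : ∀ s ∈ Icc (0 : ℝ) 1, x + s • h ∈ Metric.ball x r := by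
    intro s hs
    rw [Metric.mem_ball, dist_eq_norm, add_sub_cancel_left, norm_smul, Real.norm_of_nonneg hs.1]
    rw [Metric.mem_ball, dist_eq_norm] at hy
    nlinarith [norm_nonneg h, hs.2]
  have hcont : ContinuousOn (fun s : ℝ => D (x + s • h, J h)) (uIcc 0 1) := by
    rw [uIcc_of_le zero_le_one]
    refine hD.comp (by fun_prop) fun s hs => ⟨(hball _ (hseg s hs)).2, mem_univ _⟩
  have hDint := hcont.intervalIntegrable (μ := volume)
  have hFTC : f y - f x = ∫ s in (0 : ℝ)..1, D (x + s • h, J h) := by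
    refine hφ _ _ fun b => ?_
    rw [← (φ b).intervalIntegral_comp_comm hDint]
    have hd : ∀ s ∈ uIcc (0 : ℝ) 1, HasDerivAt (fun s : ℝ => φ b (f (x + s • h)))
        (φ b (D (x + s • h, J h))) s := by
      intro s hs
      rw [uIcc_of_le zero_le_one] at hs
      have := hf _ (hball _ (hseg s hs)).2 h b
      rw [← sub_self s] at this
      have := this.comp_sub_const s s
      refine this.congr_of_eventuallyEq (Eventually.of_forall fun s' => ?_)
      simp only [sub_smul]
      congr 2
      abel
    rw [intervalIntegral.integral_eq_sub_of_hasDerivAt hd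
      ((φ b).continuous.comp_continuousOn hcont).intervalIntegrable]
    simp [h]
  have hconst : L (J h) = ∫ s in (0 : ℝ)..1, D (x, J h) := by simp [hL]
  rw [hFTC, ContinuousLinearMap.comp_apply, hconst,
    ← intervalIntegral.integral_sub hDint intervalIntegrable_const]
  refine (intervalIntegral.norm_integral_le_of_norm_le_const (C := ε * ‖h‖) fun s hs => ?_).trans ?_
  · rw [uIoc_of_le zero_le_one] at hs
    exact hbd _ (hseg s (Ioc_subset_Icc_self hs)) h
  · simp

theorem SobTarget.sc0On (hG : SobTarget G B ord ev) {U : Set (E.X 0)} {f : E.X 0 → G.X 0}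
    {P : ι → E.X 0 → ℝ → EuclideanSpace ℝ (Fin n)} (hP : ∀ a, SobC0 E U (ord a + 1) (P a))
    (hf : ∀ x ∈ U, ∀ a t, ev a t (f x) = P a x t)
    (hB : ∀ x ∈ U, ∀ a t, P a x (t + 1) = B (P a x t)) : Sc0On E G U f := by
  intro m
  obtain ⟨g, hg, hgP⟩ := hG.exists_continuousOn hP hB m
  exact ⟨g, hg, fun x hx => hG.ext _ _ fun a t => (hgP x hx a t).trans (hf _ hx a t).symm⟩

/-- A map of scales is of class `sc^k` if its evaluations are. -/
theorem SobTarget.scOn (hG : SobTarget G B ord ev) (hGc : ∀ m, CompleteSpace (G.X m))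
    (hGi : ∀ m, Function.Injective (G.incl m)) (hE : E.IsRegular) {U : Set (E.X 0)}
    (hU : IsOpen U) {f : E.X 0 → G.X 0} {P : ι → E.X 0 → ℝ → EuclideanSpace ℝ (Fin n)}
    (hP : ∀ a, SobC k E U (ord a + 1) (P a)) (hf : ∀ x ∈ U, ∀ a t, ev a t (f x) = P a x t)
    (hB : ∀ x ∈ U, ∀ a t, P a x (t + 1) = B (P a x t)) : ScOn k E G U f := by
  induction k generalizing E G ι with
  | zero => exact hG.sc0On hP hf hB
  | succ k ih =>
    have h0 : Sc0On E G U f := hG.sc0On (fun a => (hP a).sobC0) hf hB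
    -- The base component of the tangent map takes values in `G¹`, so it must be of one order more.
    -- The shift provides it, since its argument lies in `E¹`.
    have hPk := fun a => (hP a).of_succ.shift.comp_map E.tangentFst (U' := E.tangentSet U)
      fun p hp => hp
    refine ⟨h0, ?_⟩
    choose hP0 δ hδ hδC using hP
    -- For directions coming from `E₁` equivariance is inherited by differentiation. It extends to
    -- all directions because `E₁` is dense in `E₀` and `δ` is continuous there.
    have hδB : ∀ p ∈ E.tangentSet U, ∀ a t, δ a p (t + 1) = B (δ a p t) := by
      rintro ⟨x, h⟩ hp a t
      have hc : ∀ t, Continuous fun h : E.X 0 => δ a (x, h) t := fun t =>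
        ((hδC a).sobC0.continuousOn t).comp_continuous (by fun_prop) fun h => hp
      refine (hE.denseRange 0).induction_on (p := fun h => δ a (x, h) (t + 1) = B (δ a (x, h) t)) h
        (isClosed_eq (hc _) (B.continuous.comp (hc _))) fun h => ?_
      have d1 := (hδ a).hasDerivAt x h hp (t + 1)
      have d2 := B.toContinuousLinearMap.hasFDerivAt.comp_hasDerivAt (0 : ℝ)
        ((hδ a).hasDerivAt x h hp t)
      refine d1.unique (d2.congr_of_eventuallyEq ?_)
      have hc : ContinuousAt (fun s : ℝ => E.incl 0 (x + s • h)) 0 := by fun_prop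
      have hU' : U ∈ 𝓝 (E.incl 0 (x + (0 : ℝ) • h)) := hU.mem_nhds (by rw [zero_smul, add_zero]; exact hp)
      filter_upwards [hc.preimage_mem_nhds hU'] with s hs
      exact hB _ hs a t
    obtain ⟨D, hDc, hD⟩ := hG.exists_continuousOn (E := E.tangent) (fun a => (hδC a).sobC0) hδB 0
    replace hD : ∀ p ∈ E.tangentSet U, ∀ a t, ev a t (D p) = δ a p t := hD
    replace hDc : ContinuousOn D (E.tangentSet U) := hDc
    obtain ⟨g, -, hg⟩ := h0 1
    have hDadd : ∀ x : E.X 1, E.incl 0 x ∈ U → ∀ h h', D (x, h + h') = D (x, h) + D (x, h') :=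
      fun x hx h h' => hG.ext _ _ fun a t => by
        rw [map_add, hD _ hx, hD _ hx, hD _ hx]; exact (hδ a).map_add x hx h h' t
    have hDsm : ∀ x : E.X 1, E.incl 0 x ∈ U → ∀ (c : ℝ) h, D (x, c • h) = c • D (x, h) :=
      fun x hx c h => hG.ext _ _ fun a t => by
        rw [map_smul, hD _ hx, hD _ hx]; exact (hδ a).map_smul x hx c h t
    have hset : E.tangentSet U = (E.incl 0 ⁻¹' U) ×ˢ univ := by ext; simp [ScScale.tangentSet]
    -- The base component is the continuous lift `g` of `f` to level one, the fibre component is the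
    -- map `D` with evaluations `δ`.
    refine ⟨fun p => (g p.1, D p), ?_, ?_⟩
    · intro x hx
      let L : E.X 0 →L[ℝ] G.X 0 :=
        { toFun := fun h => D (x, h)
          map_add' := hDadd x hx
          map_smul' := hDsm x hx
          cont := hDc.comp_continuous (by fun_prop) fun h => hx }
      refine ⟨L, ?_, fun h => ⟨g x, hg x hx, rfl⟩⟩
      have := hG.complete
      refine hasFDerivAt_of_directional (V := EuclideanSpace ℝ (Fin n)) (β := ι × ℝ) (hE.compact 0)
        (hU.preimage (E.incl 0).continuous) (D := D) (hset ▸ hDc) (fun b => ev b.1 b.2)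
        (fun y z h => hG.ext _ _ fun a t => h (a, t)) ?_ hx (fun h => rfl) hDsm
      rintro x hx h ⟨a, t⟩
      have d1 := (hδ a).hasDerivAt x h hx t
      rw [← hD _ hx] at d1
      refine d1.congr_of_eventuallyEq ?_
      have hc : ContinuousAt (fun s : ℝ => E.incl 0 (x + s • h)) 0 := by fun_prop
      have hU' : U ∈ 𝓝 (E.incl 0 (x + (0 : ℝ) • h)) := hU.mem_nhds (by simpa using hx)
      filter_upwards [hc.preimage_mem_nhds hU'] with s hs
      exact hf _ hs a t
    · refine ih (G := G.tangent) (hG.tangent (hGc 1) (hGi 0))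
        (P := Sum.elim (fun a p => P a (E.incl 0 p.1)) δ)
        (fun m => ?_) (fun m => ?_) hE.tangent (E.isOpen_tangentSet hU) ?_ ?_ ?_
      · have := hGc (m + 1)
        have := hGc m
        exact inferInstanceAs (CompleteSpace (G.X (m + 1) × G.X m))
      · exact (hGi (m + 1)).prodMap (hGi m)
      · rintro (a | a)
        · exact hPk a
        · exact hδC a
      · rintro p hp (a | a) t
        · change ev a t (G.incl 0 (g p.1)) = P a (E.incl 0 p.1) t
          rw [← hf _ hp]
          exact congrArg _ (hg p.1 hp)
        · exact hD p hp a t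
      · rintro p hp (a | a) t
        · exact hB _ hp a t
        · exact hδB p hp a t

end Targets

/-! ### Locality of sc-differentiability -/

section Locality

variable {k : ℕ} {E F : ScScale}

theorem Sc0On.congr {U : Set (E.X 0)} {f f' : E.X 0 → F.X 0} (h : Sc0On E F U f)
    (hf : EqOn f f' U) : Sc0On E F U f' := fun m => by
  obtain ⟨g, hg, hgf⟩ := h m
  exact ⟨g, hg, fun x hx => (hgf x hx).trans (hf hx)⟩

theorem ScOn.sc0On {U : Set (E.X 0)} {f : E.X 0 → F.X 0} (h : ScOn k E F U f) :
    Sc0On E F U f := by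
  cases k with
  | zero => exact h
  | succ k => exact h.1

theorem ScOn.congr {U : Set (E.X 0)} (hU : IsOpen U) {f f' : E.X 0 → F.X 0} (h : ScOn k E F U f)
    (hf : EqOn f f' U) : ScOn k E F U f' := by
  cases k with
  | zero => exact Sc0On.congr h hf
  | succ k =>
    obtain ⟨h0, T, hT, h1⟩ := h
    refine ⟨h0.congr hf, T, fun x hx => ?_, h1⟩
    obtain ⟨L, hL, hy⟩ := hT x hx
    refine ⟨L, hL.congr_of_eventuallyEq ?_, fun h => ?_⟩
    · filter_upwards [(hU.preimage (E.incl 0).continuous).mem_nhds hx] with y hy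
      exact (hf hy).symm
    · rw [← hf hx]
      exact hy h

/-- The derivative along `E₁` determines the bounded operator on `E₀`, because `E₁` is dense; the
base component is determined because `F₁ → F₀` is injective. Tangent maps found on different open
sets thus agree on overlaps. -/
theorem IsScTangentMap.eq {U U' : Set (E.X 0)} {f : E.X 0 → F.X 0}
    {T T' : E.tangent.X 0 → F.tangent.X 0} (hE : DenseRange (E.incl 0))
    (hF : Function.Injective (F.incl 0)) (hT : IsScTangentMap E F U f T)
    (hT' : IsScTangentMap E F U' f T') {p : E.tangent.X 0} (hp : p ∈ E.tangentSet U)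
    (hp' : p ∈ E.tangentSet U') : T p = T' p := by
  obtain ⟨x, h⟩ := p
  obtain ⟨L, hL, hy⟩ := hT x hp
  obtain ⟨L', hL', hy'⟩ := hT' x hp'
  have e : L = L' := by
    have := hL.unique hL'
    refine ContinuousLinearMap.ext fun z => congrFun (hE.equalizer L.continuous L'.continuous ?_) z
    funext y
    exact DFunLike.congr_fun this y
  obtain ⟨y, hy1, hy2⟩ := hy h
  obtain ⟨y', hy1', hy2'⟩ := hy' h
  rw [hy2, hy2', e, hF (hy1.trans hy1'.symm)]

theorem Sc0On.of_local (hF : F.IsRegular) {U : Set (E.X 0)} (hU : IsOpen U)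
    {f : E.X 0 → F.X 0} (h : ∀ x ∈ U, ∃ O, IsOpen O ∧ x ∈ O ∧ Sc0On E F (U ∩ O) f) :
    Sc0On E F U f := by
  intro m
  have hex : ∀ x : E.X m, ∃ y : F.X m, E.toBase m x ∈ U → F.toBase m y = f (E.toBase m x) := by
    intro x
    by_cases hx : E.toBase m x ∈ U
    · obtain ⟨O, hO, hxO, hk⟩ := h _ hx
      obtain ⟨g, -, hg⟩ := hk m
      exact ⟨g x, fun _ => hg x ⟨hx, hxO⟩⟩
    · exact ⟨0, fun h => absurd h hx⟩
  choose g hg using hex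
  refine ⟨g, fun x hx => ?_, hg⟩
  obtain ⟨O, hO, hxO, hk⟩ := h _ hx
  obtain ⟨g', hg'c, hg'⟩ := hk m
  have hn : E.toBase m ⁻¹' (U ∩ O) ∈ 𝓝 x :=
    ((hU.inter hO).preimage (E.toBase m).continuous).mem_nhds ⟨hx, hxO⟩
  refine ((hg'c.continuousAt hn).congr ?_).continuousWithinAt
  filter_upwards [hn] with y hy
  exact hF.toBase_injective m ((hg' y hy).trans (hg y hy.1).symm)

/-- The property of being `sc^k` is local. -/
theorem ScOn.of_local (hE : E.IsRegular) (hF : F.IsRegular) {U : Set (E.X 0)} (hU : IsOpen U)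
    {f : E.X 0 → F.X 0} (h : ∀ x ∈ U, ∃ O, IsOpen O ∧ x ∈ O ∧ ScOn k E F (U ∩ O) f) :
    ScOn k E F U f := by
  have h0 : Sc0On E F U f := Sc0On.of_local hF hU fun x hx => by
    obtain ⟨O, hO, hxO, hk⟩ := h x hx
    exact ⟨O, hO, hxO, hk.sc0On⟩
  induction k generalizing E F with
  | zero => exact h0
  | succ k ih =>
    refine ⟨h0, ?_⟩
    choose! O hO hxO hk using h
    have hT : ∀ x, ∃ T : E.tangent.X 0 → F.tangent.X 0, x ∈ U → IsScTangentMap E F (U ∩ O x) f T ∧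
        ScOn k E.tangent F.tangent (E.tangentSet (U ∩ O x)) T := by
      intro x
      by_cases hx : x ∈ U
      · obtain ⟨T, hT⟩ := (hk x hx).2
        exact ⟨T, fun _ => hT⟩
      · exact ⟨0, fun h => absurd h hx⟩
    choose T hT using hT
    -- The global tangent map uses, at a tangent vector, the local tangent map chosen for its base
    -- point. By uniqueness it coincides near each point with a single local one, so its regularity
    -- is again a local question.
    have heq : ∀ x ∈ U, EqOn (T x) (fun p => T (E.incl 0 p.1) p) (E.tangentSet (U ∩ O x)) := by
      intro x hx p hp
      exact IsScTangentMap.eq (hE.denseRange 0) (hF.injective 0) (hT x hx).1 (hT _ hp.1).1 hp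
        ⟨hp.1, hxO _ hp.1⟩
    have hloc : ∀ p ∈ E.tangentSet U, ∃ O', IsOpen O' ∧ p ∈ O' ∧
        ScOn k E.tangent F.tangent (E.tangentSet U ∩ O') (fun p => T (E.incl 0 p.1) p) := by
      intro p hp
      refine ⟨E.tangentSet (O (E.incl 0 p.1)), E.isOpen_tangentSet (hO _ hp), hxO _ hp, ?_⟩
      exact (hT _ hp).2.congr (E.isOpen_tangentSet (hU.inter (hO _ hp))) (heq _ hp)
    refine ⟨fun p => T (E.incl 0 p.1) p, fun x hx => (hT _ hx).1 x ⟨hx, hxO _ hx⟩, ?_⟩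
    exact ih hE.tangent hF.tangent (E.isOpen_tangentSet hU) hloc
      (Sc0On.of_local hF.tangent (E.isOpen_tangentSet hU) fun x hx => by
        obtain ⟨O, hO, hxO, hk⟩ := hloc x hx
        exact ⟨O, hO, hxO, hk.sc0On⟩)

end Locality

/-! ### Maps into the Sobolev scale -/

section SobolevMaps

variable {n : ℕ} {A B : EuclideanSpace ℝ (Fin n) ≃L[ℝ] EuclideanSpace ℝ (Fin n)} {E : ScScale}

theorem sobLin_sobolevScale :
    SobLin (sobolevScale A) 2 (fun ξ => SobolevSection.toFun (ξ : SobolevSection A 2)) where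
  sTendsto m ξ := by
    refine ((SobolevSection.tendsto_iff (l := 𝓝 ξ)
      (Ξ := fun ζ : SobolevSection A (m + 2) => ζ)).1 tendsto_id).congr isOpen_univ
      (fun i t _ => ?_) fun t _ => ?_
    · exact (sobolevScale_toBase_apply m _ t).symm
    · exact (sobolevScale_toBase_apply m _ t).symm
  map_add _ _ _ := rfl
  map_smul _ _ _ := rfl

theorem isRegular_sobolevScale : (sobolevScale A).IsRegular := isScBanach_sobolevScale.isRegular

/-- A map into the scale of sections is sc-smooth if it is locally given by families of functions
which are smooth in the sense of `SobC`. -/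
theorem scSmoothOn_of_sobC (hE : E.IsRegular) {U : Set (E.X 0)} (hU : IsOpen U)
    {f : E.X 0 → SobolevSection B 2} (h : ∀ x ∈ U, ∃ O, IsOpen O ∧ x ∈ O ∧
      ∃ P : E.X 0 → ℝ → EuclideanSpace ℝ (Fin n), (∀ k, SobC k E (U ∩ O) 2 P) ∧
        ∀ y ∈ U ∩ O, ∀ t, f y t = P y t) :
    ScSmoothOn E (sobolevScale B) U f := by
  intro k
  refine ScOn.of_local hE isRegular_sobolevScale hU fun x hx => ?_
  obtain ⟨O, hO, hxO, P, hP, hfP⟩ := h x hx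
  refine ⟨O, hO, hxO, ?_⟩
  refine sobTarget_sobolevScale.scOn (P := fun _ => P) (fun m => isScBanach_sobolevScale.complete m)
    (fun m => isScBanach_sobolevScale.injective m) hE (hU.inter hO) (fun _ => hP k)
    (fun y hy _ t => hfP y hy t) fun y hy _ t => ?_
  rw [← hfP y hy, ← hfP y hy]
  exact (f y).equivariant t

end SobolevMaps

/-! ### The covering of the circle -/

section CircleCover

theorem continuous_toCircle : Continuous toCircle :=
  Circle.exp.continuous.comp (by fun_prop)

theorem toCircle_eq_iff {s t : ℝ} : toCircle s = toCircle t ↔ ∃ m : ℤ, s = t + m := by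
  rw [toCircle, toCircle, Circle.exp_eq_exp]
  refine exists_congr fun m => ?_
  have : (2 * Real.pi) ≠ 0 := by positivity
  constructor
  · intro h
    refine mul_left_cancel₀ this ?_
    rw [h]; ring
  · rintro rfl
    ring

@[simp] theorem toCircle_add_one (t : ℝ) : toCircle (t + 1) = toCircle t :=
  toCircle_eq_iff.2 ⟨1, by simp⟩

@[simp] theorem toCircle_add_intCast (t : ℝ) (m : ℤ) : toCircle (t + m) = toCircle t :=
  toCircle_eq_iff.2 ⟨m, rfl⟩

theorem toCircle_add (s t : ℝ) : toCircle (s + t) = toCircle s * toCircle t := by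
  rw [toCircle, mul_add, Circle.exp_add]; rfl

theorem isLocalHomeomorph_toCircle : IsLocalHomeomorph toCircle :=
  isLocalHomeomorph_circleExp.comp
    (Homeomorph.mulLeft₀ (2 * Real.pi) (by positivity)).isLocalHomeomorph

theorem isQuotientMap_toCircle : IsQuotientMap toCircle :=
  isLocalHomeomorph_toCircle.isOpenMap.isQuotientMap continuous_toCircle toCircle_surjective

theorem exists_circle_map {X : Type*} {w : ℝ → X} (hw : ∀ t, w (t + 1) = w t) :
    ∃ v : Circle → X, ∀ t, v (toCircle t) = w t := by
  choose r hr using toCircle_surjective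
  refine ⟨fun z => w (r z), fun t => ?_⟩
  obtain ⟨m, hm⟩ := toCircle_eq_iff.1 (hr (toCircle t))
  simp only [hm]
  have := Function.Periodic.int_mul (f := w) (c := 1) hw m t
  simpa using this

theorem forall_of_periodic {p : ℝ → Prop} (hp : ∀ t, p (t + 1) ↔ p t)
    (h : ∀ t ∈ Icc (0 : ℝ) 1, p t) (t : ℝ) : p t := by
  have hper : Function.Periodic p 1 := fun t => propext (hp t)
  obtain ⟨s, hs, hst⟩ := hper.exists_mem_Ico₀ one_pos t
  rw [hst]
  exact h s (Ico_subset_Icc_self hs)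

/-- A condition holding near every point of the compact interval `[0, 1]`, uniformly in nearby
parameters, holds eventually on all of it, and by periodicity on the line. This is the source of all
openness statements about graphs of sections. -/
theorem eventually_forall_of_periodic {ι : Type*} {l : Filter ι} {p : ι → ℝ → Prop}
    (hp : ∀ i t, p i (t + 1) ↔ p i t)
    (h : ∀ t, ∀ᶠ q : ι × ℝ in l ×ˢ 𝓝 t, p q.1 q.2) : ∀ᶠ i in l, ∀ t, p i t := by
  have h1 : ∀ᶠ i in l, ∀ t ∈ Icc (0 : ℝ) 1, p i t := by
    refine isCompact_Icc.induction_on (p := fun s => ∀ᶠ i in l, ∀ t ∈ s, p i t) (by simp)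
      (fun s t hst ht => ht.mono fun i hi r hr => hi r (hst hr)) (fun s t hs ht => ?_)
      (fun t _ => ?_)
    · filter_upwards [hs, ht] with i h1 h2 r hr
      exact hr.elim (h1 r) (h2 r)
    · obtain ⟨a, ha, b, hb, hab⟩ := eventually_prod_iff.1 (h t)
      exact ⟨{s | b s}, mem_nhdsWithin_of_mem_nhds hb, ha.mono fun i hi s hs => hab hi hs⟩
  exact h1.mono fun i hi => forall_of_periodic (hp i) hi

end CircleCover

/-! ### Loops and their charts -/

section Loops

variable {n : ℕ} {M : Type*} [TopologicalSpace M] [ChartedSpace (EuclideanSpace ℝ (Fin n)) M]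
  [IsManifold (𝓡 n) ∞ M] {W Z : Type*} [NormedAddCommGroup W] [NormedSpace ℝ W]
  [NormedAddCommGroup Z] [NormedSpace ℝ Z] {k : ℕ}

/-- A smooth function on `ℝ × M` in a chart of `M`. -/
theorem ContMDiffOn.contDiffOn_comp_chart {S : Set (ℝ × M)} {G : ℝ × M → W}
    (hG : ContMDiffOn (𝓘(ℝ, ℝ).prod (𝓡 n)) 𝓘(ℝ, W) ∞ G S) (q : M) :
    ContDiffOn ℝ ∞ (fun p : ℝ × EuclideanSpace ℝ (Fin n) =>
      G (p.1, (chartAt (EuclideanSpace ℝ (Fin n)) q).symm p.2))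
      {p | p.2 ∈ (chartAt (EuclideanSpace ℝ (Fin n)) q).target ∧
        (p.1, (chartAt (EuclideanSpace ℝ (Fin n)) q).symm p.2) ∈ S} := by
  have h1 : ContMDiffOn 𝓘(ℝ, ℝ × EuclideanSpace ℝ (Fin n)) (𝓘(ℝ, ℝ).prod (𝓡 n)) ∞
      (fun p : ℝ × EuclideanSpace ℝ (Fin n) =>
        (p.1, (chartAt (EuclideanSpace ℝ (Fin n)) q).symm p.2))
      {p | p.2 ∈ (chartAt (EuclideanSpace ℝ (Fin n)) q).target ∧
        (p.1, (chartAt (EuclideanSpace ℝ (Fin n)) q).symm p.2) ∈ S} := by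
    refine ContMDiffOn.prodMk contDiff_fst.contMDiff.contMDiffOn ?_
    exact (contMDiffOn_chart_symm (I := 𝓡 n) (n := ∞) (x := q)).comp
      contDiff_snd.contMDiff.contMDiffOn fun p hp => hp.1
  exact (hG.comp h1 fun p hp => hp.2).contDiffOn

theorem isOpen_comp_chart {S : Set (ℝ × M)} (hS : IsOpen S) (q : M) :
    IsOpen {p : ℝ × EuclideanSpace ℝ (Fin n) | p.2 ∈ (chartAt (EuclideanSpace ℝ (Fin n)) q).target ∧
        (p.1, (chartAt (EuclideanSpace ℝ (Fin n)) q).symm p.2) ∈ S} := by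
  have hc : ContinuousOn (fun p : ℝ × EuclideanSpace ℝ (Fin n) =>
      (p.1, (chartAt (EuclideanSpace ℝ (Fin n)) q).symm p.2))
      (Prod.snd ⁻¹' (chartAt (EuclideanSpace ℝ (Fin n)) q).target) :=
    continuousOn_fst.prodMk ((chartAt (EuclideanSpace ℝ (Fin n)) q).continuousOn_symm.comp
      continuousOn_snd fun p hp => hp)
  exact hc.isOpen_inter_preimage
    ((chartAt (EuclideanSpace ℝ (Fin n)) q).open_target.preimage continuous_snd) hS

theorem MemSobolevLoc.mono {U U' : Set ℝ} {f : ℝ → W} (h : MemSobolevLoc k U f) (hU : U' ⊆ U) :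
    MemSobolevLoc k U' f := by
  obtain ⟨g, hg⟩ := h
  exact ⟨g, hg.zero, fun j hj => (hg.l2 j hj).mono hU,
    fun j hj η h1 h2 h3 => hg.weak j hj η h1 h2 (h3.trans hU)⟩

/-- The interval from the definition may leave the chart domain. It is shrunk so that the loop stays
inside; the chart expression is then continuous, and its weak derivatives can be replaced by
primitives. -/
theorem IsSobolevLoop.exists_chart {v : Circle → M} (hv : IsSobolevLoop n k v) (t : ℝ)
    {O : Set ℝ} (hO : O ∈ 𝓝 t) : ∃ ε > 0, Ioo (t - ε) (t + ε) ⊆ O ∧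
      (∀ s ∈ Ioo (t - ε) (t + ε), v (toCircle s) ∈
        (chartAt (EuclideanSpace ℝ (Fin n)) (v (toCircle t))).source) ∧
      SobolevOn k (Ioo (t - ε) (t + ε))
        (fun s => chartAt (EuclideanSpace ℝ (Fin n)) (v (toCircle t)) (v (toCircle s))) := by
  obtain ⟨ε, hε, h⟩ := hv.2 t
  have hvc : Continuous fun s => v (toCircle s) := hv.1.comp continuous_toCircle
  have h1 : (fun s => v (toCircle s)) ⁻¹'
      (chartAt (EuclideanSpace ℝ (Fin n)) (v (toCircle t))).source ∈ 𝓝 t :=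
    hvc.continuousAt.preimage_mem_nhds ((chartAt _ _).open_source.mem_nhds (mem_chart_source _ _))
  obtain ⟨δ, hδ, hsub⟩ := (nhds_basis_Ioo_pos t).mem_iff.1 (inter_mem hO
    (inter_mem h1 (Ioo_mem_nhds (show t - ε < t by linarith) (show t < t + ε by linarith))))
  refine ⟨δ, hδ, fun s hs => (hsub hs).1, fun s hs => (hsub hs).2.1, ?_⟩
  refine (memSobolevLoc_iff isOpen_Ioo ordConnected_Ioo ?_).1 (h.mono fun s hs => (hsub hs).2.2)
  exact (chartAt _ _).continuousOn.comp hvc.continuousOn fun s hs => (hsub hs).2.1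

/-- Superposition of a smooth function with a loop of class `W^{k,2}`. -/
theorem IsSobolevLoop.sobolevOn_comp [CompleteSpace W] {v : Circle → M}
    (hv : IsSobolevLoop n (k + 1) v) {S : Set (ℝ × M)} (hS : IsOpen S) {G : ℝ × M → W}
    (hG : ContMDiffOn (𝓘(ℝ, ℝ).prod (𝓡 n)) 𝓘(ℝ, W) ∞ G S) {I : Set ℝ} (hI : IsOpen I)
    (hvS : ∀ t ∈ I, (t, v (toCircle t)) ∈ S) :
    SobolevOn (k + 1) I (fun t => G (t, v (toCircle t))) := by
  refine SobolevOn.of_local fun t ht => ?_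
  obtain ⟨ε, hε, hO, hsrc, hsob⟩ := hv.exists_chart t (hI.mem_nhds ht)
  refine ⟨Ioo (t - ε) (t + ε), isOpen_Ioo, ⟨by linarith, by linarith⟩, ?_⟩
  set φ := chartAt (EuclideanSpace ℝ (Fin n)) (v (toCircle t)) with hφ
  have h1 : SobolevOn (k + 1) (Ioo (t - ε) (t + ε)) (fun s => (s, φ (v (toCircle s)))) :=
    ((((contDiff_id (𝕜 := ℝ) (E := ℝ)).sobolevOn (k := k + 1) isOpen_Ioo).sTendsto isOpen_Ioo
      (pure ())).prodMk isOpen_Ioo (hsob.sTendsto isOpen_Ioo (pure ()))).lim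
  have h2 := h1.superpose isOpen_Ioo (isOpen_comp_chart hS (v (toCircle t)))
    (hG.contDiffOn_comp_chart (v (toCircle t))) fun s hs => by
      refine ⟨φ.map_source (hsrc s hs), ?_⟩
      rw [φ.left_inv (hsrc s hs)]
      exact hvS s (hO hs)
  refine h2.congr isOpen_Ioo fun s hs => ?_
  simp only [← hφ, φ.left_inv (hsrc s hs)]

/-- A loop which is a smooth function of a function of class `W^{k,2}` is of class `W^{k,2}`. -/
theorem isSobolevLoop_of_comp [CompleteSpace Z] {v : Circle → M} {u : ℝ → Z}
    (hu : SobolevOn (k + 1) univ u) {Ω : Set Z} (hΩ : IsOpen Ω) {H : Z → M}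
    (hH : ContMDiffOn 𝓘(ℝ, Z) (𝓡 n) ∞ H Ω) (huΩ : ∀ t, u t ∈ Ω)
    (hv : ∀ t, v (toCircle t) = H (u t)) : IsSobolevLoop n (k + 1) v := by
  have huc : Continuous u := continuousOn_univ.1 (hu.continuousOn isOpen_univ)
  have hvc : Continuous fun t => v (toCircle t) := by
    simp only [hv]
    exact hH.continuousOn.comp_continuous huc huΩ
  refine ⟨isQuotientMap_toCircle.continuous_iff.2 hvc, fun t => ?_⟩
  set φ := chartAt (EuclideanSpace ℝ (Fin n)) (v (toCircle t)) with hφ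
  have h1 : (fun s => v (toCircle s)) ⁻¹' φ.source ∈ 𝓝 t :=
    hvc.continuousAt.preimage_mem_nhds (φ.open_source.mem_nhds (mem_chart_source _ _))
  obtain ⟨δ, hδ, hsub⟩ := (nhds_basis_Ioo_pos t).mem_iff.1 h1
  have hΩ' : IsOpen (Ω ∩ H ⁻¹' φ.source) := hH.continuousOn.isOpen_inter_preimage hΩ φ.open_source
  have hφH : ContDiffOn ℝ ∞ (fun z => φ (H z)) (Ω ∩ H ⁻¹' φ.source) :=
    ((contMDiffOn_chart (I := 𝓡 n) (n := ∞) (x := v (toCircle t))).comp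
      (hH.mono inter_subset_left) fun z hz => hz.2).contDiffOn
  refine ⟨δ, hδ, (memSobolevLoc_iff isOpen_Ioo ordConnected_Ioo
    (φ.continuousOn.comp hvc.continuousOn hsub)).2 ?_⟩
  refine ((hu.mono (subset_univ _)).superpose isOpen_Ioo hΩ' hφH fun s hs => ⟨huΩ s, ?_⟩).congr
    isOpen_Ioo fun s hs => ?_
  · rw [mem_preimage, ← hv]; exact hsub hs
  · simp only [hv, Function.comp_apply]

end Loops

/-! ### Fibre charts and the charts of the loop space -/

section FiberCharts

variable {n : ℕ} {M : Type*} [TopologicalSpace M] [ChartedSpace (EuclideanSpace ℝ (Fin n)) M]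

namespace FiberChart

variable (c : FiberChart n M)

/-- The fibre component of a fibre chart. -/
noncomputable def fwd (p : ℝ × M) : EuclideanSpace ℝ (Fin n) := (c.e p).2

/-- The fibre component of the inverse of a fibre chart. -/
noncomputable def bwd (p : ℝ × EuclideanSpace ℝ (Fin n)) : M := (c.e.symm p).2

theorem contMDiffOn_fwd : ContMDiffOn (𝓘(ℝ, ℝ).prod (𝓡 n)) 𝓘(ℝ, EuclideanSpace ℝ (Fin n)) ∞ c.fwd
    c.e.source :=
  contMDiff_snd.comp_contMDiffOn c.smooth

theorem contMDiffOn_bwd : ContMDiffOn 𝓘(ℝ, ℝ × EuclideanSpace ℝ (Fin n)) (𝓡 n) ∞ c.bwd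
    c.e.target := by
  have h : ContMDiff 𝓘(ℝ, ℝ × EuclideanSpace ℝ (Fin n)) (𝓘(ℝ, ℝ).prod (𝓡 n)) ∞
      (fun p : ℝ × EuclideanSpace ℝ (Fin n) => (p.1, p.2)) :=
    contDiff_fst.contMDiff.prodMk contDiff_snd.contMDiff
  exact contMDiff_snd.comp_contMDiffOn (c.smooth_symm.comp h.contMDiffOn fun p hp => hp)

variable {c}

theorem apply_eq {t : ℝ} {q : M} (h : (t, q) ∈ c.e.source) : c.e (t, q) = (t, c.fwd (t, q)) :=
  Prod.ext (c.fst _ h) rfl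

theorem symm_eq {t : ℝ} {x : EuclideanSpace ℝ (Fin n)} (h : (t, x) ∈ c.e.target) :
    c.e.symm (t, x) = (t, c.bwd (t, x)) := by
  refine Prod.ext ?_ rfl
  have := c.fst _ (c.e.map_target h)
  rw [c.e.right_inv h] at this
  exact this.symm

theorem bwd_mem {t : ℝ} {x : EuclideanSpace ℝ (Fin n)} (h : (t, x) ∈ c.e.target) :
    (t, c.bwd (t, x)) ∈ c.e.source := by
  rw [← symm_eq h]; exact c.e.map_target h

theorem fwd_mem {t : ℝ} {q : M} (h : (t, q) ∈ c.e.source) : (t, c.fwd (t, q)) ∈ c.e.target := by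
  rw [← apply_eq h]; exact c.e.map_source h

theorem fwd_bwd {t : ℝ} {x : EuclideanSpace ℝ (Fin n)} (h : (t, x) ∈ c.e.target) :
    c.fwd (t, c.bwd (t, x)) = x := by
  rw [← symm_eq h, fwd, c.e.right_inv h]

theorem bwd_fwd {t : ℝ} {q : M} (h : (t, q) ∈ c.e.source) : c.bwd (t, c.fwd (t, q)) = q := by
  rw [← apply_eq h, bwd, c.e.left_inv h]

theorem fwd_add_one {t : ℝ} {q : M} (h : (t, q) ∈ c.e.source) :
    c.fwd (t + 1, q) = c.A (c.fwd (t, q)) := c.equivariant t q h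

theorem mem_target_add_one {t : ℝ} {x : EuclideanSpace ℝ (Fin n)} :
    (t + 1, c.A x) ∈ c.e.target ↔ (t, x) ∈ c.e.target := by
  constructor
  · intro h
    have h1 := (c.source_iff t _).1 (bwd_mem h)
    have h2 := fwd_add_one h1
    rw [fwd_bwd h] at h2
    rw [c.A.injective h2]
    exact fwd_mem h1
  · intro h
    have h1 := bwd_mem h
    have h2 := fwd_mem ((c.source_iff t _).2 h1)
    rwa [fwd_add_one h1, fwd_bwd h] at h2

theorem bwd_add_one {t : ℝ} {x : EuclideanSpace ℝ (Fin n)} (h : (t, x) ∈ c.e.target) :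
    c.bwd (t + 1, c.A x) = c.bwd (t, x) := by
  have h1 := bwd_mem h
  have h2 := bwd_fwd ((c.source_iff t _).2 h1)
  rwa [fwd_add_one h1, fwd_bwd h] at h2

theorem represents_iff {v : Circle → M} {ξ : ℝ → EuclideanSpace ℝ (Fin n)} :
    c.Represents v ξ ↔ ∀ t, (t, v (toCircle t)) ∈ c.e.source ∧ c.fwd (t, v (toCircle t)) = ξ t :=
  forall_congr' fun t => and_congr_right fun h => by rw [apply_eq h, Prod.mk_right_inj]

theorem represents_iff_symm {v : Circle → M} {ξ : ℝ → EuclideanSpace ℝ (Fin n)} :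
    c.Represents v ξ ↔ ∀ t, (t, ξ t) ∈ c.e.target ∧ c.bwd (t, ξ t) = v (toCircle t) := by
  rw [represents_iff]
  refine forall_congr' fun t => ⟨?_, ?_⟩
  · rintro ⟨h1, h2⟩
    rw [← h2]
    exact ⟨fwd_mem h1, bwd_fwd h1⟩
  · rintro ⟨h1, h2⟩
    rw [← h2]
    exact ⟨bwd_mem h1, fwd_bwd h1⟩

variable [IsManifold (𝓡 n) ∞ M] {k : ℕ}

theorem sobolevOn_fwd {v : Circle → M} (hv : IsSobolevLoop n (k + 1) v)
    (hs : ∀ t, (t, v (toCircle t)) ∈ c.e.source) :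
    SobolevOn (k + 1) univ (fun t => c.fwd (t, v (toCircle t))) :=
  hv.sobolevOn_comp c.e.open_source c.contMDiffOn_fwd isOpen_univ fun t _ => hs t

theorem isSobolevLoop_of_represents {v : Circle → M} {ξ : ℝ → EuclideanSpace ℝ (Fin n)}
    (h : c.Represents v ξ) (hξ : SobolevOn (k + 1) univ ξ) : IsSobolevLoop n (k + 1) v := by
  have h1 : SobolevOn (k + 1) univ (fun s => (s, ξ s)) :=
    ((((contDiff_id (𝕜 := ℝ) (E := ℝ)).sobolevOn (k := k + 1) isOpen_univ).sTendsto isOpen_univ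
      (pure ())).prodMk isOpen_univ (hξ.sTendsto isOpen_univ (pure ()))).lim
  rw [represents_iff_symm] at h
  exact isSobolevLoop_of_comp h1 c.e.open_target c.contMDiffOn_bwd (fun t => (h t).1)
    fun t => (h t).2.symm

theorem exists_represents {v : Circle → M} (hv : IsSobolevLoop n (k + 1) v)
    (hs : ∀ t, (t, v (toCircle t)) ∈ c.e.source) :
    ∃ ξ : SobolevSection c.A (k + 1), c.Represents v ξ := by
  have h := sobolevOn_fwd hv hs
  refine ⟨SobolevSection.ofSobolevOn _ (continuousOn_univ.1 (h.continuousOn isOpen_univ))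
    (fun t => ?_) h, represents_iff.2 fun t => ⟨hs t, rfl⟩⟩
  rw [toCircle_add_one]
  exact fwd_add_one (hs t)

theorem exists_represents_symm (ξ : SobolevSection c.A (k + 1))
    (hs : ∀ t, (t, ξ t) ∈ c.e.target) : ∃ v, IsSobolevLoop n (k + 1) v ∧ c.Represents v ξ := by
  obtain ⟨v, hv⟩ := exists_circle_map (w := fun t => c.bwd (t, ξ t)) fun t => by
    rw [ξ.equivariant, bwd_add_one (hs t)]
  have h : c.Represents v ξ := represents_iff_symm.2 fun t => ⟨hs t, (hv t).symm⟩
  exact ⟨v, isSobolevLoop_of_represents h ξ.sobolevOn, h⟩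

variable {v₀ : SobolevLoopSpace n M}

theorem mem_source_iff {v : SobolevLoopSpace n M} :
    v ∈ (c.loopChart v₀).chart.source ↔ ∀ t, (t, v (toCircle t)) ∈ c.e.source :=
  ⟨fun ⟨ξ, h⟩ t => (h t).1, fun h => exists_represents v.sobolev h⟩

theorem mem_chart_target_iff {ξ : SobolevSection c.A 2} :
    ξ ∈ (c.loopChart v₀).chart.target ↔ ∀ t, (t, ξ t) ∈ c.e.target :=
  ⟨fun ⟨v, h⟩ t => (represents_iff_symm.1 h t).1, fun h => by
    obtain ⟨v, hv, hr⟩ := exists_represents_symm ξ h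
    exact ⟨⟨v, hv⟩, hr⟩⟩

theorem represents_chart {v : SobolevLoopSpace n M} (h : v ∈ (c.loopChart v₀).chart.source) :
    c.Represents v (SobolevSection.toFun ((c.loopChart v₀).chart v : SobolevSection c.A 2)) := by
  have h' : ∃ ξ : SobolevSection c.A 2, c.Represents v ξ := h
  have e : c.loopEquiv v₀ v = h'.choose := dif_pos h'
  change c.Represents v (c.loopEquiv v₀ v).toFun
  rw [e]
  exact h'.choose_spec

theorem represents_symm {ξ : SobolevSection c.A 2} (h : ξ ∈ (c.loopChart v₀).chart.target) :
    c.Represents ((c.loopChart v₀).chart.symm ξ : SobolevLoopSpace n M) ξ := by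
  have h' : ∃ v : SobolevLoopSpace n M, c.Represents v ξ := h
  have e : (c.loopEquiv v₀).symm ξ = h'.choose := dif_pos h'
  change c.Represents ((c.loopEquiv v₀).symm ξ).toFun ξ
  rw [e]
  exact h'.choose_spec

theorem chart_apply {v : SobolevLoopSpace n M} (h : v ∈ (c.loopChart v₀).chart.source) (t : ℝ) :
    SobolevSection.toFun ((c.loopChart v₀).chart v : SobolevSection c.A 2) t =
      c.fwd (t, v (toCircle t)) :=
  ((represents_iff.1 (represents_chart h)) t).2.symm

theorem symm_apply {ξ : SobolevSection c.A 2} (h : ξ ∈ (c.loopChart v₀).chart.target) (t : ℝ) :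
    ((c.loopChart v₀).chart.symm ξ : SobolevLoopSpace n M) (toCircle t) = c.bwd (t, ξ t) :=
  ((represents_iff_symm.1 (represents_symm h)) t).2.symm

end FiberChart

/-- Sections with graph in an invariant open set form an open set. -/
theorem SobolevSection.isOpen_forall_mem {A : EuclideanSpace ℝ (Fin n) ≃L[ℝ] EuclideanSpace ℝ (Fin n)}
    {k : ℕ} {Ω : Set (ℝ × EuclideanSpace ℝ (Fin n))} (hΩ : IsOpen Ω)
    (hA : ∀ t x, (t + 1, A x) ∈ Ω ↔ (t, x) ∈ Ω) :
    IsOpen {ξ : SobolevSection A (k + 1) | ∀ t, (t, ξ t) ∈ Ω} := by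
  rw [isOpen_iff_eventually]
  intro ξ hξ
  refine eventually_forall_of_periodic (p := fun (ζ : SobolevSection A (k + 1)) t => (t, ζ t) ∈ Ω)
    (fun ζ t => ?_) fun t => ?_
  · rw [ζ.equivariant, hA]
  · have h1 := ((SobolevSection.tendsto_iff (l := 𝓝 ξ)
      (Ξ := fun ζ : SobolevSection A (k + 1) => ζ)).1 tendsto_id).cconv t (mem_univ t)
    exact (tendsto_snd.prodMk_nhds h1).eventually (hΩ.mem_nhds (hξ t))

end FiberCharts

/-! ### Two auxiliary facts on sc-maps and linear families -/

section ScMaps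

variable {n : ℕ} {E F : ScScale}

theorem ScSmoothOn.continuousOn {U : Set (E.X 0)} {f : E.X 0 → F.X 0} (h : ScSmoothOn E F U f) :
    ContinuousOn f U := by
  obtain ⟨g, hg, hgf⟩ := h 0 0
  exact ContinuousOn.congr hg fun x hx => (hgf x hx).symm

/-- The pair of the time and a linear family. -/
theorem SobLin.sobC_graph {V : Type*} [NormedAddCommGroup V] [NormedSpace ℝ V] [CompleteSpace V]
    {k k₀ : ℕ} {σ : E.X 0 → ℝ → V} (h : SobLin E k₀ σ) {U : Set (E.X 0)} :
    SobC k E U k₀ (fun x t => (t, σ x t)) :=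
  (SobC.const (f := fun t : ℝ => t) contDiff_id).prodMk h.sobC

end ScMaps

/-! ### Transition maps are sc-smooth -/

section Transitions

variable {n : ℕ} {M : Type*} [TopologicalSpace M] [ChartedSpace (EuclideanSpace ℝ (Fin n)) M]
  [IsManifold (𝓡 n) ∞ M] {Z W : Type*} [NormedAddCommGroup Z] [NormedSpace ℝ Z]
  [NormedAddCommGroup W] [NormedSpace ℝ W]

/-- Composition of a smooth function on `ℝ × M` with a smooth map to `ℝ × M`. -/
theorem ContMDiffOn.contDiffOn_comp_pair {S : Set (ℝ × M)} {G : ℝ × M → W}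
    (hG : ContMDiffOn (𝓘(ℝ, ℝ).prod (𝓡 n)) 𝓘(ℝ, W) ∞ G S) {Ω : Set Z} {τ : Z → ℝ}
    (hτ : ContDiff ℝ ∞ τ) {H : Z → M} (hH : ContMDiffOn 𝓘(ℝ, Z) (𝓡 n) ∞ H Ω) :
    ContDiffOn ℝ ∞ (fun z => G (τ z, H z)) {z | z ∈ Ω ∧ (τ z, H z) ∈ S} :=
  (hG.comp ((hτ.contMDiff.contMDiffOn (s := Ω)).prodMk hH |>.mono fun z hz => hz.1)
    fun z hz => hz.2).contDiffOn

theorem isOpen_comp_pair {S : Set (ℝ × M)} (hS : IsOpen S) {Ω : Set Z} (hΩ : IsOpen Ω) {τ : Z → ℝ}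
    (hτ : Continuous τ) {H : Z → M} (hH : ContinuousOn H Ω) :
    IsOpen {z | z ∈ Ω ∧ (τ z, H z) ∈ S} :=
  (hτ.continuousOn.prodMk hH).isOpen_inter_preimage hΩ hS

namespace FiberChart

variable (c d : FiberChart n M) {v₀ w₀ : SobolevLoopSpace n M}

/-- The domain of the transition from `c` to `d`. -/
def overlap : Set (ℝ × EuclideanSpace ℝ (Fin n)) :=
  {p | p ∈ c.e.target ∧ (p.1, c.bwd p) ∈ d.e.source}

theorem isOpen_overlap : IsOpen (c.overlap d) :=
  isOpen_comp_pair d.e.open_source c.e.open_target continuous_fst c.contMDiffOn_bwd.continuousOn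

theorem contDiffOn_overlap :
    ContDiffOn ℝ ∞ (fun p => d.fwd (p.1, c.bwd p)) (c.overlap d) :=
  d.contMDiffOn_fwd.contDiffOn_comp_pair contDiff_fst c.contMDiffOn_bwd

theorem mem_overlap_add_one (t : ℝ) (x : EuclideanSpace ℝ (Fin n)) :
    (t + 1, c.A x) ∈ c.overlap d ↔ (t, x) ∈ c.overlap d := by
  simp only [overlap, mem_ofPred_eq, mem_target_add_one]
  refine and_congr_right fun h => ?_
  rw [bwd_add_one h, d.source_iff]

theorem isOpen_chart_target : IsOpen (c.loopChart v₀).chart.target := by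
  have : (c.loopChart v₀).chart.target =
      {ξ : SobolevSection c.A (1 + 1) | ∀ t, (t, ξ t) ∈ c.e.target} :=
    Set.ext fun ξ => mem_chart_target_iff
  rw [this]
  exact SobolevSection.isOpen_forall_mem c.e.open_target fun t x => mem_target_add_one

theorem overlap_eq : (c.loopChart v₀).chart.target ∩
    (c.loopChart v₀).chart.symm ⁻¹' (d.loopChart w₀).chart.source =
      {ξ : SobolevSection c.A (1 + 1) | ∀ t, (t, ξ t) ∈ c.overlap d} := by
  ext ξ
  constructor
  · rintro ⟨h1, h2⟩ t
    refine ⟨mem_chart_target_iff.1 h1 t, ?_⟩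
    rw [← symm_apply h1]
    exact (mem_source_iff (v₀ := w₀)).1 h2 t
  · intro h
    have h1 : ξ ∈ (c.loopChart v₀).chart.target := mem_chart_target_iff.2 fun t => (h t).1
    refine ⟨h1, (mem_source_iff (v₀ := w₀)).2 fun t => ?_⟩
    rw [symm_apply h1]
    exact (h t).2

theorem isOpen_overlap_chart : IsOpen ((c.loopChart v₀).chart.target ∩
    (c.loopChart v₀).chart.symm ⁻¹' (d.loopChart w₀).chart.source) := by
  rw [overlap_eq]
  exact SobolevSection.isOpen_forall_mem (c.isOpen_overlap d) (c.mem_overlap_add_one d)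

/-- The transition is the superposition with the smooth map `(t, x) ↦ d.fwd (t, c.bwd (t, x))`,
which changes neither the time nor the order of derivatives. -/
theorem scSmoothOn_transition : ScSmoothOn (c.loopChart v₀).model (d.loopChart w₀).model
    ((c.loopChart v₀).chart.target ∩ (c.loopChart v₀).chart.symm ⁻¹' (d.loopChart w₀).chart.source)
    (fun y => (d.loopChart w₀).chart ((c.loopChart v₀).chart.symm y)) := by
  refine scSmoothOn_of_sobC isRegular_sobolevScale (c.isOpen_overlap_chart d) fun x hx =>
    ⟨univ, isOpen_univ, mem_univ _, fun ξ t => d.fwd (t, c.bwd (t, SobolevSection.toFun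
      (ξ : SobolevSection c.A 2) t)), fun k => ?_, ?_⟩
  · refine (sobLin_sobolevScale.sobC_graph).superpose (k₀ := 1) (c.isOpen_overlap d)
      (c.contDiffOn_overlap d) fun ξ hξ t => ?_
    have h1 := hξ.1
    rw [overlap_eq] at h1
    exact h1 t
  · rintro ξ ⟨⟨h1, h2⟩, -⟩ t
    exact (chart_apply h2 t).trans (congrArg (fun q => d.fwd (t, q)) (symm_apply h1 t))

end FiberChart

end Transitions

/-! ### The topology of the loop space -/

section LoopTopology

variable {n : ℕ} {M : Type*} [TopologicalSpace M] [ChartedSpace (EuclideanSpace ℝ (Fin n)) M]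
  [IsManifold (𝓡 n) ∞ M]

namespace FiberChart

variable (c : FiberChart n M) (v₀ : SobolevLoopSpace n M)

theorem isOpen_chart_preimage {V : Set (SobolevSection c.A 2)} (hV : IsOpen V) :
    IsOpen ((c.loopChart v₀).chart.source ∩ (c.loopChart v₀).chart ⁻¹' V) :=
  TopologicalSpace.isOpen_generateFrom_of_mem ⟨_, ⟨c, v₀, rfl⟩, V, hV, rfl⟩

theorem isOpen_chart_source : IsOpen (c.loopChart v₀).chart.source := by
  have := c.isOpen_chart_preimage v₀ isOpen_univ
  exact (inter_univ (c.loopChart v₀).chart.source) ▸ this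

theorem continuousOn_chart :
    ContinuousOn (c.loopChart v₀).chart (c.loopChart v₀).chart.source :=
  (continuousOn_open_iff (c.isOpen_chart_source v₀)).2 fun V hV => c.isOpen_chart_preimage v₀ hV

/-- The topology is generated by preimages under charts. Continuity of an inverse chart is therefore
continuity of the transition maps, together with openness of their domains. -/
theorem continuousOn_chart_symm :
    ContinuousOn (c.loopChart v₀).chart.symm (c.loopChart v₀).chart.target := by
  refine continuousOn_isOpen_of_generateFrom ?_
  rintro _ ⟨_, ⟨d, w₀, rfl⟩, V, hV, rfl⟩
  have h1 := (c.scSmoothOn_transition d (v₀ := v₀) (w₀ := w₀)).continuousOn.isOpen_inter_preimage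
    (c.isOpen_overlap_chart d) hV
  rw [preimage_inter, ← inter_assoc]
  exact h1

end FiberChart

variable {N : ℕ}

/-- The push forward of loops by a smooth function. -/
noncomputable def loopPush {G : M → EuclideanSpace ℝ (Fin N)}
    (hG : ContMDiff (𝓡 n) 𝓘(ℝ, EuclideanSpace ℝ (Fin N)) ∞ G) (v : SobolevLoopSpace n M) :
    SobolevSection (ContinuousLinearEquiv.refl ℝ (EuclideanSpace ℝ (Fin N))) 2 :=
  have h : SobolevOn 2 univ (fun t => G (v (toCircle t))) :=
    v.sobolev.sobolevOn_comp (k := 1) (S := univ) (G := fun p : ℝ × M => G p.2) isOpen_univ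
      (hG.comp contMDiff_snd).contMDiffOn isOpen_univ fun _ _ => mem_univ _
  SobolevSection.ofSobolevOn (fun t => G (v (toCircle t)))
    (continuousOn_univ.1 (h.continuousOn (k := 1) isOpen_univ)) (fun t => by simp) h

/-- In a chart the push forward is the superposition with `G ∘ c.bwd`. -/
theorem continuousAt_loopPush {G : M → EuclideanSpace ℝ (Fin N)}
    (hG : ContMDiff (𝓡 n) 𝓘(ℝ, EuclideanSpace ℝ (Fin N)) ∞ G) {v : SobolevLoopSpace n M}
    {c : FiberChart n M} (hc : ∀ t, (t, v (toCircle t)) ∈ c.e.source) :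
    ContinuousAt (loopPush hG) v := by
  have hv : v ∈ (c.loopChart v).chart.source := FiberChart.mem_source_iff.2 hc
  have hsm : ScSmoothOn (sobolevScale c.A)
      (sobolevScale (ContinuousLinearEquiv.refl ℝ (EuclideanSpace ℝ (Fin N))))
      (c.loopChart v).chart.target (fun ξ => loopPush hG ((c.loopChart v).chart.symm ξ)) := by
    have hGb : ContDiffOn ℝ ∞ (fun p => G (c.bwd p)) c.e.target :=
      (hG.comp_contMDiffOn c.contMDiffOn_bwd).contDiffOn
    refine scSmoothOn_of_sobC (n := N) isRegular_sobolevScale c.isOpen_chart_target fun x hx =>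
      ⟨univ, isOpen_univ, mem_univ _, fun ξ t => G (c.bwd (t, SobolevSection.toFun
        (ξ : SobolevSection c.A 2) t)), fun k => ?_, ?_⟩
    · exact (sobLin_sobolevScale.sobC_graph).superpose (k₀ := 1) c.e.open_target hGb
        fun ξ hξ t => FiberChart.mem_chart_target_iff.1 hξ.1 t
    · rintro ξ ⟨h1, -⟩ t
      exact congrArg G (FiberChart.symm_apply h1 t)
  have h1 : ContinuousAt (fun ξ => loopPush hG ((c.loopChart v).chart.symm ξ))
      ((c.loopChart v).chart v) :=
    hsm.continuousOn.continuousAt (c.isOpen_chart_target.mem_nhds ((c.loopChart v).chart.map_source hv))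
  have h2 := h1.comp ((c.continuousOn_chart v).continuousAt ((c.isOpen_chart_source v).mem_nhds hv))
  refine h2.congr ?_
  filter_upwards [(c.isOpen_chart_source v).mem_nhds hv] with w hw
  exact congrArg (loopPush hG) ((c.loopChart v).chart.left_inv hw)

theorem tendsto_loop_of_chart {ι : Type*} {l : Filter ι} {V : ι → SobolevLoopSpace n M}
    {v : SobolevLoopSpace n M} {c : FiberChart n M} (hv : v ∈ (c.loopChart v).chart.source)
    (h1 : ∀ᶠ i in l, V i ∈ (c.loopChart v).chart.source)
    (h2 : Tendsto (fun i => (c.loopChart v).chart (V i)) l (𝓝 ((c.loopChart v).chart v))) :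
    Tendsto V l (𝓝 v) := by
  have h3 : ContinuousAt (c.loopChart v).chart.symm ((c.loopChart v).chart v) :=
    (c.continuousOn_chart_symm v).continuousAt
      (c.isOpen_chart_target.mem_nhds ((c.loopChart v).chart.map_source hv))
  have h4 := h3.tendsto.comp h2
  rw [(c.loopChart v).chart.left_inv hv] at h4
  refine h4.congr' ?_
  filter_upwards [h1] with i hi
  exact (c.loopChart v).chart.left_inv hi

end LoopTopology

/-! ### Metrizability of the loop space -/

section Metrizability

variable {n : ℕ} {M : Type*} [TopologicalSpace M] [ChartedSpace (EuclideanSpace ℝ (Fin n)) M]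
  [IsManifold (𝓡 n) ∞ M] [T2Space M]

/-- A bump function at `x`, as a vector valued function. -/
noncomputable def bumpVec (x : M) (f : SmoothBumpFunction (𝓡 n) x) (q : M) :
    EuclideanSpace ℝ (Fin 1) := f q • EuclideanSpace.single 0 1

theorem contMDiff_bumpVec (x : M) (f : SmoothBumpFunction (𝓡 n) x) :
    ContMDiff (𝓡 n) 𝓘(ℝ, EuclideanSpace ℝ (Fin 1)) ∞ (bumpVec x f) :=
  f.contMDiff.smul contMDiff_const

theorem bumpVec_apply (x : M) (f : SmoothBumpFunction (𝓡 n) x) (q : M) :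
    bumpVec x f q 0 = f q := by simp [bumpVec]

theorem contMDiff_bumpChart (x : M) (f : SmoothBumpFunction (𝓡 n) x) :
    ContMDiff (𝓡 n) 𝓘(ℝ, EuclideanSpace ℝ (Fin n)) ∞
      (fun q => f q • chartAt (EuclideanSpace ℝ (Fin n)) x q) :=
  f.contMDiff_smul contMDiffOn_chart

/-- Where the bump function does not vanish, the point is recovered from the value of the bump
function and from the localized chart. Both are defined on all of `M`. -/
theorem chart_symm_bump {x : M} {f : SmoothBumpFunction (𝓡 n) x} {q : M} (hq : bumpVec x f q 0 ≠ 0) :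
    (chartAt (EuclideanSpace ℝ (Fin n)) x).symm
      ((bumpVec x f q 0)⁻¹ • f q • chartAt (EuclideanSpace ℝ (Fin n)) x q) = q ∧
    q ∈ (chartAt (EuclideanSpace ℝ (Fin n)) x).source := by
  rw [bumpVec_apply] at hq ⊢
  have : q ∈ (chartAt (EuclideanSpace ℝ (Fin n)) x).source := f.support_subset_source hq
  rw [inv_smul_smul₀ hq]
  exact ⟨(chartAt _ x).left_inv this, this⟩

/-- Loops are convergent if their images under bump functions and localized charts are. -/
theorem tendsto_loop_of_loopPush {ι : Type*} {l : Filter ι} {V : ι → SobolevLoopSpace n M}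
    {v : SobolevLoopSpace n M} {c : FiberChart n M} (hc : ∀ t, (t, v (toCircle t)) ∈ c.e.source)
    {J : Set M} (f : ∀ x : M, SmoothBumpFunction (𝓡 n) x) (hJ : ∀ q, ∃ x ∈ J, f x q ≠ 0)
    (h1 : ∀ x ∈ J, Tendsto (fun i => loopPush (contMDiff_bumpVec x (f x)) (V i)) l
      (𝓝 (loopPush (contMDiff_bumpVec x (f x)) v)))
    (h2 : ∀ x ∈ J, Tendsto (fun i => loopPush (contMDiff_bumpChart x (f x)) (V i)) l
      (𝓝 (loopPush (contMDiff_bumpChart x (f x)) v))) :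
    Tendsto V l (𝓝 v) := by
  have hv : v ∈ (c.loopChart v).chart.source := FiberChart.mem_source_iff.2 hc
  have hT : ∀ x ∈ J, STendsto 2 l univ
      (fun i t => (bumpVec x (f x) (V i (toCircle t)),
        f x (V i (toCircle t)) • chartAt (EuclideanSpace ℝ (Fin n)) x (V i (toCircle t))))
      (fun t => (bumpVec x (f x) (v (toCircle t)),
        f x (v (toCircle t)) • chartAt (EuclideanSpace ℝ (Fin n)) x (v (toCircle t)))) :=
    fun x hx => (SobolevSection.tendsto_iff.1 (h1 x hx)).prodMk isOpen_univ
      (SobolevSection.tendsto_iff.1 (h2 x hx))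
  have hb : ∀ x ∈ J, ∀ t, f x (v (toCircle t)) ≠ 0 → ∀ᶠ p : ι × ℝ in l ×ˢ 𝓝 t,
      bumpVec x (f x) (V p.1 (toCircle p.2)) 0 ≠ 0 := by
    intro x hx t ht
    have h3 := ((continuous_fst.tendsto _).comp ((hT x hx).cconv (k := 1) t (mem_univ t)))
    have hev : Continuous fun y : EuclideanSpace ℝ (Fin 1) => y 0 := by fun_prop
    refine ((hev.tendsto _).comp h3).eventually_ne ?_
    rwa [bumpVec_apply]
  -- The pushed forward loops converge locally uniformly. The smooth recovery formula near a point
  -- where some bump function does not vanish yields convergence in `M`, and with it that almost all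
  -- loops lie in the domain of the chart.
  have hM : ∀ t, Tendsto (fun p : ι × ℝ => V p.1 (toCircle p.2)) (l ×ˢ 𝓝 t) (𝓝 (v (toCircle t))) := by
    intro t
    obtain ⟨x, hx, hxt⟩ := hJ (v (toCircle t))
    have hxt' : bumpVec x (f x) (v (toCircle t)) 0 ≠ 0 := by rwa [bumpVec_apply]
    have h3 := (hT x hx).cconv (k := 1) t (mem_univ t)
    have h4 : ContinuousAt (fun y : EuclideanSpace ℝ (Fin 1) × EuclideanSpace ℝ (Fin n) =>
        (chartAt (EuclideanSpace ℝ (Fin n)) x).symm ((y.1 0)⁻¹ • y.2))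
        (bumpVec x (f x) (v (toCircle t)),
          f x (v (toCircle t)) • chartAt (EuclideanSpace ℝ (Fin n)) x (v (toCircle t))) := by
      refine ContinuousAt.comp (g := (chartAt (EuclideanSpace ℝ (Fin n)) x).symm) ?_ ?_
      · refine (chartAt (EuclideanSpace ℝ (Fin n)) x).continuousAt_symm ?_
        have := (chartAt (EuclideanSpace ℝ (Fin n)) x).map_source (chart_symm_bump hxt').2
        simpa only [bumpVec_apply, inv_smul_smul₀ hxt] using this
      · have h5 : Continuous fun y : EuclideanSpace ℝ (Fin 1) × EuclideanSpace ℝ (Fin n) => y.1 0 := by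
          fun_prop
        exact (h5.continuousAt.inv₀ hxt').smul continuous_snd.continuousAt
    have h5 := h4.tendsto.comp h3
    rw [(chart_symm_bump hxt').1] at h5
    refine h5.congr' ?_
    filter_upwards [hb x hx t hxt] with p hp
    exact (chart_symm_bump hp).1
  have hev : ∀ᶠ i in l, V i ∈ (c.loopChart v).chart.source := by
    have := eventually_forall_of_periodic (l := l)
      (p := fun i t => (t, V i (toCircle t)) ∈ c.e.source) (fun i t => by
        rw [toCircle_add_one, c.source_iff])
      (fun t => (tendsto_snd.prodMk_nhds (hM t)).eventually (c.e.open_source.mem_nhds (hc t)))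
    filter_upwards [this] with i hi
    exact FiberChart.mem_source_iff.2 hi
  refine tendsto_loop_of_chart hv hev ?_
  refine SobolevSection.tendsto_iff.2 ⟨fun i => SobolevSection.sobolevOn _,
    SobolevSection.sobolevOn _, SobConv.of_local fun t _ => ?_⟩
  obtain ⟨x, hx, hxt⟩ := hJ (v (toCircle t))
  obtain ⟨a, ha, b, hbt, hab⟩ := eventually_prod_iff.1 (hb x hx t hxt)
  have hvb : ∀ᶠ s in 𝓝 t, bumpVec x (f x) (v (toCircle s)) 0 ≠ 0 := by
    have : Continuous fun s => bumpVec x (f x) (v (toCircle s)) 0 := by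
      have h3 := (contMDiff_bumpVec x (f x)).continuous.comp (v.sobolev.1.comp continuous_toCircle)
      have h4 : Continuous fun y : EuclideanSpace ℝ (Fin 1) => y 0 := by fun_prop
      exact h4.comp h3
    exact this.continuousAt.eventually_ne (by rwa [bumpVec_apply])
  obtain ⟨O, hOb, hO, htO⟩ := _root_.mem_nhds_iff.1 (inter_mem hbt hvb)
  -- The continuity theorem for superpositions requires the domain condition for every index, so the
  -- family is restricted to the indices for which it holds.
  refine ⟨O, hO, htO, SobConv.of_subtype (s := {i | a i ∧ V i ∈ (c.loopChart v).chart.source})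
    (inter_mem ha hev) ?_⟩
  set φ := chartAt (EuclideanSpace ℝ (Fin n)) x with hφ
  -- `H` recovers the point of `M` from time, bump value and localized chart value. On `O` the chart
  -- representation of a loop is therefore a superposition of its push forwards with a smooth
  -- function, which transfers convergence in `W^{2,2}`.
  let Ω₀ : Set (ℝ × EuclideanSpace ℝ (Fin 1) × EuclideanSpace ℝ (Fin n)) :=
    {p | p.2.1 0 ≠ 0} ∩ (fun p => (p.2.1 0)⁻¹ • p.2.2) ⁻¹' φ.target
  let H : ℝ × EuclideanSpace ℝ (Fin 1) × EuclideanSpace ℝ (Fin n) → M :=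
    fun p => φ.symm ((p.2.1 0)⁻¹ • p.2.2)
  have hsmul : ContDiffOn ℝ ∞ (fun p : ℝ × EuclideanSpace ℝ (Fin 1) × EuclideanSpace ℝ (Fin n) =>
      (p.2.1 0)⁻¹ • p.2.2) {p | p.2.1 0 ≠ 0} :=
    ContDiffOn.smul (ContDiffOn.inv (ContDiff.contDiffOn (by fun_prop)) fun p hp => hp)
      (ContDiff.contDiffOn (by fun_prop))
  have hΩ₀ : IsOpen Ω₀ := hsmul.continuousOn.isOpen_inter_preimage
    (isOpen_ne_fun (by fun_prop) continuous_const) φ.open_target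
  have hH : ContMDiffOn 𝓘(ℝ, ℝ × EuclideanSpace ℝ (Fin 1) × EuclideanSpace ℝ (Fin n)) (𝓡 n) ∞
      H Ω₀ := (contMDiffOn_chart_symm (I := 𝓡 n) (n := ∞) (x := x)).comp
    (hsmul.contMDiffOn.mono inter_subset_left) fun p hp => hp.2
  have hF := c.contMDiffOn_fwd.contDiffOn_comp_pair
    (contDiff_fst (𝕜 := ℝ) (E := ℝ) (F := EuclideanSpace ℝ (Fin 1) × EuclideanSpace ℝ (Fin n))) hH
  have hΩ := isOpen_comp_pair c.e.open_source hΩ₀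
    (continuous_fst (X := ℝ) (Y := EuclideanSpace ℝ (Fin 1) × EuclideanSpace ℝ (Fin n)))
    hH.continuousOn
  have hmem : ∀ (w : SobolevLoopSpace n M), (∀ t, (t, w (toCircle t)) ∈ c.e.source) → ∀ s,
      bumpVec x (f x) (w (toCircle s)) 0 ≠ 0 →
      (s, bumpVec x (f x) (w (toCircle s)), f x (w (toCircle s)) • φ (w (toCircle s))) ∈
        {z | z ∈ Ω₀ ∧ (z.1, H z) ∈ c.e.source} ∧
      H (s, bumpVec x (f x) (w (toCircle s)), f x (w (toCircle s)) • φ (w (toCircle s))) =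
        w (toCircle s) := by
    intro w hw s hs
    have h3 := chart_symm_bump hs
    refine ⟨⟨⟨hs, ?_⟩, ?_⟩, h3.1⟩
    · have := φ.map_source h3.2
      rw [bumpVec_apply] at hs
      simpa only [mem_preimage, bumpVec_apply, inv_smul_smul₀ hs] using this
    · change (s, H _) ∈ c.e.source
      simp only [H]
      rw [h3.1]
      exact hw s
  have hid : STendsto 2 (comap ((↑) : {i | a i ∧ V i ∈ (c.loopChart v).chart.source} → ι) l) O
      (fun _ t => t) (fun t : ℝ => t) :=
    (contDiff_id.sobolevOn hO).sTendsto hO _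
  have h6 := (hid.prodMk hO (((hT x hx).mono (subset_univ O)).comp_tendsto tendsto_comap)).superpose
    (k := 1) hO hΩ hF
    (fun i s hs => (hmem _ (FiberChart.mem_source_iff.1 i.2.2) s (hab i.2.1 (hOb hs).1)).1)
    (fun s hs => (hmem _ hc s (hOb hs).2).1)
  refine h6.conv.congr hO (Eventually.of_forall fun i s hs => ?_) fun s hs => ?_
  · rw [FiberChart.chart_apply i.2.2]
    exact congrArg (fun q => c.fwd (s, q))
      (hmem _ (FiberChart.mem_source_iff.1 i.2.2) s (hab i.2.1 (hOb hs).1)).2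
  · rw [FiberChart.chart_apply hv]
    exact congrArg (fun q => c.fwd (s, q)) (hmem _ hc s (hOb hs).2).2

/-- Second countability provides countably many bump functions whose supports cover `M`. The
corresponding push forwards embed the loop space into a countable product of normed spaces. The
Hausdorff property and paracompactness follow from metrizability. -/
theorem metrizableSpace_sobolevLoopSpace [SecondCountableTopology M]
    (hcov : ∀ v : SobolevLoopSpace n M, ∃ c : FiberChart n M, ∀ t, (t, v (toCircle t)) ∈ c.e.source) :
    TopologicalSpace.MetrizableSpace (SobolevLoopSpace n M) := by
  let f : ∀ x : M, SmoothBumpFunction (𝓡 n) x := fun x => Classical.arbitrary _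
  obtain ⟨J, hJc, hJ⟩ := TopologicalSpace.countable_cover_nhds (f := fun x => Function.support (f x))
    fun x => (f x).support_mem_nhds
  have hJ' : ∀ q, ∃ x ∈ J, f x q ≠ 0 := fun q => by
    have : q ∈ ⋃ x ∈ J, Function.support (f x) := by rw [hJ]; trivial
    simpa using this
  have : Countable J := hJc.to_subtype
  let Φ : SobolevLoopSpace n M → ∀ x : J,
      SobolevSection (ContinuousLinearEquiv.refl ℝ (EuclideanSpace ℝ (Fin 1))) 2 ×
        SobolevSection (ContinuousLinearEquiv.refl ℝ (EuclideanSpace ℝ (Fin n))) 2 :=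
    fun v x => (loopPush (contMDiff_bumpVec x.1 (f x)) v, loopPush (contMDiff_bumpChart x.1 (f x)) v)
  have hΦ : IsInducing Φ := by
    refine isInducing_iff_nhds.2 fun v => le_antisymm ?_ ?_
    · rw [← tendsto_iff_comap, tendsto_pi_nhds]
      obtain ⟨c, hc⟩ := hcov v
      exact fun x => (continuousAt_loopPush _ hc).prodMk_nhds (continuousAt_loopPush _ hc)
    · obtain ⟨c, hc⟩ := hcov v
      have h := tendsto_pi_nhds.1 (tendsto_comap (f := Φ) (x := 𝓝 (Φ v)))
      exact tendsto_loop_of_loopPush (V := id) hc f hJ'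
        (fun x hx => (continuous_fst.tendsto _).comp (h ⟨x, hx⟩))
        (fun x hx => (continuous_snd.tendsto _).comp (h ⟨x, hx⟩))
  have hinj : Function.Injective Φ := by
    intro v w h
    refine SobolevLoopSpace.ext (funext fun z => ?_)
    obtain ⟨t, rfl⟩ := toCircle_surjective z
    obtain ⟨x, hx, hxt⟩ := hJ' (v (toCircle t))
    have h1 := congrFun h ⟨x, hx⟩
    have h2 : bumpVec x (f x) (v (toCircle t)) = bumpVec x (f x) (w (toCircle t)) :=
      congrArg (fun p => SobolevSection.toFun (Prod.fst p) t) h1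
    have h3 : f x (v (toCircle t)) • chartAt (EuclideanSpace ℝ (Fin n)) x (v (toCircle t)) =
        f x (w (toCircle t)) • chartAt (EuclideanSpace ℝ (Fin n)) x (w (toCircle t)) :=
      congrArg (fun p => SobolevSection.toFun (Prod.snd p) t) h1
    have h4 : bumpVec x (f x) (v (toCircle t)) 0 ≠ 0 := by rwa [bumpVec_apply]
    have h5 : bumpVec x (f x) (w (toCircle t)) 0 ≠ 0 := by rwa [← h2]
    change v (toCircle t) = w (toCircle t)
    rw [← (chart_symm_bump h4).1, ← (chart_symm_bump h5).1, h2, h3]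
  exact (IsEmbedding.mk hΦ hinj).metrizableSpace

end Metrizability

/-! ### The manifold structure and the levels of the loop space -/

section LoopManifold

variable {n : ℕ} {M : Type*} [TopologicalSpace M] [ChartedSpace (EuclideanSpace ℝ (Fin n)) M]
  [IsManifold (𝓡 n) ∞ M]

theorem isScManifold_sobolevLoopSpace [T2Space M] [SecondCountableTopology M]
    (hcov : ∀ v : SobolevLoopSpace n M, ∃ c : FiberChart n M, ∀ t, (t, v (toCircle t)) ∈ c.e.source) :
    IsScManifold (SobolevLoopSpace n M) (loopAtlas n M) := by
  have := metrizableSpace_sobolevLoopSpace hcov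
  let := TopologicalSpace.metrizableSpaceMetric (SobolevLoopSpace n M)
  refine ⟨inferInstance, inferInstance, ?_, ?_, ?_, ?_, ?_, ?_, ?_⟩
  · rintro _ ⟨c, v₀, rfl⟩
    exact isScBanach_sobolevScale
  · rintro _ ⟨c, v₀, rfl⟩
    exact c.isOpen_chart_source v₀
  · rintro _ ⟨c, v₀, rfl⟩
    exact c.isOpen_chart_target
  · rintro _ ⟨c, v₀, rfl⟩
    exact c.continuousOn_chart v₀
  · rintro _ ⟨c, v₀, rfl⟩
    exact c.continuousOn_chart_symm v₀
  · intro v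
    obtain ⟨c, hc⟩ := hcov v
    exact ⟨_, ⟨c, v, rfl⟩, FiberChart.mem_source_iff.2 hc⟩
  · rintro _ ⟨c, v₀, rfl⟩ _ ⟨d, w₀, rfl⟩
    exact c.scSmoothOn_transition d

theorem FiberChart.mem_range_toBase_chart_iff {c : FiberChart n M} {v₀ v : SobolevLoopSpace n M}
    (hv : v ∈ (c.loopChart v₀).chart.source) (m : ℕ) :
    (c.loopChart v₀).chart v ∈ range ((c.loopChart v₀).model.toBase m) ↔
      IsSobolevLoop n (m + 2) v.toFun := by
  refine (mem_range_toBase_iff (A := c.A)).trans ⟨fun h => ?_, fun h => ?_⟩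
  · exact FiberChart.isSobolevLoop_of_represents (k := m + 1) (FiberChart.represents_chart hv) h
  · refine SobolevOn.congr isOpen_univ (FiberChart.sobolevOn_fwd (k := m + 1) h
      (FiberChart.mem_source_iff.1 hv)) fun t _ => ?_
    exact (FiberChart.chart_apply hv t).symm

theorem scLevel_loopAtlas
    (hcov : ∀ v : SobolevLoopSpace n M, ∃ c : FiberChart n M, ∀ t, (t, v (toCircle t)) ∈ c.e.source)
    (m : ℕ) : scLevel (loopAtlas n M) m = {v | IsSobolevLoop n (m + 2) v.toFun} := by
  ext v
  constructor
  · rintro ⟨_, ⟨c, v₀, rfl⟩, hv, h⟩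
    exact (FiberChart.mem_range_toBase_chart_iff hv m).1 h
  · intro h
    obtain ⟨c, hc⟩ := hcov v
    have hv : v ∈ (c.loopChart v).chart.source := FiberChart.mem_source_iff.2 hc
    exact ⟨_, ⟨c, v, rfl⟩, hv, (FiberChart.mem_range_toBase_chart_iff hv m).2 h⟩

end LoopManifold

/-! ### Restriction to open subsets -/

theorem Sc0On.mono {E F : ScScale} {U U' : Set (E.X 0)} {f : E.X 0 → F.X 0} (h : Sc0On E F U f)
    (hU' : U' ⊆ U) : Sc0On E F U' f := fun m => by
  obtain ⟨g, hg, hgf⟩ := h m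
  exact ⟨g, hg.mono (preimage_mono hU'), fun x hx => hgf x (hU' hx)⟩

theorem ScOn.mono {k : ℕ} {E F : ScScale} {U U' : Set (E.X 0)} {f : E.X 0 → F.X 0}
    (h : ScOn k E F U f) (hU' : U' ⊆ U) : ScOn k E F U' f := by
  induction k generalizing E F with
  | zero => exact Sc0On.mono h hU'
  | succ k ih =>
    obtain ⟨h0, T, hT, h1⟩ := h
    exact ⟨h0.mono hU', T, fun x hx => hT x (hU' hx), ih h1 fun p hp => hU' hp⟩

section Restriction

variable {X : Type*} [TopologicalSpace X] {𝒜 : Set (ScChart X)} {S : Set X}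

theorem ScChart.restrict_symm_apply {c : ScChart X} {x₀ : S} {y : c.model.X 0}
    (hy : y ∈ (c.restrict S x₀).chart.target) :
    (((c.restrict S x₀).chart.symm y : S) : X) = c.chart.symm y := by
  have h : c.chart.symm y ∈ S := hy.2
  exact congrArg Subtype.val (dif_pos h)

/-- On an open subset of an sc-manifold, the restricted charts define the structure of an
sc-manifold. -/
theorem IsScManifold.restrict (h : IsScManifold X 𝒜) (hS : IsOpen S) [ParacompactSpace S] :
    IsScManifold S (restrictAtlas 𝒜 S) where
  t2 := have := h.t2; inferInstance
  paracompact := inferInstance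
  banach := by
    rintro _ ⟨c, hc, x₀, rfl⟩
    exact h.banach c hc
  open_source := by
    rintro _ ⟨c, hc, x₀, rfl⟩
    exact (h.open_source c hc).preimage continuous_subtype_val
  open_target := by
    rintro _ ⟨c, hc, x₀, rfl⟩
    exact (h.continuousOn_symm c hc).isOpen_inter_preimage (h.open_target c hc) hS
  continuousOn := by
    rintro _ ⟨c, hc, x₀, rfl⟩
    exact (h.continuousOn c hc).comp continuous_subtype_val.continuousOn fun x hx => hx
  continuousOn_symm := by
    rintro _ ⟨c, hc, x₀, rfl⟩
    rw [continuousOn_iff_continuous_domRestrict, continuous_induced_rng,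
      ← continuousOn_univ]
    rw [continuousOn_univ]
    have : ContinuousOn c.chart.symm (c.restrict S x₀).chart.target :=
      (h.continuousOn_symm c hc).mono inter_subset_left
    refine (continuousOn_iff_continuous_domRestrict.1 this).congr fun y => ?_
    exact (ScChart.restrict_symm_apply y.2).symm
  cover x := by
    obtain ⟨c, hc, hx⟩ := h.cover x
    exact ⟨_, ⟨c, hc, x, rfl⟩, hx⟩
  compatible := by
    rintro _ ⟨c, hc, x₀, rfl⟩ _ ⟨d, hd, y₀, rfl⟩ k
    have hset : (c.restrict S x₀).chart.target ∩
        (c.restrict S x₀).chart.symm ⁻¹' (d.restrict S y₀).chart.source =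
        (c.chart.target ∩ c.chart.symm ⁻¹' d.chart.source) ∩
          (c.chart.target ∩ c.chart.symm ⁻¹' S) := by
      ext y
      constructor
      · rintro ⟨hy, hd'⟩
        refine ⟨⟨hy.1, ?_⟩, hy⟩
        change c.chart.symm y ∈ d.chart.source
        exact (ScChart.restrict_symm_apply hy) ▸ hd'
      · rintro ⟨⟨-, hd'⟩, hy⟩
        refine ⟨hy, ?_⟩
        change (((c.restrict S x₀).chart.symm y : S) : X) ∈ d.chart.source
        rw [ScChart.restrict_symm_apply (x₀ := x₀) hy]
        exact hd'
    have ho := (h.continuousOn_symm c hc).isOpen_inter_preimage (h.open_target c hc)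
      (h.open_source d hd)
    have ho' := (h.continuousOn_symm c hc).isOpen_inter_preimage (h.open_target c hc) hS
    rw [hset]
    refine ScOn.congr (ho.inter ho') ((h.compatible c hc d hd k).mono inter_subset_left) ?_
    rintro y ⟨-, hy⟩
    exact congrArg d.chart (ScChart.restrict_symm_apply (x₀ := x₀) hy).symm

theorem scLevel_restrictAtlas (m : ℕ) :
    scLevel (restrictAtlas 𝒜 S) m = {x : S | (x : X) ∈ scLevel 𝒜 m} := by
  ext x
  constructor
  · rintro ⟨_, ⟨c, hc, x₀, rfl⟩, hx, h⟩
    exact ⟨c, hc, hx, h⟩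
  · rintro ⟨c, hc, hx, h⟩
    exact ⟨_, ⟨c, hc, x, rfl⟩, hx, h⟩

end Restriction

/-! ### The inverse function theorem relative to the time coordinate -/

section FiberRegular

variable {X : Type*} [NormedAddCommGroup X] [NormedSpace ℝ X] [FiniteDimensional ℝ X]

/-- The derivative of `G (t, x)` in the direction of `x`. -/
noncomputable def fiberDeriv (G : ℝ × X → X) (z : ℝ × X) : X →L[ℝ] X :=
  (fderiv ℝ G z).comp (ContinuousLinearMap.inr ℝ ℝ X)

/-- `G` is smooth near `z`, and its derivative in the direction of `X` at `z` is invertible. -/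
def IsFiberRegularAt (G : ℝ × X → X) (z : ℝ × X) : Prop :=
  (∀ᶠ z' in 𝓝 z, ContDiffAt ℝ ∞ G z') ∧ (fiberDeriv G z).det ≠ 0

variable {G G' : ℝ × X → X} {z : ℝ × X}

theorem IsFiberRegularAt.contDiffAt (h : IsFiberRegularAt G z) : ContDiffAt ℝ ∞ G z :=
  h.1.self_of_nhds

theorem ContDiffAt.continuousAt_fiberDeriv (h : ContDiffAt ℝ ∞ G z) :
    ContinuousAt (fiberDeriv G) z :=
  (h.fderiv_right (m := 0) (by simp)).continuousAt.clm_comp continuousAt_const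

theorem IsFiberRegularAt.eventually (h : IsFiberRegularAt G z) :
    ∀ᶠ z' in 𝓝 z, IsFiberRegularAt G z' :=
  (eventually_eventually_nhds.2 h.1).and <|
    (ContinuousLinearMap.continuous_det.continuousAt.comp
      h.contDiffAt.continuousAt_fiberDeriv).eventually_ne h.2

theorem isOpen_isFiberRegularAt (G : ℝ × X → X) : IsOpen {z | IsFiberRegularAt G z} :=
  isOpen_iff_mem_nhds.2 fun _ h => IsFiberRegularAt.eventually h

theorem IsFiberRegularAt.congr (h : IsFiberRegularAt G z) (hG : G' =ᶠ[𝓝 z] G) :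
    IsFiberRegularAt G' z := by
  refine ⟨?_, ?_⟩
  · filter_upwards [h.1, eventually_eventually_nhds.2 hG] with z' h1 h2
    exact h1.congr_of_eventuallyEq h2
  · rw [fiberDeriv, hG.fderiv_eq]
    exact h.2

theorem IsFiberRegularAt.comp {c : ℝ} {τ : X → X} (h : IsFiberRegularAt G (z.1 + c, τ z.2))
    (B : X ≃L[ℝ] X) (hτ : ∀ᶠ x in 𝓝 z.2, ContDiffAt ℝ ∞ τ x) (hτ' : (fderiv ℝ τ z.2).det ≠ 0) :
    IsFiberRegularAt (fun z => B (G (z.1 + c, τ z.2))) z := by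
  have hτz := hτ.self_of_nhds
  have hcd : ∀ z' : ℝ × X, ContDiffAt ℝ ∞ τ z'.2 →
      ContDiffAt ℝ ∞ (fun z : ℝ × X => (z.1 + c, τ z.2)) z' := fun z' hz' =>
    (contDiffAt_fst.add contDiffAt_const).prodMk (hz'.comp z' contDiffAt_snd)
  refine ⟨?_, ?_⟩
  · have h1 := (hcd z hτz).continuousAt.tendsto.eventually h.1
    filter_upwards [h1, (continuous_snd.tendsto z).eventually hτ] with z' h2 h3
    exact B.contDiff.contDiffAt.comp z' (ContDiffAt.comp z' h2 (hcd z' h3))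
  · have hd : HasFDerivAt (fun z : ℝ × X => (z.1 + c, τ z.2))
        ((ContinuousLinearMap.fst ℝ ℝ X).prod
          ((fderiv ℝ τ z.2).comp (ContinuousLinearMap.snd ℝ ℝ X))) z :=
      (hasFDerivAt_fst.add_const c).prodMk
        ((hτz.differentiableAt (by simp)).hasFDerivAt.comp z hasFDerivAt_snd)
    have hG := (h.contDiffAt.differentiableAt (by simp)).hasFDerivAt
    have hc := (B.hasFDerivAt (x := G (z.1 + c, τ z.2))).comp z (HasFDerivAt.comp z hG hd)
    have e : fiberDeriv (fun z => B (G (z.1 + c, τ z.2))) z =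
        (B : X →L[ℝ] X).comp ((fiberDeriv G (z.1 + c, τ z.2)).comp (fderiv ℝ τ z.2)) := by
      rw [fiberDeriv, show fderiv ℝ (fun z => B (G (z.1 + c, τ z.2))) z = _ from hc.fderiv]
      ext x
      simp [fiberDeriv]
    have hB : (B : X →L[ℝ] X).det ≠ 0 := (B.toLinearEquiv.isUnit_det').ne_zero
    rw [e]
    simp only [ContinuousLinearMap.det, ContinuousLinearMap.toLinearMap_comp, LinearMap.det_comp]
    exact mul_ne_zero hB (mul_ne_zero h.2 hτ')

/-- The derivative of `(t, x) ↦ (t, G (t, x))` is block triangular, so it is invertible when the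
fibre derivative is. Restricting to the open set of regular points makes the inverse smooth on its
whole domain, not only at the image of `z`. -/
theorem IsFiberRegularAt.exists_openPartialHomeomorph (h : IsFiberRegularAt G z) :
    ∃ Φ : OpenPartialHomeomorph (ℝ × X) (ℝ × X), z ∈ Φ.source ∧ (∀ z' , Φ z' = (z'.1, G z')) ∧
      ContDiffOn ℝ ∞ Φ.symm Φ.target := by
  have hd : ∀ z, IsFiberRegularAt G z → ∃ e : (ℝ × X) ≃L[ℝ] (ℝ × X),
      HasFDerivAt (fun z => (z.1, G z)) (e : (ℝ × X) →L[ℝ] (ℝ × X)) z := by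
    intro z hz
    have h1 : HasFDerivAt (fun z : ℝ × X => (z.1, G z))
        ((ContinuousLinearMap.fst ℝ ℝ X).prod (fderiv ℝ G z)) z :=
      hasFDerivAt_fst.prodMk (hz.contDiffAt.differentiableAt (by simp)).hasFDerivAt
    have hinj : Function.Injective ((ContinuousLinearMap.fst ℝ ℝ X).prod (fderiv ℝ G z)) := by
      rw [injective_iff_map_eq_zero]
      rintro ⟨s, x⟩ hsx
      have hs : s = 0 := congrArg Prod.fst hsx
      have hx : fiberDeriv G z x = 0 := by
        have := congrArg Prod.snd hsx
        rw [hs] at this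
        simpa [fiberDeriv] using this
      let B := (fiberDeriv G z).toContinuousLinearEquivOfDetNeZero hz.2
      have hx' : B x = 0 := hx
      rw [hs, (map_eq_zero_iff B B.injective).1 hx']
      rfl
    refine ⟨(LinearEquiv.ofInjectiveEndo _ hinj).toContinuousLinearEquiv, ?_⟩
    convert h1 using 1
    exact ContinuousLinearMap.ext fun _ => rfl
  have hc : ∀ z, IsFiberRegularAt G z → ContDiffAt ℝ ∞ (fun z => (z.1, G z)) z := fun z hz =>
    contDiffAt_fst.prodMk hz.contDiffAt
  obtain ⟨e, he⟩ := hd z h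
  let Φ := (hc z h).toOpenPartialHomeomorph _ he (by simp)
  have hΦ : ∀ z, Φ z = (z.1, G z) := fun z => rfl
  refine ⟨Φ.restrOpen _ (isOpen_isFiberRegularAt G), ⟨(hc z h).mem_toOpenPartialHomeomorph_source he
    (by simp), h⟩, hΦ, ?_⟩
  intro y hy
  refine ContDiffAt.contDiffWithinAt ?_
  have hy' := (Φ.restrOpen _ (isOpen_isFiberRegularAt G)).map_target hy
  obtain ⟨e', he'⟩ := hd _ hy'.2
  exact (Φ.restrOpen _ (isOpen_isFiberRegularAt G)).contDiffAt_symm hy he' (hc _ hy'.2)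

/-- Invertible maps near `B` can be deformed to `B` through invertible maps. -/
theorem ContinuousLinearMap.eventually_det_ne_zero {B : X →L[ℝ] X} (hB : B.det ≠ 0) :
    ∀ᶠ L in 𝓝 B, ∀ s ∈ Icc (0 : ℝ) 1, ((1 - s) • L + s • B).det ≠ 0 := by
  have h := ContinuousLinearMap.continuous_det.continuousAt.eventually_ne hB
  obtain ⟨r, hr, hball⟩ := Metric.eventually_nhds_iff_ball.1 h
  filter_upwards [Metric.ball_mem_nhds B hr] with L hL s hs
  refine hball _ ?_
  exact (convex_ball B r) hL (Metric.mem_ball_self hr) (by linarith [hs.2]) hs.1 (by ring)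

end FiberRegular

/-! ### Frames along a path in the manifold -/

section Frames

variable {X : Type*} [NormedAddCommGroup X] [NormedSpace ℝ X] [FiniteDimensional ℝ X]

theorem DifferentiableAt.hasFDerivAt_fiber {G : ℝ × X → X} {t : ℝ} {y : X}
    (h : DifferentiableAt ℝ G (t, y)) : HasFDerivAt (fun y => G (t, y)) (fiberDeriv G (t, y)) y := by
  have h1 : HasFDerivAt (fun y : X => (t, y)) (ContinuousLinearMap.inr ℝ ℝ X) y :=
    hasFDerivAt_prodMk_right t y
  exact HasFDerivAt.comp y h.hasFDerivAt h1

theorem isFiberRegularAt_clm (B : X ≃L[ℝ] X) (z : ℝ × X) :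
    IsFiberRegularAt (fun z : ℝ × X => B z.2) z := by
  have hs : ContDiff ℝ ∞ (fun z : ℝ × X => B z.2) := B.contDiff.comp contDiff_snd
  refine ⟨Eventually.of_forall fun z' => hs.contDiffAt, ?_⟩
  have h1 := (hs.contDiffAt (x := (z.1, z.2))).differentiableAt (by simp) |>.hasFDerivAt_fiber
  rw [show fiberDeriv (fun z : ℝ × X => B z.2) z = _ from h1.unique B.hasFDerivAt]
  exact (B.toLinearEquiv.isUnit_det').ne_zero

variable {n : ℕ} {M : Type*} [TopologicalSpace M] [ChartedSpace (EuclideanSpace ℝ (Fin n)) M]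
  [IsManifold (𝓡 n) ∞ M] {F F' : ℝ × M → EuclideanSpace ℝ (Fin n)} {t : ℝ} {q : M}

/-- The expression of `F` in the chart at `x`. -/
noncomputable def inChart (F : ℝ × M → EuclideanSpace ℝ (Fin n)) (x : M)
    (z : ℝ × EuclideanSpace ℝ (Fin n)) : EuclideanSpace ℝ (Fin n) :=
  F (z.1, (chartAt (EuclideanSpace ℝ (Fin n)) x).symm z.2)

/-- `F` is smooth near `(t, q)`, and its derivative in the direction of `M` is invertible there. -/
def IsFrameAt (F : ℝ × M → EuclideanSpace ℝ (Fin n)) (t : ℝ) (q : M) : Prop :=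
  IsFiberRegularAt (inChart F q) (t, chartAt (EuclideanSpace ℝ (Fin n)) q q)

theorem contDiffOn_chart_change (x y : M) :
    ContDiffOn ℝ ∞ (fun z => chartAt (EuclideanSpace ℝ (Fin n)) x
      ((chartAt (EuclideanSpace ℝ (Fin n)) y).symm z))
      ((chartAt (EuclideanSpace ℝ (Fin n)) y).target ∩
        (chartAt (EuclideanSpace ℝ (Fin n)) y).symm ⁻¹' (chartAt (EuclideanSpace ℝ (Fin n)) x).source) :=
  ((contMDiffOn_chart (I := 𝓡 n) (n := ∞) (x := x)).comp
    ((contMDiffOn_chart_symm (I := 𝓡 n) (n := ∞) (x := y)).mono inter_subset_left)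
    fun z hz => hz.2).contDiffOn

/-- Chart changes have invertible derivative, because composing with the reverse change gives the
identity. Regularity can thus be tested in any chart around the point. -/
theorem isFiberRegularAt_chart_change {x y : M}
    (hx : q ∈ (chartAt (EuclideanSpace ℝ (Fin n)) x).source)
    (hy : q ∈ (chartAt (EuclideanSpace ℝ (Fin n)) y).source)
    (h : IsFiberRegularAt (inChart F x) (t, chartAt (EuclideanSpace ℝ (Fin n)) x q)) :
    IsFiberRegularAt (inChart F y) (t, chartAt (EuclideanSpace ℝ (Fin n)) y q) := by
  have hcx := contDiffOn_chart_change (n := n) x y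
  have hcy := contDiffOn_chart_change (n := n) y x
  set φ := chartAt (EuclideanSpace ℝ (Fin n)) x
  set ψ := chartAt (EuclideanSpace ℝ (Fin n)) y
  have hoy : IsOpen (ψ.target ∩ ψ.symm ⁻¹' φ.source) :=
    ψ.continuousOn_symm.isOpen_inter_preimage ψ.open_target φ.open_source
  have hox : IsOpen (φ.target ∩ φ.symm ⁻¹' ψ.source) :=
    φ.continuousOn_symm.isOpen_inter_preimage φ.open_target ψ.open_source
  have hqy : ψ q ∈ ψ.target ∩ ψ.symm ⁻¹' φ.source :=
    ⟨ψ.map_source hy, by rwa [mem_preimage, ψ.left_inv hy]⟩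
  have hqx : φ q ∈ φ.target ∩ φ.symm ⁻¹' ψ.source :=
    ⟨φ.map_source hx, by rwa [mem_preimage, φ.left_inv hx]⟩
  have hτ : ∀ᶠ z in 𝓝 (ψ q), ContDiffAt ℝ ∞ (fun z => φ (ψ.symm z)) z := by
    filter_upwards [hoy.mem_nhds hqy] with z hz using hcx.contDiffAt (hoy.mem_nhds hz)
  have e1 : φ (ψ.symm (ψ q)) = φ q := by rw [ψ.left_inv hy]
  have hdet : (fderiv ℝ (fun z => φ (ψ.symm z)) (ψ q)).det ≠ 0 := by
    have h1 := (hτ.self_of_nhds.differentiableAt (by simp)).hasFDerivAt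
    have h2 : HasFDerivAt (fun z => ψ (φ.symm z)) (fderiv ℝ (fun z => ψ (φ.symm z)) (φ q))
        (φ (ψ.symm (ψ q))) := by
      rw [e1]
      exact ((hcy.contDiffAt (hox.mem_nhds hqx)).differentiableAt (by simp)).hasFDerivAt
    have h3 := HasFDerivAt.comp (ψ q) h2 h1
    have h4 : HasFDerivAt (fun z => ψ (φ.symm (φ (ψ.symm z))))
        (ContinuousLinearMap.id ℝ (EuclideanSpace ℝ (Fin n))) (ψ q) := by
      refine (hasFDerivAt_id _).congr_of_eventuallyEq ?_
      filter_upwards [hoy.mem_nhds hqy] with z hz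
      rw [φ.left_inv hz.2, ψ.right_inv hz.1, id]
    have h5 := congrArg ContinuousLinearMap.det (h3.unique h4)
    simp only [ContinuousLinearMap.det, ContinuousLinearMap.toLinearMap_comp, LinearMap.det_comp] at h5
    exact right_ne_zero_of_mul ((h5.trans LinearMap.det_id).trans_ne one_ne_zero)
  have h' : IsFiberRegularAt (inChart F x) ((t, ψ q).1 + 0, φ (ψ.symm (t, ψ q).2)) := by
    simpa only [add_zero, e1] using h
  refine (h'.comp (z := (t, ψ q)) (τ := fun z => φ (ψ.symm z)) (ContinuousLinearEquiv.refl ℝ _) hτ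
    hdet).congr ?_
  filter_upwards [(continuous_snd.tendsto (t, ψ q)).eventually (hoy.mem_nhds hqy)] with z hz
  change F (z.1, ψ.symm z.2) = F (z.1 + 0, φ.symm (φ (ψ.symm z.2)))
  rw [φ.left_inv hz.2, add_zero]

theorem isFrameAt_iff {x : M} (hx : q ∈ (chartAt (EuclideanSpace ℝ (Fin n)) x).source) :
    IsFrameAt F t q ↔
      IsFiberRegularAt (inChart F x) (t, chartAt (EuclideanSpace ℝ (Fin n)) x q) :=
  ⟨isFiberRegularAt_chart_change (mem_chart_source _ q) hx,
    isFiberRegularAt_chart_change hx (mem_chart_source _ q)⟩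

theorem continuousAt_inChart {x : M} (hx : q ∈ (chartAt (EuclideanSpace ℝ (Fin n)) x).source) :
    ContinuousAt (fun z : ℝ × EuclideanSpace ℝ (Fin n) =>
      (z.1, (chartAt (EuclideanSpace ℝ (Fin n)) x).symm z.2))
      (t, chartAt (EuclideanSpace ℝ (Fin n)) x q) :=
  continuousAt_fst.prodMk (ContinuousAt.comp (f := Prod.snd)
    (g := (chartAt (EuclideanSpace ℝ (Fin n)) x).symm)
    ((chartAt (EuclideanSpace ℝ (Fin n)) x).continuousAt_symm
      ((chartAt (EuclideanSpace ℝ (Fin n)) x).map_source hx)) continuousAt_snd)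

theorem IsFrameAt.congr (h : IsFrameAt F t q) (hF : ∀ᶠ p in 𝓝 (t, q), F' p = F p) :
    IsFrameAt F' t q := by
  refine IsFiberRegularAt.congr h ?_
  have hc := continuousAt_inChart (n := n) (t := t) (mem_chart_source (EuclideanSpace ℝ (Fin n)) q)
  have hq : (chartAt (EuclideanSpace ℝ (Fin n)) q).symm (chartAt (EuclideanSpace ℝ (Fin n)) q q) = q :=
    (chartAt (EuclideanSpace ℝ (Fin n)) q).left_inv (mem_chart_source _ q)
  rw [ContinuousAt, hq] at hc
  exact hc.eventually hF

theorem eventually_isFrameAt (h : IsFrameAt F t q) : ∀ᶠ p in 𝓝 (t, q), IsFrameAt F p.1 p.2 := by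
  set φ := chartAt (EuclideanSpace ℝ (Fin n)) q with hφ
  have hq : q ∈ φ.source := mem_chart_source _ q
  have hc : ContinuousAt (fun p : ℝ × M => (p.1, φ p.2)) (t, q) :=
    continuousAt_fst.prodMk (ContinuousAt.comp (f := Prod.snd) (g := φ) (φ.continuousAt hq)
      continuousAt_snd)
  filter_upwards [hc.eventually (IsFiberRegularAt.eventually h),
    (continuous_snd.tendsto (t, q)).eventually (φ.open_source.mem_nhds hq)] with p h1 h2
  exact (isFrameAt_iff h2).2 h1

theorem IsFrameAt.contMDiffAt (h : IsFrameAt F t q) :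
    ContMDiffAt (𝓘(ℝ, ℝ).prod (𝓡 n)) 𝓘(ℝ, EuclideanSpace ℝ (Fin n)) ∞ F (t, q) := by
  set φ := chartAt (EuclideanSpace ℝ (Fin n)) q with hφ
  have hq : q ∈ φ.source := mem_chart_source _ q
  have h1 : ContMDiffAt (𝓘(ℝ, ℝ).prod (𝓡 n)) 𝓘(ℝ, ℝ × EuclideanSpace ℝ (Fin n)) ∞
      (fun p : ℝ × M => (p.1, φ p.2)) (t, q) :=
    contMDiffAt_fst.prodMk_space
      (ContMDiffAt.comp (t, q) ((contMDiffOn_chart (x := q)).contMDiffAt (φ.open_source.mem_nhds hq))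
        contMDiffAt_snd)
  have h2 : ContMDiffAt 𝓘(ℝ, ℝ × EuclideanSpace ℝ (Fin n)) 𝓘(ℝ, EuclideanSpace ℝ (Fin n)) ∞
      (inChart F q) (t, φ q) := (IsFiberRegularAt.contDiffAt h).contMDiffAt
  refine (ContMDiffAt.comp (t, q) h2 h1).congr_of_eventuallyEq ?_
  filter_upwards [(continuous_snd.tendsto (t, q)).eventually (φ.open_source.mem_nhds hq)] with p hp
  simp only [Function.comp, inChart, ← hφ, φ.left_inv hp]

theorem IsFrameAt.comp {c : ℝ} (h : IsFrameAt F (t + c) q)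
    (B : EuclideanSpace ℝ (Fin n) ≃L[ℝ] EuclideanSpace ℝ (Fin n)) :
    IsFrameAt (fun p => B (F (p.1 + c, p.2))) t q := by
  have h1 := IsFiberRegularAt.comp (z := (t, chartAt (EuclideanSpace ℝ (Fin n)) q q)) (τ := id) h B
    (Eventually.of_forall fun _ => contDiffAt_id) (by simp [ContinuousLinearMap.det])
  exact h1

/-- A frame at `(a, w a)` can be deformed to a chart. -/
theorem exists_frame_transition {a b : ℝ} {w : ℝ → M} (hF : IsFrameAt F a (w a))
    (hw : ContinuousAt w a) {x : M} (hx : w a ∈ (chartAt (EuclideanSpace ℝ (Fin n)) x).source)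
    (hab : a < b) :
    ∃ (F' : ℝ × M → EuclideanSpace ℝ (Fin n))
      (B : EuclideanSpace ℝ (Fin n) ≃L[ℝ] EuclideanSpace ℝ (Fin n)),
      (∀ t ≤ a, ∀ q, F' (t, q) = F (t, q)) ∧
      (∀ t ≥ b, ∀ q, F' (t, q) = B (chartAt (EuclideanSpace ℝ (Fin n)) x q)) ∧
      ∀ t ≥ a, w t ∈ (chartAt (EuclideanSpace ℝ (Fin n)) x).source → IsFrameAt F' t (w t) := by
  set φ := chartAt (EuclideanSpace ℝ (Fin n)) x with hφ
  set G := inChart F x with hG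
  have hreg : IsFiberRegularAt G (a, φ (w a)) := (isFrameAt_iff hx).1 hF
  -- The frame is interpolated with the linear image `B ∘ φ` of the chart, `B` being the fibre
  -- derivative of `F` at the starting point. The fibre derivative of the interpolation is then a
  -- convex combination of `B` with an operator close to `B`, hence invertible.
  let B := (fiberDeriv G (a, φ (w a))).toContinuousLinearEquivOfDetNeZero hreg.2
  have hBc : (B : EuclideanSpace ℝ (Fin n) →L[ℝ] EuclideanSpace ℝ (Fin n)) =
      fiberDeriv G (a, φ (w a)) := ContinuousLinearMap.ext fun _ => rfl
  have hγ : ContinuousAt (fun t => (t, φ (w t))) a :=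
    continuousAt_id.prodMk (ContinuousAt.comp (g := φ) (φ.continuousAt hx) hw)
  have h1 := hγ.eventually hreg.eventually
  have h2 := (hreg.contDiffAt.continuousAt_fiberDeriv.tendsto.comp hγ.tendsto).eventually
    (ContinuousLinearMap.eventually_det_ne_zero hreg.2)
  obtain ⟨δ, hδ, hball⟩ := Metric.eventually_nhds_iff_ball.1 (h1.and h2)
  -- The transition has to be short, so that the fibre derivative of `F` stays close to `B` while it
  -- takes place, and it has to end before `b`.
  set ρ := min (δ / 2) (b - a) with hρ
  have hρ0 : 0 < ρ := lt_min (by linarith) (by linarith)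
  have hρδ : ρ < δ := (min_le_left _ _).trans_lt (by linarith)
  have hρb : ρ ≤ b - a := min_le_right _ _
  let χ : ℝ → ℝ := fun t => Real.smoothTransition ((t - a) / ρ)
  have hχ : ContDiff ℝ ∞ χ := Real.smoothTransition.contDiff.comp (by fun_prop)
  have hχ0 : ∀ t ≤ a, χ t = 0 := fun t ht =>
    Real.smoothTransition.zero_of_nonpos (div_nonpos_of_nonpos_of_nonneg (by linarith) hρ0.le)
  have hχ1 : ∀ t, a + ρ ≤ t → χ t = 1 := fun t ht =>
    Real.smoothTransition.one_of_one_le ((one_le_div hρ0).2 (by linarith))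
  refine ⟨fun p => (1 - χ p.1) • F p + χ p.1 • B (φ p.2), B, fun t ht q => ?_, fun t ht q => ?_,
    fun t ht hwt => ?_⟩
  · simp [hχ0 t ht]
  · simp [hχ1 t (by linarith)]
  refine (isFrameAt_iff hwt).2 ?_
  have hev : ∀ᶠ z in 𝓝 (t, φ (w t)), z.2 ∈ φ.target :=
    (continuous_snd.tendsto (t, φ (w t))).eventually (φ.open_target.mem_nhds (φ.map_source hwt))
  rcases le_or_gt t (a + ρ) with htρ | htρ
  · have hmem : t ∈ Metric.ball a δ := by
      rw [Metric.mem_ball, Real.dist_eq, abs_of_nonneg (by linarith)]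
      linarith
    obtain ⟨hr, hd⟩ := hball t hmem
    have hsm : ∀ z, ContDiffAt ℝ ∞ G z →
        ContDiffAt ℝ ∞ (fun z => (1 - χ z.1) • G z + χ z.1 • B z.2) z := fun z hz => by
      have hχz : ContDiffAt ℝ ∞ (fun z : ℝ × EuclideanSpace ℝ (Fin n) => χ z.1) z :=
        (hχ.comp contDiff_fst).contDiffAt
      exact ((contDiffAt_const.sub hχz).smul hz).add
        (hχz.smul (B.contDiff.comp contDiff_snd).contDiffAt)
    have key : IsFiberRegularAt (fun z => (1 - χ z.1) • G z + χ z.1 • B z.2) (t, φ (w t)) := by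
      refine ⟨hr.1.mono hsm, ?_⟩
      have h3 := ((hsm _ hr.contDiffAt).differentiableAt (by simp)).hasFDerivAt_fiber
      have h4 := (hr.contDiffAt.differentiableAt (by simp)).hasFDerivAt_fiber
      have h5 := (h4.const_smul (1 - χ t)).add ((B.hasFDerivAt (x := φ (w t))).const_smul (χ t))
      rw [h3.unique h5, hBc]
      exact hd _ ⟨Real.smoothTransition.nonneg _, Real.smoothTransition.le_one _⟩
    refine key.congr (hev.mono fun z hz => ?_)
    change _ + χ z.1 • B (φ (φ.symm z.2)) = _
    rw [φ.right_inv hz]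
    rfl
  · refine (isFiberRegularAt_clm B (t, φ (w t))).congr ?_
    filter_upwards [hev, (continuous_fst.tendsto (t, φ (w t))).eventually (lt_mem_nhds htρ)] with z hz h3
    change (1 - χ z.1) • F _ + χ z.1 • B (φ (φ.symm z.2)) = _
    rw [φ.right_inv hz, hχ1 _ h3.le]
    simp

end Frames

/-! ### Every loop lies in the domain of a fibre chart -/

section ChartExistence

variable {n : ℕ} {M : Type*} [TopologicalSpace M] [ChartedSpace (EuclideanSpace ℝ (Fin n)) M]
  [IsManifold (𝓡 n) ∞ M] {F : ℝ × M → EuclideanSpace ℝ (Fin n)}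

theorem isFrameAt_chart {x q : M} (hq : q ∈ (chartAt (EuclideanSpace ℝ (Fin n)) x).source) (t : ℝ) :
    IsFrameAt (fun p : ℝ × M => chartAt (EuclideanSpace ℝ (Fin n)) x p.2) t q := by
  refine (isFrameAt_iff hq).2 ((isFiberRegularAt_clm (ContinuousLinearEquiv.refl ℝ _) _).congr ?_)
  filter_upwards [(continuous_snd.tendsto (t, chartAt (EuclideanSpace ℝ (Fin n)) x q)).eventually
    ((chartAt (EuclideanSpace ℝ (Fin n)) x).open_target.mem_nhds
      ((chartAt (EuclideanSpace ℝ (Fin n)) x).map_source hq))] with z hz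
  exact (chartAt (EuclideanSpace ℝ (Fin n)) x).right_inv hz

theorem eventually_fst_lt {t a : ℝ} (h : t < a) (q : M) : ∀ᶠ p in 𝓝 (t, q), p.1 < a :=
  (continuous_fst.tendsto (t, q)).eventually (gt_mem_nhds h)

/-- Extension of frames along a path in a chart domain. -/
theorem exists_frame_extension {w : ℝ → M} (hw : Continuous w) {a b : ℝ} (ha : 0 ≤ a) (hab : a < b)
    {x : M} (hx : ∀ t ∈ Icc a b, w t ∈ (chartAt (EuclideanSpace ℝ (Fin n)) x).source)
    (hF : ∀ t ∈ Icc 0 a, IsFrameAt F t (w t)) :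
    ∃ (F' : ℝ × M → EuclideanSpace ℝ (Fin n))
      (B : EuclideanSpace ℝ (Fin n) ≃L[ℝ] EuclideanSpace ℝ (Fin n)),
      (∀ t ≤ 0, ∀ q, F' (t, q) = F (t, q)) ∧
      (∀ t, (a + b) / 2 ≤ t → ∀ q, F' (t, q) = B (chartAt (EuclideanSpace ℝ (Fin n)) x q)) ∧
      ∀ t ∈ Icc 0 b, IsFrameAt F' t (w t) := by
  obtain ⟨F', B, h1, h2, h3⟩ := exists_frame_transition (b := (a + b) / 2) (hF a ⟨ha, le_rfl⟩)
    hw.continuousAt (hx a ⟨le_rfl, hab.le⟩) (by linarith)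
  refine ⟨F', B, fun t ht => h1 t (ht.trans ha), h2, fun t ht => ?_⟩
  rcases lt_or_ge t a with hta | hta
  · refine (hF t ⟨ht.1, hta.le⟩).congr ?_
    filter_upwards [eventually_fst_lt hta (w t)] with p hp using h1 p.1 hp.le p.2
  · exact h3 t hta (hx t ⟨hta, ht.2⟩)

/-- By compactness `[0, 1]` is subdivided into intervals each of which the path maps into one chart
domain. The frame is extended over them one after the other. Starting from the chart at `w 0` for
all `t ≤ 0` prepares the closing up at `t = 1`. -/
theorem exists_frame_Icc {w : ℝ → M} (hw : Continuous w) :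
    ∃ F : ℝ × M → EuclideanSpace ℝ (Fin n),
      (∀ t ≤ 0, ∀ q, F (t, q) = chartAt (EuclideanSpace ℝ (Fin n)) (w 0) q) ∧
      ∀ t ∈ Icc 0 1, IsFrameAt F t (w t) := by
  obtain ⟨τ, h0, hmono, ⟨m, hm⟩, hτ⟩ := exists_monotone_Icc_subset_open_cover_Icc
    (zero_le_one (α := ℝ)) (c := fun x : M => (fun t : Icc (0 : ℝ) 1 => w t) ⁻¹'
      (chartAt (EuclideanSpace ℝ (Fin n)) x).source)
    (fun x => (chartAt _ x).open_source.preimage (hw.comp continuous_subtype_val))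
    fun t _ => mem_iUnion.2 ⟨w t, mem_chart_source _ _⟩
  have key : ∀ N : ℕ, ∃ F : ℝ × M → EuclideanSpace ℝ (Fin n),
      (∀ t ≤ 0, ∀ q, F (t, q) = chartAt (EuclideanSpace ℝ (Fin n)) (w 0) q) ∧
      ∀ t ∈ Icc (0 : ℝ) (τ N), IsFrameAt F t (w t) := by
    intro N
    induction N with
    | zero =>
      refine ⟨fun p => chartAt (EuclideanSpace ℝ (Fin n)) (w 0) p.2, fun _ _ _ => rfl, fun t ht => ?_⟩
      rw [h0, Icc_self, mem_singleton_iff] at ht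
      rw [ht]
      exact isFrameAt_chart (mem_chart_source _ _) 0
    | succ N ih =>
      obtain ⟨F, hF0, hF⟩ := ih
      obtain ⟨x, hx⟩ := hτ N
      rcases (hmono N.le_succ).lt_or_eq with hlt | heq
      · obtain ⟨F', B, h1, -, h3⟩ := exists_frame_extension hw (τ N).2.1 hlt (x := x)
          (fun t ht => hx (a := ⟨t, (τ N).2.1.trans ht.1, ht.2.trans (τ (N + 1)).2.2⟩)
            ⟨ht.1, ht.2⟩) hF
        exact ⟨F', fun t ht q => (h1 t ht q).trans (hF0 t ht q), h3⟩
      · rw [← Nat.succ_eq_add_one, ← heq]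
        exact ⟨F, hF0, hF⟩
  obtain ⟨F, hF0, hF⟩ := key m
  rw [hm m le_rfl] at hF
  exact ⟨F, hF0, hF⟩

/-- Along a loop there is a frame which is equivariant for some clutching map. -/
theorem exists_equivariant_frame {w : ℝ → M} (hw : Continuous w) (hw1 : ∀ t, w (t + 1) = w t) :
    ∃ (E : ℝ × M → EuclideanSpace ℝ (Fin n))
      (A : EuclideanSpace ℝ (Fin n) ≃L[ℝ] EuclideanSpace ℝ (Fin n)),
      (∀ t q, E (t + 1, q) = A (E (t, q))) ∧ ∀ t, IsFrameAt E t (w t) := by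
  obtain ⟨F₁, h0, hF₁⟩ := exists_frame_Icc (n := n) hw
  have hw10 : w 1 = w 0 := by rw [← hw1 0, zero_add]
  set φ := chartAt (EuclideanSpace ℝ (Fin n)) (w 0) with hφ
  have hev : ∀ᶠ t in 𝓝 (1 : ℝ), w t ∈ φ.source :=
    hw.continuousAt.eventually (φ.open_source.mem_nhds (by rw [hw10]; exact mem_chart_source _ _))
  obtain ⟨δ', hδ', hball⟩ := Metric.eventually_nhds_iff_ball.1 hev
  set δ := min (δ' / 2) 1 with hδ
  have hδ0 : 0 < δ := lt_min (by linarith) one_pos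
  have hδδ' : δ < δ' := (min_le_left _ _).trans_lt (by linarith)
  have hδ1 : δ ≤ 1 := min_le_right _ _
  -- Near `t = 1` the frame is deformed to `B ∘ φ`, with the same chart `φ` that the frame equals
  -- for `t ≤ 0`. The translates of the frame therefore fit together smoothly, and `B` becomes the
  -- clutching map.
  obtain ⟨F, B, h1, h2, hF⟩ := exists_frame_extension hw (a := 1 - δ) (b := 1) (x := w 0)
    (by linarith) (by linarith) (fun t ht => hball t (by
      rw [Metric.mem_ball, Real.dist_eq, abs_of_nonpos (by linarith [ht.2])]; linarith [ht.1]))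
    (fun t ht => hF₁ t ⟨ht.1, by linarith [ht.2]⟩)
  let E : ℝ × M → EuclideanSpace ℝ (Fin n) := fun p => (B ^ ⌊p.1⌋) (F (p.1 - ⌊p.1⌋, p.2))
  have hE1 : ∀ t q, E (t + 1, q) = B (E (t, q)) := by
    intro t q
    simp only [E, Int.floor_add_one, zpow_add_one, Int.cast_add, Int.cast_one, add_sub_add_right_eq_sub]
    rw [(Commute.self_zpow B ⌊t⌋).symm.eq]
    rfl
  -- The extension agrees with `F` also slightly to the left of zero. There `E (t, q) = B⁻¹ F (t +
  -- 1, q) = φ q`, because `F = B ∘ φ` from time `1 - δ / 2` on. This removes the apparent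
  -- discontinuity of the integer part.
  have hEF : ∀ t, -(δ / 2) < t → t < 1 → ∀ q, E (t, q) = F (t, q) := by
    intro t ht0 ht1 q
    rcases lt_or_ge t 0 with h | h
    · have hfl : ⌊t⌋ = -1 := Int.floor_eq_iff.2 ⟨by push_cast; linarith, by push_cast; linarith⟩
      simp only [E, hfl, Int.cast_neg, Int.cast_one, sub_neg_eq_add, zpow_neg, zpow_one]
      rw [h2 (t + 1) (by linarith), h1 t h.le, h0 t h.le]
      exact B.symm_apply_apply _
    · have hfl : ⌊t⌋ = 0 := Int.floor_eq_iff.2 ⟨by simpa using h, by simpa using ht1⟩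
      simp only [E, hfl, Int.cast_zero, sub_zero, zpow_zero]
      rfl
  have hshift : ∀ (t : ℝ) (q : M), IsFrameAt E (t + 1) q ↔ IsFrameAt E t q := by
    intro t q
    constructor
    · intro h
      refine (h.comp B.symm).congr (Eventually.of_forall fun p => ?_)
      rw [hE1, B.symm_apply_apply]
    · intro h
      have h' : IsFrameAt E (t + 1 + (-1)) q := by rwa [add_neg_cancel_right]
      refine (h'.comp B).congr (Eventually.of_forall fun p => ?_)
      rw [← hE1, neg_add_cancel_right]
  refine ⟨E, B, hE1, ?_⟩
  have h01 : ∀ t ∈ Ico (0 : ℝ) 1, IsFrameAt E t (w t) := by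
    intro t ht
    refine (hF t ⟨ht.1, ht.2.le⟩).congr ?_
    filter_upwards [eventually_fst_lt ht.2 (w t), (continuous_fst.tendsto (t, w t)).eventually
      (lt_mem_nhds (show -(δ / 2) < t by linarith [ht.1]))] with p hp hp'
    exact hEF p.1 hp' hp p.2
  refine forall_of_periodic (fun t => by rw [hw1, hshift]) fun t ht => ?_
  rcases ht.2.lt_or_eq with h | rfl
  · exact h01 t ⟨ht.1, h⟩
  · rw [hw10, ← zero_add 1, hshift]
    exact h01 0 ⟨le_rfl, one_pos⟩

/-- The map `(t, q) ↦ (t, F (t, q))` is a local diffeomorphism where `F` is a frame. -/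
theorem IsFrameAt.exists_section {p : ℝ × M} (h : IsFrameAt F p.1 p.2) :
    (∃ u ∈ 𝓝 p, InjOn (fun p : ℝ × M => (p.1, F p)) u) ∧
    ∃ S : ℝ × EuclideanSpace ℝ (Fin n) → ℝ × M,
      ContMDiffAt (𝓘(ℝ, ℝ).prod (𝓡 n)) (𝓘(ℝ, ℝ).prod (𝓡 n)) ∞ S (p.1, F p) ∧ S (p.1, F p) = p ∧
      ∀ᶠ y in 𝓝 (p.1, F p), ((S y).1, F (S y)) = y := by
  obtain ⟨Φ, h1, h2, h3⟩ := IsFiberRegularAt.exists_openPartialHomeomorph h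
  set φ := chartAt (EuclideanSpace ℝ (Fin n)) p.2 with hφ
  have hq : p.2 ∈ φ.source := mem_chart_source _ _
  have e : ∀ p : ℝ × M, p.2 ∈ φ.source → Φ (p.1, φ p.2) = (p.1, F p) := fun p hp => by
    rw [h2]
    simp only [inChart, ← hφ, φ.left_inv hp]
  have hy : (p.1, F p) ∈ Φ.target := by rw [← e p hq]; exact Φ.map_source h1
  have hy' : Φ.symm (p.1, F p) = (p.1, φ p.2) := by rw [← e p hq, Φ.left_inv h1]
  refine ⟨?_, fun y => ((Φ.symm y).1, φ.symm (Φ.symm y).2), ?_, ?_, ?_⟩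
  · have hc : ContinuousAt (fun p : ℝ × M => (p.1, φ p.2)) p :=
      continuousAt_fst.prodMk (ContinuousAt.comp (f := Prod.snd) (g := φ) (φ.continuousAt hq)
        continuousAt_snd)
    refine ⟨_, inter_mem (hc (Φ.open_source.mem_nhds h1))
      ((continuous_snd.tendsto p) (φ.open_source.mem_nhds hq)), ?_⟩
    rintro r ⟨hr1, hr2⟩ r' ⟨hr1', hr2'⟩ hrr'
    have h4 : (r.1, φ r.2) = (r'.1, φ r'.2) :=
      Φ.injOn hr1 hr1' ((e r hr2).trans (hrr'.trans (e r' hr2').symm))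
    exact Prod.ext (Prod.ext_iff.1 h4).1 (φ.injOn hr2 hr2' (Prod.ext_iff.1 h4).2)
  · have hid : ContMDiff (𝓘(ℝ, ℝ).prod (𝓡 n)) 𝓘(ℝ, ℝ × EuclideanSpace ℝ (Fin n)) ∞
        (fun y : ℝ × EuclideanSpace ℝ (Fin n) => y) :=
      contMDiff_fst.prodMk_space contMDiff_snd
    have hs : ContMDiffAt 𝓘(ℝ, ℝ × EuclideanSpace ℝ (Fin n)) 𝓘(ℝ, ℝ × EuclideanSpace ℝ (Fin n)) ∞
        Φ.symm (p.1, F p) := (h3.contDiffAt (Φ.open_target.mem_nhds hy)).contMDiffAt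
    have hs' := ContMDiffAt.comp (p.1, F p) hs (hid (p.1, F p))
    have hs1 : ContMDiffAt (𝓘(ℝ, ℝ).prod (𝓡 n)) 𝓘(ℝ, ℝ) ∞ (fun y => (Φ.symm y).1) (p.1, F p) :=
      ContMDiffAt.comp (p.1, F p) contDiff_fst.contMDiff.contMDiffAt hs'
    have hs2 : ContMDiffAt (𝓘(ℝ, ℝ).prod (𝓡 n)) (𝓡 n) ∞ (fun y => (Φ.symm y).2) (p.1, F p) :=
      ContMDiffAt.comp (p.1, F p) contDiff_snd.contMDiff.contMDiffAt hs'
    refine hs1.prodMk (ContMDiffAt.comp (g := φ.symm) (p.1, F p) ?_ hs2)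
    rw [hy']
    exact (contMDiffOn_chart_symm (x := p.2)).contMDiffAt (φ.open_target.mem_nhds (φ.map_source hq))
  · simp only [hy', φ.left_inv hq]
  · filter_upwards [Φ.open_target.mem_nhds hy] with y hyt
    have h5 := h2 (Φ.symm y)
    rw [Φ.right_inv hyt] at h5
    exact h5.symm

/-- The chart defined by an equivariant frame on an invariant open set on which it is injective. -/
theorem exists_fiberChart_of_frame [Nonempty M] {E : ℝ × M → EuclideanSpace ℝ (Fin n)}
    {A : EuclideanSpace ℝ (Fin n) ≃L[ℝ] EuclideanSpace ℝ (Fin n)}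
    (hE : ∀ t q, E (t + 1, q) = A (E (t, q))) {W : Set (ℝ × M)} (hW : IsOpen W)
    (hWE : ∀ p ∈ W, IsFrameAt E p.1 p.2) (hinj : InjOn (fun p : ℝ × M => (p.1, E p)) W)
    (hW1 : ∀ t q, (t + 1, q) ∈ W ↔ (t, q) ∈ W) : ∃ c : FiberChart n M, c.e.source = W := by
  have hsm : ContMDiffOn (𝓘(ℝ, ℝ).prod (𝓡 n)) (𝓘(ℝ, ℝ).prod (𝓡 n)) ∞
      (fun p : ℝ × M => (p.1, E p)) W := fun p hp =>
    (contMDiffAt_fst.prodMk (hWE p hp).contMDiffAt).contMDiffWithinAt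
  let e : PartialEquiv (ℝ × M) (ℝ × EuclideanSpace ℝ (Fin n)) := hinj.toPartialEquiv
  have he : ∀ p, e p = (p.1, E p) := fun p => rfl
  have hloc : ∀ p ∈ W, e.target ∈ 𝓝 (e p) ∧
      ContMDiffAt (𝓘(ℝ, ℝ).prod (𝓡 n)) (𝓘(ℝ, ℝ).prod (𝓡 n)) ∞ e.symm (e p) := by
    intro p hp
    obtain ⟨-, S, hS, hSp, hSe⟩ := (hWE p hp).exists_section
    have hSW : ∀ᶠ y in 𝓝 (p.1, E p), S y ∈ W :=
      hS.continuousAt.eventually (hW.mem_nhds (by rwa [hSp]))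
    constructor
    · filter_upwards [hSe, hSW] with y hy hyW
      rw [← hy]
      exact e.map_source hyW
    · refine hS.congr_of_eventuallyEq ?_
      filter_upwards [hSe, hSW] with y hy hyW
      rw [← e.left_inv hyW, he, hy]
  have htarget : ∀ y ∈ e.target, e.target ∈ 𝓝 y ∧
      ContMDiffAt (𝓘(ℝ, ℝ).prod (𝓡 n)) (𝓘(ℝ, ℝ).prod (𝓡 n)) ∞ e.symm y := fun y hy => by
    have := hloc (e.symm y) (e.map_target hy)
    rwa [e.right_inv hy] at this
  have hsym : ContMDiffOn (𝓘(ℝ, ℝ).prod (𝓡 n)) (𝓘(ℝ, ℝ).prod (𝓡 n)) ∞ e.symm e.target :=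
    fun y hy => (htarget y hy).2.contMDiffWithinAt
  exact ⟨{
    A := A
    e := { e with
      open_source := hW
      open_target := isOpen_iff_mem_nhds.2 fun y hy => (htarget y hy).1
      continuousOn_toFun := hsm.continuousOn
      continuousOn_invFun := hsym.continuousOn }
    fst := fun _ _ => rfl
    smooth := hsm
    smooth_symm := hsym
    source_iff := hW1
    equivariant := fun t q _ => hE t q }, rfl⟩

/-- Every continuous loop lies in the domain of a chart. -/
theorem exists_fiberChart [T2Space M] {v : Circle → M} (hv : Continuous v) :
    ∃ c : FiberChart n M, ∀ t, (t, v (toCircle t)) ∈ c.e.source := by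
  have : Nonempty M := ⟨v 1⟩
  have hw : Continuous fun t => v (toCircle t) := hv.comp continuous_toCircle
  obtain ⟨E, A, hE, hEw⟩ := exists_equivariant_frame (n := n) hw fun t => by rw [toCircle_add_one]
  set f : ℝ × M → ℝ × EuclideanSpace ℝ (Fin n) := fun p => (p.1, E p) with hf
  have hEm : ∀ (m : ℤ) (t : ℝ) (q : M), E (t + m, q) = (A ^ m) (E (t, q)) := by
    intro m
    induction m with
    | zero =>
      intro t q
      rw [Int.cast_zero, add_zero, zpow_zero]
      rfl
    | succ m ih =>
      intro t q
      rw [Int.cast_add, Int.cast_one, ← add_assoc, hE, ih, zpow_add_one, (Commute.self_zpow A m).symm.eq]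
      rfl
    | pred m ih =>
      intro t q
      have h1 := hE (t + ((-(m : ℤ) - 1 : ℤ) : ℝ)) q
      have h2 : t + ((-(m : ℤ) - 1 : ℤ) : ℝ) + 1 = t + ((-(m : ℤ) : ℤ) : ℝ) := by push_cast; ring
      rw [h2, ih] at h1
      have h3 : A * A ^ (-(m : ℤ) - 1) = A ^ (-(m : ℤ)) := by rw [mul_self_zpow]; congr 1; ring
      refine A.injective (h1.symm.trans ?_)
      rw [← h3]
      rfl
  have hfr : ∀ (t : ℝ) (q : M), IsFrameAt E (t + 1) q ↔ IsFrameAt E t q := by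
    intro t q
    constructor
    · intro h
      refine (h.comp A.symm).congr (Eventually.of_forall fun p => ?_)
      rw [hE, A.symm_apply_apply]
    · intro h
      have h' : IsFrameAt E (t + 1 + (-1)) q := by rwa [add_neg_cancel_right]
      refine (h'.comp A).congr (Eventually.of_forall fun p => ?_)
      rw [← hE, neg_add_cancel_right]
  have hcont : ∀ p : ℝ × M, IsFrameAt E p.1 p.2 → ContinuousAt f p := fun p hp =>
    continuousAt_fst.prodMk hp.contMDiffAt.continuousAt
  -- The map `f` keeps the time, so it is injective on the graph. Being locally injective near this
  -- compact set as well, it is injective on a neighbourhood.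
  obtain ⟨O, hO, hKO, hOinj⟩ := InjOn.exists_isOpen_superset (f := f)
    (s := (fun t => (t, v (toCircle t))) '' Icc (0 : ℝ) 1)
    (by
      rintro _ ⟨t, -, rfl⟩ _ ⟨s, -, rfl⟩ hst
      have : t = s := congrArg Prod.fst hst
      rw [this])
    (isCompact_Icc.image (continuous_id.prodMk hw))
    (by
      rintro _ ⟨t, -, rfl⟩
      exact hcont (t, v (toCircle t)) (hEw t))
    (by
      rintro _ ⟨t, -, rfl⟩
      exact (IsFrameAt.exists_section (p := (t, v (toCircle t))) (hEw t)).1)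
  -- All translates with time in the closed interval `[0, 1]` are required to lie in `O`, including
  -- both `0` and `1` at integer times. This makes `W` invariant and open, and injectivity on `W`
  -- follows from injectivity on `O` after translation.
  let W : Set (ℝ × M) := {p | IsFrameAt E p.1 p.2 ∧ ∀ m : ℤ, p.1 + m ∈ Icc (0 : ℝ) 1 → (p.1 + m, p.2) ∈ O}
  have hWopen : IsOpen W := by
    refine isOpen_iff_mem_nhds.2 fun p hp => (eventually_isFrameAt hp.1).and ?_
    have h1 : ∀ m : ℤ, ∀ᶠ r : ℝ × M in 𝓝 p, r.1 + (m : ℝ) ∈ Icc (0 : ℝ) 1 → (r.1 + (m : ℝ), r.2) ∈ O := by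
      intro m
      by_cases hm : p.1 + m ∈ Icc (0 : ℝ) 1
      · have hc : Continuous fun r : ℝ × M => (r.1 + m, r.2) := by fun_prop
        filter_upwards [hc.continuousAt.eventually (hO.mem_nhds (hp.2 m hm))] with r hr _ using hr
      · have hc : Continuous fun r : ℝ × M => r.1 + m := by fun_prop
        filter_upwards [hc.continuousAt.eventually (isClosed_Icc.isOpen_compl.mem_nhds hm)] with r hr hr'
        exact absurd hr' hr
    -- For times within distance one of `p.1`, only these finitely many translations can reach `[0,
    -- 1]`.
    have h2 : ∀ᶠ r : ℝ × M in 𝓝 p, ∀ m ∈ Finset.Icc (-⌊p.1⌋ - 2) (-⌊p.1⌋ + 2),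
        r.1 + (m : ℝ) ∈ Icc (0 : ℝ) 1 → (r.1 + (m : ℝ), r.2) ∈ O :=
      (Finset.eventually_all _).2 fun m _ => h1 m
    have h3 : ∀ᶠ r : ℝ × M in 𝓝 p, r.1 ∈ Ioo (p.1 - 1) (p.1 + 1) :=
      (continuous_fst.tendsto p).eventually (Ioo_mem_nhds (by linarith) (by linarith))
    filter_upwards [h2, h3] with r hr hr3 m hm
    refine hr m (Finset.mem_Icc.2 ?_) hm
    have h4 := Int.floor_le p.1
    have h5 := Int.lt_floor_add_one p.1
    obtain ⟨h6, h7⟩ := hm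
    obtain ⟨h8, h9⟩ := hr3
    constructor
    · have : ((-⌊p.1⌋ - 2 : ℤ) : ℝ) ≤ m := by push_cast; linarith
      exact_mod_cast this
    · have : (m : ℝ) ≤ ((-⌊p.1⌋ + 2 : ℤ) : ℝ) := by push_cast; linarith
      exact_mod_cast this
  have hWinj : InjOn f W := by
    rintro ⟨t, q⟩ hp ⟨t', q'⟩ hp' hpp'
    have ht : t = t' := congrArg Prod.fst hpp'
    subst ht
    have hq : E (t, q) = E (t, q') := congrArg Prod.snd hpp'
    have hm : t + ((-⌊t⌋ : ℤ) : ℝ) ∈ Icc (0 : ℝ) 1 := by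
      have h4 := Int.floor_le t
      have h5 := Int.lt_floor_add_one t
      constructor <;> push_cast <;> linarith
    have h6 := hOinj (hp.2 _ hm) (hp'.2 _ hm) (Prod.ext rfl (by
      change E _ = E _
      simp only [hEm, hq]))
    exact Prod.ext rfl (Prod.ext_iff.1 h6).2
  have hW1 : ∀ t q, (t + 1, q) ∈ W ↔ (t, q) ∈ W := by
    intro t q
    refine and_congr (hfr t q) ⟨fun h m hm => ?_, fun h m hm => ?_⟩
    · have := h (m - 1)
      simp only [Int.cast_sub, Int.cast_one, add_add_sub_cancel] at this
      exact this hm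
    · have := h (m + 1)
      have e : t + 1 + (m : ℝ) = t + ((m + 1 : ℤ) : ℝ) := by push_cast; ring
      simp only [e] at hm ⊢
      exact this hm
  obtain ⟨c, hc⟩ := exists_fiberChart_of_frame hE hWopen (fun p hp => hp.1) hWinj hW1
  refine ⟨c, fun t => ?_⟩
  rw [hc]
  refine ⟨hEw t, fun m hm => ?_⟩
  have h1 := hKO ⟨t + m, hm, rfl⟩
  simpa only [toCircle_add_intCast] using h1

end ChartExistence

/-! ### The logarithm on the circle -/

section CircleLog

/-- The inverse of `toCircle` with values in `(-1/2, 1/2]`. -/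
noncomputable def circleLog (z : Circle) : ℝ := Complex.arg z / (2 * Real.pi)

theorem toCircle_circleLog (z : Circle) : toCircle (circleLog z) = z := by
  rw [toCircle, circleLog, mul_div_cancel₀ _ (by positivity)]
  exact Circle.exp_arg z

theorem arg_toCircle {s : ℝ} (hs : |s| < 1 / 2) : Complex.arg (toCircle s) = 2 * Real.pi * s := by
  obtain ⟨h1, h2⟩ := abs_lt.1 hs
  have := Real.pi_pos
  exact Circle.arg_exp (by nlinarith) (by nlinarith)

theorem circleLog_toCircle {s : ℝ} (hs : |s| < 1 / 2) : circleLog (toCircle s) = s := by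
  rw [circleLog, arg_toCircle hs, mul_div_cancel_left₀ _ (by positivity)]

/-- The circle without the point `-1`. -/
def slitCircle : Set Circle := {z | (z : ℂ) ∈ Complex.slitPlane}

theorem isOpen_slitCircle : IsOpen slitCircle :=
  Complex.isOpen_slitPlane.preimage continuous_subtype_val

theorem toCircle_mem_slitCircle {s : ℝ} (hs : |s| < 1 / 2) : toCircle s ∈ slitCircle := by
  refine Complex.mem_slitPlane_iff_arg.2 ⟨?_, Circle.coe_ne_zero _⟩
  rw [arg_toCircle hs]
  have := Real.pi_pos
  have h2 := (abs_lt.1 hs).2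
  nlinarith

theorem contMDiff_toCircle : ContMDiff 𝓘(ℝ, ℝ) (𝓡 1) ∞ toCircle :=
  contMDiff_circleExp.comp (contDiff_const.mul contDiff_id).contMDiff

theorem contMDiffOn_circleLog : ContMDiffOn (𝓡 1) 𝓘(ℝ, ℝ) ∞ circleLog slitCircle := by
  intro z hz
  refine ContMDiffAt.contMDiffWithinAt ?_
  have h1 : ContDiffAt ℝ ∞ (fun w : ℂ => (Complex.log w).im / (2 * Real.pi)) (z : ℂ) :=
    (Complex.imCLM.contDiff.contDiffAt.comp _ ((Complex.contDiffAt_log hz).restrict_scalars ℝ)).div_const _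
  have : Fact (Module.finrank ℝ ℂ = 1 + 1) := finrank_real_complex_fact'
  have h2 : ContMDiff (𝓡 1) 𝓘(ℝ, ℂ) ∞ (fun z : Circle => (z : ℂ)) := contMDiff_coe_sphere (n := 1)
  have e : circleLog = fun z : Circle => (Complex.log (z : ℂ)).im / (2 * Real.pi) :=
    funext fun z => by rw [Complex.log_im, circleLog]
  rw [e]
  exact ContMDiffAt.comp (g := fun w : ℂ => (Complex.log w).im / (2 * Real.pi)) z h1.contMDiffAt
    h2.contMDiffAt

end CircleLog

/-! ### Lifts of circle maps -/

section Lifts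

theorem exists_eq_intCast_of_continuous {f : ℝ → ℝ} (hf : Continuous f) (h : ∀ t, ∃ m : ℤ, f t = m) :
    ∃ m : ℤ, ∀ t, f t = m := by
  choose m hm using h
  have hc : Continuous m := by
    rw [Int.isClosedEmbedding_coe_real.isInducing.continuous_iff]
    exact hf.congr hm
  exact ⟨m 0, fun t => by rw [hm t, PreconnectedSpace.constant inferInstance hc (x := t) (y := 0)]⟩

theorem lift_unique {Ψ Ψ' : ℝ → ℝ} (h : Continuous Ψ) (h' : Continuous Ψ')
    (he : ∀ t, toCircle (Ψ t) = toCircle (Ψ' t)) : ∃ m : ℤ, ∀ t, Ψ t = Ψ' t + m := by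
  obtain ⟨m, hm⟩ := exists_eq_intCast_of_continuous (h.sub h') fun t => by
    obtain ⟨m, hm⟩ := toCircle_eq_iff.1 (he t)
    exact ⟨m, by simp [hm]⟩
  exact ⟨m, fun t => by
    have : Ψ t - Ψ' t = m := hm t
    linarith⟩

/-- `Ψ` is a lift of `ψ : S¹ → S¹` of degree `d`. -/
structure IsLift (ψ : Circle → Circle) (Ψ : ℝ → ℝ) (d : ℤ) : Prop where
  continuous : Continuous Ψ
  toCircle_eq : ∀ t, toCircle (Ψ t) = ψ (toCircle t)
  add_one : ∀ t, Ψ (t + 1) = Ψ t + d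

theorem isLift_of_toCircle_eq {ψ : Circle → Circle} {Ψ : ℝ → ℝ} (h : Continuous Ψ)
    (he : ∀ t, toCircle (Ψ t) = ψ (toCircle t)) : ∃ d, IsLift ψ Ψ d := by
  obtain ⟨d, hd⟩ := lift_unique (h.comp (continuous_add_const (1 : ℝ))) h fun t => by
    rw [Function.comp, he, he, toCircle_add_one]
  exact ⟨d, h, he, hd⟩

theorem exists_isLift {ψ : Circle → Circle} (hψ : Continuous ψ) : ∃ Ψ d, IsLift ψ Ψ d := by
  obtain ⟨F, ⟨-, hF⟩, -⟩ := Circle.isCoveringMap_exp.existsUnique_continuousMap_lifts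
    (⟨fun t : ℝ => ψ (toCircle t), hψ.comp continuous_toCircle⟩ : C(ℝ, Circle)) 0
    (Complex.arg (ψ (toCircle 0))) (Circle.exp_arg _)
  have he : ∀ t, toCircle (F t / (2 * Real.pi)) = ψ (toCircle t) := fun t => by
    rw [toCircle, mul_div_cancel₀ _ (by positivity)]
    exact congrFun hF t
  obtain ⟨d, hd⟩ := isLift_of_toCircle_eq (F.continuous.div_const _) he
  exact ⟨_, d, hd⟩

variable {ψ φ : Circle → Circle} {Ψ Φ : ℝ → ℝ} {d d' : ℤ} {k : ℕ}

theorem IsLift.add_intCast (h : IsLift ψ Ψ d) (m : ℤ) (t : ℝ) : Ψ (t + m) = Ψ t + m * d := by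
  have hp : Function.Periodic (fun t => Ψ t - t * d) 1 := fun t => by
    simp only [h.add_one]; ring
  have := hp.int_mul m t
  simp only [mul_one] at this
  linarith

/-- Near `t` the lift is `Ψ t + circleLog (ψ (toCircle s) * (toCircle (Ψ t))⁻¹)`, a smooth function
of the loop. -/
theorem IsLift.sobolevOn (h : IsLift ψ Ψ d) (hψ : IsSobolevLoop 1 (k + 1) ψ) :
    SobolevOn (k + 1) univ Ψ := by
  refine SobolevOn.of_local fun t _ => ?_
  obtain ⟨O, hO, hOo, htO⟩ := _root_.mem_nhds_iff.1
    (h.continuous.continuousAt.preimage_mem_nhds (Metric.ball_mem_nhds (Ψ t) (ε := 1 / 2) (by norm_num)))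
  have hO' : ∀ s ∈ O, |Ψ s - Ψ t| < 1 / 2 := fun s hs => by
    have := hO hs
    rwa [mem_preimage, Metric.mem_ball, Real.dist_eq] at this
  have hz : ∀ s, ψ (toCircle s) * (toCircle (Ψ t))⁻¹ = toCircle (Ψ s - Ψ t) := fun s => by
    rw [← h.toCircle_eq, mul_inv_eq_iff_eq_mul, ← toCircle_add, sub_add_cancel]
  have hG : ContMDiffOn (𝓘(ℝ, ℝ).prod (𝓡 1)) 𝓘(ℝ, ℝ) ∞
      (fun p : ℝ × Circle => Ψ t + circleLog (p.2 * (toCircle (Ψ t))⁻¹))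
      {p | p.2 * (toCircle (Ψ t))⁻¹ ∈ slitCircle} :=
    contMDiffOn_const.add (contMDiffOn_circleLog.comp
      (contMDiff_snd.mul contMDiff_const).contMDiffOn fun p hp => hp)
  have hS : IsOpen {p : ℝ × Circle | p.2 * (toCircle (Ψ t))⁻¹ ∈ slitCircle} :=
    isOpen_slitCircle.preimage (continuous_snd.mul continuous_const)
  refine ⟨O, hOo, htO, (hψ.sobolevOn_comp hS hG hOo fun s hs => ?_).congr hOo fun s hs => ?_⟩
  · change ψ (toCircle s) * (toCircle (Ψ t))⁻¹ ∈ slitCircle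
    rw [hz]
    exact toCircle_mem_slitCircle (hO' s hs)
  · simp only [hz, circleLog_toCircle (hO' s hs), add_sub_cancel]

theorem isSobolevLoop_of_lift (h : ∀ t, toCircle (Ψ t) = ψ (toCircle t))
    (hΨ : SobolevOn (k + 1) univ Ψ) : IsSobolevLoop 1 (k + 1) ψ :=
  isSobolevLoop_of_comp hΨ isOpen_univ contMDiff_toCircle.contMDiffOn (fun _ => mem_univ _)
    fun t => (h t).symm

/-- Lifts of `ψ` and of its inverse compose to a translation by an integer. Differentiating, the
derivatives multiply to one; comparing increments over a period, so do the degrees. -/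
theorem IsLift.of_isSobolevDiffeo (h : IsLift ψ Ψ d) (hψ : IsSobolevDiffeo 2 ψ) :
    (∀ t, deriv Ψ t ≠ 0) ∧ (d = 1 ∨ d = -1) := by
  obtain ⟨hs, φ, h1, h2, hφ⟩ := hψ
  obtain ⟨Φ, d', hΦ⟩ := exists_isLift hφ.1
  obtain ⟨m, hm⟩ := lift_unique (hΦ.continuous.comp h.continuous) continuous_id fun t => by
    rw [Function.comp, hΦ.toCircle_eq, h.toCircle_eq, h1]
    rfl
  have hdΨ : ∀ t, HasDerivAt Ψ (deriv Ψ t) t := fun t =>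
    (h.sobolevOn (k := 1) hs).hasDerivAt (k := 0) isOpen_univ (mem_univ t)
  have hdΦ : ∀ t, HasDerivAt Φ (deriv Φ t) t := fun t =>
    (hΦ.sobolevOn (k := 1) hφ).hasDerivAt (k := 0) isOpen_univ (mem_univ t)
  constructor
  · intro t
    have e1 := (hdΦ (Ψ t)).comp t (hdΨ t)
    have e2 : HasDerivAt (Φ ∘ Ψ) 1 t := by
      rw [show Φ ∘ Ψ = fun t => t + (m : ℝ) from funext hm]
      exact (hasDerivAt_id t).add_const _
    exact right_ne_zero_of_mul ((e1.unique e2).trans_ne one_ne_zero)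
  · have e := hm (0 + 1)
    have e0 := hm 0
    simp only [Function.comp, id] at e e0
    rw [h.add_one, hΦ.add_intCast, e0] at e
    have : (d : ℝ) * d' = 1 := by linarith
    exact Int.eq_one_or_neg_one_of_mul_eq_one (by exact_mod_cast this)

theorem IsLift.surjective (h : IsLift ψ Ψ d) (hd : d = 1 ∨ d = -1) : Function.Surjective Ψ := by
  intro s
  have hm : ∀ m : ℤ, Ψ m = Ψ 0 + m * d := fun m => by
    have := h.add_intCast m 0
    rwa [zero_add] at this
  obtain ⟨N, hN⟩ := exists_nat_gt |s - Ψ 0|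
  obtain ⟨h1, h2⟩ := abs_lt.1 hN
  have e1 := hm N
  have e2 := hm (-N)
  push_cast at e1 e2
  rcases hd with rfl | rfl
  · push_cast at e1 e2
    exact mem_range_of_exists_le_of_exists_ge h.continuous ⟨-N, by linarith⟩ ⟨N, by linarith⟩
  · push_cast at e1 e2
    exact mem_range_of_exists_le_of_exists_ge h.continuous ⟨N, by linarith⟩ ⟨-N, by linarith⟩

/-- Inverses of lifts. -/
theorem IsLift.exists_inverse (h : IsLift ψ Ψ d) (hd : d = 1 ∨ d = -1)
    (hΨ : SobolevOn (k + 2) univ Ψ) (h0 : ∀ t, deriv Ψ t ≠ 0) :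
    ∃ (φ : Circle → Circle) (Φ : ℝ → ℝ), Function.LeftInverse φ ψ ∧ Function.RightInverse φ ψ ∧
      (∀ t, Φ (Ψ t) = t) ∧ (∀ t, Ψ (Φ t) = t) ∧ SobolevOn (k + 2) univ Φ ∧
      ∀ t, toCircle (Φ t) = φ (toCircle t) := by
  have hinj := (hΨ.isC1Immersion h0).injective
  obtain ⟨Φ, h2⟩ := (h.surjective hd).hasRightInverse
  have h1 : ∀ t, Φ (Ψ t) = t := fun t => hinj (h2 _)
  have hΦ1 : ∀ t, Φ (t + 1) = Φ t + d := fun t => by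
    refine hinj ?_
    rw [h2, h.add_intCast, h2]
    rcases hd with rfl | rfl <;> norm_num
  obtain ⟨φ, hφ⟩ := exists_circle_map (w := fun t => toCircle (Φ t)) fun t => by
    rw [hΦ1, toCircle_add_intCast]
  have hS := (STendsto.inverse (P := fun _ : Unit => Ψ) (Q := fun _ => Φ)
    (hΨ.sTendsto isOpen_univ ⊤) (fun _ => h0) h0 (fun _ => h1) (fun _ => h2) h1 h2).lim
  refine ⟨φ, Φ, fun z => ?_, fun z => ?_, h1, h2, hS, fun t => (hφ t).symm⟩
  · obtain ⟨t, rfl⟩ := toCircle_surjective z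
    rw [← h.toCircle_eq, hφ, h1]
  · obtain ⟨t, rfl⟩ := toCircle_surjective z
    rw [hφ, ← h.toCircle_eq, h2]

theorem IsLift.isSobolevDiffeo (h : IsLift ψ Ψ d) (hd : d = 1 ∨ d = -1)
    (hΨ : SobolevOn (k + 2) univ Ψ) (h0 : ∀ t, deriv Ψ t ≠ 0) : IsSobolevDiffeo (k + 2) ψ := by
  obtain ⟨φ, Φ, hl, hr, -, -, hS, hφ⟩ := h.exists_inverse hd hΨ h0
  exact ⟨isSobolevLoop_of_lift (k := k + 1) h.toCircle_eq hΨ, φ, hl, hr,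
    isSobolevLoop_of_lift (k := k + 1) hφ hS⟩

/-- Once the derivative of the lift vanishes nowhere, inversion preserves `W^{k+2,2}`, so no
separate condition on the inverse remains. -/
theorem isSobolevDiffeo_iff (hψ : IsSobolevDiffeo 2 ψ) :
    IsSobolevDiffeo (k + 2) ψ ↔ IsSobolevLoop 1 (k + 2) ψ := by
  refine ⟨fun h => h.1, fun h => ?_⟩
  obtain ⟨Ψ, d, hΨ⟩ := exists_isLift h.1
  obtain ⟨h0, hd⟩ := hΨ.of_isSobolevDiffeo hψ
  exact hΨ.isSobolevDiffeo hd (hΨ.sobolevOn (k := k + 1) h) h0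

/-- A smooth function close to a lift. -/
theorem IsLift.exists_contDiff (h : IsLift ψ Ψ d) (hΨ : SobolevOn 2 univ Ψ) :
    ∃ Θ : ℝ → ℝ, ContDiff ℝ ∞ Θ ∧ (∀ t, Θ (t + 1) = Θ t + d) ∧ ∀ t, |Ψ t - Θ t| < 1 / 2 := by
  -- Subtracting `t * d` makes the lift periodic, hence a section of the trivial line bundle. Smooth
  -- sections are dense in `W^{2,2}`, and staying within `1/2` of a given section is an open
  -- condition there.
  have hs : SobolevOn 2 univ (fun t => EuclideanSpace.single (0 : Fin 1) (Ψ t - t * d)) := by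
    have hF : ContDiffOn ℝ ∞ (fun p : ℝ × ℝ => EuclideanSpace.single (0 : Fin 1) (p.2 - p.1 * d)) univ := by
      have : ∀ x : ℝ, EuclideanSpace.single (0 : Fin 1) x = x • EuclideanSpace.single (0 : Fin 1) (1 : ℝ) :=
        fun x => by ext i; simp [Subsingleton.elim i 0]
      refine ContDiff.contDiffOn ?_
      rw [show (fun p : ℝ × ℝ => EuclideanSpace.single (0 : Fin 1) (p.2 - p.1 * d)) =
        fun p : ℝ × ℝ => (p.2 - p.1 * d) • EuclideanSpace.single (0 : Fin 1) (1 : ℝ) from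
        funext fun p => this _]
      fun_prop
    have h1 := ((contDiff_id (𝕜 := ℝ) (E := ℝ)).sobolevOn (k := 2) isOpen_univ).sTendsto isOpen_univ
      (pure ()) |>.prodMk isOpen_univ (hΨ.sTendsto isOpen_univ (pure ()))
    exact SobolevOn.superpose (k := 1) isOpen_univ isOpen_univ hF h1.lim fun t _ => mem_univ _
  let η : SobolevSection (ContinuousLinearEquiv.refl ℝ (EuclideanSpace ℝ (Fin 1))) 2 :=
    SobolevSection.ofSobolevOn _ (continuousOn_univ.1 (hs.continuousOn (k := 1) isOpen_univ))
      (fun t => by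
        rw [h.add_one]
        simp only [ContinuousLinearEquiv.refl_apply]
        congr 1
        ring) hs
  have hη : ∀ t, η t 0 = Ψ t - t * d := fun t => by
    change (EuclideanSpace.single (0 : Fin 1) (Ψ t - t * d)) 0 = _
    simp
  have hev : Continuous fun x : EuclideanSpace ℝ (Fin 1) => x 0 := by fun_prop
  have hO := SobolevSection.isOpen_forall_mem (k := 1)
    (A := ContinuousLinearEquiv.refl ℝ (EuclideanSpace ℝ (Fin 1)))
    (Ω := {p | |p.2 0 - η p.1 0| < 1 / 2})
    (isOpen_lt ((hev.comp continuous_snd).sub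
      (hev.comp (η.property.1.comp continuous_fst))).abs continuous_const)
    (fun t x => by simp [η.property.2.1 t])
  obtain ⟨ζ, hζ, hsm⟩ := (SobolevSection.dense_contDiff (k := 0)
    (A := ContinuousLinearEquiv.refl ℝ (EuclideanSpace ℝ (Fin 1)))).inter_open_nonempty _ hO
    ⟨η, fun t => by simp⟩
  refine ⟨fun t => ζ t 0 + t * d, ?_, fun t => ?_, fun t => ?_⟩
  · have hp : ContDiff ℝ ∞ fun x : EuclideanSpace ℝ (Fin 1) => x 0 := by fun_prop
    exact (hp.comp hsm).add (contDiff_id.mul contDiff_const)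
  · have := congrArg (fun x : EuclideanSpace ℝ (Fin 1) => x 0) (ζ.property.2.1 t)
    simp only [ContinuousLinearEquiv.refl_apply] at this
    simp only [this]
    ring
  · have := hζ t
    simp only [mem_ofPred_eq, hη] at this
    rw [abs_sub_comm]
    convert this using 2
    ring

end Lifts

/-! ### Open conditions on families of functions -/

section OpenFamilies

variable {E : ScScale} {V : Type*} [NormedAddCommGroup V] [NormedSpace ℝ V] {k k₀ : ℕ}

theorem SobC0.derivs {U : Set (E.X 0)} {P : E.X 0 → ℝ → V} (h : SobC0 E U (k₀ + 1) P) :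
    SobC0 E U k₀ (fun x => deriv (P x)) := fun m x => (h m x).derivs (k := m + k₀)

theorem SobC0.isOpen_forall_mem {U : Set (E.X 0)} (hU : IsOpen U) {P : E.X 0 → ℝ → V}
    (h : SobC0 E U (k₀ + 1) P) {Ω : Set V} (hΩ : IsOpen Ω)
    (hper : ∀ x ∈ U, ∀ t, P x (t + 1) ∈ Ω ↔ P x t ∈ Ω) : IsOpen {x | x ∈ U ∧ ∀ t, P x t ∈ Ω} := by
  refine isOpen_iff_mem_nhds.2 fun x hx => ?_
  have h1 : ∀ᶠ y : {y : E.X 0 // E.toBase 0 y ∈ U} in 𝓝 ⟨x, hx.1⟩, ∀ t, P (E.toBase 0 y) t ∈ Ω :=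
    eventually_forall_of_periodic
      (p := fun (y : {y : E.X 0 // E.toBase 0 y ∈ U}) t => P (E.toBase 0 y) t ∈ Ω)
      (fun y t => hper _ y.2 t)
      fun t => (h 0 ⟨x, hx.1⟩).cconv (k := 0 + k₀) t (mem_univ t) (hΩ.mem_nhds (hx.2 t))
  have h2 : map Subtype.val (𝓝 (⟨x, hx.1⟩ : {y : E.X 0 // E.toBase 0 y ∈ U})) = 𝓝 x :=
    (IsOpen.isOpenEmbedding_subtypeVal (s := {y | E.toBase 0 y ∈ U}) hU).map_nhds_eq ⟨x, hx.1⟩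
  rw [← h2, mem_map]
  filter_upwards [h1] with y hy using ⟨y.2, hy⟩

end OpenFamilies

/-! ### Smooth families of lifts and openness of the diffeomorphisms -/

section LiftFamilies

/-- A smooth family of lifts of the maps `S¹ → S¹` in the domain of a chart. -/
structure LiftFamily (c : FiberChart 1 Circle) where
  d : ℤ
  Ω : Set (ℝ × EuclideanSpace ℝ (Fin 1))
  K : ℝ × EuclideanSpace ℝ (Fin 1) → ℝ
  isOpen : IsOpen Ω
  contDiffOn : ContDiffOn ℝ ∞ K Ω
  mem_add_one : ∀ t x, (t + 1, c.A x) ∈ Ω ↔ (t, x) ∈ Ω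
  toCircle_eq : ∀ z ∈ Ω, toCircle (K z) = c.bwd z
  add_one : ∀ t x, (t, x) ∈ Ω → K (t + 1, c.A x) = K (t, x) + d

/-- The lift `Ψ` of `ψ` is only of class `W^{2,2}`, while `K` has to be smooth in `t`. It is
therefore built around a smooth `Θ` within `1/2` of `Ψ`, by adding the logarithm of the quotient of
the circle map by `toCircle (Θ t)`. This bound keeps the quotient away from `-1`. -/
theorem exists_liftFamily {c : FiberChart 1 Circle} {ψ : Circle → Circle} (hψ : IsSobolevLoop 1 2 ψ)
    {ξ : ℝ → EuclideanSpace ℝ (Fin 1)} (h : c.Represents ψ ξ) :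
    ∃ L : LiftFamily c, ∀ t, (t, ξ t) ∈ L.Ω := by
  obtain ⟨Ψ, d, hΨ⟩ := exists_isLift hψ.1
  obtain ⟨Θ, hΘ, hΘ1, hΘΨ⟩ := hΨ.exists_contDiff (hΨ.sobolevOn (k := 1) hψ)
  have hq : ContMDiffOn 𝓘(ℝ, ℝ × EuclideanSpace ℝ (Fin 1)) (𝓡 1) ∞
      (fun z => c.bwd z * (toCircle (Θ z.1))⁻¹) c.e.target :=
    c.contMDiffOn_bwd.mul (contMDiff_toCircle.comp (hΘ.comp contDiff_fst).contMDiff).inv.contMDiffOn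
  have hper : ∀ t x, (t, x) ∈ c.e.target → c.bwd (t + 1, c.A x) * (toCircle (Θ (t + 1)))⁻¹ =
      c.bwd (t, x) * (toCircle (Θ t))⁻¹ := fun t x hx => by
    rw [FiberChart.bwd_add_one hx, hΘ1, toCircle_add_intCast]
  refine ⟨{
    d := d
    Ω := c.e.target ∩ (fun z => c.bwd z * (toCircle (Θ z.1))⁻¹) ⁻¹' slitCircle
    K := fun z => Θ z.1 + circleLog (c.bwd z * (toCircle (Θ z.1))⁻¹)
    isOpen := hq.continuousOn.isOpen_inter_preimage c.e.open_target isOpen_slitCircle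
    contDiffOn := ((hΘ.comp contDiff_fst).contDiffOn).add
      (contMDiffOn_circleLog.comp (hq.mono inter_subset_left) fun z hz => hz.2).contDiffOn
    mem_add_one := fun t x => ?_
    toCircle_eq := fun z hz => ?_
    add_one := fun t x hx => ?_ }, fun t => ?_⟩
  · refine (and_congr_left fun _ => FiberChart.mem_target_add_one).trans
      (and_congr_right fun hx => ?_)
    simp only [mem_preimage, hper t x hx]
  · rw [toCircle_add, toCircle_circleLog, mul_comm, inv_mul_cancel_right]
  · change Θ (t + 1) + circleLog (c.bwd (t + 1, c.A x) * (toCircle (Θ (t + 1)))⁻¹) =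
      Θ t + circleLog (c.bwd (t, x) * (toCircle (Θ t))⁻¹) + d
    rw [hper t x hx.1, hΘ1]
    ring
  · obtain ⟨h1, h2⟩ := FiberChart.represents_iff_symm.1 h t
    refine ⟨h1, ?_⟩
    have e : c.bwd (t, ξ t) * (toCircle (Θ t))⁻¹ = toCircle (Ψ t - Θ t) := by
      rw [h2, ← hΨ.toCircle_eq, mul_inv_eq_iff_eq_mul, ← toCircle_add, sub_add_cancel]
    change c.bwd (t, ξ t) * (toCircle (Θ t))⁻¹ ∈ slitCircle
    rw [e]
    exact toCircle_mem_slitCircle (hΘΨ t)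

namespace LiftFamily

variable {c : FiberChart 1 Circle} (L : LiftFamily c)

/-- The lift given by a section. -/
def lift (ξ : SobolevSection c.A 2) (t : ℝ) : ℝ := L.K (t, ξ t)

/-- The sections with graph in the domain of the family. -/
def dom : Set (SobolevSection c.A 2) := {ξ | ∀ t, (t, ξ t) ∈ L.Ω}

theorem isOpen_dom : IsOpen L.dom :=
  SobolevSection.isOpen_forall_mem (k := 1) L.isOpen L.mem_add_one

theorem sobC (k : ℕ) : SobC k (sobolevScale c.A) L.dom 2 L.lift :=
  sobLin_sobolevScale.sobC_graph.superpose (k₀ := 1) L.isOpen L.contDiffOn fun ξ hξ t => hξ t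

theorem sobolevOn_lift {ξ : SobolevSection c.A 2} (hξ : ξ ∈ L.dom) : SobolevOn 2 univ (L.lift ξ) := by
  have := ((L.sobC 0).sobC0 0 ⟨ξ, hξ⟩).lim
  exact this

theorem lift_add_one {ξ : SobolevSection c.A 2} (hξ : ξ ∈ L.dom) (t : ℝ) :
    L.lift ξ (t + 1) = L.lift ξ t + L.d := by
  rw [lift, ξ.equivariant, L.add_one _ _ (hξ t), lift]

theorem isLift {ξ : SobolevSection c.A 2} (hξ : ξ ∈ L.dom) {ψ : Circle → Circle}
    (h : c.Represents ψ ξ) : IsLift ψ (L.lift ξ) L.d where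
  continuous := continuousOn_univ.1 ((L.sobolevOn_lift hξ).continuousOn (k := 1) isOpen_univ)
  toCircle_eq t := (L.toCircle_eq _ (hξ t)).trans (FiberChart.represents_iff_symm.1 h t).2
  add_one := L.lift_add_one hξ

/-- The sections with lift of nonvanishing derivative. -/
def regDom : Set (SobolevSection c.A 2) := {ξ | ξ ∈ L.dom ∧ ∀ t, deriv (L.lift ξ) t ∈ ({0}ᶜ : Set ℝ)}

theorem isOpen_regDom : IsOpen L.regDom := by
  refine SobC0.isOpen_forall_mem (E := sobolevScale c.A) (k₀ := 0) L.isOpen_dom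
    ((L.sobC 0).sobC0.derivs) isOpen_compl_singleton fun ξ hξ t => ?_
  have e : (fun s => L.lift ξ (s + 1)) = fun s => L.lift ξ s + L.d := funext (L.lift_add_one hξ)
  have := congrArg (fun f => deriv f t) e
  simp only [deriv_comp_add_const, deriv_add_const] at this
  rw [this]

theorem mem_regDom {ξ : SobolevSection c.A 2} (hξ : ξ ∈ L.dom) {ψ : Circle → Circle}
    (h : c.Represents ψ ξ) (hψ : IsSobolevDiffeo 2 ψ) : ξ ∈ L.regDom ∧ (L.d = 1 ∨ L.d = -1) := by
  obtain ⟨h0, hd⟩ := (L.isLift hξ h).of_isSobolevDiffeo hψ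
  exact ⟨⟨hξ, h0⟩, hd⟩

theorem isSobolevDiffeo {ξ : SobolevSection c.A 2} (hξ : ξ ∈ L.regDom) (hd : L.d = 1 ∨ L.d = -1)
    {ψ : Circle → Circle} (h : c.Represents ψ ξ) : IsSobolevDiffeo 2 ψ :=
  (L.isLift hξ.1 h).isSobolevDiffeo (k := 0) hd (L.sobolevOn_lift hξ.1) hξ.2

end LiftFamily

/-- In a chart the lifts depend continuously on the section in `W^{2,2} ⊆ C¹` and have a common
degree `±1`. Nonvanishing of the derivative is an open condition, and together with the degree it
characterizes diffeomorphisms. -/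
theorem isOpen_circleDiffeo : IsOpen CircleDiffeo := by
  refine isOpen_iff_mem_nhds.2 fun ψ hψ => ?_
  obtain ⟨c, hc⟩ := exists_fiberChart (n := 1) ψ.sobolev.1
  have hs : ψ ∈ (c.loopChart ψ).chart.source := FiberChart.mem_source_iff.2 hc
  obtain ⟨L, hL⟩ := exists_liftFamily ψ.sobolev (FiberChart.represents_chart hs)
  obtain ⟨hreg, hd⟩ := L.mem_regDom hL (FiberChart.represents_chart hs) hψ
  have ho := (c.continuousOn_chart ψ).isOpen_inter_preimage (c.isOpen_chart_source ψ) L.isOpen_regDom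
  filter_upwards [ho.mem_nhds ⟨hs, hreg⟩] with φ hφ
  exact L.isSobolevDiffeo hφ.2 hd (FiberChart.represents_chart hφ.1)

end LiftFamilies

/-! ### Composition and inversion in charts -/

section SmoothnessInCharts

variable {n : ℕ} {M : Type*} [TopologicalSpace M] [ChartedSpace (EuclideanSpace ℝ (Fin n)) M]
  [IsManifold (𝓡 n) ∞ M] {E : ScScale} {Z : Type*} [NormedAddCommGroup Z] [NormedSpace ℝ Z]
  [CompleteSpace Z]

/-- A map into a loop space which is locally given by smooth families of functions. -/
theorem scSmoothOn_loopChart (hE : E.IsRegular) {U : Set (E.X 0)} (hU : IsOpen U)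
    {w : E.X 0 → SobolevLoopSpace n M}
    (hloc : ∀ x ∈ U, ∃ O, IsOpen O ∧ x ∈ O ∧ ∃ (Q : E.X 0 → ℝ → Z) (Ω : Set Z) (H : Z → M),
      (∀ k, SobC k E (U ∩ O) 2 Q) ∧ IsOpen Ω ∧ ContMDiffOn 𝓘(ℝ, Z) (𝓡 n) ∞ H Ω ∧
      ∀ y ∈ U ∩ O, ∀ t, Q y t ∈ Ω ∧ H (Q y t) = w y (toCircle t))
    (e : FiberChart n M) (v₀ : SobolevLoopSpace n M) :
    IsOpen (U ∩ w ⁻¹' (e.loopChart v₀).chart.source) ∧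
    ScSmoothOn E (e.loopChart v₀).model (U ∩ w ⁻¹' (e.loopChart v₀).chart.source)
      (fun x => (e.loopChart v₀).chart (w x)) := by
  -- Adjoining the time to the family makes the condition that the graph lies in the domain of `e` a
  -- pointwise open condition, and the chart representation a superposition with `e.fwd`.
  have hloc' : ∀ x ∈ U, ∃ O, IsOpen O ∧ x ∈ O ∧ ∃ (Q : E.X 0 → ℝ → ℝ × Z) (Ω : Set (ℝ × Z))
      (G : ℝ × Z → EuclideanSpace ℝ (Fin n)), (∀ k, SobC k E (U ∩ O) 2 Q) ∧ IsOpen Ω ∧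
      ContDiffOn ℝ ∞ G Ω ∧ ∀ y ∈ U ∩ O, ∀ t, (Q y t ∈ Ω ↔ (t, w y (toCircle t)) ∈ e.e.source) ∧
        G (Q y t) = e.fwd (t, w y (toCircle t)) := by
    intro x hx
    obtain ⟨O, hO, hxO, Q, Ω, H, hQ, hΩ, hH, hw⟩ := hloc x hx
    have hΩ' : IsOpen (Prod.snd ⁻¹' Ω : Set (ℝ × Z)) := hΩ.preimage continuous_snd
    have hH' : ContMDiffOn 𝓘(ℝ, ℝ × Z) (𝓡 n) ∞ (fun z : ℝ × Z => H z.2) (Prod.snd ⁻¹' Ω) :=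
      hH.comp contDiff_snd.contMDiff.contMDiffOn fun z hz => hz
    refine ⟨O, hO, hxO, fun y t => (t, Q y t), _, _,
      fun k => (SobC.const (f := fun t : ℝ => t) contDiff_id).prodMk (hQ k),
      isOpen_comp_pair e.e.open_source hΩ' continuous_fst hH'.continuousOn,
      e.contMDiffOn_fwd.contDiffOn_comp_pair contDiff_fst hH', fun y hy t => ⟨?_, ?_⟩⟩
    · simp only [mem_ofPred_eq, mem_preimage, (hw y hy t).2]
      exact and_iff_right (hw y hy t).1
    · simp only [(hw y hy t).2]
  have hopen : IsOpen (U ∩ w ⁻¹' (e.loopChart v₀).chart.source) := by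
    refine isOpen_iff_mem_nhds.2 fun x hx => ?_
    obtain ⟨O, hO, hxO, Q, Ω, G, hQ, hΩ, hG, hw⟩ := hloc' x hx.1
    have ho := (hQ 0).sobC0.isOpen_forall_mem (k₀ := 1) (hU.inter hO) hΩ fun y hy t => by
      rw [(hw y hy t).1, (hw y hy (t + 1)).1, toCircle_add_one, e.source_iff]
    have hx' := (FiberChart.mem_source_iff (v₀ := v₀)).1 hx.2
    filter_upwards [ho.mem_nhds ⟨⟨hx.1, hxO⟩, fun t => (hw x ⟨hx.1, hxO⟩ t).1.2 (hx' t)⟩] with y hy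
    exact ⟨hy.1.1, (FiberChart.mem_source_iff (v₀ := v₀)).2 fun t => (hw y hy.1 t).1.1 (hy.2 t)⟩
  refine ⟨hopen, scSmoothOn_of_sobC hE hopen fun x hx => ?_⟩
  obtain ⟨O, hO, hxO, Q, Ω, G, hQ, hΩ, hG, hw⟩ := hloc' x hx.1
  have hsub : U ∩ w ⁻¹' (e.loopChart v₀).chart.source ∩ O ⊆ U ∩ O :=
    inter_subset_inter_left _ inter_subset_left
  refine ⟨O, hO, hxO, fun y t => G (Q y t), fun k => ((hQ k).mono hsub).superpose (k₀ := 1) hΩ hG ?_, ?_⟩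
  · exact fun y hy t => (hw y (hsub hy) t).1.2 ((FiberChart.mem_source_iff (v₀ := v₀)).1 hy.1.2 t)
  · exact fun y hy t => (FiberChart.chart_apply hy.1.2 t).trans (hw y (hsub hy) t).2.symm

/-- Smoothness of composition in charts. -/
theorem scSmoothOn_comp (hE : E.IsRegular) {U : Set (E.X 0)} (hU : IsOpen U) {c : FiberChart n M}
    {b : FiberChart 1 Circle} (α : E.Map (sobolevScale c.A)) (β : E.Map (sobolevScale b.A))
    {v : E.X 0 → SobolevLoopSpace n M} {ψ : E.X 0 → SobolevLoopSpace 1 Circle}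
    (hv : ∀ x ∈ U, c.Represents (v x) (SobolevSection.toFun (α.map 0 x)))
    (hψ : ∀ x ∈ U, b.Represents (ψ x) (SobolevSection.toFun (β.map 0 x)))
    (hψD : ∀ x ∈ U, ψ x ∈ CircleDiffeo) {w : E.X 0 → SobolevLoopSpace n M}
    (hw : ∀ x ∈ U, ∀ z, w x z = v x (ψ x z)) (e : FiberChart n M) (v₀ : SobolevLoopSpace n M) :
    IsOpen (U ∩ w ⁻¹' (e.loopChart v₀).chart.source) ∧
    ScSmoothOn E (e.loopChart v₀).model (U ∩ w ⁻¹' (e.loopChart v₀).chart.source)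
      (fun x => (e.loopChart v₀).chart (w x)) := by
  refine scSmoothOn_loopChart (Z := ℝ × EuclideanSpace ℝ (Fin n)) hE hU (fun x hx => ?_) e v₀
  obtain ⟨L, hL⟩ := exists_liftFamily (ψ x).sobolev (hψ x hx)
  obtain ⟨hreg, hd⟩ := L.mem_regDom hL (hψ x hx) (hψD x hx)
  have hlift : ∀ k, SobC k E (U ∩ β.map 0 ⁻¹' L.regDom) 2 (fun y => L.lift (β.map 0 y)) := fun k =>
    (L.sobC k).comp_map β fun y hy => hy.2.1
  -- In the chart `c` the loop `v` is `t ↦ c.bwd (t, ξ t)`, so `v ∘ ψ` is `c.bwd` applied to `(Ψ, ξ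
  -- ∘ Ψ)`, with `Ψ` the lift of `ψ`. It is smooth by composition with a family of immersions.
  refine ⟨β.map 0 ⁻¹' L.regDom, L.isOpen_regDom.preimage (β.map 0).continuous, hreg,
    fun y t => (L.lift (β.map 0 y) t, SobolevSection.toFun (α.map 0 y) (L.lift (β.map 0 y) t)),
    c.e.target, c.bwd, fun k => (hlift k).prodMk ?_, c.e.open_target, c.contMDiffOn_bwd,
    fun y hy t => ?_⟩
  · exact (sobLin_sobolevScale.comp_map α).sobC_comp (k₀ := 0) (hlift k) fun y hy => hy.2.2
  · obtain ⟨h1, h2⟩ := FiberChart.represents_iff_symm.1 (hv y hy.1) (L.lift (β.map 0 y) t)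
    refine ⟨h1, ?_⟩
    rw [h2, (L.isLift hy.2.1 (hψ y hy.1)).toCircle_eq, hw y hy.1]

/-- Smoothness of inversion in charts. -/
theorem scSmoothOn_inverse (hE : E.IsRegular) {U : Set (E.X 0)} (hU : IsOpen U)
    {b : FiberChart 1 Circle} (β : E.Map (sobolevScale b.A)) {ψ : E.X 0 → SobolevLoopSpace 1 Circle}
    (hψ : ∀ x ∈ U, b.Represents (ψ x) (SobolevSection.toFun (β.map 0 x)))
    (hψD : ∀ x ∈ U, ψ x ∈ CircleDiffeo) {w : E.X 0 → SobolevLoopSpace 1 Circle}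
    (hw : ∀ x ∈ U, Function.LeftInverse (w x) (ψ x)) (e : FiberChart 1 Circle)
    (v₀ : SobolevLoopSpace 1 Circle) :
    IsOpen (U ∩ w ⁻¹' (e.loopChart v₀).chart.source) ∧
    ScSmoothOn E (e.loopChart v₀).model (U ∩ w ⁻¹' (e.loopChart v₀).chart.source)
      (fun x => (e.loopChart v₀).chart (w x)) := by
  refine scSmoothOn_loopChart (Z := ℝ) hE hU (fun x hx => ?_) e v₀
  obtain ⟨L, hL⟩ := exists_liftFamily (ψ x).sobolev (hψ x hx)
  obtain ⟨hreg, hd⟩ := L.mem_regDom hL (hψ x hx) (hψD x hx)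
  have hO : IsOpen (β.map 0 ⁻¹' L.regDom) := L.isOpen_regDom.preimage (β.map 0).continuous
  have hinv : ∀ y : E.X 0, ∃ Φ : ℝ → ℝ, y ∈ U ∩ β.map 0 ⁻¹' L.regDom →
      (∀ t, Φ (L.lift (β.map 0 y) t) = t) ∧ (∀ t, L.lift (β.map 0 y) (Φ t) = t) ∧
      ∀ t, toCircle (Φ t) = w y (toCircle t) := by
    intro y
    by_cases hy : y ∈ U ∩ β.map 0 ⁻¹' L.regDom
    · obtain ⟨φ, Φ, hl, hr, h1, h2, -, h3⟩ := (L.isLift hy.2.1 (hψ y hy.1)).exists_inverse (k := 0) hd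
        (L.sobolevOn_lift hy.2.1) hy.2.2
      refine ⟨Φ, fun _ => ⟨h1, h2, fun t => ?_⟩⟩
      rw [h3, (hw y hy.1).eq_rightInverse hr]
    · exact ⟨id, fun h => absurd h hy⟩
  choose Φ hΦ using hinv
  refine ⟨_, hO, hreg, Φ, univ, toCircle, fun k => ?_, isOpen_univ,
    contMDiff_toCircle.contMDiffOn, fun y hy t => ⟨mem_univ _, (hΦ y hy).2.2 t⟩⟩
  exact (sobLin_sobolevScale.comp_map β).sobC_inverse (k₀ := 0) (hU.inter hO) L.isOpen L.contDiffOn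
    (fun y hy t => hy.2.1 t) (fun y hy t => hy.2.2 t) (fun y hy => (hΦ y hy).1)
    (fun y hy => (hΦ y hy).2.1)

end SmoothnessInCharts

/-! ### Testing sc-smoothness in charts -/

section SmoothMaps

variable {X Y : Type*} [TopologicalSpace X] [TopologicalSpace Y] {𝒜 : Set (ScChart X)}
  {ℬ : Set (ScChart Y)}

/-- The charts of `𝒜` are continuous with open domains, and they cover `X`. -/
structure IsContinuousAtlas (𝒜 : Set (ScChart X)) : Prop where
  open_source : ∀ c ∈ 𝒜, IsOpen c.chart.source
  continuousOn : ∀ c ∈ 𝒜, ContinuousOn c.chart c.chart.source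
  cover : ∀ x : X, ∃ c ∈ 𝒜, x ∈ c.chart.source

theorem IsScManifold.isContinuousAtlas (h : IsScManifold X 𝒜) : IsContinuousAtlas 𝒜 :=
  ⟨h.open_source, h.continuousOn, h.cover⟩

theorem IsContinuousAtlas.prod (h𝒜 : IsContinuousAtlas 𝒜) (hℬ : IsContinuousAtlas ℬ) :
    IsContinuousAtlas (prodAtlas 𝒜 ℬ) where
  open_source := by
    rintro _ ⟨c, hc, d, hd, rfl⟩
    exact (h𝒜.open_source c hc).prod (hℬ.open_source d hd)
  continuousOn := by
    rintro _ ⟨c, hc, d, hd, rfl⟩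
    exact (h𝒜.continuousOn c hc).prodMap (hℬ.continuousOn d hd)
  cover x := by
    obtain ⟨c, hc, hxc⟩ := h𝒜.cover x.1
    obtain ⟨d, hd, hxd⟩ := hℬ.cover x.2
    exact ⟨_, ⟨c, hc, d, hd, rfl⟩, hxc, hxd⟩

/-- A map is sc-smooth if its representatives are sc-smooth with open domains. -/
theorem scSmooth_of_charts (h𝒜 : IsContinuousAtlas 𝒜) (hℬ : IsScManifold Y ℬ) {f : X → Y}
    (h : ∀ c ∈ 𝒜, ∀ d ∈ ℬ,
      IsOpen (c.chart.target ∩ (fun y => f (c.chart.symm y)) ⁻¹' d.chart.source) ∧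
      ScSmoothOn c.model d.model (c.chart.target ∩ (fun y => f (c.chart.symm y)) ⁻¹' d.chart.source)
        (fun y => d.chart (f (c.chart.symm y)))) : ScSmooth 𝒜 ℬ f := by
  refine ⟨continuous_iff_continuousAt.2 fun x => ?_, fun c hc d hd => (h c hc d hd).2⟩
  obtain ⟨c, hc, hxc⟩ := h𝒜.cover x
  obtain ⟨d, hd, hxd⟩ := hℬ.cover (f x)
  obtain ⟨ho, hs⟩ := h c hc d hd
  have hx : c.chart x ∈ c.chart.target ∩ (fun y => f (c.chart.symm y)) ⁻¹' d.chart.source := by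
    refine ⟨c.chart.map_source hxc, ?_⟩
    rw [mem_preimage, c.chart.left_inv hxc]
    exact hxd
  have h1 : ContinuousAt c.chart x :=
    (h𝒜.continuousOn c hc).continuousAt ((h𝒜.open_source c hc).mem_nhds hxc)
  have h2 := (hs.continuousOn.continuousAt (ho.mem_nhds hx)).comp h1
  have h3 : ContinuousAt d.chart.symm (d.chart (f (c.chart.symm (c.chart x)))) :=
    (hℬ.continuousOn_symm d hd).continuousAt
      ((hℬ.open_target d hd).mem_nhds (d.chart.map_source hx.2))
  refine (ContinuousAt.comp (f := fun x => d.chart (f (c.chart.symm (c.chart x)))) h3 h2).congr ?_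
  filter_upwards [h1.preimage_mem_nhds (ho.mem_nhds hx), (h𝒜.open_source c hc).mem_nhds hxc]
    with y hy hyc
  exact (d.chart.left_inv hy.2).trans (congrArg f (c.chart.left_inv hyc))

end SmoothMaps

/-! ### The reparametrization action and the sc-Lie group of diffeomorphisms -/

section Diffeomorphisms

theorem isScManifold_loopAtlas {n : ℕ} {M : Type*} [TopologicalSpace M]
    [ChartedSpace (EuclideanSpace ℝ (Fin n)) M] [IsManifold (𝓡 n) ∞ M] [T2Space M]
    [SecondCountableTopology M] : IsScManifold (SobolevLoopSpace n M) (loopAtlas n M) :=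
  isScManifold_sobolevLoopSpace fun v => exists_fiberChart v.sobolev.1

theorem isScManifold_diffeoAtlas : IsScManifold CircleDiffeo diffeoAtlas := by
  have := metrizableSpace_sobolevLoopSpace (n := 1) (M := Circle)
    fun v => exists_fiberChart v.sobolev.1
  let := TopologicalSpace.metrizableSpaceMetric (SobolevLoopSpace 1 Circle)
  have : ParacompactSpace CircleDiffeo := inferInstance
  exact isScManifold_loopAtlas.restrict isOpen_circleDiffeo

theorem scLevel_diffeoAtlas (m : ℕ) :
    scLevel diffeoAtlas m = {ψ | IsSobolevDiffeo (m + 2) ψ.1.toFun} := by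
  rw [diffeoAtlas, scLevel_restrictAtlas,
    scLevel_loopAtlas (n := 1) fun v => exists_fiberChart v.sobolev.1]
  exact Set.ext fun ψ => (isSobolevDiffeo_iff ψ.2).symm

variable {n : ℕ} {M : Type*} [TopologicalSpace M] [ChartedSpace (EuclideanSpace ℝ (Fin n)) M]
  [IsManifold (𝓡 n) ∞ M] [T2Space M]

theorem IsSobolevLoop.comp {v : Circle → M} (hv : IsSobolevLoop n 2 v) {ψ : Circle → Circle}
    (hψ : IsSobolevDiffeo 2 ψ) : IsSobolevLoop n 2 (fun z => v (ψ z)) := by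
  obtain ⟨c, hc⟩ := exists_fiberChart (n := n) hv.1
  obtain ⟨Ψ, d, hΨ⟩ := exists_isLift hψ.1.1
  obtain ⟨h0, -⟩ := hΨ.of_isSobolevDiffeo hψ
  have hΨs := (hΨ.sobolevOn (k := 1) hψ.1).sTendsto isOpen_univ (pure ())
  have hs := (FiberChart.sobolevOn_fwd (k := 1) hv hc).sTendsto isOpen_univ (pure ())
  have h1 := hΨs.prodMk isOpen_univ (hs.comp hΨs le_rfl le_rfl (fun _ => h0) h0)
  refine isSobolevLoop_of_comp (k := 1) h1.lim c.e.open_target c.contMDiffOn_bwd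
    (fun t => FiberChart.fwd_mem (hc _)) fun t => ?_
  rw [FiberChart.bwd_fwd (hc _), hΨ.toCircle_eq]

/-- The reparametrization of loops. -/
def reparametrize (p : SobolevLoopSpace n M × CircleDiffeo) : SobolevLoopSpace n M :=
  ⟨fun z => p.1 (p.2.1 z), p.1.sobolev.comp p.2.2⟩

variable {c : FiberChart 1 Circle} {w₀ : SobolevLoopSpace 1 Circle} {x₀ : CircleDiffeo}

theorem represents_restrict_symm {y : SobolevSection c.A 2}
    (hy : y ∈ ((c.loopChart w₀).restrict CircleDiffeo x₀).chart.target) :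
    c.Represents (((c.loopChart w₀).restrict CircleDiffeo x₀).chart.symm y).1.toFun y := by
  have h := FiberChart.represents_symm (v₀ := w₀) hy.1
  have e := ScChart.restrict_symm_apply (x₀ := x₀) hy
  rwa [← e] at h

theorem scSmooth_reparametrize [SecondCountableTopology M] :
    ScSmooth (prodAtlas (loopAtlas n M) diffeoAtlas) (loopAtlas n M) reparametrize := by
  refine scSmooth_of_charts (isScManifold_loopAtlas.isContinuousAtlas.prod
    isScManifold_diffeoAtlas.isContinuousAtlas) isScManifold_loopAtlas ?_
  rintro _ ⟨_, ⟨c, v₀, rfl⟩, _, ⟨_, ⟨b, w₀, rfl⟩, x₀, rfl⟩, rfl⟩ _ ⟨e, u₀, rfl⟩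
  exact scSmoothOn_comp (isRegular_sobolevScale.prod isRegular_sobolevScale)
    ((isScManifold_loopAtlas.open_target _ ⟨c, v₀, rfl⟩).prod
      (isScManifold_diffeoAtlas.open_target _ ⟨_, ⟨b, w₀, rfl⟩, x₀, rfl⟩))
    (ScScale.fst (sobolevScale c.A) (sobolevScale b.A)) (ScScale.snd _ _)
    (v := fun y => (c.loopChart v₀).chart.symm y.1)
    (ψ := fun y => (((b.loopChart w₀).restrict CircleDiffeo x₀).chart.symm y.2).1)
    (fun y hy => FiberChart.represents_symm hy.1) (fun y hy => represents_restrict_symm hy.2)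
    (fun y hy => Subtype.property _) (fun y hy z => rfl) e u₀

namespace CircleDiffeo

theorem ext {φ ψ : CircleDiffeo} (h : ∀ z, φ.1 z = ψ.1 z) : φ = ψ :=
  Subtype.ext (SobolevLoopSpace.ext (funext h))

/-- The product `φ ψ = ψ ∘ φ`. -/
noncomputable def mul (φ ψ : CircleDiffeo) : CircleDiffeo :=
  ⟨reparametrize (ψ.1, φ), (reparametrize (ψ.1, φ)).sobolev, by
    obtain ⟨φ', h1, h2, h3⟩ := φ.2.2
    obtain ⟨ψ', h4, h5, h6⟩ := ψ.2.2
    exact ⟨fun z => φ' (ψ' z), h4.comp h1, h5.comp h2,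
      h3.comp ⟨h6, ψ.1, h5, h4, ψ.2.1⟩⟩⟩

/-- The identity map. -/
noncomputable def one : CircleDiffeo :=
  have h : IsSobolevLoop 1 2 (fun z : Circle => z) :=
    isSobolevLoop_of_lift (k := 1) (Ψ := fun t => t) (fun _ => rfl) (contDiff_id.sobolevOn isOpen_univ)
  ⟨⟨fun z => z, h⟩, h, fun z => z, fun _ => rfl, fun _ => rfl, h⟩

/-- The inverse diffeomorphism. -/
noncomputable def inv (φ : CircleDiffeo) : CircleDiffeo :=
  ⟨⟨φ.2.2.choose, φ.2.2.choose_spec.2.2⟩, φ.2.2.choose_spec.2.2, φ.1,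
    φ.2.2.choose_spec.2.1, φ.2.2.choose_spec.1, φ.2.1⟩

theorem leftInverse_inv (φ : CircleDiffeo) : Function.LeftInverse (inv φ).1 φ.1 :=
  φ.2.2.choose_spec.1

theorem rightInverse_inv (φ : CircleDiffeo) : Function.RightInverse (inv φ).1 φ.1 :=
  φ.2.2.choose_spec.2.1

/-- The group structure of `𝒟`. -/
noncomputable instance group : Group CircleDiffeo :=
  let : Mul CircleDiffeo := ⟨mul⟩
  let : One CircleDiffeo := ⟨one⟩
  let : Inv CircleDiffeo := ⟨inv⟩
  Group.ofLeftAxioms (fun _ _ _ => ext fun _ => rfl) (fun _ => ext fun _ => rfl)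
    -- As `φ ψ = ψ ∘ φ`, the left inverse law `φ⁻¹ φ = 1` reads `φ (φ⁻¹ z) = z`, so the right
    -- inverse property of the map is the relevant one.
    fun φ => ext fun z => rightInverse_inv φ z

theorem scSmooth_mul : ScSmooth (prodAtlas diffeoAtlas diffeoAtlas) diffeoAtlas
    (fun p : CircleDiffeo × CircleDiffeo => mul p.1 p.2) := by
  have hD := isScManifold_diffeoAtlas
  refine scSmooth_of_charts (hD.isContinuousAtlas.prod hD.isContinuousAtlas) hD ?_
  rintro _ ⟨_, ⟨_, ⟨b, w₀, rfl⟩, x₀, rfl⟩, _, ⟨_, ⟨c, v₀, rfl⟩, y₀, rfl⟩, rfl⟩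
    _ ⟨_, ⟨e, u₀, rfl⟩, z₀, rfl⟩
  exact scSmoothOn_comp (isRegular_sobolevScale.prod isRegular_sobolevScale)
    ((hD.open_target _ ⟨_, ⟨b, w₀, rfl⟩, x₀, rfl⟩).prod
      (hD.open_target _ ⟨_, ⟨c, v₀, rfl⟩, y₀, rfl⟩))
    -- In `φ ψ = ψ ∘ φ` the second factor is the outer map, hence plays the role of the loop, and
    -- the first factor reparametrizes it.
    (ScScale.snd (sobolevScale b.A) (sobolevScale c.A)) (ScScale.fst _ _)
    (v := fun y => (((c.loopChart v₀).restrict CircleDiffeo y₀).chart.symm y.2).1)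
    (ψ := fun y => (((b.loopChart w₀).restrict CircleDiffeo x₀).chart.symm y.1).1)
    (w := fun y => (mul (((b.loopChart w₀).restrict CircleDiffeo x₀).chart.symm y.1)
      (((c.loopChart v₀).restrict CircleDiffeo y₀).chart.symm y.2)).1)
    (fun y hy => represents_restrict_symm hy.2) (fun y hy => represents_restrict_symm hy.1)
    (fun y hy => Subtype.property _) (fun y hy z => rfl) e u₀

theorem scSmooth_inv : ScSmooth diffeoAtlas diffeoAtlas inv := by
  have hD := isScManifold_diffeoAtlas
  refine scSmooth_of_charts hD.isContinuousAtlas hD ?_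
  rintro _ ⟨_, ⟨b, w₀, rfl⟩, x₀, rfl⟩ _ ⟨_, ⟨e, u₀, rfl⟩, z₀, rfl⟩
  exact scSmoothOn_inverse isRegular_sobolevScale
    (hD.open_target _ ⟨_, ⟨b, w₀, rfl⟩, x₀, rfl⟩)
    (⟨fun m => ContinuousLinearMap.id ℝ _, fun _ _ => rfl⟩ :
      (sobolevScale b.A).Map (sobolevScale b.A))
    (ψ := fun y => (((b.loopChart w₀).restrict CircleDiffeo x₀).chart.symm y).1)
    (w := fun y => (inv (((b.loopChart w₀).restrict CircleDiffeo x₀).chart.symm y)).1)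
    (fun y hy => represents_restrict_symm hy) (fun y hy => Subtype.property _)
    (fun y hy => leftInverse_inv _) e u₀

end CircleDiffeo

end Diffeomorphisms

theorem mainTheorem8 {n : ℕ} {M : Type*} [TopologicalSpace M]
    [ChartedSpace (EuclideanSpace ℝ (Fin n)) M] [IsManifold (𝓡 n) ∞ M]
    [T2Space M] [SecondCountableTopology M] :
    -- `W^{2,2}(S¹, M)` is an sc-manifold with levels `W^{m+2,2}(S¹, M)`
    IsScManifold (SobolevLoopSpace n M) (loopAtlas n M) ∧
    (∀ m, scLevel (loopAtlas n M) m = {v | IsSobolevLoop n (m + 2) v.toFun}) ∧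
    -- `𝒟` is an open subset of `W^{2,2}(S¹, S¹)`, an sc-manifold with levels `𝒟^{m+2}`
    IsOpen CircleDiffeo ∧
    IsScManifold CircleDiffeo diffeoAtlas ∧
    (∀ m, scLevel diffeoAtlas m = {ψ | IsSobolevDiffeo (m + 2) ψ.1.toFun}) ∧
    -- the reparametrization action is well defined and sc-smooth
    (∃ f : SobolevLoopSpace n M × CircleDiffeo → SobolevLoopSpace n M,
      (∀ v ψ z, f (v, ψ) z = v (ψ.1 z)) ∧
      ScSmooth (prodAtlas (loopAtlas n M) diffeoAtlas) (loopAtlas n M) f) ∧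
    -- `𝒟`, with the multiplication `φ ψ = ψ ∘ φ`, is an sc-Lie group
    (∃ _ : Group CircleDiffeo, (∀ (φ ψ : CircleDiffeo) (z : Circle), (φ * ψ).1 z = ψ.1 (φ.1 z)) ∧
      IsScLieGroup CircleDiffeo diffeoAtlas) :=
  ⟨isScManifold_loopAtlas, scLevel_loopAtlas fun v => exists_fiberChart v.sobolev.1,
    isOpen_circleDiffeo, isScManifold_diffeoAtlas, scLevel_diffeoAtlas,
    ⟨reparametrize, fun _ _ _ => rfl, scSmooth_reparametrize⟩,
    CircleDiffeo.group, fun _ _ _ => rfl,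
    isScManifold_diffeoAtlas, CircleDiffeo.scSmooth_mul, CircleDiffeo.scSmooth_inv⟩
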